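/- **Notation.** For an integer $N\ge 1$ write $G=\mathbb Z/N\mathbb Z$ and $e(x)=e^{2\pi i x}$, and let $\|x\|$ be the distance from $x\in\mathbb R/\mathbb Z$ to $0$. Let $S\subseteq G$ be a set of characters, where $\xi\in S$ acts by $\xi\cdot x=\xi x/N \bmod 1$; put $\|x\|_S=\max_{\xi\in S}\|\xi\cdot x\|$ and $B(S,\rho)=\{x\in G:\|\xi\cdot x\|<\rho\ \forall \xi\in S\}$. A function $\phi:B\to\mathbb R/\mathbb Z$ is *locally quadratic* if $\partial_{h_1}\partial_{h_2}\partial_{h_3}\phi(x)=0$ whenever $x+\omega\cdot h\in B$ for all $\omega\in\{0,1\}^3$, where $\partial_hf(x)=f(x+h)-f(x)$; put $\phi''(a,b)=\phi(a+b)-\phi(a)-\phi(b)+\phi(0)$. A *smooth cutoff on $B(S,\sigma)$ with constant $\Lambda$* is a function $\psi(n)=F((\xi\cdot n)_{\xi\in S})$ with $F:(\mathbb R/\mathbb Z)^S\to[0,1]$ $\Lambda$-Lipschitz in the sup metric and vanishing outside $\{\|x_\xi\|<\sigma\ \forall\xi\}$. Integers are also regarded as elements of $G$. **Theorem.** For all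 reals $C,A>0$ there is $K>0$ such that the following holds. Let $N\ge1$, $0<\delta<1$, $0<R<N$ and $C^{-1}\delta^{C}\le\rho\le 1$ with $\log N\le\delta^{-C}$, and let $S$ contain the character $1/N$ (that is, $1\in S$) with $|S|\le\log^C(1/\delta)$. Let $\phi$ be a locally quadratic form on $B(S,64\rho)$, let $\psi$ be a smooth cutoff on $B(S,64\rho)$ with constant $\delta^{-(C|S|)^C}$, and let $\chi$ be a Dirichlet character modulo some $k\ge1$ (for instance the character $\chi_{Siegel}$ of a Siegel zero, with $k=q_{Siegel}$). Consider the hypotheses: * (H1, type I) there are $0<D\le C\sqrt R$ and more than $\delta^{C}D$ integers $d\in[D/2,D]$ with $\left|\sum_{n\in[\delta N,N],\,d\mid n}\psi(n)e(\phi(n))\right|\ge\delta N/d$; * (H2, twisted type I) the same with $\left|\sum_{n\in[\delta N,N],\,d\mid n}\psi(n)\chi(n/d)e(\phi(n))\right|\ge\delta N/d$; * (H3, type II) there are real $L,M$ with $\sqrt R\le L\le N/\sqrt R$, $\delta N\le LM\le N$ and $$\left|\sum_{\ell,\ell'\in[L,2L],\ m,m'\in[M,2M]}\psi(m\ell)\psi(m'\ell)\psi(m\ell')\psi(m'\ell')\,e\big(\phi(m\ell)-\phi(m'\ell)-\phi(m\ell')+\phi(m'\ell')\big)\right|\ge\delta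 L^2M^2 .$$ Consider the conclusions: * (C1) with $\rho_1=\rho/R^K$, there is an integer $1\le q\le K\delta^{-(K|S|)^K}$ such that $\|q\phi''(a,b)\|\le K\delta^{-(K|S|)^K}R^K\,\|a\|_S\|b\|_S/\rho_1^2$ for all $a,b\in B\big(S,\delta^K\rho_1/(K|S|)^{|S|}\big)$; * (C2) there is an integer $1\le q\le K\delta^{-(K|S|)^K}$ such that $\|q\phi''(a,b)\|\le K\delta^{-(K|S|)^K}\,\|a\|_S\|b\|_S/\rho^2$ for all $a,b\in B\big(S,\delta^K\rho/(K|S|)^{|S|}\big)$; * (C3) $R\le K\delta^{-(K|S|)^K}$; * (C4) $\delta\le K\exp\!\big(-K^{-1}\log^{1/K}N\big)$; * (C5) $k\ge\delta^{-(A|S|)^A}$. Then (H1) implies that one of (C1), (C3), (C4) holds; (H2) implies that one of (C1), (C3), (C4), (C5) holds; and (H3) implies that one of (C2), (C3), (C4) holds. -/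

import Mathlib

namespace BohrQuad

/-- The value `ξ·x = ξx/N mod 1` of the character of `ℤ/Nℤ` with index `ξ`. -/
noncomputable def charVal {N : ℕ} [NeZero N] (ξ x : ZMod N) : UnitAddCircle :=
  ZMod.toAddCircle (ξ * x)

/-- The Bohr set `B(S, ρ)`; on `UnitAddCircle = ℝ/ℤ` the norm is the distance to the
nearest integer. -/
def bohrSet {N : ℕ} [NeZero N] (S : Finset (ZMod N)) (ρ : ℝ) : Set (ZMod N) :=
  {x | ∀ ξ ∈ S, ‖charVal ξ x‖ < ρ}

/-- `‖x‖_S`, the supremum of `‖ξ·x‖` over `ξ ∈ S` (a maximum over a finite set). -/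
noncomputable def bohrNorm {N : ℕ} [NeZero N] (S : Finset (ZMod N)) (x : ZMod N) : ℝ :=
  ⨆ ξ : S, ‖charVal (ξ : ZMod N) x‖

/-- The discrete derivative `∂_h f(x) = f(x + h) - f(x)`. -/
def discreteDeriv {G A : Type*} [Add G] [Sub A] (h : G) (f : G → A) (x : G) : A :=
  f (x + h) - f x

/-- `φ` is locally quadratic on `B`: all triple derivatives vanish on cubes contained in `B`.
The values of `φ` outside `B` are irrelevant. -/
def IsLocallyQuadraticOn {G : Type*} [AddCommGroup G] (B : Set G) (φ : G → UnitAddCircle) :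
    Prop :=
  ∀ (x : G) (h : Fin 3 → G), (∀ ω : Finset (Fin 3), x + ∑ i ∈ ω, h i ∈ B) →
    discreteDeriv (h 0) (discreteDeriv (h 1) (discreteDeriv (h 2) φ)) x = 0

/-- The bilinear form `φ''(a, b) = φ(a + b) - φ(a) - φ(b) + φ(0)`. -/
def secondDiff {G : Type*} [AddCommGroup G] (φ : G → UnitAddCircle) (a b : G) : UnitAddCircle :=
  φ (a + b) - φ a - φ b + φ 0

/-- `e(x) = exp(2πix)` on `ℝ/ℤ`. -/
noncomputable def e (x : UnitAddCircle) : ℂ := (AddCircle.toCircle x : ℂ)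

/-- `ψ` is a smooth cutoff on `B(S, σ)` of Lipschitz constant at most `Λ`: it has the form
`ψ(n) = F((ξ·n)_{ξ ∈ S})` with `F : (ℝ/ℤ)^S → [0, 1]` a `Λ`-Lipschitz function
(for the sup metric) that vanishes outside the open box of radius `σ`. -/
def IsSmoothCutoff {N : ℕ} [NeZero N] (S : Finset (ZMod N)) (σ Λ : ℝ) (ψ : ZMod N → ℝ) : Prop :=
  ∃ F : (S → UnitAddCircle) → ℝ,
    (∀ x y, |F x - F y| ≤ Λ * dist x y) ∧
    (∀ x, 0 ≤ F x ∧ F x ≤ 1) ∧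
    (∀ x, F x ≠ 0 → ∀ ξ, ‖x ξ‖ < σ) ∧
    ∀ n, ψ n = F (fun ξ => charVal (ξ : ZMod N) n)

/-- Large type I sums: for more than `δ^C D` many integers `d ∈ [D/2, D]`, where `D ≤ C√R`, the
sum of `ψ(n) e(φ(n))` over the multiples `n` of `d` in `[δN, N]` is at least `δN/d`. -/
def TypeI {N : ℕ} [NeZero N] (C δ R : ℝ) (ψ : ZMod N → ℝ) (φ : ZMod N → UnitAddCircle) : Prop :=
  ∃ (D : ℝ) (E : Finset ℕ), 0 < D ∧ D ≤ C * √R ∧ δ ^ C * D < (E.card : ℝ) ∧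
    ∀ d ∈ E, D / 2 ≤ (d : ℝ) ∧ (d : ℝ) ≤ D ∧
      δ * N / d ≤ ‖∑ n ∈ Finset.Icc ⌈δ * N⌉₊ N with d ∣ n,
        (ψ (n : ZMod N) : ℂ) * e (φ (n : ZMod N))‖

/-- Large twisted type I sums, with the weight `χ(n/d)`. -/
def TwistedTypeI {N : ℕ} [NeZero N] (C δ R : ℝ) {k : ℕ} (χ : DirichletCharacter ℂ k)
    (ψ : ZMod N → ℝ) (φ : ZMod N → UnitAddCircle) : Prop :=
  ∃ (D : ℝ) (E : Finset ℕ), 0 < D ∧ D ≤ C * √R ∧ δ ^ C * D < (E.card : ℝ) ∧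
    ∀ d ∈ E, D / 2 ≤ (d : ℝ) ∧ (d : ℝ) ≤ D ∧
      δ * N / d ≤ ‖∑ n ∈ Finset.Icc ⌈δ * N⌉₊ N with d ∣ n,
        (ψ (n : ZMod N) : ℂ) * χ ((n / d : ℕ) : ZMod k) * e (φ (n : ZMod N))‖

/-- A large type II sum. -/
def TypeII {N : ℕ} [NeZero N] (δ R : ℝ) (ψ : ZMod N → ℝ) (φ : ZMod N → UnitAddCircle) : Prop :=
  ∃ L M : ℝ, √R ≤ L ∧ L ≤ N / √R ∧ δ * N ≤ L * M ∧ L * M ≤ N ∧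
    δ * L ^ 2 * M ^ 2 ≤
      ‖∑ l ∈ Finset.Icc ⌈L⌉₊ ⌊2 * L⌋₊, ∑ l' ∈ Finset.Icc ⌈L⌉₊ ⌊2 * L⌋₊,
        ∑ m ∈ Finset.Icc ⌈M⌉₊ ⌊2 * M⌋₊, ∑ m' ∈ Finset.Icc ⌈M⌉₊ ⌊2 * M⌋₊,
          ((ψ ((m * l : ℕ) : ZMod N) * ψ ((m' * l : ℕ) : ZMod N) *
            ψ ((m * l' : ℕ) : ZMod N) * ψ ((m' * l' : ℕ) : ZMod N) : ℝ) : ℂ) *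
          e (φ ((m * l : ℕ) : ZMod N) - φ ((m' * l : ℕ) : ZMod N)
            - φ ((m * l' : ℕ) : ZMod N) + φ ((m' * l' : ℕ) : ZMod N))‖

/-- The quantity `δ^{-(A s)^A}`, written `δ^{-O(s)^{O(1)}}` with implied constants `A`. -/
noncomputable def loss (A δ : ℝ) (s : ℕ) : ℝ := δ ^ (-(A * s) ^ A)

/-- `φ''` is approximately rational: there is a positive integer `q ≤ K δ^{-(K|S|)^K}` with
`‖q φ''(a, b)‖ ≤ H ‖a‖_S ‖b‖_S / r²` for all `a, b ∈ B(S, δ^K r / (K|S|)^{|S|})`. -/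
def ApproxRational {N : ℕ} [NeZero N] (K δ H r : ℝ) (S : Finset (ZMod N))
    (φ : ZMod N → UnitAddCircle) : Prop :=
  ∃ q : ℕ, 0 < q ∧ (q : ℝ) ≤ K * loss K δ S.card ∧
    ∀ a ∈ bohrSet S (δ ^ K * r / (K * S.card) ^ S.card),
    ∀ b ∈ bohrSet S (δ ^ K * r / (K * S.card) ^ S.card),
      ‖q • secondDiff φ a b‖ ≤ H * (bohrNorm S a * bohrNorm S b / r ^ 2)

/-- Conclusion in the type I and twisted type I cases, at radius `ρ₁ = ρ / R^K`. -/
def ConclusionI {N : ℕ} [NeZero N] (K δ ρ R : ℝ) (S : Finset (ZMod N))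
    (φ : ZMod N → UnitAddCircle) : Prop :=
  ApproxRational K δ (K * loss K δ S.card * R ^ K) (ρ / R ^ K) S φ

/-- Conclusion in the type II case, at radius `ρ` and without any dependence on `R`. -/
def ConclusionII {N : ℕ} [NeZero N] (K δ ρ : ℝ) (S : Finset (ZMod N))
    (φ : ZMod N → UnitAddCircle) : Prop :=
  ApproxRational K δ (K * loss K δ S.card) ρ S φ

/-- Degenerate cases: `R` is small, or `δ` is quasi-polynomially small in `N`. -/
def Degenerate (K δ R : ℝ) (s N : ℕ) : Prop :=
  R ≤ K * loss K δ s ∨ δ ≤ K * Real.exp (-(Real.log N ^ (1 / K)) / K)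

end BohrQuad

/-!
The theorem is proved by inverting three kinds of exponential sums with a locally quadratic phase on
a Bohr set `B(S, σ)` of `ℤ/Nℤ`. Everything is measured against a parameter `X`, a `loss` dominating
`1/δ`, `1/ρ`, the Lipschitz constant and the modulus of the character; if `R` is at most a large
power of `X` the degenerate conclusion holds, so `R` may be taken larger. The denominators obtained
at first depend on the pair `(a, b)`. They are made uniform by `exists_uniform_denominator`: a set of
elements of an abelian group all of whose short subset sums have order at most `Q` is killed by one
integer `q ≤ Q ^ 2`, as soon as the number of summands exceeds `2 log₂ Q`.

*Type I sums* (`exists_denominator_of_typeI`). For each `d`, averaging over the shifts `k (i a + j b)`,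
which leave a weight of period `k` unchanged, gives a bilinear sum in `i` and `j` with phase
`i j d² k² φ''(a, b)`, so that `d² k² φ''(a, b)` is close to a rational with small denominator. As `d`
varies over a dense set of integers, the factor `d²` is removed by differencing.

*Type II sums near the origin* (`exists_denominator_of_typeII`). Write `F = ψ e(φ)`. For many pairs
`(l, l')` the sum of `F(ml) conj F(ml')` over `m` is large. Shifting `m` by `h` and expanding the
locally linear phases `φ''(·, lh)` into characters (`charApprox`) gives frequencies `γ_l` such that
`γ_l l / N` is almost independent of `l`. The set of pairs `(l, γ_l)` has small doubling, so it
contains many three-dimensional cubes; differencing along these shows that, for many `k` and `h`,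
`φ''(a, kh)` is rational for all small `a`. Distinct products `kh` are plentiful because the
multiplicative energy of intervals is small (`card_sq_le_card_products`), which gives a dense set of
rational directions, hence rationality for all small `a` and `b`.

*Type II sums away from the origin* (`exists_denominator_extension`). The radius in the previous
step is `δ` to a power which is polynomial in `|S|`, whereas the conclusion asks for
`δ^K ρ / (K|S|)^|S|`, with a bounded power of `δ`. With
`q` the denominator already found, `φ` is nearly linear along small multiples of `q`, so `F(n)` can
be expanded around `n` into locally linear pieces with tent weights. The bilinear structure and the
Fourier transform make the derivative `φ(n + qb) - φ(n)` rational for many products `n = ml`, hence,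
by the energy bound again, for a proportion `U⁻⁶` of all `n`, with `U` a fixed power of `1/δ`. Two
such points differ by `ja` with `j ≤ U⁶`, for every `a`, and comparing the derivatives there yields
`φ''(a, b)` for all `a` of norm about `ρ U⁻⁶`. The cases of two small, one small and no small
argument are then put together in `exists_denominator_of_typeII_large_radius`.
-/

namespace BohrQuad

open Finset ComplexConjugate

/-! ### Distances and phases on the circle -/

lemma circle_norm_le_half (x : UnitAddCircle) : ‖x‖ ≤ 1 / 2 := by
  simpa using AddCircle.norm_le_half_period (p := (1 : ℝ)) (x := x) one_ne_zero

lemma circle_norm_coe (t : ℝ) (ht : |t| ≤ 1 / 2) : ‖(t : UnitAddCircle)‖ = |t| :=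
  (AddCircle.norm_coe_eq_abs_iff (1 : ℝ) one_ne_zero).2 (by simpa using ht)

lemma exists_circle_rep (x : UnitAddCircle) :
    ∃ t : ℝ, (t : UnitAddCircle) = x ∧ |t| = ‖x‖ ∧ |t| ≤ 1 / 2 := by
  obtain ⟨y, rfl⟩ := QuotientAddGroup.mk_surjective x
  refine ⟨y - round y, ?_, ?_, abs_sub_round y⟩
  · rw [AddCircle.coe_sub]
    have : ((round y : ℝ) : UnitAddCircle) = 0 := by
      rw [AddCircle.coe_eq_zero_iff]
      exact ⟨round y, by simp⟩
    rw [this, sub_zero]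
  · exact (UnitAddCircle.norm_eq (x := y)).symm

lemma circle_norm_coe_le (t : ℝ) : ‖(t : UnitAddCircle)‖ ≤ |t| := by
  by_cases h : |t| ≤ 1 / 2
  · exact (circle_norm_coe t h).le
  · exact (circle_norm_le_half _).trans (not_le.1 h).le

lemma norm_nsmul_eq_of_le {n : ℕ} {x : UnitAddCircle} (h : n * ‖x‖ ≤ 1 / 2) :
    ‖n • x‖ = n * ‖x‖ := by
  obtain ⟨t, rfl, ht, -⟩ := exists_circle_rep x
  have h1 : n • (t : UnitAddCircle) = ((n * t : ℝ) : UnitAddCircle) := by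
    rw [← nsmul_eq_mul]; exact (AddCircle.coe_nsmul (1 : ℝ)).symm
  rw [h1, circle_norm_coe, abs_mul, Nat.abs_cast, ht]
  rwa [abs_mul, Nat.abs_cast, ht]

lemma norm_zsmul_le_abs (n : ℤ) (x : UnitAddCircle) : ‖n • x‖ ≤ |(n : ℝ)| * ‖x‖ := by
  have := norm_zsmul_le n x
  rwa [Int.norm_eq_abs] at this

/-- If all multiples of `x` up to `I` are small, then `x` is smaller by the factor `I`. -/
lemma mul_norm_le_of_multiples {x : UnitAddCircle} {c : ℝ} (hc : c ≤ 1 / 4) {I : ℕ}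
    (h : ∀ i : ℕ, 1 ≤ i → i ≤ I → ‖i • x‖ ≤ c) (hI : 1 ≤ I) : I * ‖x‖ ≤ c := by
  have h1 : ‖x‖ ≤ c := by simpa using h 1 le_rfl hI
  induction I, hI using Nat.le_induction with
  | base => simpa using h1
  | succ n hn ih =>
    have ih' := ih (fun i h1 h2 => h i h1 (by omega))
    have : ‖(n + 1) • x‖ = ((n + 1 : ℕ) : ℝ) * ‖x‖ := by
      apply norm_nsmul_eq_of_le
      push_cast
      linarith
    rw [← this]
    exact h _ (by omega) le_rfl

lemma eq_zero_of_nsmul_eq_zero_of_norm_lt {n : ℕ} {x : UnitAddCircle} (hn : 0 < n)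
    (h : n • x = 0) (hx : n * ‖x‖ < 1) : x = 0 := by
  obtain ⟨t, rfl, ht, -⟩ := exists_circle_rep x
  have h1 : ((n * t : ℝ) : UnitAddCircle) = 0 := by
    rw [← nsmul_eq_mul, ← h]; exact AddCircle.coe_nsmul (1 : ℝ)
  rw [AddCircle.coe_eq_zero_iff] at h1
  obtain ⟨k, hk⟩ := h1
  simp only [zsmul_eq_mul, mul_one] at hk
  rw [← ht] at hx
  have h2 : |(k : ℝ)| < 1 := by rw [hk, abs_mul, Nat.abs_cast]; exact hx
  have h3 : k = 0 := by
    have : |k| < 1 := by exact_mod_cast h2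
    exact Int.abs_lt_one_iff.1 this
  rw [h3, Int.cast_zero] at hk
  have : t = 0 := by
    rcases mul_eq_zero.1 hk.symm with h | h
    · exact absurd h (by positivity)
    · exact h
  rw [this]; rfl

lemma exists_nsmul_eq_norm_le {n : ℕ} (hn : 0 < n) (x : UnitAddCircle) :
    ∃ w : UnitAddCircle, n • w = x ∧ n * ‖w‖ ≤ ‖x‖ := by
  obtain ⟨t, rfl, ht, -⟩ := exists_circle_rep x
  have hn' : (0 : ℝ) < n := by exact_mod_cast hn
  refine ⟨((t / n : ℝ) : UnitAddCircle), ?_, ?_⟩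
  · rw [← AddCircle.coe_nsmul, nsmul_eq_mul]
    congr 1
    field_simp
  · calc n * ‖((t / n : ℝ) : UnitAddCircle)‖ ≤ n * |t / n| :=
        mul_le_mul_of_nonneg_left (circle_norm_coe_le _) hn'.le
      _ = |t| := by rw [abs_div, Nat.abs_cast]; field_simp
      _ = _ := ht

lemma e_add (x y : UnitAddCircle) : e (x + y) = e x * e y := by
  simp [e, AddCircle.toCircle_add]

@[simp] lemma e_zero : e 0 = 1 := by simp [e]

@[simp] lemma norm_e (x : UnitAddCircle) : ‖e x‖ = 1 := Circle.norm_coe _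

lemma e_neg (x : UnitAddCircle) : e (-x) = conj (e x) := by
  rw [e, AddCircle.toCircle_neg, Circle.coe_inv_eq_conj, e]

lemma e_sub (x y : UnitAddCircle) : e (x - y) = e x * conj (e y) := by
  rw [sub_eq_add_neg, e_add, e_neg]

lemma e_mul_conj (x : UnitAddCircle) : e x * conj (e x) = 1 := by
  rw [← e_sub, sub_self, e_zero]

lemma e_coe (t : ℝ) : e (t : UnitAddCircle) = Complex.exp (2 * Real.pi * t * Complex.I) := by
  simp only [e, AddCircle.toCircle_apply_mk, Circle.coe_exp]
  congr 1
  push_cast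
  ring

lemma e_re (t : ℝ) : (e (t : UnitAddCircle)).re = Real.cos (2 * Real.pi * t) := by
  rw [e_coe]
  have : (2 * Real.pi * t * Complex.I : ℂ) = ((2 * Real.pi * t : ℝ) : ℂ) * Complex.I := by
    push_cast; ring
  rw [this, Complex.exp_ofReal_mul_I_re]

lemma norm_sq_e_sub_one (x : UnitAddCircle) : ‖e x - 1‖ ^ 2 = 2 * (1 - (e x).re) := by
  have h1 : ‖e x‖ ^ 2 = (e x).re ^ 2 + (e x).im ^ 2 := by
    rw [← Complex.normSq_eq_norm_sq, Complex.normSq_apply]; ring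
  rw [norm_e] at h1
  rw [← Complex.normSq_eq_norm_sq, Complex.normSq_apply]
  simp only [Complex.sub_re, Complex.one_re, Complex.sub_im, Complex.one_im]
  nlinarith

lemma one_sub_e_re (x : UnitAddCircle) : 8 * ‖x‖ ^ 2 ≤ 1 - (e x).re := by
  obtain ⟨t, rfl, ht, ht2⟩ := exists_circle_rep x
  rw [e_re, ← ht]
  have h1 : Real.cos (2 * Real.pi * t) = 1 - 2 * Real.sin (Real.pi * |t|) ^ 2 := by
    have : Real.sin (Real.pi * |t|) ^ 2 = Real.sin (Real.pi * t) ^ 2 := by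
      rcases abs_choice t with h | h <;> rw [h]
      rw [mul_neg, Real.sin_neg]; ring
    rw [this, mul_assoc, Real.cos_two_mul, Real.cos_sq']
    ring
  have h2 : 2 * |t| ≤ Real.sin (Real.pi * |t|) := by
    have := Real.mul_le_sin (x := Real.pi * |t|) (by positivity)
      (by nlinarith [Real.pi_pos])
    have h3 : 2 / Real.pi * (Real.pi * |t|) = 2 * |t| := by field_simp
    linarith
  rw [h1]
  nlinarith [abs_nonneg t]

lemma four_mul_norm_le (x : UnitAddCircle) : 4 * ‖x‖ ≤ ‖e x - 1‖ := by
  have h1 := one_sub_e_re x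
  have h2 := norm_sq_e_sub_one x
  nlinarith [norm_nonneg x, norm_nonneg (e x - 1)]

lemma norm_e_sub_one_le (x : UnitAddCircle) : ‖e x - 1‖ ≤ 7 * ‖x‖ := by
  obtain ⟨t, rfl, ht, -⟩ := exists_circle_rep x
  rw [← ht, e_coe]
  have : (2 * Real.pi * t * Complex.I : ℂ) = Complex.I * ((2 * Real.pi * t : ℝ) : ℂ) := by
    push_cast; ring
  rw [this]
  refine (Real.norm_exp_I_mul_ofReal_sub_one_le).trans ?_
  rw [Real.norm_eq_abs, abs_mul, abs_of_pos (by positivity)]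
  have := Real.pi_lt_d2
  nlinarith [abs_nonneg t]

lemma norm_e_sub_e_le (x y : UnitAddCircle) : ‖e x - e y‖ ≤ 7 * ‖x - y‖ := by
  have : e x - e y = (e (x - y) - 1) * e y := by
    rw [sub_mul, one_mul, ← e_add, sub_add_cancel]
  rw [this, norm_mul, norm_e, mul_one]
  exact norm_e_sub_one_le _

lemma one_sub_le_e_re (x : UnitAddCircle) : 1 - 7 * ‖x‖ ≤ (e x).re := by
  have h1 := norm_e_sub_one_le x
  have h2 := Complex.abs_re_le_norm (e x - 1)
  rw [Complex.sub_re, Complex.one_re] at h2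
  have := abs_le.1 (h2.trans h1)
  linarith

/-- The geometric sum over an interval of integers. -/
lemma norm_sum_Icc_e (θ : UnitAddCircle) (a b : ℤ) :
    2 * ‖θ‖ * ‖∑ j ∈ Icc a b, e (j • θ)‖ ≤ 1 := by
  have key : ∀ b : ℤ, a - 1 ≤ b →
      (e θ - 1) * ∑ j ∈ Icc a b, e (j • θ) = e ((b + 1) • θ) - e (a • θ) := by
    intro b hb
    induction b, hb using Int.leInduction with
    | base => simp
    | succ n hn ih =>
      have : Icc a (n + 1) = insert (n + 1) (Icc a n) := by
        ext x; simp only [mem_insert, mem_Icc]; omega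
      rw [this, sum_insert (by simp), mul_add, ih, add_smul (n + 1) 1 θ, e_add, one_smul]
      ring
  by_cases hab : a - 1 ≤ b
  · have h1 := congrArg norm (key b hab)
    rw [norm_mul] at h1
    have h2 : ‖e ((b + 1) • θ) - e (a • θ)‖ ≤ 2 := by
      refine (norm_sub_le _ _).trans ?_
      simp only [norm_e]; norm_num
    have h3 := four_mul_norm_le θ
    have h4 := norm_nonneg (∑ j ∈ Icc a b, e (j • θ))
    nlinarith
  · rw [Icc_eq_empty (by omega)]
    simp

/-! ### Averaging, pigeonhole and rational approximation -/

/-- Some translate of the progression `0, b, 2b, …` meets `A` in at least the expected number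
of points. -/
lemma exists_translate_card {H : Type*} [AddCommGroup H] [DecidableEq H] (A Ω : Finset H) (b : H)
    (w : ℕ) (hw : 0 < w) (hA : A.Nonempty) (h : ∀ a ∈ A, ∀ i < w, a - i • b ∈ Ω) :
    ∃ z ∈ Ω, w * #A ≤ #Ω * #{i ∈ range w | z + i • b ∈ A} := by
  have h1 : ∑ z ∈ Ω, #{i ∈ range w | z + i • b ∈ A} = w * #A := by
    simp only [card_filter]
    rw [sum_comm]
    rw [← card_range w, ← smul_eq_mul, ← sum_const]
    rw [card_range]
    refine sum_congr rfl fun i hi => ?_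
    rw [← card_filter]
    refine card_bij (fun z _ => z + i • b) (fun z hz => (mem_filter.1 hz).2)
      (fun z _ z' _ hzz => by simpa using hzz) (fun a ha => ?_)
    exact ⟨a - i • b, mem_filter.2 ⟨h a ha i (mem_range.1 hi), by simpa using ha⟩, by simp⟩
  have hΩ : Ω.Nonempty := by
    obtain ⟨a, ha⟩ := hA
    exact ⟨_, h a ha 0 hw⟩
  by_contra hcon
  push Not at hcon
  have h2 : ∑ z ∈ Ω, #Ω * #{i ∈ range w | z + i • b ∈ A} < ∑ z ∈ Ω, w * #A :=
    sum_lt_sum_of_nonempty hΩ hcon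
  rw [← mul_sum, h1, sum_const, smul_eq_mul] at h2
  exact lt_irrefl _ h2

/-- If a dense set of integers `t` in `[-J, J]` makes `t θ` small, then `θ` is close to a rational
with small denominator, to within the accuracy expected from the length `J`. -/
theorem exists_denominator_of_dense {J η ε : ℝ} {A : Finset ℤ} {θ : UnitAddCircle}
    (hAJ : ∀ t ∈ A, |(t : ℝ)| ≤ J) (hη : 0 < η) (hη1 : η ≤ 1) (hcard : η * J ≤ #A)
    (hJ : 64 ≤ η * J) (hε : ε ≤ η / 64) (hθ : ∀ t ∈ A, ‖t • θ‖ ≤ ε) :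
    ∃ q : ℕ, 0 < q ∧ (q : ℝ) ≤ 8 / η ∧ ‖q • θ‖ ≤ 144 * ε / (η ^ 2 * J) := by
  have hJ0 : 64 ≤ J := by nlinarith
  have hAne : A.Nonempty := by
    rw [← card_pos]
    have : (0 : ℝ) < #A := by linarith
    exact_mod_cast this
  -- translates of progressions of step `q` and length `w` with `q w ≤ J` meet `A` often
  have block : ∀ q w : ℕ, 0 < w → (q : ℝ) * w ≤ J →
      ∃ z : ℤ, w * η / 4 ≤ #{i ∈ range w | z + i • (q : ℤ) ∈ A} := by
    intro q w hw hqw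
    obtain ⟨z, -, hz⟩ := exists_translate_card A (Icc (⌈-J⌉ - q * w) ⌊J⌋) (q : ℤ) w hw hAne (by
      intro a ha i hi
      have h1 := abs_le.1 (hAJ a ha)
      have h2 : ⌈-J⌉ ≤ a := Int.ceil_le.2 h1.1
      have h3 : a ≤ ⌊J⌋ := Int.le_floor.2 h1.2
      have h4 : (i : ℤ) * q ≤ q * w := by
        rw [mul_comm]
        exact mul_le_mul_of_nonneg_left (by exact_mod_cast hi.le) (by positivity)
      have h5 : (0 : ℤ) ≤ i * q := by positivity
      simp only [mem_Icc, nsmul_eq_mul]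
      constructor <;> linarith)
    refine ⟨z, ?_⟩
    have h1 : ((#(Icc (⌈-J⌉ - q * w : ℤ) ⌊J⌋) : ℕ) : ℝ) ≤ 4 * J := by
      have h3 := Int.floor_le J
      have h4 := Int.le_ceil (-J)
      rw [Int.card_Icc, ← Int.cast_natCast, Int.toNat_eq_max, Int.cast_max]
      refine max_le ?_ (by push_cast; linarith)
      push_cast
      linarith
    have h2 : (w : ℝ) * #A ≤ 4 * J * #{i ∈ range w | z + i • (q : ℤ) ∈ A} := by
      calc (w : ℝ) * #A ≤ (#(Icc (⌈-J⌉ - q * w : ℤ) ⌊J⌋) : ℝ) * #{i ∈ range w | z + i • (q : ℤ) ∈ A} := by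
            exact_mod_cast hz
        _ ≤ _ := by gcongr
    have h3 : (w : ℝ) * (η * J) ≤ w * #A := by gcongr
    have h4 : J * (w * η) ≤ J * (4 * #{i ∈ range w | z + i • (q : ℤ) ∈ A}) := by linarith
    have := le_of_mul_le_mul_left h4 (by linarith)
    linarith
  have hε0 : 0 ≤ ε := by
    obtain ⟨a, ha⟩ := hAne
    exact (norm_nonneg _).trans (hθ a ha)
  have hdiff : ∀ z q : ℤ, ∀ i j : ℕ, i ≤ j → z + i • q ∈ A → z + j • q ∈ A →
      ‖(j - i) • (q • θ)‖ ≤ 2 * ε := by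
    intro z q i j hij hi hj
    have h1 : (j - i) • (q • θ) = (z + j • q) • θ - (z + i • q) • θ := by
      rw [← sub_smul, ← natCast_zsmul, ← mul_smul]
      congr 1
      push_cast [Nat.cast_sub hij, nsmul_eq_mul]
      ring
    rw [h1]
    refine (norm_sub_le _ _).trans ?_
    linarith [hθ _ hi, hθ _ hj]
  -- a first denominator, from two close elements of `A`
  obtain ⟨q, hq0, hq, hqθ⟩ : ∃ q : ℕ, 0 < q ∧ (q : ℝ) ≤ 8 / η ∧ ‖q • θ‖ ≤ 2 * ε := by
    set w := ⌈8 / η⌉₊ with hw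
    have hw0 : 0 < w := Nat.ceil_pos.2 (by positivity)
    have hw1 : 8 / η ≤ w := Nat.le_ceil _
    have hw2 : (w : ℝ) < 8 / η + 1 := Nat.ceil_lt_add_one (by positivity)
    have h8 : 8 / η ≤ J / 8 := by
      rw [div_le_div_iff₀ hη (by norm_num)]; linarith
    obtain ⟨z, hz⟩ := block 1 w hw0 (by push_cast; linarith)
    have h2 : 1 < #{i ∈ range w | z + i • ((1 : ℕ) : ℤ) ∈ A} := by
      have h3 : 8 ≤ w * η := by rwa [div_le_iff₀ hη] at hw1
      have h4 : (2 : ℝ) ≤ #{i ∈ range w | z + i • ((1 : ℕ) : ℤ) ∈ A} :=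
        le_trans (by linarith) hz
      exact_mod_cast h4
    obtain ⟨i, hi, j, hj, hij⟩ := one_lt_card.1 h2
    wlog hlt : i < j generalizing i j
    · exact this j hj i hi hij.symm (by omega)
    simp only [mem_filter, mem_range] at hi hj
    refine ⟨j - i, by omega, ?_, ?_⟩
    · have : ((j - i : ℕ) : ℝ) + 1 ≤ w := by
        have : j - i + 1 ≤ w := by omega
        exact_mod_cast this
      linarith
    · have := hdiff z 1 i j hlt.le (by simpa using hi.2) (by simpa using hj.2)
      simpa using this
  refine ⟨q, hq0, hq, ?_⟩
  by_contra hcon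
  push Not at hcon
  set x := ‖q • θ‖ with hx
  have hx0 : 0 < x := lt_of_le_of_lt (by positivity) hcon
  have hε1 : 0 < ε := by linarith
  rw [div_lt_iff₀ (by positivity)] at hcon
  set w := ⌊16 * ε / (η * x)⌋₊ + 1 with hw
  have hw1 : 16 * ε / (η * x) < w := by rw [hw]; push_cast; exact Nat.lt_floor_add_one _
  have hw2 : (w : ℝ) ≤ 18 * ε / (η * x) := by
    have h1 : (w : ℝ) ≤ 16 * ε / (η * x) + 1 := by
      rw [hw]; push_cast
      gcongr
      exact Nat.floor_le (by positivity)
    have h2 : 1 ≤ 2 * ε / (η * x) := by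
      rw [le_div_iff₀ (by positivity)]; nlinarith
    have h3 : 18 * ε / (η * x) = 16 * ε / (η * x) + 2 * ε / (η * x) := by ring
    linarith
  have hwx : (w : ℝ) * x ≤ 18 * ε / η := by
    calc (w : ℝ) * x ≤ 18 * ε / (η * x) * x := by gcongr
      _ = 18 * ε / η := by field_simp
  have hwx2 : (w : ℝ) * x ≤ 1 / 2 := by
    refine hwx.trans ?_
    rw [div_le_iff₀ hη]; linarith
  obtain ⟨z, hz⟩ := block q w (by omega) (by
    calc (q : ℝ) * w ≤ 8 / η * (18 * ε / (η * x)) := by gcongr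
      _ = 144 * ε / (η ^ 2 * x) := by field_simp; ring
      _ ≤ J := by
        rw [div_le_iff₀ (by positivity)]; linarith)
  -- the points of `A` on the block lie in a window of length `2ε / x`
  set B := {i ∈ range w | z + i • (q : ℤ) ∈ A} with hB
  have hBne : B.Nonempty := by
    rw [← card_pos]
    have h1 : (0 : ℝ) < w := by rw [hw]; positivity
    have h2 : (0 : ℝ) < #B := lt_of_lt_of_le (by positivity) hz
    exact_mod_cast h2
  set i0 := B.min' hBne
  have hi0 : i0 ∈ B := B.min'_mem hBne
  have hsub : B ⊆ Icc i0 (i0 + ⌊2 * ε / x⌋₊) := by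
    intro j hj
    have hle : i0 ≤ j := B.min'_le j hj
    simp only [hB, mem_filter, mem_range] at hi0 hj
    rw [mem_Icc]
    refine ⟨hle, ?_⟩
    have h1 := hdiff z q i0 j hle hi0.2 hj.2
    rw [natCast_zsmul, norm_nsmul_eq_of_le] at h1
    · have h2 : ((j - i0 : ℕ) : ℝ) ≤ 2 * ε / x := by rwa [le_div_iff₀ hx0]
      have := Nat.le_floor h2
      omega
    · refine le_trans ?_ hwx2
      gcongr
      omega
  have h5 : (#B : ℝ) ≤ 4 * ε / x := by
    have h6 : #B ≤ ⌊2 * ε / x⌋₊ + 1 := by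
      refine (card_le_card hsub).trans ?_
      simp
      omega
    have h7 : (#B : ℝ) ≤ 2 * ε / x + 1 := by
      calc (#B : ℝ) ≤ (⌊2 * ε / x⌋₊ : ℝ) + 1 := by exact_mod_cast h6
        _ ≤ _ := by gcongr; exact Nat.floor_le (by positivity)
    have h8 : 1 ≤ 2 * ε / x := by rw [le_div_iff₀ hx0]; linarith
    have h9 : 4 * ε / x = 2 * ε / x + 2 * ε / x := by ring
    linarith
  have h6 : 4 * ε / x < w * η / 4 := by
    calc 4 * ε / x = 16 * ε / (η * x) * η / 4 := by field_simp; ring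
      _ < _ := by gcongr
  linarith

/-- Pigeonhole for a homomorphism into a torus: many elements of `A` have the same image up to
an error `r` in each coordinate. -/
lemma exists_card_le_of_hom {H κ : Type*} [AddCommGroup H] [DecidableEq H] [Fintype κ]
    (A : Finset H) (hA : A.Nonempty) (f : H →+ (κ → UnitAddCircle)) {r : ℝ} (hr : 0 < r)
    (I : Finset ℤ)
    (hI : ∀ a ∈ A, ∀ i, ∀ t : ℝ, (t : UnitAddCircle) = f a i → |t| = ‖f a i‖ → |t| ≤ 1 / 2 →
      ⌊t / r⌋ ∈ I) :
    ∃ a₀ ∈ A, #A ≤ #I ^ Fintype.card κ * #{a ∈ A | ∀ i, ‖f (a - a₀) i‖ < r} := by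
  classical
  choose rep h1 h2 h3 using exists_circle_rep
  set c : H → κ → ℤ := fun a i => ⌊rep (f a i) / r⌋ with hc
  have hmaps : ∀ a ∈ A, c a ∈ Fintype.piFinset (fun _ : κ => I) := by
    intro a ha
    rw [Fintype.mem_piFinset]
    intro i
    exact hI a ha i _ (h1 _) (h2 _) (h3 _)
  have hcardI : #(Fintype.piFinset (fun _ : κ => I)) = #I ^ Fintype.card κ := by
    simp
  have hne : (Fintype.piFinset (fun _ : κ => I)).Nonempty := by
    obtain ⟨a, ha⟩ := hA
    exact ⟨_, hmaps a ha⟩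
  obtain ⟨y, hy, hle⟩ : ∃ y ∈ Fintype.piFinset (fun _ : κ => I),
      #A ≤ #I ^ Fintype.card κ * #{a ∈ A | c a = y} := by
    by_contra hcon
    push Not at hcon
    have h4 := card_eq_sum_card_fiberwise hmaps
    have h5 : ∑ y ∈ Fintype.piFinset (fun _ : κ => I), #I ^ Fintype.card κ * #{a ∈ A | c a = y}
        < ∑ y ∈ Fintype.piFinset (fun _ : κ => I), #A := sum_lt_sum_of_nonempty hne hcon
    rw [← mul_sum, ← h4, sum_const, hcardI, smul_eq_mul] at h5
    exact lt_irrefl _ h5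
  have hpos : 0 < #{a ∈ A | c a = y} := by
    rcases Nat.eq_zero_or_pos #{a ∈ A | c a = y} with h0 | h0
    · rw [h0, mul_zero] at hle
      have := card_pos.2 hA
      omega
    · exact h0
  obtain ⟨a₀, ha₀⟩ := card_pos.1 hpos
  rw [mem_filter] at ha₀
  refine ⟨a₀, ha₀.1, hle.trans (Nat.mul_le_mul_left _ (card_le_card ?_))⟩
  intro a ha
  rw [mem_filter] at ha ⊢
  refine ⟨ha.1, fun i => ?_⟩
  have h4 : c a i = c a₀ i := by rw [ha.2, ha₀.2]
  rw [map_sub, Pi.sub_apply, ← h1 (f a i), ← h1 (f a₀ i), ← AddCircle.coe_sub]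
  refine lt_of_le_of_lt (circle_norm_coe_le _) ?_
  have h5 : |rep (f a i) / r - rep (f a₀ i) / r| < 1 := Int.abs_sub_lt_one_of_floor_eq_floor h4
  rwa [← sub_div, abs_div, abs_of_pos hr, div_lt_one hr] at h5

/-! ### Products of two integers -/

/-- The multiplicative energy of a set of pairs in a box is at most the size of the box, up to
logarithms: a solution of `k h = k' h'` has the form `(k, h) = (g a, t b)`,
`(k', h') = (g b, t a)`. -/
lemma card_mul_eq_mul_le (P M : ℕ) (A : Finset (ℕ × ℕ))
    (hA : ∀ x ∈ A, 1 ≤ x.1 ∧ x.1 ≤ P ∧ 1 ≤ x.2 ∧ x.2 ≤ M) :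
    (#{x ∈ A ×ˢ A | x.1.1 * x.1.2 = x.2.1 * x.2.2} : ℝ) ≤ P * M * (1 + Real.log P) ^ 2 := by
  set B : Finset ((ℕ × ℕ) × (ℕ × ℕ)) :=
    (Icc 1 P ×ˢ Icc 1 P).biUnion fun ab =>
      (Icc 1 (P / ab.1) ×ˢ Icc 1 (M / ab.2)).image fun gt => (ab, gt) with hB
  have hsub : {x ∈ A ×ˢ A | x.1.1 * x.1.2 = x.2.1 * x.2.2} ⊆
      B.image fun x => ((x.2.1 * x.1.1, x.2.2 * x.1.2), (x.2.1 * x.1.2, x.2.2 * x.1.1)) := by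
    rintro ⟨⟨k, h⟩, ⟨k', h'⟩⟩ hx
    simp only [mem_filter, mem_product] at hx
    obtain ⟨⟨h1, h2⟩, h3⟩ := hx
    obtain ⟨hk1, hk2, hh1, hh2⟩ := hA _ h1
    obtain ⟨hk1', hk2', hh1', hh2'⟩ := hA _ h2
    simp only at hk1 hk2 hh1 hh2 hk1' hk2' hh1' hh2'
    obtain ⟨a, ha⟩ := Nat.gcd_dvd_left k k'
    obtain ⟨b, hb⟩ := Nat.gcd_dvd_right k k'
    set g := Nat.gcd k k' with hg
    have hg0 : 0 < g := Nat.gcd_pos_of_pos_left _ hk1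
    have hcop : Nat.Coprime a b := by
      have := Nat.gcd_mul_left g a b
      rw [← ha, ← hb, ← hg] at this
      exact Nat.eq_of_mul_eq_mul_left hg0 (by rw [mul_one]; exact this.symm)
    have hab : a * h = b * h' := by
      apply Nat.eq_of_mul_eq_mul_left hg0
      rw [← mul_assoc, ← mul_assoc, ← ha, ← hb, h3]
    obtain ⟨t, ht⟩ : b ∣ h := hcop.symm.dvd_of_dvd_mul_left ⟨h', hab⟩
    have ha0 : 0 < a := Nat.pos_of_ne_zero fun h => by simp [h] at ha; omega
    have hb0 : 0 < b := Nat.pos_of_ne_zero fun h => by simp [h] at hb; omega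
    have ht0 : 0 < t := Nat.pos_of_ne_zero fun h => by simp [h] at ht; omega
    have ht' : h' = t * a := by
      apply Nat.eq_of_mul_eq_mul_left hb0
      rw [← hab, ht]; ring
    rw [mem_image]
    refine ⟨((a, b), (g, t)), ?_, ?_⟩
    · rw [hB, mem_biUnion]
      refine ⟨(a, b), ?_, mem_image.2 ⟨(g, t), ?_, rfl⟩⟩
      · simp only [mem_product, mem_Icc]
        refine ⟨⟨ha0, ?_⟩, hb0, ?_⟩
        · calc a ≤ g * a := Nat.le_mul_of_pos_left _ hg0
            _ ≤ P := ha ▸ hk2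
        · calc b ≤ g * b := Nat.le_mul_of_pos_left _ hg0
            _ ≤ P := hb ▸ hk2'
      · simp only [mem_product, mem_Icc]
        refine ⟨⟨hg0, (Nat.le_div_iff_mul_le ha0).2 (ha ▸ hk2)⟩, ht0,
          (Nat.le_div_iff_mul_le hb0).2 ?_⟩
        rw [mul_comm, ← ht]; exact hh2
    · simp only [Prod.mk.injEq]
      exact ⟨⟨ha.symm, by rw [ht]; ring⟩, hb.symm, ht'.symm⟩
  have hharm : ((∑ a ∈ Icc 1 P, (a : ℝ)⁻¹) : ℝ) ≤ 1 + Real.log P := by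
    have := harmonic_le_one_add_log P
    rw [harmonic_eq_sum_Icc] at this
    push_cast at this
    exact this
  have hharm0 : 0 ≤ ((∑ a ∈ Icc 1 P, (a : ℝ)⁻¹) : ℝ) := sum_nonneg fun _ _ => by positivity
  calc (#{x ∈ A ×ˢ A | x.1.1 * x.1.2 = x.2.1 * x.2.2} : ℝ) ≤ #B := by
        exact_mod_cast (card_le_card hsub).trans card_image_le
    _ ≤ ∑ ab ∈ Icc 1 P ×ˢ Icc 1 P, (((P / ab.1) * (M / ab.2) : ℕ) : ℝ) := by
        rw [← Nat.cast_sum]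
        norm_cast
        refine card_biUnion_le.trans (sum_le_sum fun ab _ => card_image_le.trans ?_)
        simp
    _ ≤ ∑ ab ∈ Icc 1 P ×ˢ Icc 1 P, (P * (ab.1 : ℝ)⁻¹) * (M * (ab.2 : ℝ)⁻¹) := by
        refine sum_le_sum fun ab _ => ?_
        rw [Nat.cast_mul, ← div_eq_mul_inv, ← div_eq_mul_inv]
        exact mul_le_mul Nat.cast_div_le Nat.cast_div_le (by positivity) (by positivity)
    _ = P * M * (∑ a ∈ Icc 1 P, (a : ℝ)⁻¹) ^ 2 := by
        rw [sum_product, sq, sum_mul_sum, mul_sum]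
        refine sum_congr rfl fun a _ => ?_
        rw [mul_sum]
        refine sum_congr rfl fun b _ => ?_
        ring
    _ ≤ _ := by gcongr

/-- A dense set of pairs in a box has many distinct products. -/
lemma card_sq_le_card_products (P M : ℕ) (A : Finset (ℕ × ℕ))
    (hA : ∀ x ∈ A, 1 ≤ x.1 ∧ x.1 ≤ P ∧ 1 ≤ x.2 ∧ x.2 ≤ M) :
    (#A : ℝ) ^ 2 ≤ #(A.image fun x => x.1 * x.2) * (P * M * (1 + Real.log P) ^ 2) := by
  refine le_trans ?_ (mul_le_mul_of_nonneg_left (card_mul_eq_mul_le P M A hA) (by positivity))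
  set f : ℕ × ℕ → ℕ := fun x => x.1 * x.2
  have h1 : #A = ∑ y ∈ A.image f, #{x ∈ A | f x = y} :=
    card_eq_sum_card_fiberwise fun x hx => mem_image_of_mem f hx
  have h2 : #{x ∈ A ×ˢ A | x.1.1 * x.1.2 = x.2.1 * x.2.2}
      = ∑ y ∈ A.image f, #{x ∈ A | f x = y} ^ 2 := by
    rw [card_eq_sum_card_fiberwise (f := fun x => f x.1) (t := A.image f)]
    · refine sum_congr rfl fun y _ => ?_
      rw [sq, ← card_product]
      congr 1
      ext x
      simp only [mem_filter, mem_product, f]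
      constructor
      · rintro ⟨⟨⟨h3, h4⟩, h5⟩, h6⟩
        exact ⟨⟨h3, h6⟩, h4, h5 ▸ h6⟩
      · rintro ⟨⟨h3, h4⟩, h5, h6⟩
        exact ⟨⟨⟨h3, h5⟩, h4.trans h6.symm⟩, h4⟩
    · intro x hx
      exact mem_image_of_mem f (mem_product.1 (mem_filter.1 hx).1).1
  rw [h2]
  nth_rewrite 1 [h1]
  push_cast
  exact sq_sum_le_card_mul_sum_sq

/-! ### Uniform exponents -/

lemma prime_pow_dvd_lcm {p e a b : ℕ} (hp : p.Prime) (ha : a ≠ 0) (hb : b ≠ 0)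
    (h : p ^ e ∣ Nat.lcm a b) : p ^ e ∣ a ∨ p ^ e ∣ b := by
  rw [hp.pow_dvd_iff_le_factorization (Nat.lcm_ne_zero ha hb), Nat.factorization_lcm ha hb,
    Finsupp.sup_apply, le_sup_iff] at h
  rwa [hp.pow_dvd_iff_le_factorization ha, hp.pow_dvd_iff_le_factorization hb]

/-- If all subset sums of `x` have order at most `Q`, and every prime power dividing `E` divides
the order of some `x i`, then `E ≤ Q²`: for each prime power `p ^ e` exactly dividing `E`, at
least half of the subset sums have order divisible by `p ^ e`. -/
lemma exponent_le_sq {M : Type*} [AddCommGroup M] {t Q E : ℕ} (x : Fin t → M) (hE : 0 < E)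
    (hQ : ∀ s : Finset (Fin t), 0 < addOrderOf (∑ i ∈ s, x i) ∧ addOrderOf (∑ i ∈ s, x i) ≤ Q)
    (hx : ∀ p e : ℕ, p.Prime → e ≠ 0 → p ^ e ∣ E → ∃ i, p ^ e ∣ addOrderOf (x i)) :
    E ≤ Q ^ 2 := by
  set v : Finset (Fin t) → ℕ := fun s => addOrderOf (∑ i ∈ s, x i) with hv
  have hv0 : ∀ s, v s ≠ 0 := fun s => (hQ s).1.ne'
  have hdvd : E ^ (2 ^ t) ∣ (∏ s, v s) ^ 2 := by
    have hprod0 : (∏ s, v s) ≠ 0 := prod_ne_zero_iff.2 fun s _ => hv0 s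
    rw [← Nat.factorization_le_iff_dvd (pow_ne_zero _ hE.ne') (pow_ne_zero _ hprod0)]
    intro p
    rw [Nat.factorization_pow, Nat.factorization_pow, Finsupp.smul_apply, Finsupp.smul_apply,
      smul_eq_mul, smul_eq_mul, Nat.factorization_prod fun s _ => hv0 s, Finsupp.finsetSum_apply]
    rcases Nat.eq_zero_or_pos (E.factorization p) with h0 | h0
    · rw [h0, mul_zero]; exact Nat.zero_le _
    have hp : p.Prime := by
      by_contra hp
      rw [Nat.factorization_eq_zero_of_not_prime E hp] at h0
      exact lt_irrefl _ h0
    obtain ⟨i, hi⟩ := hx p _ hp h0.ne' (Nat.ordProj_dvd E p)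
    set e := E.factorization p
    have hpair : ∀ s, e ≤ (v s).factorization p + (v (symmDiff s {i})).factorization p := by
      intro s
      have hlcm : addOrderOf (x i) ∣ Nat.lcm (v s) (v (symmDiff s {i})) := by
        apply addOrderOf_dvd_of_nsmul_eq_zero
        have ha : Nat.lcm (v s) (v (symmDiff s {i})) • ∑ j ∈ s, x j = 0 :=
          addOrderOf_dvd_iff_nsmul_eq_zero.1 (Nat.dvd_lcm_left _ _)
        have hb : Nat.lcm (v s) (v (symmDiff s {i})) • ∑ j ∈ symmDiff s {i}, x j = 0 :=
          addOrderOf_dvd_iff_nsmul_eq_zero.1 (Nat.dvd_lcm_right _ _)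
        by_cases his : i ∈ s
        · have : x i = ∑ j ∈ s, x j - ∑ j ∈ symmDiff s {i}, x j := by
            have h1 : symmDiff s {i} = s.erase i := by
              ext j; simp only [mem_symmDiff, mem_singleton, mem_erase]
              constructor
              · rintro (h | ⟨h, h'⟩)
                · exact ⟨h.2, h.1⟩
                · exact absurd (h ▸ his) h'
              · rintro ⟨h, h'⟩; exact Or.inl ⟨h', h⟩
            rw [h1, ← add_sum_erase s x his]; abel
          rw [this, smul_sub, ha, hb, sub_zero]
        · have : x i = ∑ j ∈ symmDiff s {i}, x j - ∑ j ∈ s, x j := by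
            have h1 : symmDiff s {i} = insert i s := by
              ext j; simp only [mem_symmDiff, mem_singleton, mem_insert]
              constructor
              · rintro (h | h)
                · exact Or.inr h.1
                · exact Or.inl h.1
              · rintro (h | h)
                · exact Or.inr ⟨h, h ▸ his⟩
                · exact Or.inl ⟨h, fun h' => his (h' ▸ h)⟩
            rw [h1, sum_insert his]; abel
          rw [this, smul_sub, ha, hb, sub_zero]
      rcases prime_pow_dvd_lcm hp (hv0 _) (hv0 _) (hi.trans hlcm) with h | h
      · rw [hp.pow_dvd_iff_le_factorization (hv0 _)] at h; omega
      · rw [hp.pow_dvd_iff_le_factorization (hv0 _)] at h; omega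
    have hinv : ∑ s, (v (symmDiff s {i})).factorization p = ∑ s, (v s).factorization p :=
      Equiv.sum_comp (Function.Involutive.toPerm (fun s : Finset (Fin t) => symmDiff s {i})
        fun s => by simp) (fun s => (v s).factorization p)
    calc 2 ^ t * e = ∑ _s : Finset (Fin t), e := by simp
      _ ≤ ∑ s, ((v s).factorization p + (v (symmDiff s {i})).factorization p) :=
        sum_le_sum fun s _ => hpair s
      _ = 2 * ∑ s, (v s).factorization p := by rw [sum_add_distrib, hinv]; ring
  have h1 : E ^ (2 ^ t) ≤ (∏ s, v s) ^ 2 :=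
    Nat.le_of_dvd (pow_pos (prod_pos fun s _ => (hQ s).1) 2) hdvd
  have h2 : ∏ s, v s ≤ Q ^ (2 ^ t) := by
    calc ∏ s, v s ≤ ∏ _s : Finset (Fin t), Q := prod_le_prod' fun s _ => (hQ s).2
      _ = _ := by simp
  have h3 : E ^ (2 ^ t) ≤ (Q ^ 2) ^ (2 ^ t) := by
    rw [← pow_mul, mul_comm 2, pow_mul]
    exact h1.trans (Nat.pow_le_pow_left h2 2)
  exact (Nat.pow_le_pow_iff_left (by positivity)).1 h3

/-- If all sums of at most `T` elements of `X` have order at most `Q`, with `Q² < 2^T`, then `X`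
is killed by a single integer of size at most `Q²`. -/
theorem exists_uniform_exponent {M : Type*} [AddCommGroup M] (X : Set M) (Q T : ℕ)
    (hT : Q ^ 2 < 2 ^ T)
    (hQ : ∀ t ≤ T, ∀ x : Fin t → M, (∀ i, x i ∈ X) → ∀ s : Finset (Fin t),
      0 < addOrderOf (∑ i ∈ s, x i) ∧ addOrderOf (∑ i ∈ s, x i) ≤ Q) :
    ∃ E : ℕ, 0 < E ∧ E ≤ Q ^ 2 ∧ ∀ x ∈ X, E • x = 0 := by
  by_contra hcon
  push Not at hcon
  have key : ∀ t ≤ T, ∃ E : ℕ, 2 ^ t ≤ E ∧ ∃ x : Fin t → M, (∀ i, x i ∈ X) ∧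
      ∀ p e : ℕ, p.Prime → e ≠ 0 → p ^ e ∣ E → ∃ i, p ^ e ∣ addOrderOf (x i) := by
    intro t
    induction t with
    | zero =>
      refine fun _ => ⟨1, by simp, Fin.elim0, fun i => i.elim0, fun p e hp he h => ?_⟩
      have h1 := Nat.dvd_one.1 h
      rcases Nat.pow_eq_one.1 h1 with h2 | h2
      · exact absurd h2 hp.one_lt.ne'
      · exact absurd h2 he
    | succ t ih =>
      intro ht
      obtain ⟨E, hE, x, hx, hpe⟩ := ih (by omega)
      have hE0 : 0 < E := lt_of_lt_of_le (by positivity) hE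
      have hEQ : E ≤ Q ^ 2 := exponent_le_sq x hE0 (hQ t (by omega) x hx) hpe
      obtain ⟨y, hy, hEy⟩ := hcon E hE0 hEQ
      have hy0 : 0 < addOrderOf y := by
        have := (hQ 1 (by omega) (fun _ => y) (fun _ => hy) univ).1
        simpa using this
      refine ⟨Nat.lcm E (addOrderOf y), ?_, Fin.cons y x, ?_, ?_⟩
      · obtain ⟨c, hc⟩ := Nat.dvd_lcm_left E (addOrderOf y)
        have hl0 : 0 < Nat.lcm E (addOrderOf y) := Nat.lcm_pos hE0 hy0
        have hc2 : 2 ≤ c := by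
          by_contra hc2
          have : c = 0 ∨ c = 1 := by omega
          rcases this with rfl | rfl
          · omega
          · apply hEy
            rw [mul_one] at hc
            rw [← addOrderOf_dvd_iff_nsmul_eq_zero, ← hc]
            exact Nat.dvd_lcm_right _ _
        rw [hc, pow_succ]
        exact Nat.mul_le_mul hE hc2
      · intro i
        refine Fin.cases ?_ (fun j => ?_) i
        · simpa using hy
        · simpa using hx j
      · intro p e hp he h
        rcases prime_pow_dvd_lcm hp hE0.ne' hy0.ne' h with h | h
        · obtain ⟨i, hi⟩ := hpe p e hp he h
          exact ⟨i.succ, by simpa using hi⟩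
        · exact ⟨0, by simpa using h⟩
  obtain ⟨E, hE, x, hx, hpe⟩ := key T le_rfl
  have := exponent_le_sq x (lt_of_lt_of_le (by positivity) hE) (hQ T le_rfl x hx) hpe
  omega

/-! ### Bohr sets -/

section Bohr

variable {N : ℕ} [NeZero N] {S : Finset (ZMod N)}

lemma charVal_add (ξ x y : ZMod N) : charVal ξ (x + y) = charVal ξ x + charVal ξ y := by
  simp [charVal, mul_add]

lemma charVal_sub (ξ x y : ZMod N) : charVal ξ (x - y) = charVal ξ x - charVal ξ y := by
  simp [charVal, mul_sub]

@[simp] lemma charVal_zero (ξ : ZMod N) : charVal ξ 0 = 0 := by simp [charVal]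

lemma charVal_neg (ξ x : ZMod N) : charVal ξ (-x) = -charVal ξ x := by simp [charVal]

lemma charVal_zsmul (ξ x : ZMod N) (n : ℤ) : charVal ξ (n • x) = n • charVal ξ x := by
  rw [charVal, charVal, mul_smul_comm, map_zsmul]

lemma charVal_add_left (ξ η x : ZMod N) : charVal (ξ + η) x = charVal ξ x + charVal η x := by
  simp [charVal, add_mul]

lemma charVal_sub_left (ξ η x : ZMod N) : charVal (ξ - η) x = charVal ξ x - charVal η x := by
  simp [charVal, sub_mul]

lemma charVal_comm (ξ x : ZMod N) : charVal ξ x = charVal x ξ := by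
  simp [charVal, mul_comm]

lemma charVal_intCast (ξ : ZMod N) (n : ℤ) : charVal ξ (n : ZMod N) = n • charVal 1 ξ := by
  rw [charVal, charVal, one_mul, ← map_zsmul, zsmul_eq_mul, mul_comm]

/-- The homomorphism `x ↦ (ξ·x)_{ξ ∈ S}`. -/
noncomputable def charHom (S : Finset (ZMod N)) : ZMod N →+ (S → UnitAddCircle) where
  toFun x ξ := charVal (ξ : ZMod N) x
  map_zero' := by ext ξ; simp
  map_add' x y := by ext ξ; simp [charVal_add]

lemma norm_charVal_le_bohrNorm {ξ : ZMod N} (hξ : ξ ∈ S) (x : ZMod N) :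
    ‖charVal ξ x‖ ≤ bohrNorm S x :=
  le_ciSup (f := fun ξ : S => ‖charVal (ξ : ZMod N) x‖) (Set.finite_range _).bddAbove ⟨ξ, hξ⟩

lemma bohrNorm_nonneg (x : ZMod N) : 0 ≤ bohrNorm S x :=
  Real.iSup_nonneg fun _ => norm_nonneg _

lemma bohrNorm_le {x : ZMod N} {c : ℝ} (hc : 0 ≤ c) (h : ∀ ξ ∈ S, ‖charVal ξ x‖ ≤ c) :
    bohrNorm S x ≤ c :=
  Real.iSup_le (fun ξ => h ξ ξ.2) hc

lemma bohrNorm_lt_iff {x : ZMod N} {r : ℝ} (hr : 0 < r) :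
    bohrNorm S x < r ↔ x ∈ bohrSet S r := by
  constructor
  · intro h ξ hξ
    exact (norm_charVal_le_bohrNorm hξ x).trans_lt h
  · intro h
    rcases S.eq_empty_or_nonempty with rfl | hS
    · simpa [bohrNorm] using hr
    · have : Nonempty S := hS.to_subtype
      obtain ⟨ξ, hξ⟩ := exists_eq_ciSup_of_finite (f := fun ξ : S => ‖charVal (ξ : ZMod N) x‖)
      rw [bohrNorm, ← hξ]
      exact h ξ ξ.2

@[simp] lemma bohrNorm_zero : bohrNorm S (0 : ZMod N) = 0 :=
  le_antisymm (bohrNorm_le le_rfl (by simp)) (bohrNorm_nonneg _)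

lemma bohrNorm_add_le (x y : ZMod N) : bohrNorm S (x + y) ≤ bohrNorm S x + bohrNorm S y :=
  bohrNorm_le (add_nonneg (bohrNorm_nonneg _) (bohrNorm_nonneg _)) fun ξ hξ => by
    rw [charVal_add]
    exact (norm_add_le _ _).trans
      (add_le_add (norm_charVal_le_bohrNorm hξ x) (norm_charVal_le_bohrNorm hξ y))

lemma bohrNorm_neg (x : ZMod N) : bohrNorm S (-x) = bohrNorm S x := by
  simp [bohrNorm, charVal_neg]

lemma bohrNorm_sub_le (x y : ZMod N) : bohrNorm S (x - y) ≤ bohrNorm S x + bohrNorm S y := by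
  rw [sub_eq_add_neg, ← bohrNorm_neg y]
  exact bohrNorm_add_le _ _

lemma bohrNorm_zsmul_le (n : ℤ) (x : ZMod N) : bohrNorm S (n • x) ≤ |(n : ℝ)| * bohrNorm S x :=
  bohrNorm_le (mul_nonneg (abs_nonneg _) (bohrNorm_nonneg _)) fun ξ hξ => by
    rw [charVal_zsmul]
    exact (norm_zsmul_le_abs _ _).trans
      (mul_le_mul_of_nonneg_left (norm_charVal_le_bohrNorm hξ x) (abs_nonneg _))

lemma bohrNorm_nsmul_le (n : ℕ) (x : ZMod N) : bohrNorm S (n • x) ≤ n * bohrNorm S x := by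
  have := bohrNorm_zsmul_le (S := S) n x
  simpa using this

lemma bohrNorm_sum_le {ι : Type*} (s : Finset ι) (f : ι → ZMod N) :
    bohrNorm S (∑ i ∈ s, f i) ≤ ∑ i ∈ s, bohrNorm S (f i) :=
  le_sum_of_subadditive _ bohrNorm_zero.le bohrNorm_add_le _ _

lemma abs_valMinAbs_eq (x : ZMod N) : |(x.valMinAbs : ℝ)| = N * ‖charVal 1 x‖ := by
  have hN : (0 : ℝ) < N := by exact_mod_cast NeZero.pos N
  have h1 : charVal 1 x = ((x.valMinAbs / N : ℝ) : UnitAddCircle) := by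
    rw [charVal, one_mul]
    conv_lhs => rw [← ZMod.coe_valMinAbs x]
    rw [ZMod.toAddCircle_intCast]
  have h2 : |(x.valMinAbs : ℝ)| ≤ N / 2 := by
    have h := ZMod.natAbs_valMinAbs_le x
    have h' : ((x.valMinAbs.natAbs : ℕ) : ℝ) ≤ ((N / 2 : ℕ) : ℝ) := by exact_mod_cast h
    rw [Nat.cast_natAbs, Int.cast_abs] at h'
    exact h'.trans Nat.cast_div_le
  rw [h1, circle_norm_coe, abs_div, Nat.abs_cast]
  · field_simp
  · rw [abs_div, Nat.abs_cast, div_le_iff₀ hN]; linarith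

lemma abs_valMinAbs_le (h1 : (1 : ZMod N) ∈ S) (x : ZMod N) :
    |(x.valMinAbs : ℝ)| ≤ N * bohrNorm S x := by
  rw [abs_valMinAbs_eq]
  exact mul_le_mul_of_nonneg_left (norm_charVal_le_bohrNorm h1 x) (by positivity)

lemma eq_zero_of_bohrNorm_eq_zero (h1 : (1 : ZMod N) ∈ S) {x : ZMod N} (hx : bohrNorm S x = 0) :
    x = 0 := by
  have h := abs_valMinAbs_le h1 x
  rw [hx, mul_zero] at h
  have h2 : x.valMinAbs = 0 := by
    have : (x.valMinAbs : ℝ) = 0 := abs_eq_zero.1 (le_antisymm h (abs_nonneg _))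
    exact_mod_cast this
  exact (ZMod.valMinAbs_eq_zero x).1 h2

/-- Since `1 ∈ S`, an element of small Bohr norm is a small integer, so a frequency close to a
multiple of `N` is nearly trivial on it. -/
lemma norm_charVal_le (h1 : (1 : ZMod N) ∈ S) (γ x : ZMod N) :
    ‖charVal γ x‖ ≤ N * bohrNorm S x * ‖charVal 1 γ‖ := by
  have h2 : charVal γ x = x.valMinAbs • charVal 1 γ := by
    conv_lhs => rw [← ZMod.coe_valMinAbs x]
    rw [charVal_intCast]
  rw [h2]
  exact (norm_zsmul_le_abs _ _).trans
    (mul_le_mul_of_nonneg_right (abs_valMinAbs_le h1 x) (norm_nonneg _))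

open Classical in
/-- The Bohr set `{x : ‖x‖_S < r}` as a finite set. -/
noncomputable def bohrFin (S : Finset (ZMod N)) (r : ℝ) : Finset (ZMod N) :=
  {x | bohrNorm S x < r}

@[simp] lemma mem_bohrFin {r : ℝ} {x : ZMod N} : x ∈ bohrFin S r ↔ bohrNorm S x < r := by
  simp [bohrFin]

lemma bohrFin_nonempty {r : ℝ} (hr : 0 < r) : (bohrFin S r).Nonempty :=
  ⟨0, by simpa using hr⟩

lemma card_bohrFin_pos {r : ℝ} (hr : 0 < r) : (0 : ℝ) < #(bohrFin S r) := by
  exact_mod_cast card_pos.2 (bohrFin_nonempty hr)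

lemma bohrNorm_lt_of_charHom {r : ℝ} (hr : 0 < r) {x : ZMod N}
    (h : ∀ i, ‖charHom S x i‖ < r) : bohrNorm S x < r :=
  (bohrNorm_lt_iff hr).2 fun ξ hξ => h ⟨ξ, hξ⟩

/-- The number of cells of length `r` needed to cover the circle. -/
lemma card_cells_le {r : ℝ} (hr : 0 < r) (hr1 : r ≤ 1) :
    (#(Icc ⌊-(1 / 2) / r⌋ ⌊(1 / 2) / r⌋) : ℝ) ≤ 3 / r := by
  have h1 := Int.floor_le ((1 / 2) / r)
  have h2 := Int.lt_floor_add_one (-(1 / 2) / r)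
  have h3 : 1 ≤ 1 / r := by rw [le_div_iff₀ hr]; linarith
  rw [Int.card_Icc, ← Int.cast_natCast, Int.toNat_eq_max, Int.cast_max]
  refine max_le ?_ (by push_cast; positivity)
  push_cast
  have h4 : (1 / 2) / r - -(1 / 2) / r = 1 / r := by ring
  have h5 : 3 / r = 1 / r + 2 * (1 / r) := by ring
  linarith

lemma floor_mem_cells {r : ℝ} (hr : 0 < r) {t : ℝ} (ht : |t| ≤ 1 / 2) :
    ⌊t / r⌋ ∈ Icc ⌊-(1 / 2) / r⌋ ⌊(1 / 2) / r⌋ := by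
  rw [mem_Icc]
  have := abs_le.1 ht
  exact ⟨Int.floor_mono (by gcongr; exact this.1), Int.floor_mono (by gcongr; exact this.2)⟩

lemma card_le_bohrFin {r : ℝ} (hr : 0 < r) (hr1 : r ≤ 1) :
    (N : ℝ) ≤ (3 / r) ^ #S * #(bohrFin S r) := by
  obtain ⟨a₀, -, h⟩ := exists_card_le_of_hom (univ : Finset (ZMod N)) univ_nonempty (charHom S) hr
    (Icc ⌊-(1 / 2) / r⌋ ⌊(1 / 2) / r⌋) (fun a _ i t _ _ ht => floor_mem_cells hr ht)
  have h2 : #{a | ∀ i, ‖charHom S (a - a₀) i‖ < r} ≤ #(bohrFin S r) := by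
    refine card_le_card_of_injOn (fun a => a - a₀) (fun a ha => ?_) (fun a _ b _ hab => by simpa using hab)
    rw [mem_coe, mem_filter] at ha
    rw [mem_coe, mem_bohrFin]
    exact bohrNorm_lt_of_charHom hr ha.2
  have h3 : N ≤ #(Icc ⌊-(1 / 2) / r⌋ ⌊(1 / 2) / r⌋) ^ #S * #(bohrFin S r) := by
    simp only [card_univ, ZMod.card, Fintype.card_coe] at h
    exact h.trans (Nat.mul_le_mul_left _ h2)
  calc (N : ℝ) ≤ (#(Icc ⌊-(1 / 2) / r⌋ ⌊(1 / 2) / r⌋) : ℝ) ^ #S * #(bohrFin S r) := by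
        exact_mod_cast h3
    _ ≤ _ := by
        gcongr
        exact card_cells_le hr hr1

lemma card_bohrFin_two_mul_le {r : ℝ} (hr : 0 < r) :
    (#(bohrFin S (2 * r)) : ℝ) ≤ 4 ^ #S * #(bohrFin S r) := by
  obtain ⟨a₀, -, h⟩ := exists_card_le_of_hom (bohrFin S (2 * r)) (bohrFin_nonempty (by positivity))
    (charHom S) hr (Icc (-2) 1) (fun a ha i t _ ht _ => by
      rw [mem_bohrFin] at ha
      have h1 : |t| < 2 * r := by
        rw [ht]
        exact (norm_charVal_le_bohrNorm i.2 a).trans_lt ha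
      have h2 := abs_lt.1 h1
      have h3 : -2 < t / r := by rw [lt_div_iff₀ hr]; linarith
      have h4 : t / r < 2 := by rw [div_lt_iff₀ hr]; linarith
      rw [mem_Icc]
      refine ⟨Int.le_floor.2 (by push_cast; exact h3.le), ?_⟩
      have : ⌊t / r⌋ < 2 := Int.floor_lt.2 (by push_cast; exact h4)
      omega)
  have h2 : #{a ∈ bohrFin S (2 * r) | ∀ i, ‖charHom S (a - a₀) i‖ < r} ≤ #(bohrFin S r) := by
    refine card_le_card_of_injOn (fun a => a - a₀) (fun a ha => ?_) (fun a _ b _ hab => by simpa using hab)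
    rw [mem_coe, mem_filter] at ha
    rw [mem_coe, mem_bohrFin]
    exact bohrNorm_lt_of_charHom hr ha.2
  have h3 : #(bohrFin S (2 * r)) ≤ 4 ^ #S * #(bohrFin S r) := by
    simp only [Fintype.card_coe] at h
    exact h.trans (Nat.mul_le_mul_left _ h2)
  exact_mod_cast h3

/-! ### Locally quadratic functions -/

/-- The mixed second difference of a locally quadratic function at a point `n` is that at `0`. -/
lemma IsLocallyQuadraticOn.sub_eq_secondDiff {R : ℝ} (hR : 0 < R) {φ : ZMod N → UnitAddCircle}
    (hφ : IsLocallyQuadraticOn (bohrSet S R) φ) {n a b : ZMod N}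
    (hab : bohrNorm S a + bohrNorm S b < R) (h0 : bohrNorm S n < R)
    (h1 : bohrNorm S (n + a) < R) (h2 : bohrNorm S (n + b) < R)
    (h3 : bohrNorm S (n + a + b) < R) :
    φ (n + a + b) - φ (n + a) - φ (n + b) + φ n = secondDiff φ a b := by
  have ha : bohrNorm S a < R := by linarith [bohrNorm_nonneg (S := S) b]
  have hb : bohrNorm S b < R := by linarith [bohrNorm_nonneg (S := S) a]
  have hab' : bohrNorm S (a + b) < R := (bohrNorm_add_le _ _).trans_lt hab
  have hz : bohrNorm S (0 : ZMod N) < R := by simpa using hR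
  rw [bohrNorm_lt_iff hR] at *
  have key := hφ 0 ![n, a, b] (by
    intro ω
    have : ∑ i ∈ ω, (![n, a, b] : Fin 3 → ZMod N) i =
        (if (0 : Fin 3) ∈ ω then n else 0) + (if (1 : Fin 3) ∈ ω then a else 0)
          + (if (2 : Fin 3) ∈ ω then b else 0) := by
      have h4 : ∑ i ∈ ω, (![n, a, b] : Fin 3 → ZMod N) i =
          ∑ i, if i ∈ ω then (![n, a, b] : Fin 3 → ZMod N) i else 0 := by simp
      rw [h4, Fin.sum_univ_three]
      simp
    rw [this, zero_add]
    by_cases c0 : (0 : Fin 3) ∈ ω <;> by_cases c1 : (1 : Fin 3) ∈ ω <;>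
      by_cases c2 : (2 : Fin 3) ∈ ω <;> simp [*])
  simp only [discreteDeriv, Matrix.cons_val_zero, Matrix.cons_val_one, Matrix.cons_val, zero_add] at key
  simp only [secondDiff]
  rw [← sub_eq_zero, ← key]
  abel

lemma secondDiff_comm {G : Type*} [AddCommGroup G] (φ : G → UnitAddCircle) (a b : G) :
    secondDiff φ a b = secondDiff φ b a := by
  simp only [secondDiff, add_comm a b]; abel

@[simp] lemma secondDiff_zero_left {G : Type*} [AddCommGroup G] (φ : G → UnitAddCircle) (b : G) :
    secondDiff φ 0 b = 0 := by
  simp [secondDiff]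

/-- `χ` is additive as long as the Bohr norms involved add up to less than `R`. -/
def LocAdd (S : Finset (ZMod N)) (R : ℝ) (χ : ZMod N → UnitAddCircle) : Prop :=
  ∀ x y, bohrNorm S x + bohrNorm S y < R → χ (x + y) = χ x + χ y

lemma IsLocallyQuadraticOn.locAdd {R R' : ℝ} {φ : ZMod N → UnitAddCircle}
    (hφ : IsLocallyQuadraticOn (bohrSet S R) φ) {b : ZMod N} (hR' : 0 < R')
    (hb : R' + bohrNorm S b ≤ R) : LocAdd S R' (fun a => secondDiff φ a b) := by
  intro x y hxy
  have hR : 0 < R := by linarith [bohrNorm_nonneg (S := S) b]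
  have hx := bohrNorm_nonneg (S := S) x
  have hy := bohrNorm_nonneg (S := S) y
  have hb' := bohrNorm_nonneg (S := S) b
  have h1 := hφ.sub_eq_secondDiff hR (n := y) (a := x) (b := b) (by linarith) (by linarith)
    (by linarith [bohrNorm_add_le (S := S) y x]) (by linarith [bohrNorm_add_le (S := S) y b])
    (by linarith [bohrNorm_add_le (S := S) (y + x) b, bohrNorm_add_le (S := S) y x])
  show secondDiff φ (x + y) b = secondDiff φ x b + secondDiff φ y b
  rw [← h1]
  simp only [secondDiff, add_comm x y]
  abel

lemma LocAdd.zero {R : ℝ} {χ : ZMod N → UnitAddCircle} (hR : 0 < R) (h : LocAdd S R χ) :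
    χ 0 = 0 := by
  have := h 0 0 (by simpa using hR)
  rw [add_zero] at this
  simpa using this

lemma LocAdd.neg {R : ℝ} {χ : ZMod N → UnitAddCircle} (h : LocAdd S R χ) {x : ZMod N}
    (hx : 2 * bohrNorm S x < R) : χ (-x) = -χ x := by
  have h1 := h x (-x) (by rw [bohrNorm_neg]; linarith)
  rw [add_neg_cancel, h.zero (by linarith [bohrNorm_nonneg (S := S) x])] at h1
  exact (neg_eq_of_add_eq_zero_right h1.symm).symm

lemma LocAdd.sub {R : ℝ} {χ : ZMod N → UnitAddCircle} (h : LocAdd S R χ) {x y : ZMod N}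
    (hxy : bohrNorm S x + 2 * bohrNorm S y < R) : χ (x - y) = χ x - χ y := by
  have h0 := bohrNorm_nonneg (S := S) x
  have h2 := bohrNorm_nonneg (S := S) y
  rw [sub_eq_add_neg, h x (-y) (by rw [bohrNorm_neg]; linarith), h.neg (by linarith),
    sub_eq_add_neg]

lemma LocAdd.nsmul {R : ℝ} {χ : ZMod N → UnitAddCircle} (h : LocAdd S R χ) {x : ZMod N} (n : ℕ)
    (hx : n * bohrNorm S x < R) : χ (n • x) = n • χ x := by
  induction n with
  | zero => simpa using h.zero (by simpa using hx)
  | succ n ih =>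
    push_cast at hx
    rw [succ_nsmul, succ_nsmul, h, ih]
    · linarith [bohrNorm_nonneg (S := S) x]
    · linarith [bohrNorm_nsmul_le (S := S) n x]

lemma LocAdd.zsmul {R : ℝ} {χ : ZMod N → UnitAddCircle} (h : LocAdd S R χ) {x : ZMod N} (n : ℤ)
    (hx : 2 * (|(n : ℝ)| * bohrNorm S x) < R) : χ (n • x) = n • χ x := by
  have h0 : 0 ≤ |(n : ℝ)| * bohrNorm S x := mul_nonneg (abs_nonneg _) (bohrNorm_nonneg _)
  obtain ⟨m, rfl | rfl⟩ := n.eq_nat_or_neg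
  · rw [natCast_zsmul, natCast_zsmul]
    refine h.nsmul m ?_
    simp only [Int.cast_natCast, Nat.abs_cast] at hx h0
    linarith
  · simp only [Int.cast_neg, Int.cast_natCast, abs_neg, Nat.abs_cast] at hx h0
    rw [neg_smul, neg_smul, natCast_zsmul, natCast_zsmul, h.neg, h.nsmul]
    · linarith
    · linarith [bohrNorm_nsmul_le (S := S) m x]

/-! ### Fourier analysis of locally additive functions -/

lemma sum_e_charVal (n : ZMod N) : ∑ γ, e (charVal γ n) = if n = 0 then (N : ℂ) else 0 := by
  have h := AddChar.sum_mulShift n (ZMod.isPrimitive_stdAddChar N)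
  rw [ZMod.card] at h
  simp only [Nat.cast_ite, Nat.cast_zero] at h
  rw [← h]
  refine sum_congr rfl fun γ _ => ?_
  rw [charVal, ZMod.toAddCircle_apply, e_coe, ZMod.stdAddChar_apply, ZMod.toCircle_apply]
  congr 1
  push_cast
  ring

lemma parseval {ι κ : Type*} (s : Finset ι) (t : Finset κ) (f : ι → ℂ) (g : κ → ℂ)
    (p : ι → ZMod N) (p' : κ → ZMod N) (y : ZMod N) :
    ∑ γ, (∑ i ∈ s, f i * e (-charVal γ (p i))) * conj (∑ j ∈ t, g j * e (-charVal γ (p' j)))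
        * e (charVal γ y)
      = N * ∑ i ∈ s, ∑ j ∈ t, if p i - p' j = y then f i * conj (g j) else 0 := by
  have h1 : ∀ γ : ZMod N, (∑ i ∈ s, f i * e (-charVal γ (p i))) *
      conj (∑ j ∈ t, g j * e (-charVal γ (p' j))) * e (charVal γ y)
      = ∑ i ∈ s, ∑ j ∈ t, f i * conj (g j) * e (charVal γ (y - (p i - p' j))) := by
    intro γ
    rw [map_sum, sum_mul_sum, sum_mul]
    refine sum_congr rfl fun i _ => ?_
    rw [sum_mul]
    refine sum_congr rfl fun j _ => ?_
    rw [map_mul, ← e_neg, neg_neg, charVal_sub, charVal_sub,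
      show charVal γ y - (charVal γ (p i) - charVal γ (p' j))
        = -charVal γ (p i) + charVal γ (p' j) + charVal γ y by abel, e_add, e_add]
    ring
  simp_rw [h1]
  rw [sum_comm, mul_sum]
  refine sum_congr rfl fun i _ => ?_
  rw [sum_comm, mul_sum]
  refine sum_congr rfl fun j _ => ?_
  rw [← mul_sum, sum_e_charVal]
  by_cases h : p i - p' j = y
  · rw [if_pos h, if_pos (by rw [h, sub_self])]; ring
  · rw [if_neg h, if_neg (fun h' => h (sub_eq_zero.1 h').symm)]; ring

/-- The tent function `max(0, 1 - ‖x‖_S / r)` on the Bohr set of radius `r`. -/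
noncomputable def tent (S : Finset (ZMod N)) (r : ℝ) (x : ZMod N) : ℝ :=
  max 0 (1 - bohrNorm S x / r)

lemma tent_nonneg (r : ℝ) (x : ZMod N) : 0 ≤ tent S r x := le_max_left _ _

lemma tent_le_one {r : ℝ} (hr : 0 < r) (x : ZMod N) : tent S r x ≤ 1 :=
  max_le zero_le_one (by have := bohrNorm_nonneg (S := S) x; have : 0 ≤ bohrNorm S x / r := by positivity
                         linarith)

lemma tent_eq_zero {r : ℝ} (hr : 0 < r) {x : ZMod N} (hx : r ≤ bohrNorm S x) : tent S r x = 0 :=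
  max_eq_left (by rw [sub_nonpos, le_div_iff₀ hr]; linarith)

lemma bohrNorm_lt_of_tent_ne_zero {r : ℝ} (hr : 0 < r) {x : ZMod N} (hx : tent S r x ≠ 0) :
    bohrNorm S x < r := by
  by_contra h
  exact hx (tent_eq_zero hr (not_lt.1 h))

lemma half_le_tent {r : ℝ} (hr : 0 < r) {x : ZMod N} (hx : bohrNorm S x ≤ r / 2) :
    1 / 2 ≤ tent S r x := by
  refine le_trans ?_ (le_max_right _ _)
  have : bohrNorm S x / r ≤ 1 / 2 := by rw [div_le_iff₀ hr]; linarith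
  linarith

lemma abs_tent_sub_le {r : ℝ} (hr : 0 < r) (x y : ZMod N) :
    |tent S r x - tent S r y| ≤ bohrNorm S (x - y) / r := by
  have h1 : |bohrNorm S x - bohrNorm S y| ≤ bohrNorm S (x - y) := by
    rw [abs_sub_le_iff]
    constructor
    · have := bohrNorm_add_le (S := S) (x - y) y
      rw [sub_add_cancel] at this; linarith
    · have := bohrNorm_sub_le (S := S) x (x - y)
      rw [sub_sub_cancel] at this; linarith
  have h2 := abs_max_sub_max_le_abs (1 - bohrNorm S x / r) (1 - bohrNorm S y / r) 0
  rw [max_comm _ 0, max_comm _ 0] at h2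
  refine h2.trans ?_
  rw [show 1 - bohrNorm S x / r - (1 - bohrNorm S y / r) = -((bohrNorm S x - bohrNorm S y) / r) by ring,
    abs_neg, abs_div, abs_of_pos hr]
  gcongr

/-- The mass `Σ_x tent(x)²`. -/
noncomputable def tentMass (S : Finset (ZMod N)) (r : ℝ) : ℝ := ∑ x, tent S r x ^ 2

lemma card_le_tentMass {r : ℝ} (hr : 0 < r) :
    (#(bohrFin S r) : ℝ) ≤ 4 ^ (#S + 1) * tentMass S r := by
  have h1 : (#(bohrFin S (r / 2)) : ℝ) * (1 / 4) ≤ tentMass S r := by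
    rw [tentMass, ← nsmul_eq_mul, ← sum_const]
    calc ∑ _x ∈ bohrFin S (r / 2), (1 / 4 : ℝ) ≤ ∑ x ∈ bohrFin S (r / 2), tent S r x ^ 2 := by
          refine sum_le_sum fun x hx => ?_
          have := half_le_tent hr (mem_bohrFin.1 hx).le
          nlinarith
      _ ≤ _ := sum_le_sum_of_subset_of_nonneg (subset_univ _) fun _ _ _ => sq_nonneg _
  have h2 := card_bohrFin_two_mul_le (S := S) (half_pos hr)
  rw [mul_div_cancel₀ r (two_ne_zero)] at h2
  calc (#(bohrFin S r) : ℝ) ≤ 4 ^ #S * #(bohrFin S (r / 2)) := h2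
    _ ≤ 4 ^ #S * (4 * tentMass S r) := by gcongr; linarith
    _ = _ := by rw [pow_succ]; ring

lemma tentMass_pos {r : ℝ} (hr : 0 < r) : 0 < tentMass S r := by
  have h1 := card_bohrFin_pos (S := S) hr
  have h2 := card_le_tentMass (S := S) hr
  have h3 : (0 : ℝ) < 4 ^ (#S + 1) := by positivity
  nlinarith

/-- The normalised autocorrelation of the tent function, a positive-definite bump. -/
noncomputable def bump (S : Finset (ZMod N)) (r : ℝ) (y : ZMod N) : ℝ :=
  (∑ x, tent S r x * tent S r (x - y)) / tentMass S r

lemma bump_nonneg (r : ℝ) (y : ZMod N) : 0 ≤ bump S r y :=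
  div_nonneg (sum_nonneg fun _ _ => mul_nonneg (tent_nonneg _ _) (tent_nonneg _ _))
    (sum_nonneg fun _ _ => sq_nonneg _)

lemma bump_zero {r : ℝ} (hr : 0 < r) : bump S r (0 : ZMod N) = 1 := by
  rw [bump, div_eq_one_iff_eq (tentMass_pos hr).ne']
  simp [tentMass, sq]

lemma bohrNorm_lt_of_bump_ne_zero {r : ℝ} (hr : 0 < r) {y : ZMod N} (hy : bump S r y ≠ 0) :
    bohrNorm S y < 2 * r := by
  by_contra h
  apply hy
  rw [bump, sum_eq_zero, zero_div]
  intro x _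
  by_contra h0
  have h1 := bohrNorm_lt_of_tent_ne_zero hr (left_ne_zero_of_mul h0)
  have h2 := bohrNorm_lt_of_tent_ne_zero hr (right_ne_zero_of_mul h0)
  have h3 := bohrNorm_sub_le (S := S) x (x - y)
  rw [sub_sub_cancel] at h3
  linarith

lemma sum_tent_shift_sq (r : ℝ) (y : ZMod N) : ∑ x, tent S r (x - y) ^ 2 = tentMass S r :=
  Equiv.sum_comp (Equiv.subRight y) fun x => tent S r x ^ 2

lemma one_sub_bump_le {r : ℝ} (hr : 0 < r) (y : ZMod N) :
    1 - bump S r y ≤ 4 ^ (#S + 1) * (bohrNorm S y / r) ^ 2 := by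
  have hW := tentMass_pos (S := S) hr
  have h1 : 2 * (tentMass S r - ∑ x, tent S r x * tent S r (x - y))
      = ∑ x, (tent S r x - tent S r (x - y)) ^ 2 := by
    have : ∀ x : ZMod N, (tent S r x - tent S r (x - y)) ^ 2
        = tent S r x ^ 2 + tent S r (x - y) ^ 2 - 2 * (tent S r x * tent S r (x - y)) :=
      fun x => by ring
    simp_rw [this]
    rw [sum_sub_distrib, sum_add_distrib, sum_tent_shift_sq, ← mul_sum]
    rw [tentMass]; ring
  have hB : ∑ x, (tent S r x - tent S r (x - y)) ^ 2
      ≤ ∑ x, ((if x ∈ bohrFin S r then (bohrNorm S y / r) ^ 2 else 0)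
        + (if x - y ∈ bohrFin S r then (bohrNorm S y / r) ^ 2 else 0)) := by
    refine sum_le_sum fun x _ => ?_
    have h2 := abs_tent_sub_le (S := S) hr x (x - y)
    rw [sub_sub_cancel] at h2
    have h3 : (tent S r x - tent S r (x - y)) ^ 2 ≤ (bohrNorm S y / r) ^ 2 :=
      sq_le_sq' (abs_le.1 h2).1 (abs_le.1 h2).2
    have h4 := sq_nonneg (bohrNorm S y / r)
    by_cases hx : x ∈ bohrFin S r
    · rw [if_pos hx]; split_ifs <;> linarith
    · by_cases hxy : x - y ∈ bohrFin S r
      · rw [if_neg hx, if_pos hxy]; linarith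
      · rw [if_neg hx, if_neg hxy]
        rw [mem_bohrFin, not_lt] at hx hxy
        rw [tent_eq_zero hr hx, tent_eq_zero hr hxy]; simp
  have hC : ∑ x, ((if x ∈ bohrFin S r then (bohrNorm S y / r) ^ 2 else 0)
        + (if x - y ∈ bohrFin S r then (bohrNorm S y / r) ^ 2 else 0))
      = 2 * (#(bohrFin S r) * (bohrNorm S y / r) ^ 2) := by
    rw [sum_add_distrib]
    have h5 : ∑ x, (if x - y ∈ bohrFin S r then (bohrNorm S y / r) ^ 2 else 0)
        = ∑ x, (if x ∈ bohrFin S r then (bohrNorm S y / r) ^ 2 else 0) :=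
      Equiv.sum_comp (Equiv.subRight y) fun x => if x ∈ bohrFin S r then (bohrNorm S y / r) ^ 2 else 0
    rw [h5, sum_ite_mem, univ_inter, sum_const, nsmul_eq_mul]
    ring
  have h6 : (1 - bump S r y) * tentMass S r ≤ #(bohrFin S r) * (bohrNorm S y / r) ^ 2 := by
    rw [bump, sub_mul, one_mul, div_mul_cancel₀ _ hW.ne']
    linarith
  have h7 := card_le_tentMass (S := S) hr
  refine le_of_mul_le_mul_right (h6.trans ?_) hW
  calc (#(bohrFin S r) : ℝ) * (bohrNorm S y / r) ^ 2
      ≤ (4 ^ (#S + 1) * tentMass S r) * (bohrNorm S y / r) ^ 2 := by gcongr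
    _ = _ := by ring

/-- The weight of the frequency `γ` in the expansion of `bump · e(χ)` into characters. -/
noncomputable def coeff (S : Finset (ZMod N)) (r : ℝ) (χ : ZMod N → UnitAddCircle) (γ : ZMod N) :
    ℝ :=
  ‖∑ x, (tent S r x * e (χ x)) * e (-charVal γ x)‖ ^ 2 / (N * tentMass S r)

lemma coeff_nonneg {r : ℝ} (χ : ZMod N → UnitAddCircle) (γ : ZMod N) : 0 ≤ coeff S r χ γ :=
  div_nonneg (sq_nonneg _) (mul_nonneg (by positivity) (sum_nonneg fun _ _ => sq_nonneg _))

/-- A locally additive phase, cut off by the bump, is an average of global characters with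
nonnegative weights. -/
theorem sum_coeff_mul_e {r : ℝ} (hr : 0 < r) {χ : ZMod N → UnitAddCircle}
    (hχ : LocAdd S (4 * r) χ) (y : ZMod N) :
    ∑ γ, (coeff S r χ γ : ℂ) * e (charVal γ y) = bump S r y * e (χ y) := by
  have hW := tentMass_pos (S := S) hr
  have hN : (0 : ℝ) < N := by exact_mod_cast NeZero.pos N
  have h1 := parseval univ univ (fun x => (tent S r x : ℂ) * e (χ x))
    (fun x => (tent S r x : ℂ) * e (χ x)) (fun x : ZMod N => x) (fun x => x) y
  have h2 : ∀ x : ZMod N, ∑ x', (if x - x' = y then (tent S r x : ℂ) * e (χ x)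
      * conj ((tent S r x' : ℂ) * e (χ x')) else 0)
      = (tent S r x * tent S r (x - y) : ℝ) * e (χ y) := by
    intro x
    rw [sum_eq_single (x - y)]
    · rw [if_pos (by abel), map_mul, Complex.conj_ofReal]
      by_cases h0 : tent S r x * tent S r (x - y) = 0
      · rw [h0, Complex.ofReal_zero, zero_mul]
        rcases mul_eq_zero.1 h0 with h | h <;> simp [h]
      · have h3 := bohrNorm_lt_of_tent_ne_zero hr (left_ne_zero_of_mul h0)
        have h4 := bohrNorm_lt_of_tent_ne_zero hr (right_ne_zero_of_mul h0)
        have h5 : bohrNorm S y < 2 * r := by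
          have h6 := bohrNorm_sub_le (S := S) x (x - y)
          rw [sub_sub_cancel] at h6; linarith
        have h6 := hχ (x - y) y (by linarith)
        rw [sub_add_cancel] at h6
        rw [h6, e_add]
        push_cast
        linear_combination (tent S r x * tent S r (x - y) * e (χ y) : ℂ) * e_mul_conj (χ (x - y))
    · intro b _ hb
      rw [if_neg]
      rintro rfl
      exact hb (by abel)
    · intro h; exact absurd (mem_univ _) h
  simp_rw [h2] at h1
  rw [← sum_mul, ← Complex.ofReal_sum] at h1
  have h3 : ∀ γ : ZMod N, (coeff S r χ γ : ℂ) * e (charVal γ y) * (N * tentMass S r)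
      = (∑ x, (tent S r x * e (χ x)) * e (-charVal γ x)) *
        conj (∑ x, (tent S r x * e (χ x)) * e (-charVal γ x)) * e (charVal γ y) := by
    intro γ
    rw [Complex.mul_conj, Complex.normSq_eq_norm_sq, coeff]
    push_cast
    have h4 : (N : ℂ) * (tentMass S r : ℂ) ≠ 0 := by
      exact_mod_cast (mul_pos hN hW).ne'
    rw [mul_right_comm, div_mul_cancel₀ _ h4]
  have hNW : ((N : ℂ) * (tentMass S r : ℂ)) ≠ 0 := by exact_mod_cast (mul_pos hN hW).ne'
  apply mul_right_cancel₀ hNW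
  rw [sum_mul]
  simp_rw [h3]
  rw [h1, bump]
  push_cast
  have h4 : (tentMass S r : ℂ) ≠ 0 := by exact_mod_cast hW.ne'
  field_simp

lemma sum_coeff {r : ℝ} (hr : 0 < r) {χ : ZMod N → UnitAddCircle} (hχ : LocAdd S (4 * r) χ) :
    ∑ γ, coeff S r χ γ = 1 := by
  have h := sum_coeff_mul_e hr hχ 0
  rw [bump_zero hr, hχ.zero (by positivity)] at h
  simp only [charVal_zero, e_zero, mul_one] at h
  exact_mod_cast h

/-- The frequencies whose character approximates `χ` near `0`, with error proportional to the
Bohr norm. -/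
def charApprox (S : Finset (ZMod N)) (τ : ℝ) (χ : ZMod N → UnitAddCircle) : Set (ZMod N) :=
  {γ | ∀ a, bohrNorm S a < τ → ‖χ a - charVal γ a‖ ≤ bohrNorm S a / τ}

lemma charApprox_sub {τ : ℝ} {χ χ' : ZMod N → UnitAddCircle} {γ γ' : ZMod N}
    (hγ : γ ∈ charApprox S τ χ) (hγ' : γ' ∈ charApprox S τ χ') (hτ : 0 < τ) :
    γ - γ' ∈ charApprox S (τ / 2) (χ - χ') := by
  intro a ha
  have h1 := hγ a (by linarith)
  have h2 := hγ' a (by linarith)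
  rw [charVal_sub_left, Pi.sub_apply,
    show χ a - χ' a - (charVal γ a - charVal γ' a) = (χ a - charVal γ a) - (χ' a - charVal γ' a) by abel]
  refine (norm_sub_le _ _).trans ?_
  have : bohrNorm S a / (τ / 2) = bohrNorm S a / τ + bohrNorm S a / τ := by field_simp; ring
  linarith

open Classical in
/-- Few frequencies approximate a given function. -/
lemma card_charApprox_le {τ : ℝ} (hτ : 0 < τ) (χ : ZMod N → UnitAddCircle) :
    (#{γ | γ ∈ charApprox S τ χ} : ℝ) * #(bohrFin S (τ / 16)) ≤ 64 * N := by
  have hB := card_bohrFin_pos (S := S) (r := τ / 16) (by positivity)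
  set A : Finset (ZMod N) := {γ | γ ∈ charApprox S τ χ} with hA
  rcases A.eq_empty_or_nonempty with h0 | ⟨γ₀, hγ₀⟩
  · rw [h0]; simp
  have hp := parseval (bohrFin S (τ / 16)) (bohrFin S (τ / 16)) (fun _ => 1)
    (fun _ => 1) (fun x : ZMod N => x) (fun x => x) 0
  simp only [charVal_zero, e_zero, mul_one, one_mul, map_one, sub_eq_zero] at hp
  have h1 : ∑ γ, ‖∑ x ∈ bohrFin S (τ / 16), e (-charVal γ x)‖ ^ 2 = N * #(bohrFin S (τ / 16)) := by
    have h2 : ((∑ γ, ‖∑ x ∈ bohrFin S (τ / 16), e (-charVal γ x)‖ ^ 2 : ℝ) : ℂ)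
        = ((N * #(bohrFin S (τ / 16)) : ℝ) : ℂ) := by
      push_cast
      calc _ = ∑ γ, (∑ x ∈ bohrFin S (τ / 16), e (-charVal γ x)) *
            conj (∑ x ∈ bohrFin S (τ / 16), e (-charVal γ x)) := by
            refine sum_congr rfl fun γ _ => ?_
            rw [Complex.mul_conj, Complex.normSq_eq_norm_sq]; push_cast; rfl
        _ = _ := by
            rw [hp]
            simp only [sum_ite_eq]
            rw [sum_ite_mem, inter_self, sum_const, nsmul_eq_mul, mul_one]
    exact_mod_cast h2
  have h2 : ∀ γ ∈ A, (#(bohrFin S (τ / 16)) / 8 : ℝ) ^ 2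
      ≤ ‖∑ x ∈ bohrFin S (τ / 16), e (-charVal (γ - γ₀) x)‖ ^ 2 := by
    intro γ hγ
    simp only [hA, mem_filter, mem_univ, true_and] at hγ hγ₀
    gcongr
    refine le_trans ?_ (Complex.re_le_norm _)
    rw [Complex.re_sum, div_eq_mul_inv, ← nsmul_eq_mul, ← sum_const]
    refine sum_le_sum fun x hx => ?_
    rw [mem_bohrFin] at hx
    have h3 := charApprox_sub hγ hγ₀ hτ x (by linarith)
    rw [sub_self, Pi.zero_apply, zero_sub] at h3
    have h4 : bohrNorm S x / (τ / 2) ≤ 1 / 8 := by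
      rw [div_le_iff₀ (by positivity)]; linarith
    have h5 := one_sub_le_e_re (-charVal (γ - γ₀) x)
    linarith
  have h3 : (#A : ℝ) * (#(bohrFin S (τ / 16)) / 8 : ℝ) ^ 2 ≤ N * #(bohrFin S (τ / 16)) := by
    rw [← h1, ← nsmul_eq_mul, ← sum_const]
    refine (sum_le_sum h2).trans ?_
    calc ∑ γ ∈ A, ‖∑ x ∈ bohrFin S (τ / 16), e (-charVal (γ - γ₀) x)‖ ^ 2
        ≤ ∑ γ, ‖∑ x ∈ bohrFin S (τ / 16), e (-charVal (γ - γ₀) x)‖ ^ 2 :=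
          sum_le_sum_of_subset_of_nonneg (subset_univ _) fun _ _ _ => sq_nonneg _
      _ = _ := Equiv.sum_comp (Equiv.subRight γ₀)
          fun γ => ‖∑ x ∈ bohrFin S (τ / 16), e (-charVal γ x)‖ ^ 2
  refine le_of_mul_le_mul_right ?_ hB
  linarith

open Classical in
/-- Most of the weight in the expansion of `bump · e(χ)` lies on frequencies which approximate
`χ`. -/
theorem sum_coeff_not_charApprox_le (h1S : (1 : ZMod N) ∈ S) {r r₁ : ℝ} (hr₁ : 0 < r₁)
    (hr : r₁ ≤ r) {χ : ZMod N → UnitAddCircle} (hχ : LocAdd S (4 * r) χ) :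
    ∑ γ with γ ∉ charApprox S (r₁ / 4) χ, coeff S r χ γ ≤ 2500 * 16 ^ #S * (r₁ / r) ^ 2 := by
  have hr0 : 0 < r := hr₁.trans_le hr
  set θ : ZMod N → ZMod N → UnitAddCircle := fun γ a => χ a - charVal γ a with hθ
  have hθadd : ∀ γ x y, bohrNorm S x + bohrNorm S y < 4 * r → θ γ (x + y) = θ γ x + θ γ y := by
    intro γ x y hxy
    simp only [hθ, hχ x y hxy, charVal_add]; abel
  have hB0 := card_bohrFin_pos (S := S) hr₁
  -- the mean square of the error
  have hmean : ∑ γ, coeff S r χ γ * ∑ a ∈ bohrFin S r₁, ‖θ γ a‖ ^ 2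
      ≤ #(bohrFin S r₁) * (4 ^ (#S + 1) / 8 * (r₁ / r) ^ 2) := by
    simp_rw [mul_sum]
    rw [sum_comm, ← nsmul_eq_mul, ← sum_const]
    refine sum_le_sum fun a ha => ?_
    rw [mem_bohrFin] at ha
    have h1 : ∑ γ, coeff S r χ γ * (1 - (e (-θ γ a)).re) = 1 - bump S r a := by
      have h2 := sum_coeff_mul_e hr0 hχ a
      have h3 : ∑ γ, coeff S r χ γ * (e (-θ γ a)).re = bump S r a := by
        have h4 := congrArg (fun z => (z * conj (e (χ a))).re) h2
        rw [mul_assoc, e_mul_conj, mul_one, Complex.ofReal_re, sum_mul, Complex.re_sum] at h4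
        rw [← h4]
        refine sum_congr rfl fun γ _ => ?_
        rw [mul_assoc, ← e_sub, Complex.re_ofReal_mul]
        simp only [hθ, neg_sub]
      simp_rw [mul_sub, mul_one]
      rw [sum_sub_distrib, h3, sum_coeff hr0 hχ]
    have h2 : 8 * ∑ γ, coeff S r χ γ * ‖θ γ a‖ ^ 2 ≤ 1 - bump S r a := by
      rw [← h1, mul_sum]
      refine sum_le_sum fun γ _ => ?_
      have h3 := one_sub_e_re (-θ γ a)
      rw [norm_neg] at h3
      nlinarith [coeff_nonneg (S := S) (r := r) χ γ]
    have h3 := one_sub_bump_le (S := S) hr0 a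
    have h4 : (bohrNorm S a / r) ^ 2 ≤ (r₁ / r) ^ 2 := by
      have := bohrNorm_nonneg (S := S) a
      gcongr
    have h5 : (4 : ℝ) ^ (#S + 1) * (bohrNorm S a / r) ^ 2 ≤ 4 ^ (#S + 1) * (r₁ / r) ^ 2 := by gcongr
    linarith
  -- a frequency outside `charApprox` has a large mean square error
  have hbad : ∀ γ, γ ∉ charApprox S (r₁ / 4) χ →
      (#(bohrFin S r₁) : ℝ) / (4 ^ #S * 5000) ≤ ∑ a ∈ bohrFin S r₁, ‖θ γ a‖ ^ 2 := by
    intro γ hγ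
    by_contra hcon
    push Not at hcon
    apply hγ
    set Z := {a ∈ bohrFin S r₁ | 1 / 50 < ‖θ γ a‖} with hZ
    have hZcard : 2 * #Z < #(bohrFin S (r₁ / 2)) := by
      have h1 : (#Z : ℝ) * (1 / 2500) ≤ ∑ a ∈ bohrFin S r₁, ‖θ γ a‖ ^ 2 := by
        rw [← nsmul_eq_mul, ← sum_const]
        calc ∑ _a ∈ Z, (1 / 2500 : ℝ) ≤ ∑ a ∈ Z, ‖θ γ a‖ ^ 2 := by
              refine sum_le_sum fun a ha => ?_
              have := (mem_filter.1 ha).2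
              nlinarith
          _ ≤ _ := sum_le_sum_of_subset_of_nonneg (filter_subset _ _) fun _ _ _ => sq_nonneg _
      have h2 := card_bohrFin_two_mul_le (S := S) (half_pos hr₁)
      rw [mul_div_cancel₀ r₁ two_ne_zero] at h2
      have h3 : (#(bohrFin S r₁) : ℝ) / (4 ^ #S * 5000) ≤ #(bohrFin S (r₁ / 2)) / 5000 := by
        rw [div_le_div_iff₀ (by positivity) (by norm_num)]
        nlinarith
      have h4 : 2 * (#Z : ℝ) < #(bohrFin S (r₁ / 2)) := by linarith
      exact_mod_cast h4
    have hsmall : ∀ a, bohrNorm S a < r₁ / 2 → ‖θ γ a‖ ≤ 1 / 25 := by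
      intro a ha
      obtain ⟨x, hx, hx1, hx2⟩ : ∃ x ∈ bohrFin S (r₁ / 2), x ∉ Z ∧ x + a ∉ Z := by
        by_contra hall
        push Not at hall
        have h1 : bohrFin S (r₁ / 2) ⊆ Z ∪ Z.image fun z => z - a := by
          intro x hx
          by_cases hxZ : x ∈ Z
          · exact mem_union_left _ hxZ
          · exact mem_union_right _ (mem_image.2 ⟨x + a, hall x hx hxZ, by abel⟩)
        have h2 := (card_le_card h1).trans (card_union_le _ _)
        have h3 : #(Z.image fun z => z - a) ≤ #Z := card_image_le
        omega
      rw [mem_bohrFin] at hx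
      have h1 : bohrNorm S (x + a) < r₁ := by linarith [bohrNorm_add_le (S := S) x a]
      have h2 : ‖θ γ x‖ ≤ 1 / 50 := by
        by_contra h
        exact hx1 (mem_filter.2 ⟨mem_bohrFin.2 (by linarith), not_le.1 h⟩)
      have h3 : ‖θ γ (x + a)‖ ≤ 1 / 50 := by
        by_contra h
        exact hx2 (mem_filter.2 ⟨mem_bohrFin.2 h1, not_le.1 h⟩)
      have h4 : θ γ a = θ γ (x + a) - θ γ x := by
        rw [hθadd γ x a (by linarith)]; abel
      rw [h4]
      refine (norm_sub_le _ _).trans (by linarith)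
    intro a ha
    show ‖θ γ a‖ ≤ _
    have hloc : LocAdd S (4 * r) (θ γ) := hθadd γ
    rcases (bohrNorm_nonneg (S := S) a).eq_or_lt with h0 | h0
    · rw [eq_zero_of_bohrNorm_eq_zero h1S h0.symm, hloc.zero (by linarith)]
      simp
    · set I := ⌈r₁ / (2 * bohrNorm S a)⌉₊ - 1 with hI
      have hI1 : (2 : ℝ) < r₁ / (2 * bohrNorm S a) := by
        rw [lt_div_iff₀ (by positivity)]; linarith
      have hI2 : r₁ / (2 * bohrNorm S a) ≤ I + 1 := by
        have h1 := Nat.le_ceil (r₁ / (2 * bohrNorm S a))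
        have h2 : 1 ≤ ⌈r₁ / (2 * bohrNorm S a)⌉₊ := Nat.one_le_ceil_iff.2 (by linarith)
        rw [hI]; push_cast [Nat.cast_sub h2]; linarith
      have hI3 : (I : ℝ) * bohrNorm S a < r₁ / 2 := by
        have h1 := Nat.ceil_lt_add_one (a := r₁ / (2 * bohrNorm S a)) (by positivity)
        have h2 : 1 ≤ ⌈r₁ / (2 * bohrNorm S a)⌉₊ := Nat.one_le_ceil_iff.2 (by linarith)
        have h3 : (I : ℝ) < r₁ / (2 * bohrNorm S a) := by
          rw [hI]; push_cast [Nat.cast_sub h2]; linarith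
        calc (I : ℝ) * bohrNorm S a < r₁ / (2 * bohrNorm S a) * bohrNorm S a := by gcongr
          _ = r₁ / 2 := by field_simp
      have hIpos : 1 ≤ I := by
        have : (1 : ℝ) < I := by linarith
        exact_mod_cast this.le
      have h1 := mul_norm_le_of_multiples (x := θ γ a) (c := 1 / 25) (by norm_num) (I := I) (by
        intro i _ hi
        have h2 : (i : ℝ) * bohrNorm S a < r₁ / 2 := by
          refine lt_of_le_of_lt ?_ hI3
          gcongr
        rw [← hloc.nsmul i (by linarith)]
        exact hsmall _ ((bohrNorm_nsmul_le i a).trans_lt h2)) hIpos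
      have h2 : r₁ / (4 * bohrNorm S a) ≤ I := by
        have : r₁ / (2 * bohrNorm S a) = 2 * (r₁ / (4 * bohrNorm S a)) := by field_simp; ring
        linarith
      rw [le_div_iff₀ (by positivity)]
      have h3 : r₁ / (4 * bohrNorm S a) * ‖θ γ a‖ ≤ 1 / 25 :=
        (mul_le_mul_of_nonneg_right h2 (norm_nonneg _)).trans h1
      have h4 : ‖θ γ a‖ * (r₁ / 4) = r₁ / (4 * bohrNorm S a) * ‖θ γ a‖ * bohrNorm S a := by
        field_simp
      rw [h4]
      nlinarith
  have hsum : (∑ γ with γ ∉ charApprox S (r₁ / 4) χ, coeff S r χ γ)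
      * (#(bohrFin S r₁) / (4 ^ #S * 5000)) ≤ #(bohrFin S r₁) * (4 ^ (#S + 1) / 8 * (r₁ / r) ^ 2) := by
    refine le_trans ?_ hmean
    rw [sum_mul]
    calc _ ≤ ∑ γ with γ ∉ charApprox S (r₁ / 4) χ, coeff S r χ γ * ∑ a ∈ bohrFin S r₁, ‖θ γ a‖ ^ 2 :=
          sum_le_sum fun γ hγ => mul_le_mul_of_nonneg_left (hbad γ (mem_filter.1 hγ).2)
            (coeff_nonneg _ _)
      _ ≤ _ := sum_le_sum_of_subset_of_nonneg (filter_subset _ _) fun _ _ _ =>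
          mul_nonneg (coeff_nonneg _ _) (sum_nonneg fun _ _ => sq_nonneg _)
  have h16 : (16 : ℝ) ^ #S = 4 ^ #S * 4 ^ #S := by rw [← mul_pow]; norm_num
  rw [mul_div_assoc', div_le_iff₀ (by positivity)] at hsum
  refine le_of_mul_le_mul_right (hsum.trans (le_of_eq ?_)) hB0
  rw [h16, pow_succ]
  ring

end Bohr

/-! ### A uniform denominator for a biadditive function on Bohr sets -/

section Uniform

variable {N : ℕ} [NeZero N] {S : Finset (ZMod N)}

lemma LocAdd.sum {R : ℝ} {χ : ZMod N → UnitAddCircle} (hR : 0 < R) (h : LocAdd S R χ)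
    {ι : Type*} (s : Finset ι) (x : ι → ZMod N) (hx : ∑ i ∈ s, bohrNorm S (x i) < R) :
    χ (∑ i ∈ s, x i) = ∑ i ∈ s, χ (x i) := by
  classical
  induction s using Finset.induction_on with
  | empty => simpa using h.zero hR
  | insert i s hi ih =>
    rw [sum_insert hi] at hx
    have h1 := bohrNorm_nonneg (S := S) (x i)
    rw [sum_insert hi, sum_insert hi, h _ _ ?_, ih (by linarith)]
    have := bohrNorm_sum_le (S := S) s x
    linarith

lemma addOrderOf_pos_le_of_nsmul {M : Type*} [AddMonoid M] {x : M} {q Q : ℕ} (hq : 0 < q)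
    (hqQ : q ≤ Q) (h : q • x = 0) : 0 < addOrderOf x ∧ addOrderOf x ≤ Q :=
  ⟨addOrderOf_pos_iff.2 (isOfFinAddOrder_iff_nsmul_eq_zero.2 ⟨q, hq, h⟩),
    (addOrderOf_le_of_nsmul_eq_zero hq h).trans hqQ⟩

lemma sum_bohrNorm_lt {r : ℝ} (hr : 0 < r) {T t : ℕ} (htT : t ≤ T) (hT : 0 < T) (x : Fin t → ZMod N)
    (hx : ∀ i, bohrNorm S (x i) < r / T) (s : Finset (Fin t)) :
    ∑ i ∈ s, bohrNorm S (x i) < r := by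
  have hT' : (0 : ℝ) < T := by exact_mod_cast hT
  rcases s.eq_empty_or_nonempty with rfl | hs
  · simpa using hr
  · calc ∑ i ∈ s, bohrNorm S (x i) < ∑ _i ∈ s, r / T := sum_lt_sum_of_nonempty hs fun i _ => hx i
      _ = #s * (r / T) := by rw [sum_const, nsmul_eq_mul]
      _ ≤ T * (r / T) := by
          gcongr
          exact (card_finset_fin_le s).trans htT
      _ = r := by field_simp

/-- If each value of a biadditive function on Bohr sets is close to a rational with denominator at
most `Q`, then one denominator at most `Q ^ 4` serves for all values, on Bohr sets whose radii
are smaller only by a factor logarithmic in `Q`. The rational parts are biadditive, being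
well-spaced, and a set of torsion elements all of whose short subset sums have order at most `Q` is
killed by some `E ≤ Q ^ 2`; this is applied in each variable in turn. -/
theorem exists_uniform_denominator {ra rb : ℝ} (hra : 0 < ra) (hrb : 0 < rb)
    {χ : ZMod N → ZMod N → UnitAddCircle}
    (hχa : ∀ b, bohrNorm S b < rb → LocAdd S ra (fun a => χ a b))
    (hχb : ∀ a, bohrNorm S a < ra → LocAdd S rb (χ a))
    {Q T : ℕ} (hT : Q ^ 4 < 2 ^ T) {g : ZMod N → ZMod N → ℝ}
    (hg : ∀ a b, bohrNorm S a < ra → bohrNorm S b < rb → 4 * (Q : ℝ) ^ 3 * g a b ≤ 1)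
    (h : ∀ a b, bohrNorm S a < ra → bohrNorm S b < rb →
      ∃ q : ℕ, 0 < q ∧ q ≤ Q ∧ ‖q • χ a b‖ ≤ g a b) :
    ∃ q : ℕ, 0 < q ∧ q ≤ Q ^ 4 ∧ ∀ a b, bohrNorm S a < ra / T → bohrNorm S b < rb / T →
      ‖q • χ a b‖ ≤ q * g a b := by
  have hQ1 : 1 ≤ Q := by
    obtain ⟨q, hq, hqQ, -⟩ := h 0 0 (by simpa using hra) (by simpa using hrb)
    omega
  have hT0 : 0 < T := by
    rcases Nat.eq_zero_or_pos T with rfl | h0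
    · have := Nat.one_le_pow 4 Q hQ1
      rw [pow_zero] at hT; omega
    · exact h0
  have hT1 : (1 : ℝ) ≤ T := by exact_mod_cast hT0
  have hTa : ra / T ≤ ra := div_le_self hra.le hT1
  have hTb : rb / T ≤ rb := div_le_self hrb.le hT1
  have h1 : ∀ a b, bohrNorm S a < ra → bohrNorm S b < rb →
      ∃ θ : UnitAddCircle, ‖χ a b - θ‖ ≤ g a b ∧ ∃ q : ℕ, 0 < q ∧ q ≤ Q ∧ q • θ = 0 := by
    intro a b ha hb
    obtain ⟨q, hq, hqQ, hqχ⟩ := h a b ha hb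
    obtain ⟨w, hw, hwn⟩ := exists_nsmul_eq_norm_le hq (q • χ a b)
    refine ⟨χ a b - w, ?_, q, hq, hqQ, by rw [nsmul_sub, hw, sub_self]⟩
    rw [sub_sub_cancel]
    have : (1 : ℝ) ≤ q := by exact_mod_cast hq
    nlinarith [norm_nonneg w]
  choose! θ hθ hord using h1
  -- an element of small order and small norm vanishes
  have hzero : ∀ {x y z : UnitAddCircle} {ε : ℝ}, 4 * (Q : ℝ) ^ 3 * ε ≤ 1 → ‖x - y - z‖ ≤ 3 * ε →
      (∃ q : ℕ, 0 < q ∧ q ≤ Q ∧ q • x = 0) → (∃ q : ℕ, 0 < q ∧ q ≤ Q ∧ q • y = 0) →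
      (∃ q : ℕ, 0 < q ∧ q ≤ Q ∧ q • z = 0) → x = y + z := by
    rintro x y z ε hε hn ⟨q₁, h1, h1', h1''⟩ ⟨q₂, h2, h2', h2''⟩ ⟨q₃, h3, h3', h3''⟩
    have h4 : (q₁ * q₂ * q₃) • (x - y - z) = 0 := by
      rw [nsmul_sub, nsmul_sub]
      rw [show (q₁ * q₂ * q₃) • x = (q₂ * q₃) • q₁ • x by rw [← mul_nsmul]; congr 1; ring, h1'',
        show (q₁ * q₂ * q₃) • y = (q₁ * q₃) • q₂ • y by rw [← mul_nsmul]; congr 1; ring, h2'',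
        show (q₁ * q₂ * q₃) • z = (q₁ * q₂) • q₃ • z by rw [← mul_nsmul]; congr 1; ring, h3'']
      simp
    have h5 := eq_zero_of_nsmul_eq_zero_of_norm_lt (by positivity) h4 (by
      have h6 : ((q₁ * q₂ * q₃ : ℕ) : ℝ) ≤ (Q : ℝ) ^ 3 := by
        have : q₁ * q₂ * q₃ ≤ Q * Q * Q := by gcongr
        have h7 : ((q₁ * q₂ * q₃ : ℕ) : ℝ) ≤ ((Q * Q * Q : ℕ) : ℝ) := by exact_mod_cast this
        refine h7.trans (le_of_eq ?_)
        push_cast; ring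
      calc ((q₁ * q₂ * q₃ : ℕ) : ℝ) * ‖x - y - z‖ ≤ (Q : ℝ) ^ 3 * (3 * ε) := by gcongr
        _ < 1 := by linarith)
    rw [sub_sub, sub_eq_zero] at h5
    exact h5
  -- the error bound on the whole range; the maximum of the bounds at three points suffices
  have hθa : ∀ b, bohrNorm S b < rb → LocAdd S ra (fun a => θ a b) := by
    intro b hb x y hxy
    have hx : bohrNorm S x < ra := by linarith [bohrNorm_nonneg (S := S) y]
    have hy : bohrNorm S y < ra := by linarith [bohrNorm_nonneg (S := S) x]
    have hs : bohrNorm S (x + y) < ra := (bohrNorm_add_le _ _).trans_lt hxy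
    refine hzero (ε := max (g x b) (max (g y b) (g (x + y) b))) ?_ ?_
      (hord _ _ hs hb) (hord _ _ hx hb) (hord _ _ hy hb)
    · rcases max_choice (g x b) (max (g y b) (g (x + y) b)) with h | h <;> rw [h]
      · exact hg _ _ hx hb
      · rcases max_choice (g y b) (g (x + y) b) with h | h <;> rw [h]
        · exact hg _ _ hy hb
        · exact hg _ _ hs hb
    · have e1 := hχa b hb x y hxy
      simp only at e1
      rw [show θ (x + y) b - θ x b - θ y b
        = (χ x b - θ x b) + (χ y b - θ y b) - (χ (x + y) b - θ (x + y) b) by rw [e1]; abel]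
      refine (norm_sub_le _ _).trans ((add_le_add_left (norm_add_le _ _) _).trans ?_)
      have e2 := hθ _ _ hx hb
      have e3 := hθ _ _ hy hb
      have e4 := hθ _ _ hs hb
      have m1 := le_max_left (g x b) (max (g y b) (g (x + y) b))
      have m2 := le_max_right (g x b) (max (g y b) (g (x + y) b))
      have m3 := le_max_left (g y b) (g (x + y) b)
      have m4 := le_max_right (g y b) (g (x + y) b)
      linarith
  have hθb : ∀ a, bohrNorm S a < ra → LocAdd S rb (θ a) := by
    intro a ha x y hxy
    have hx : bohrNorm S x < rb := by linarith [bohrNorm_nonneg (S := S) y]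
    have hy : bohrNorm S y < rb := by linarith [bohrNorm_nonneg (S := S) x]
    have hs : bohrNorm S (x + y) < rb := (bohrNorm_add_le _ _).trans_lt hxy
    refine hzero (ε := max (g a x) (max (g a y) (g a (x + y)))) ?_ ?_
      (hord _ _ ha hs) (hord _ _ ha hx) (hord _ _ ha hy)
    · rcases max_choice (g a x) (max (g a y) (g a (x + y))) with h | h <;> rw [h]
      · exact hg _ _ ha hx
      · rcases max_choice (g a y) (g a (x + y)) with h | h <;> rw [h]
        · exact hg _ _ ha hy
        · exact hg _ _ ha hs
    · have e1 := hχb a ha x y hxy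
      rw [show θ a (x + y) - θ a x - θ a y
        = (χ a x - θ a x) + (χ a y - θ a y) - (χ a (x + y) - θ a (x + y)) by rw [e1]; abel]
      refine (norm_sub_le _ _).trans ((add_le_add_left (norm_add_le _ _) _).trans ?_)
      have e2 := hθ _ _ ha hx
      have e3 := hθ _ _ ha hy
      have e4 := hθ _ _ ha hs
      have m1 := le_max_left (g a x) (max (g a y) (g a (x + y)))
      have m2 := le_max_right (g a x) (max (g a y) (g a (x + y)))
      have m3 := le_max_left (g a y) (g a (x + y))
      have m4 := le_max_right (g a y) (g a (x + y))
      linarith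
  have hQ2 : Q ^ 2 < 2 ^ T := lt_of_le_of_lt (Nat.pow_le_pow_right hQ1 (by norm_num)) hT
  -- a denominator uniform in the first variable
  have hunif : ∀ b, bohrNorm S b < rb → ∃ E : ℕ, 0 < E ∧ E ≤ Q ^ 2 ∧
      ∀ a, bohrNorm S a < ra / T → E • θ a b = 0 := by
    intro b hb
    obtain ⟨E, hE, hEQ, hEX⟩ := exists_uniform_exponent
      {x | ∃ a, bohrNorm S a < ra / T ∧ θ a b = x} Q T hQ2 (by
        intro t ht x hx s
        choose a ha hax using hx
        have hlt := sum_bohrNorm_lt hra ht hT0 a ha s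
        have h2 : ∑ i ∈ s, x i = θ (∑ i ∈ s, a i) b := by
          rw [(hθa b hb).sum hra s a hlt]
          exact sum_congr rfl fun i _ => (hax i).symm
        obtain ⟨q, hq, hqQ, hqθ⟩ := hord (∑ i ∈ s, a i) b
          ((bohrNorm_sum_le s a).trans_lt hlt) hb
        rw [h2]
        exact addOrderOf_pos_le_of_nsmul hq hqQ hqθ)
    exact ⟨E, hE, hEQ, fun a ha => hEX _ ⟨a, ha, rfl⟩⟩
  obtain ⟨E, hE, hEQ, hEX⟩ := exists_uniform_exponent
    (M := {a : ZMod N // bohrNorm S a < ra / T} → UnitAddCircle)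
    {x | ∃ b, bohrNorm S b < rb / T ∧ (fun a => θ a.1 b) = x} (Q ^ 2) T
    (by rw [← pow_mul]; exact hT) (by
      intro t ht x hx s
      choose b hb hbx using hx
      have hlt := sum_bohrNorm_lt hrb ht hT0 b hb s
      have h2 : ∑ i ∈ s, x i = fun a => θ a.1 (∑ i ∈ s, b i) := by
        funext a
        rw [(hθb a.1 (a.2.trans_le hTa)).sum hrb s b hlt, Finset.sum_apply]
        exact sum_congr rfl fun i _ => by rw [← hbx i]
      obtain ⟨q, hq, hqQ, hqθ⟩ := hunif (∑ i ∈ s, b i) ((bohrNorm_sum_le s b).trans_lt hlt)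
      rw [h2]
      exact addOrderOf_pos_le_of_nsmul hq hqQ (funext fun a => hqθ a.1 a.2))
  refine ⟨E, hE, by rwa [← pow_mul] at hEQ, fun a b ha hb => ?_⟩
  have h2 := congrFun (hEX _ ⟨b, hb, rfl⟩) ⟨a, ha⟩
  simp only [Pi.smul_apply, Pi.zero_apply] at h2
  have h3 : E • χ a b = E • (χ a b - θ a b) := by rw [nsmul_sub, h2, sub_zero]
  rw [h3]
  refine (norm_nsmul_le).trans ?_
  gcongr
  exact hθ a b (ha.trans_le hTa) (hb.trans_le hTb)

end Uniform

/-! ### Bilinear exponential sums and averaging over shifts -/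

lemma norm_sum_Icc_nat_e (θ : UnitAddCircle) (a b : ℕ) :
    2 * ‖θ‖ * ‖∑ i ∈ Icc a b, e (i • θ)‖ ≤ 1 := by
  have h : ∑ i ∈ Icc a b, e (i • θ) = ∑ j ∈ Icc (a : ℤ) b, e (j • θ) := by
    refine sum_bij (fun i _ => (i : ℤ)) (fun i hi => ?_) (fun i _ j _ h => by exact_mod_cast h)
      (fun j hj => ?_) (fun i _ => by rw [natCast_zsmul])
    · simp only [mem_Icc] at hi ⊢; omega
    · simp only [mem_Icc] at hj
      exact ⟨j.toNat, by simp only [mem_Icc]; omega, by omega⟩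
  rw [h]
  exact norm_sum_Icc_e θ a b

lemma norm_sum_sq_le {ι : Type*} (s : Finset ι) (f : ι → ℂ) :
    ‖∑ i ∈ s, f i‖ ^ 2 ≤ #s * ∑ i ∈ s, ‖f i‖ ^ 2 := by
  calc ‖∑ i ∈ s, f i‖ ^ 2 ≤ (∑ i ∈ s, ‖f i‖) ^ 2 := by gcongr; exact norm_sum_le _ _
    _ ≤ _ := sq_sum_le_card_mul_sum_sq

/-- If a sum of terms in `[0, B]` is at least `c`, the terms exceeding a threshold `τ`
number at least `(c - τ #s) / B`. -/
lemma le_card_filter_mul {ι : Type*} (s : Finset ι) (f : ι → ℝ) {c B τ : ℝ} (hτ : 0 ≤ τ)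
    (hB : ∀ i ∈ s, f i ≤ B) (h : c ≤ ∑ i ∈ s, f i) :
    c - τ * #s ≤ #{i ∈ s | τ < f i} * B := by
  have h1 := sum_filter_add_sum_filter_not s (fun i => τ < f i) f
  have h2 : ∑ i ∈ s with τ < f i, f i ≤ #{i ∈ s | τ < f i} * B := by
    rw [← nsmul_eq_mul, ← sum_const]
    exact sum_le_sum fun i hi => hB i (mem_filter.1 hi).1
  have h3 : ∑ i ∈ s with ¬ τ < f i, f i ≤ #{i ∈ s | ¬ τ < f i} * τ := by
    rw [← nsmul_eq_mul, ← sum_const]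
    exact sum_le_sum fun i hi => not_lt.1 (mem_filter.1 hi).2
  have h4 : (#{i ∈ s | ¬ τ < f i} : ℝ) ≤ #s := by exact_mod_cast card_filter_le _ _
  nlinarith

lemma norm_sum_le_card_mul {ι : Type*} (s : Finset ι) (f : ι → ℂ) {B : ℝ}
    (h : ∀ i ∈ s, ‖f i‖ ≤ B) : ‖∑ i ∈ s, f i‖ ≤ #s * B := by
  rw [← nsmul_eq_mul]
  exact (norm_sum_le _ _).trans (sum_le_card_nsmul _ _ _ h)

lemma sum_conj_mul_e_eq {s t : Finset ℕ} (v : ℕ → ℂ) (α : UnitAddCircle) :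
    (∑ i ∈ s, (‖∑ j ∈ t, v j * e ((i * j) • α)‖ ^ 2 : ℝ) : ℂ)
      = ∑ j ∈ t, ∑ j' ∈ t, v j * conj (v j') * ∑ i ∈ s, e (i • (((j : ℤ) - j') • α)) := by
  have h1 : ∀ i, ((‖∑ j ∈ t, v j * e ((i * j) • α)‖ ^ 2 : ℝ) : ℂ)
      = ∑ j ∈ t, ∑ j' ∈ t, v j * conj (v j') * e (i • (((j : ℤ) - j') • α)) := by
    intro i
    rw [← Complex.normSq_eq_norm_sq, ← Complex.mul_conj, map_sum, sum_mul_sum]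
    refine sum_congr rfl fun j _ => sum_congr rfl fun j' _ => ?_
    rw [sub_smul, nsmul_sub, e_sub, map_mul, mul_nsmul', mul_nsmul', natCast_zsmul, natCast_zsmul]
    ring
  simp_rw [h1]
  rw [sum_comm]
  refine sum_congr rfl fun j _ => ?_
  rw [sum_comm]
  refine sum_congr rfl fun j' _ => ?_
  rw [mul_sum]

/-- A bilinear sum with phase `ijα` is large only if `α` is close to a rational with small
denominator. -/
theorem exists_denominator_of_bilinear {a₀ a₁ : ℕ} {B : Finset ℕ} {I J η : ℝ} {u v : ℕ → ℂ}
    {α : UnitAddCircle} (hη : 0 < η) (hη1 : η ≤ 1) (hI : 128 / η ^ 4 ≤ I) (hJ : 128 / η ^ 2 ≤ J)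
    (hA : (#(Icc a₀ a₁) : ℝ) ≤ I) (hBc : (#B : ℝ) ≤ J)
    (hB : ∀ j ∈ B, ∀ j' ∈ B, |(j : ℝ) - j'| ≤ J) (hu : ∀ i, ‖u i‖ ≤ 1) (hv : ∀ j, ‖v j‖ ≤ 1)
    (h : η * I * J ≤ ‖∑ i ∈ Icc a₀ a₁, ∑ j ∈ B, u i * v j * e ((i * j) • α)‖) :
    ∃ q : ℕ, 0 < q ∧ (q : ℝ) ≤ 16 / η ^ 2 ∧ ‖q • α‖ ≤ 576 / (η ^ 6 * (I * J)) := by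
  have hI0 : 0 < I := lt_of_lt_of_le (by positivity) hI
  have hJ0 : 0 < J := lt_of_lt_of_le (by positivity) hJ
  set G : ℕ × ℕ → ℝ := fun x => ‖∑ i ∈ Icc a₀ a₁, e (i • (((x.1 : ℤ) - x.2) • α))‖ with hG
  have hGI : ∀ x, G x ≤ I := fun x => by
    refine (norm_sum_le_card_mul (B := 1) _ _ fun i _ => (norm_e _).le).trans ?_
    linarith
  have h1 : η ^ 2 * I * J ^ 2 ≤ ∑ x ∈ B ×ˢ B, G x := by
    have h2 : (η * I * J) ^ 2 ≤ I * ∑ i ∈ Icc a₀ a₁, ‖∑ j ∈ B, v j * e ((i * j) • α)‖ ^ 2 := by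
      calc (η * I * J) ^ 2 ≤ ‖∑ i ∈ Icc a₀ a₁, ∑ j ∈ B, u i * v j * e ((i * j) • α)‖ ^ 2 := by
            gcongr
        _ ≤ #(Icc a₀ a₁) * ∑ i ∈ Icc a₀ a₁, ‖∑ j ∈ B, u i * v j * e ((i * j) • α)‖ ^ 2 :=
            norm_sum_sq_le _ _
        _ ≤ I * ∑ i ∈ Icc a₀ a₁, ‖∑ j ∈ B, v j * e ((i * j) • α)‖ ^ 2 := by
            gcongr with i _
            simp_rw [mul_assoc (u i)]
            rw [← mul_sum, norm_mul]
            exact mul_le_of_le_one_left (norm_nonneg _) (hu i)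
    have h3 : ∑ i ∈ Icc a₀ a₁, ‖∑ j ∈ B, v j * e ((i * j) • α)‖ ^ 2 ≤ ∑ x ∈ B ×ˢ B, G x := by
      have h4 := congrArg norm (sum_conj_mul_e_eq (s := Icc a₀ a₁) (t := B) v α)
      rw [← Complex.ofReal_sum, Complex.norm_real, Real.norm_of_nonneg
        (sum_nonneg fun _ _ => sq_nonneg _)] at h4
      rw [h4, sum_product]
      refine (norm_sum_le _ _).trans (sum_le_sum fun j _ => ?_)
      refine (norm_sum_le _ _).trans (sum_le_sum fun j' _ => ?_)
      rw [norm_mul, norm_mul, Complex.norm_conj]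
      refine mul_le_of_le_one_left (norm_nonneg _) ?_
      exact mul_le_one₀ (hv j) (norm_nonneg _) (hv j')
    have h4 : I * (η ^ 2 * I * J ^ 2) ≤ I * ∑ x ∈ B ×ˢ B, G x := by
      have := mul_le_mul_of_nonneg_left h3 hI0.le
      linarith
    exact le_of_mul_le_mul_left h4 hI0
  have h2 := le_card_filter_mul (B ×ˢ B) G (τ := η ^ 2 * I / 2) (by positivity) (fun x _ => hGI x) h1
  set Pr := {x ∈ B ×ˢ B | η ^ 2 * I / 2 < G x} with hPr
  have h3 : η ^ 2 * J ^ 2 / 2 ≤ #Pr := by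
    have h4 : (#(B ×ˢ B) : ℝ) ≤ J ^ 2 := by
      rw [card_product]; push_cast
      rw [sq]; gcongr
    have h5 : η ^ 2 * I / 2 * #(B ×ˢ B) ≤ η ^ 2 * I / 2 * J ^ 2 := by gcongr
    have h6 : I * (η ^ 2 * J ^ 2 / 2) ≤ I * #Pr := by linarith
    exact le_of_mul_le_mul_left h6 hI0
  obtain ⟨j', hj', hcard⟩ : ∃ j' ∈ B, η ^ 2 / 2 * J ≤ #{j ∈ B | η ^ 2 * I / 2 < G (j, j')} := by
    by_contra hcon
    push Not at hcon
    have h4 : #Pr = ∑ j' ∈ B, #{j ∈ B | η ^ 2 * I / 2 < G (j, j')} := by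
      rw [hPr, card_filter, sum_product_right]
      exact sum_congr rfl fun j' _ => by rw [card_filter]
    have hne : B.Nonempty := by
      rw [nonempty_iff_ne_empty]
      rintro rfl
      simp [hPr] at h3
      have : 0 < η ^ 2 * J ^ 2 / 2 := by positivity
      linarith
    have h5 : (#Pr : ℝ) < #B * (η ^ 2 / 2 * J) := by
      rw [h4, ← nsmul_eq_mul, ← sum_const]; push_cast
      exact sum_lt_sum_of_nonempty hne hcon
    have h6 : (#B : ℝ) * (η ^ 2 / 2 * J) ≤ J * (η ^ 2 / 2 * J) := by gcongr
    nlinarith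
  set A : Finset ℤ := {j ∈ B | η ^ 2 * I / 2 < G (j, j')}.image fun j : ℕ => (j : ℤ) - j' with hAdef
  have hAcard : #A = #{j ∈ B | η ^ 2 * I / 2 < G (j, j')} :=
    card_image_of_injective _ fun x y hxy => by simpa using hxy
  obtain ⟨q, hq, hqle, hqα⟩ := exists_denominator_of_dense (A := A) (J := J) (η := η ^ 2 / 2)
    (ε := 1 / (η ^ 2 * I)) (θ := α) (by
      intro t ht
      obtain ⟨j, hj, rfl⟩ := mem_image.1 ht
      push_cast
      exact hB j (mem_filter.1 hj).1 j' hj') (by positivity)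
    (by nlinarith [pow_le_one₀ hη.le hη1 (n := 2)]) (by rw [hAcard]; exact hcard)
    (by
      rw [div_le_iff₀ (by positivity)] at hJ
      linarith) (by
      rw [div_le_iff₀ (by positivity)] at hI
      rw [div_le_div_iff₀ (by positivity) (by norm_num)]
      nlinarith) (by
      intro t ht
      obtain ⟨j, hj, rfl⟩ := mem_image.1 ht
      have h4 := (mem_filter.1 hj).2
      have h5 := norm_sum_Icc_nat_e (((j : ℤ) - j') • α) a₀ a₁
      rw [le_div_iff₀ (by positivity)]
      have h6 : 2 * ‖((j : ℤ) - (j' : ℤ)) • α‖ * (η ^ 2 * I / 2) ≤ 1 :=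
        (mul_le_mul_of_nonneg_left h4.le (by positivity)).trans h5
      linarith)
  refine ⟨q, hq, hqle.trans (le_of_eq (by field_simp; norm_num)), hqα.trans (le_of_eq ?_)⟩
  field_simp
  norm_num

/-- Averaging a sum over an interval over bounded shifts, with weights; the error comes from the
points near the two ends. -/
lemma sum_mul_norm_sum_le {ι : Type*} (V : Finset ι) (v : ι → ℤ) (w : ℕ) (hv : ∀ i ∈ V, |v i| ≤ w)
    (c : ι → ℝ) (hc : ∀ i ∈ V, 0 ≤ c i) (lo hi : ℤ) (f : ℤ → ℂ) (hf : ∀ m, ‖f m‖ ≤ 1) :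
    (∑ i ∈ V, c i) * ‖∑ m ∈ Icc lo hi, f m‖
      ≤ ∑ m ∈ Icc (lo + w) (hi - w), ‖∑ i ∈ V, c i * f (m + v i)‖ + 4 * w * ∑ i ∈ V, c i := by
  classical
  set g : ℤ → ℂ := fun m => if m ∈ Icc lo hi then f m else 0 with hg
  have hg1 : ∀ m, ‖g m‖ ≤ 1 := fun m => by
    simp only [hg]; split_ifs
    · exact hf m
    · simp
  set Ω := Icc (lo - w) (hi + w) with hΩ
  have h1 : ∀ i ∈ V, ∑ m ∈ Ω, g (m + v i) = ∑ m ∈ Icc lo hi, f m := by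
    intro i hi'
    have hvi := abs_le.1 (hv i hi')
    have h2 : ∑ m ∈ Icc lo hi, f m = ∑ m ∈ (Icc lo hi).map (addRightEmbedding (-(v i))), g (m + v i) := by
      rw [sum_map]
      refine sum_congr rfl fun m hm => ?_
      simp only [addRightEmbedding_apply, neg_add_cancel_right, hg, if_pos hm]
    rw [h2]
    symm
    apply sum_subset
    · intro m hm
      simp only [mem_map, mem_Icc, addRightEmbedding_apply, hΩ] at hm ⊢
      obtain ⟨a, ha, rfl⟩ := hm
      constructor <;> linarith
    · intro m _ hm
      simp only [hg]
      rw [if_neg]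
      intro h3
      exact hm (mem_map.2 ⟨m + v i, h3, by simp⟩)
  have h2 : ((∑ i ∈ V, c i : ℝ) : ℂ) * ∑ m ∈ Icc lo hi, f m
      = ∑ m ∈ Ω, ∑ i ∈ V, c i * g (m + v i) := by
    rw [sum_comm, Complex.ofReal_sum, sum_mul]
    refine sum_congr rfl fun i hi' => ?_
    rw [← mul_sum, h1 i hi']
  have h3 : (∑ i ∈ V, c i) * ‖∑ m ∈ Icc lo hi, f m‖ ≤ ∑ m ∈ Ω, ‖∑ i ∈ V, c i * g (m + v i)‖ := by
    have := congrArg norm h2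
    rw [norm_mul, Complex.norm_real, Real.norm_of_nonneg (sum_nonneg hc)] at this
    rw [this]
    exact norm_sum_le _ _
  refine h3.trans ?_
  set Ω₀ := Icc (lo + w) (hi - w) with hΩ₀
  have hsub : Ω₀ ⊆ Ω := Icc_subset_Icc (by omega) (by omega)
  rw [← sum_sdiff hsub, add_comm]
  refine add_le_add (le_of_eq (sum_congr rfl fun m hm => ?_)) ?_
  · congr 1
    refine sum_congr rfl fun i hi' => ?_
    have hvi := abs_le.1 (hv i hi')
    simp only [hg]
    rw [if_pos]
    simp only [hΩ₀, mem_Icc] at hm ⊢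
    constructor <;> linarith
  · have hcard : #(Ω \ Ω₀) ≤ 4 * w := by
      have h4 : Ω \ Ω₀ ⊆ Ico (lo - w) (lo + w) ∪ Ioc (hi - w) (hi + w) := by
        intro m hm
        simp only [mem_sdiff, hΩ, hΩ₀, mem_Icc, mem_union, mem_Ico, mem_Ioc] at hm ⊢
        omega
      refine (card_le_card h4).trans ((card_union_le _ _).trans ?_)
      rw [Int.card_Ico, Int.card_Ioc]
      omega
    calc ∑ m ∈ Ω \ Ω₀, ‖∑ i ∈ V, c i * g (m + v i)‖ ≤ ∑ _m ∈ Ω \ Ω₀, ∑ i ∈ V, c i :=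
          sum_le_sum fun m _ => by
            refine (norm_sum_le _ _).trans (sum_le_sum fun i hi' => ?_)
            rw [norm_mul, Complex.norm_real, Real.norm_of_nonneg (hc i hi')]
            exact mul_le_of_le_one_right (hc i hi') (hg1 _)
      _ = (#(Ω \ Ω₀) : ℝ) * ∑ i ∈ V, c i := by rw [sum_const, nsmul_eq_mul]
      _ ≤ 4 * w * ∑ i ∈ V, c i := by
          refine mul_le_mul_of_nonneg_right ?_ (sum_nonneg hc)
          exact_mod_cast hcard

lemma card_mul_norm_sum_le {ι : Type*} (V : Finset ι) (v : ι → ℤ) (w : ℕ) (hv : ∀ i ∈ V, |v i| ≤ w)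
    (lo hi : ℤ) (f : ℤ → ℂ) (hf : ∀ m, ‖f m‖ ≤ 1) :
    #V * ‖∑ m ∈ Icc lo hi, f m‖
      ≤ ∑ m ∈ Icc (lo + w) (hi - w), ‖∑ i ∈ V, f (m + v i)‖ + 4 * w * #V := by
  simpa using sum_mul_norm_sum_le V v w hv (fun _ => 1) (fun _ _ => zero_le_one) lo hi f hf

/-! ### Smooth cutoffs -/

section Cutoff

variable {N : ℕ} [NeZero N] {S : Finset (ZMod N)} {σ Λ : ℝ} {ψ : ZMod N → ℝ}

lemma IsSmoothCutoff.nonneg (h : IsSmoothCutoff S σ Λ ψ) (n : ZMod N) : 0 ≤ ψ n := by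
  obtain ⟨F, -, h1, -, h2⟩ := h
  rw [h2]; exact (h1 _).1

lemma IsSmoothCutoff.le_one (h : IsSmoothCutoff S σ Λ ψ) (n : ZMod N) : ψ n ≤ 1 := by
  obtain ⟨F, -, h1, -, h2⟩ := h
  rw [h2]; exact (h1 _).2

lemma IsSmoothCutoff.bohrNorm_lt (h : IsSmoothCutoff S σ Λ ψ) (hσ : 0 < σ) {n : ZMod N}
    (hn : ψ n ≠ 0) : bohrNorm S n < σ := by
  obtain ⟨F, -, -, h1, h2⟩ := h
  rw [h2] at hn
  rw [bohrNorm_lt_iff hσ]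
  exact fun ξ hξ => h1 _ hn ⟨ξ, hξ⟩

lemma IsSmoothCutoff.abs_sub_le (h : IsSmoothCutoff S σ Λ ψ) (hΛ : 0 ≤ Λ) (x y : ZMod N) :
    |ψ x - ψ y| ≤ Λ * bohrNorm S (x - y) := by
  obtain ⟨F, h1, -, -, h2⟩ := h
  rw [h2, h2]
  refine (h1 _ _).trans ?_
  gcongr
  rw [dist_pi_le_iff (bohrNorm_nonneg _)]
  intro ξ
  rw [dist_eq_norm, ← charVal_sub]
  exact norm_charVal_le_bohrNorm ξ.2 _

lemma IsSmoothCutoff.norm_mul_e_le (h : IsSmoothCutoff S σ Λ ψ) (n : ZMod N) (θ : UnitAddCircle) :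
    ‖(ψ n : ℂ) * e θ‖ ≤ 1 := by
  rw [norm_mul, norm_e, mul_one, Complex.norm_real, Real.norm_of_nonneg (h.nonneg n)]
  exact h.le_one n

end Cutoff

/-! ### Type I sums -/

section TypeI

variable {N : ℕ} [NeZero N] {S : Finset (ZMod N)} {σ Λ : ℝ} {ψ : ZMod N → ℝ}
  {φ : ZMod N → UnitAddCircle}

lemma IsSmoothCutoff.bohrNorm_add_lt (h : IsSmoothCutoff S σ Λ ψ) (hσ : 0 < σ) (hΛ : 0 ≤ Λ)
    {n v : ZMod N} (hv : Λ * bohrNorm S v < ψ n) : bohrNorm S (n + v) < σ := by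
  refine h.bohrNorm_lt hσ fun h0 => ?_
  have h1 := h.abs_sub_le hΛ (n + v) n
  rw [h0, add_sub_cancel_left, zero_sub, abs_neg, abs_of_nonneg (h.nonneg n)] at h1
  linarith

lemma IsLocallyQuadraticOn.secondDiff_nsmul (hφ : IsLocallyQuadraticOn (bohrSet S σ) φ)
    {a b : ZMod N} (i j : ℕ) (hab : i * bohrNorm S a + j * bohrNorm S b < σ) :
    secondDiff φ (i • a) (j • b) = (i * j) • secondDiff φ a b := by
  rcases Nat.eq_zero_or_pos i with rfl | hi
  · simp
  rcases Nat.eq_zero_or_pos j with rfl | hj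
  · rw [zero_nsmul, secondDiff_comm, secondDiff_zero_left, mul_zero, zero_nsmul]
  have hi' : (1 : ℝ) ≤ i := by exact_mod_cast hi
  have hj' : (1 : ℝ) ≤ j := by exact_mod_cast hj
  have ha := bohrNorm_nonneg (S := S) a
  have hb := bohrNorm_nonneg (S := S) b
  have ha' : bohrNorm S a ≤ i * bohrNorm S a := le_mul_of_one_le_left ha hi'
  have hb' : bohrNorm S b ≤ j * bohrNorm S b := le_mul_of_one_le_left hb hj'
  have h1 := (hφ.locAdd (b := j • b) (R' := σ - j * bohrNorm S b) (by nlinarith) (by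
    linarith [bohrNorm_nsmul_le (S := S) j b])).nsmul (x := a) i (by linarith)
  have h2 := (hφ.locAdd (b := a) (R' := σ - bohrNorm S a) (by nlinarith) (by linarith)).nsmul
    (x := b) j (by linarith)
  rw [h1, secondDiff_comm φ a (j • b), h2, secondDiff_comm φ b a, mul_comm, mul_nsmul]

/-- The phase of a locally quadratic form along a two-parameter progression. -/
lemma IsLocallyQuadraticOn.apply_add_nsmul_add_nsmul
    (hφ : IsLocallyQuadraticOn (bohrSet S σ) φ) {n a b : ZMod N} (i j : ℕ)
    (hab : i * bohrNorm S a + j * bohrNorm S b < σ) (h0 : bohrNorm S n < σ)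
    (h1 : bohrNorm S (n + i • a) < σ) (h2 : bohrNorm S (n + j • b) < σ)
    (h3 : bohrNorm S (n + i • a + j • b) < σ) :
    φ (n + i • a + j • b)
      = φ (n + i • a) + (φ (n + j • b) - φ n) + (i * j) • secondDiff φ a b := by
  have h4 := hφ.sub_eq_secondDiff ((bohrNorm_nonneg n).trans_lt h0) (n := n) (a := i • a)
    (b := j • b) (by linarith [bohrNorm_nsmul_le (S := S) i a, bohrNorm_nsmul_le (S := S) j b])
    h0 h1 h2 h3
  rw [hφ.secondDiff_nsmul i j hab] at h4
  rw [← h4]; abel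

lemma half_le_floor {x : ℝ} (hx : 1 ≤ x) : x / 2 ≤ (⌊x⌋₊ : ℝ) := by
  have h1 := Nat.lt_floor_add_one x
  have h2 : (1 : ℝ) ≤ ⌊x⌋₊ := by exact_mod_cast Nat.one_le_floor_iff x |>.2 hx
  linarith

/-- A large local average of a cut-off quadratic phase over a two-parameter progression gives
rational information on the mixed derivative. -/
lemma exists_denominator_of_local_sum (hσ : 0 < σ) (hΛ : 0 ≤ Λ)
    (hφ : IsLocallyQuadraticOn (bohrSet S σ) φ) (hψ : IsSmoothCutoff S σ Λ ψ)
    {δ κ : ℝ} (hδ : 0 < δ) (hδ1 : δ ≤ 1) (hκ2 : 16 * (Λ * κ) ≤ δ) (hκ3 : 2 * κ < σ)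
    {n A B : ZMod N} {I J : ℕ} (hA : I * bohrNorm S A ≤ κ) (hB : J * bohrNorm S B ≤ κ)
    (hI : 2 ^ 15 / δ ^ 4 ≤ I) (hJ : 2 ^ 15 / δ ^ 4 ≤ J)
    (h : 3 / 4 * δ * (I * J) ≤ ‖∑ x ∈ Icc 1 I ×ˢ Icc 1 J,
      (ψ (n + x.1 • A + x.2 • B) : ℂ) * e (φ (n + x.1 • A + x.2 • B))‖) :
    ∃ q : ℕ, 0 < q ∧ (q : ℝ) ≤ 256 / δ ^ 2 ∧
      ‖q • secondDiff φ A B‖ ≤ 576 * 4 ^ 6 / (δ ^ 6 * (I * J)) := by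
  set V : Finset (ℕ × ℕ) := Icc 1 I ×ˢ Icc 1 J with hV
  have hVcard : (#V : ℝ) = I * J := by rw [hV, card_product]; simp
  have hI0 : (0 : ℝ) < I := lt_of_lt_of_le (by positivity) hI
  have hJ0 : (0 : ℝ) < J := lt_of_lt_of_le (by positivity) hJ
  have hIJ : (0 : ℝ) < I * J := mul_pos hI0 hJ0
  have hxA : ∀ i ∈ Icc 1 I, i * bohrNorm S A ≤ κ := by
    intro i hi
    refine le_trans ?_ hA
    have : (i : ℝ) ≤ I := by exact_mod_cast (mem_Icc.1 hi).2
    exact mul_le_mul_of_nonneg_right this (bohrNorm_nonneg _)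
  have hxB : ∀ j ∈ Icc 1 J, j * bohrNorm S B ≤ κ := by
    intro i hi
    refine le_trans ?_ hB
    have : (i : ℝ) ≤ J := by exact_mod_cast (mem_Icc.1 hi).2
    exact mul_le_mul_of_nonneg_right this (bohrNorm_nonneg _)
  have hκ0 : 0 ≤ κ := le_trans (mul_nonneg hI0.le (bohrNorm_nonneg _)) hA
  have hxAB : ∀ x ∈ V, bohrNorm S (x.1 • A + x.2 • B) ≤ 2 * κ := by
    intro x hx
    obtain ⟨hx1, hx2⟩ := mem_product.1 hx
    have := bohrNorm_add_le (S := S) (x.1 • A) (x.2 • B)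
    linarith [bohrNorm_nsmul_le (S := S) x.1 A, bohrNorm_nsmul_le (S := S) x.2 B, hxA _ hx1, hxB _ hx2]
  -- the cutoff is replaced by its value at `n`
  have hrepl : ‖∑ x ∈ V, (ψ (n + x.1 • A + x.2 • B) : ℂ) * e (φ (n + x.1 • A + x.2 • B))‖
      ≤ ψ n * ‖∑ x ∈ V, e (φ (n + x.1 • A + x.2 • B))‖ + I * J * (δ / 8) := by
    have h2 : ∑ x ∈ V, (ψ (n + x.1 • A + x.2 • B) : ℂ) * e (φ (n + x.1 • A + x.2 • B))
        = (ψ n : ℂ) * ∑ x ∈ V, e (φ (n + x.1 • A + x.2 • B))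
        + ∑ x ∈ V, ((ψ (n + x.1 • A + x.2 • B) - ψ n : ℝ) : ℂ) * e (φ (n + x.1 • A + x.2 • B)) := by
      rw [mul_sum, ← sum_add_distrib]
      refine sum_congr rfl fun x _ => ?_
      push_cast; ring
    rw [h2]
    refine (norm_add_le _ _).trans (add_le_add (le_of_eq ?_) ?_)
    · rw [norm_mul, Complex.norm_real, Real.norm_of_nonneg (hψ.nonneg n)]
    rw [← hVcard]
    refine norm_sum_le_card_mul _ _ fun x hx => ?_
    rw [norm_mul, norm_e, mul_one, Complex.norm_real, Real.norm_eq_abs]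
    refine (hψ.abs_sub_le hΛ _ _).trans ?_
    rw [add_assoc, add_sub_cancel_left]
    calc Λ * bohrNorm S (x.1 • A + x.2 • B) ≤ Λ * (2 * κ) :=
          mul_le_mul_of_nonneg_left (hxAB x hx) hΛ
      _ ≤ δ / 8 := by linarith
  have h2 : δ / 2 * (I * J) ≤ ψ n * ‖∑ x ∈ V, e (φ (n + x.1 • A + x.2 • B))‖ := by
    have : (0 : ℝ) ≤ δ * (I * J) := by positivity
    linarith
  have h3 : ‖∑ x ∈ V, e (φ (n + x.1 • A + x.2 • B))‖ ≤ I * J := by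
    rw [← hVcard, ← mul_one (#V : ℝ)]
    exact norm_sum_le_card_mul V _ fun x _ => (norm_e _).le
  have hψn : δ / 2 ≤ ψ n := by
    have h4 : δ / 2 * (I * J) ≤ ψ n * (I * J) :=
      h2.trans (mul_le_mul_of_nonneg_left h3 (hψ.nonneg n))
    exact le_of_mul_le_mul_right h4 hIJ
  have h4 : δ / 2 * (I * J) ≤ ‖∑ x ∈ V, e (φ (n + x.1 • A + x.2 • B))‖ :=
    h2.trans (mul_le_of_le_one_left (norm_nonneg _) (hψ.le_one n))
  have hstay : ∀ y : ZMod N, bohrNorm S y ≤ 2 * κ → bohrNorm S (n + y) < σ := by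
    intro y hy
    refine hψ.bohrNorm_add_lt hσ hΛ ?_
    have := mul_le_mul_of_nonneg_left hy hΛ
    linarith
  have hn0 : bohrNorm S n < σ := by
    have := hstay 0 (by rw [bohrNorm_zero]; linarith)
    rwa [add_zero] at this
  have h5 : ∑ x ∈ V, e (φ (n + x.1 • A + x.2 • B)) = ∑ i ∈ Icc 1 I, ∑ j ∈ Icc 1 J,
      e (φ (n + i • A)) * e (φ (n + j • B) - φ n) * e ((i * j) • secondDiff φ A B) := by
    rw [hV, sum_product]
    refine sum_congr rfl fun i hi' => sum_congr rfl fun j hj' => ?_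
    have e1 := hxA i hi'
    have e2 := hxB j hj'
    have hx := hxAB (i, j) (mem_product.2 ⟨hi', hj'⟩)
    rw [hφ.apply_add_nsmul_add_nsmul i j (by linarith) hn0
      (hstay _ (by linarith [bohrNorm_nsmul_le (S := S) i A]))
      (hstay _ (by linarith [bohrNorm_nsmul_le (S := S) j B]))
      (by rw [add_assoc]; exact hstay _ hx), e_add, e_add]
  have h128 : (128 : ℝ) / (δ / 4) ^ 4 = 2 ^ 15 / δ ^ 4 := by field_simp; norm_num
  have h128' : (128 : ℝ) / (δ / 4) ^ 2 ≤ 2 ^ 15 / δ ^ 4 := by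
    rw [← h128]
    apply div_le_div_of_nonneg_left (by norm_num) (by positivity)
    exact pow_le_pow_of_le_one (by positivity) (by linarith) (by norm_num)
  obtain ⟨q, hq, hqle, hqα⟩ := exists_denominator_of_bilinear (a₀ := 1) (a₁ := I) (B := Icc 1 J)
    (I := I) (J := J) (η := δ / 4) (u := fun i => e (φ (n + i • A)))
    (v := fun j => e (φ (n + j • B) - φ n)) (α := secondDiff φ A B) (by positivity) (by linarith)
    (by rw [h128]; exact hI) (h128'.trans hJ) (by simp) (by simp)
    (fun j hj j' hj' => by
      simp only [mem_Icc] at hj hj'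
      have e1 : (j : ℝ) ≤ J := by exact_mod_cast hj.2
      have e2 : (j' : ℝ) ≤ J := by exact_mod_cast hj'.2
      have e3 : (0 : ℝ) ≤ j := by positivity
      have e4 : (0 : ℝ) ≤ j' := by positivity
      rw [abs_le]; constructor <;> linarith)
    (fun i => (norm_e _).le) (fun j => (norm_e _).le) (by
      rw [← h5]
      have : (0 : ℝ) ≤ δ * (I * J) := by positivity
      linarith)
  refine ⟨q, hq, hqle.trans (le_of_eq (by field_simp; norm_num)), hqα.trans (le_of_eq ?_)⟩
  rw [div_pow, div_mul_eq_mul_div, div_div_eq_mul_div]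

/-- The phase information in a single large sum over the multiples of `d`, with a weight `c` of
period `k`: the sum is averaged over the shifts `k (i a + j b)`, and the phase is then bilinear in
`i` and `j`. -/
theorem exists_denominator_of_large_sum (h1S : (1 : ZMod N) ∈ S) (hσ : 0 < σ) (hΛ : 0 ≤ Λ)
    (hφ : IsLocallyQuadraticOn (bohrSet S σ) φ) (hψ : IsSmoothCutoff S σ Λ ψ)
    {δ ω : ℝ} (hδ : 0 < δ) (hδ1 : δ ≤ 1) {d k : ℕ} (hd : 0 < d) (hω : 0 < ω)
    (hω1 : 32 * (d * k * ω) ≤ δ) (hω2 : 16 * (Λ * (d * k * ω)) ≤ δ) (hω3 : 2 * (d * k * ω) < σ)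
    {c : ℤ → ℂ} (hc : ∀ m, ‖c m‖ ≤ 1) (hck : ∀ m t, c (m + k * t) = c m) {lo hi : ℤ}
    (hlohi : ((hi - lo + 1 : ℤ) : ℝ) ≤ N / d)
    (h : δ * (N / d) ≤ ‖∑ m ∈ Icc lo hi, c m * ((ψ ((d : ZMod N) * (m : ZMod N)) : ℂ)
      * e (φ ((d : ZMod N) * (m : ZMod N))))‖)
    {a b : ZMod N} (ha0 : 0 < bohrNorm S a) (hb0 : 0 < bohrNorm S b)
    (ha : bohrNorm S a ≤ ω * δ ^ 4 / 2 ^ 16) (hb : bohrNorm S b ≤ ω * δ ^ 4 / 2 ^ 16) :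
    ∃ q : ℕ, 0 < q ∧ (q : ℝ) ≤ 256 / δ ^ 2 ∧
      ‖q • secondDiff φ ((d * k) • a) ((d * k) • b)‖
        ≤ 2 ^ 24 / (δ ^ 6 * ω ^ 2) * (bohrNorm S a * bohrNorm S b) := by
  have hN : (0 : ℝ) < N := by exact_mod_cast NeZero.pos N
  have hd' : (0 : ℝ) < d := by exact_mod_cast hd
  have hM : 0 < (N : ℝ) / d := by positivity
  set I := ⌊ω / bohrNorm S a⌋₊ with hI
  set J := ⌊ω / bohrNorm S b⌋₊ with hJ
  have hδ4 : δ ^ 4 ≤ 1 := pow_le_one₀ hδ.le hδ1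
  have hbig : ∀ x : ZMod N, 0 < bohrNorm S x → bohrNorm S x ≤ ω * δ ^ 4 / 2 ^ 16 →
      2 ^ 16 / δ ^ 4 ≤ ω / bohrNorm S x := by
    intro x hx hx'
    rw [div_le_div_iff₀ (by positivity) hx]
    rw [le_div_iff₀ (by norm_num)] at hx'
    linarith
  have hone : (2 : ℝ) ^ 16 ≤ 2 ^ 16 / δ ^ 4 := le_div_self (by norm_num) (by positivity) hδ4
  have hI1 := hbig a ha0 ha
  have hJ1 := hbig b hb0 hb
  have hI2 : ω / bohrNorm S a / 2 ≤ I := half_le_floor (by linarith)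
  have hJ2 : ω / bohrNorm S b / 2 ≤ J := half_le_floor (by linarith)
  have hIa : I * bohrNorm S a ≤ ω := by
    rw [← le_div_iff₀ ha0]; exact Nat.floor_le (by positivity)
  have hJb : J * bohrNorm S b ≤ ω := by
    rw [← le_div_iff₀ hb0]; exact Nat.floor_le (by positivity)
  have hI0 : (0 : ℝ) < I := by linarith
  have hJ0 : (0 : ℝ) < J := by linarith
  have hIJ : (0 : ℝ) < I * J := mul_pos hI0 hJ0
  set V : Finset (ℕ × ℕ) := Icc 1 I ×ˢ Icc 1 J with hV
  have hVcard : (#V : ℝ) = I * J := by rw [hV, card_product]; simp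
  set v : ℕ × ℕ → ℤ := fun x => k * (x.1 * a.valMinAbs + x.2 * b.valMinAbs) with hv
  set w := ⌊δ * (N / d) / 16⌋₊ with hw
  have hvw : ∀ x ∈ V, |v x| ≤ w := by
    intro x hx
    simp only [hV, mem_product, mem_Icc] at hx
    have hx1 : x.1 * bohrNorm S a ≤ ω := by
      refine le_trans ?_ hIa
      have : (x.1 : ℝ) ≤ I := by exact_mod_cast hx.1.2
      gcongr
    have hx2 : x.2 * bohrNorm S b ≤ ω := by
      refine le_trans ?_ hJb
      have : (x.2 : ℝ) ≤ J := by exact_mod_cast hx.2.2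
      gcongr
    have h1 : ((v x).natAbs : ℝ) ≤ δ * (N / d) / 16 := by
      rw [Nat.cast_natAbs, Int.cast_abs]
      have h3 : |(v x : ℝ)| ≤ k * (x.1 * (N * bohrNorm S a) + x.2 * (N * bohrNorm S b)) := by
        simp only [hv]; push_cast
        rw [abs_mul, Nat.abs_cast]
        gcongr
        refine (abs_add_le _ _).trans ?_
        rw [abs_mul, abs_mul, Nat.abs_cast, Nat.abs_cast]
        gcongr
        · exact abs_valMinAbs_le h1S a
        · exact abs_valMinAbs_le h1S b
      have h4 : k * (x.1 * (N * bohrNorm S a) + x.2 * (N * bohrNorm S b)) ≤ k * (N * (ω + ω)) := by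
        have : x.1 * (N * bohrNorm S a) + x.2 * (N * bohrNorm S b)
          = N * (x.1 * bohrNorm S a + x.2 * bohrNorm S b) := by ring
        rw [this]; gcongr
      refine h3.trans (h4.trans ?_)
      have h5 : (k : ℝ) * (N * (ω + ω)) = 32 * (d * k * ω) * (N / d) / 16 := by
        field_simp; ring
      rw [h5]; gcongr
    have h2 := Nat.le_floor h1
    rw [Int.abs_eq_natAbs]
    exact_mod_cast h2
  set f : ℤ → ℂ := fun m => c m * ((ψ ((d : ZMod N) * (m : ZMod N)) : ℂ)
      * e (φ ((d : ZMod N) * (m : ZMod N)))) with hf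
  have hf1 : ∀ m, ‖f m‖ ≤ 1 := fun m => by
    simp only [hf]
    rw [norm_mul]
    exact mul_le_one₀ (hc m) (norm_nonneg _) (hψ.norm_mul_e_le _ _)
  have h1 := card_mul_norm_sum_le V v w hvw lo hi f hf1
  have hw4 : (w : ℝ) ≤ δ * (N / d) / 16 := Nat.floor_le (by positivity)
  obtain ⟨m, hm⟩ : ∃ m, 3 / 4 * δ * (I * J) ≤ ‖∑ x ∈ V, f (m + v x)‖ := by
    by_contra hcon
    push Not at hcon
    rw [hVcard] at h1
    have h3 : (I * J : ℝ) * (δ * (N / d)) ≤ I * J * ‖∑ m ∈ Icc lo hi, f m‖ := by gcongr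
    have h5 : (4 * w * (I * J) : ℝ) ≤ δ * (N / d) / 4 * (I * J) := by
      have : (4 * w : ℝ) ≤ δ * (N / d) / 4 := by linarith
      gcongr
    have h7 : 0 < (I * J : ℝ) * (δ * (N / d)) := by positivity
    rcases (Icc (lo + (w : ℤ)) (hi - w)).eq_empty_or_nonempty with h0 | h0
    · rw [h0, sum_empty] at h1
      linarith
    · have h2 := sum_lt_sum_of_nonempty h0 fun m _ => hcon m
      rw [sum_const, nsmul_eq_mul] at h2
      have h4 : (#(Icc (lo + (w : ℤ)) (hi - w)) : ℝ) ≤ N / d := by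
        refine le_trans ?_ hlohi
        obtain ⟨z, hz⟩ := h0
        rw [mem_Icc] at hz
        rw [Int.card_Icc]
        have : ((hi - w + 1 - (lo + w)).toNat : ℤ) ≤ hi - lo + 1 := by omega
        exact_mod_cast this
      have h6 : (#(Icc (lo + (w : ℤ)) (hi - w)) : ℝ) * (3 / 4 * δ * (I * J))
          ≤ N / d * (3 / 4 * δ * (I * J)) := by gcongr
      linarith
  set n : ZMod N := (d : ZMod N) * (m : ZMod N) with hn
  set A : ZMod N := (d * k) • a with hA
  set B : ZMod N := (d * k) • b with hB
  have hAn : I * bohrNorm S A ≤ d * k * ω := by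
    have h2 := bohrNorm_nsmul_le (S := S) (d * k) a
    push_cast at h2
    calc I * bohrNorm S A ≤ I * (d * k * bohrNorm S a) := by gcongr
      _ = d * k * (I * bohrNorm S a) := by ring
      _ ≤ _ := by gcongr
  have hBn : J * bohrNorm S B ≤ d * k * ω := by
    have h2 := bohrNorm_nsmul_le (S := S) (d * k) b
    push_cast at h2
    calc J * bohrNorm S B ≤ J * (d * k * bohrNorm S b) := by gcongr
      _ = d * k * (J * bohrNorm S b) := by ring
      _ ≤ _ := by gcongr
  have hshift : ∀ x : ℕ × ℕ, (d : ZMod N) * ((m + v x : ℤ) : ZMod N) = n + x.1 • A + x.2 • B := by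
    intro x
    simp only [hv, hn, hA, hB, nsmul_eq_mul]
    push_cast
    ring
  have hsum : ∑ x ∈ V, f (m + v x) = c m * ∑ x ∈ V,
      (ψ (n + x.1 • A + x.2 • B) : ℂ) * e (φ (n + x.1 • A + x.2 • B)) := by
    rw [mul_sum]
    refine sum_congr rfl fun x _ => ?_
    simp only [hf]
    rw [hshift x, hck]
  rw [hsum, norm_mul] at hm
  have h215 : (2 : ℝ) ^ 15 / δ ^ 4 = 2 ^ 16 / δ ^ 4 / 2 := by ring
  obtain ⟨q, hq, hqle, hqα⟩ := exists_denominator_of_local_sum hσ hΛ hφ hψ hδ hδ1 hω2 hω3 hAn hBn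
    (by rw [h215]; linarith) (by rw [h215]; linarith)
    (hm.trans (mul_le_of_le_one_left (norm_nonneg _) (hc m)))
  refine ⟨q, hq, hqle, hqα.trans ?_⟩
  have h6 : ω / bohrNorm S a / 2 * (ω / bohrNorm S b / 2) ≤ I * J := by gcongr
  calc 576 * 4 ^ 6 / (δ ^ 6 * (I * J))
      ≤ 576 * 4 ^ 6 / (δ ^ 6 * (ω / bohrNorm S a / 2 * (ω / bohrNorm S b / 2))) := by gcongr
    _ = (576 * 4 ^ 7) / (δ ^ 6 * ω ^ 2) * (bohrNorm S a * bohrNorm S b) := by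
        field_simp; norm_num
    _ ≤ _ := by
        apply mul_le_mul_of_nonneg_right _ (by positivity)
        gcongr
        norm_num

/-- A dense set of integers in an interval starting near `0` has two members that are close. -/
lemma exists_close_pair {D η : ℝ} (hη : 0 < η) (hD : 2 < η * D) {E : Finset ℕ} (hE : η * D < #E)
    (hED : ∀ d ∈ E, (d : ℝ) ≤ D) :
    ∃ d ∈ E, ∃ t : ℕ, 0 < t ∧ (t : ℝ) ≤ 2 / η + 1 ∧ d + t ∈ E := by
  set g := ⌈2 / η⌉₊ with hg
  have hg0 : 2 / η ≤ g := Nat.le_ceil _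
  have hgpos : 0 < g := by
    have : (0 : ℝ) < g := lt_of_lt_of_le (by positivity) hg0
    exact_mod_cast this
  have hg1 : (g : ℝ) ≤ 2 / η + 1 := (Nat.ceil_lt_add_one (by positivity)).le
  obtain ⟨x, hx, y, hy, hxy, hdiv⟩ := exists_ne_map_eq_of_card_lt_of_maps_to
    (s := E) (t := range (⌊η * D / 2⌋₊ + 1)) (f := fun d => d / g) (by
      rw [card_range]
      have h1 : ((⌊η * D / 2⌋₊ + 1 : ℕ) : ℝ) ≤ η * D / 2 + 1 := by
        push_cast
        linarith [Nat.floor_le (a := η * D / 2) (by linarith)]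
      have h2 : ((⌊η * D / 2⌋₊ + 1 : ℕ) : ℝ) < #E := by linarith
      exact_mod_cast h2) (by
      intro d hd
      rw [mem_coe] at hd
      rw [mem_coe, mem_range, Nat.lt_succ_iff]
      apply Nat.le_floor
      refine (Nat.cast_div_le (α := ℝ)).trans ?_
      rw [div_le_iff₀ (by exact_mod_cast hgpos)]
      have h1 := hED d hd
      have h2 : η * D / 2 * (2 / η) ≤ η * D / 2 * g := by gcongr
      have h3 : η * D / 2 * (2 / η) = D := by field_simp
      linarith)
  wlog hlt : x < y generalizing x y
  · exact this y hy x hx hxy.symm hdiv.symm (lt_of_le_of_ne (not_lt.1 hlt) hxy.symm)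
  refine ⟨x, hx, y - x, Nat.sub_pos_of_lt hlt, ?_, by rwa [Nat.add_sub_cancel' hlt.le]⟩
  refine le_trans ?_ hg1
  have h1 := Nat.div_add_mod x g
  have h2 := Nat.div_add_mod y g
  have h3 := Nat.mod_lt x hgpos
  have h4 := Nat.mod_lt y hgpos
  rw [hdiv] at h1
  have : y - x ≤ g := by omega
  exact_mod_cast this

/-- The identity `t³ = 4t d² - (2d - t)((d + t)² - d²)` eliminates the large numbers `d² β` and
`(d + t)² β` in favour of `t³ β`. -/
lemma norm_cube_nsmul_le {β : UnitAddCircle} {d t k q q' : ℕ} {B : ℝ}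
    (h : ‖q • (d * k * (d * k)) • β‖ ≤ B)
    (h' : ‖q' • ((d + t) * k * ((d + t) * k)) • β‖ ≤ B) :
    ‖(t ^ 3 * k ^ 2 * q * q') • β‖ ≤ (4 * t * q' + (2 * d + t) * (q + q')) * B := by
  have h1 : (t ^ 3 * k ^ 2 * q * q') • β
      = (4 * t * q' : ℤ) • (q • (d * k * (d * k)) • β)
        - (2 * d - t : ℤ) • ((q : ℤ) • (q' • ((d + t) * k * ((d + t) * k)) • β)
          - (q' : ℤ) • (q • (d * k * (d * k)) • β)) := by
    simp only [← natCast_zsmul, smul_smul, ← sub_smul]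
    congr 1
    push_cast
    ring
  rw [h1]
  refine (norm_sub_le _ _).trans ?_
  rw [add_mul (4 * (t : ℝ) * q')]
  refine add_le_add ?_ ?_
  · refine (norm_zsmul_le_abs _ _).trans ?_
    push_cast
    rw [abs_of_nonneg (by positivity)]
    gcongr
  · refine (norm_zsmul_le_abs _ _).trans ?_
    rw [mul_assoc (2 * (d : ℝ) + t)]
    have h2 : |((2 * d - t : ℤ) : ℝ)| ≤ 2 * d + t := by
      push_cast
      rw [abs_le]
      have e1 : (0 : ℝ) ≤ d := by positivity
      have e2 : (0 : ℝ) ≤ t := by positivity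
      constructor <;> linarith
    have h3 : ‖(q : ℤ) • (q' • ((d + t) * k * ((d + t) * k)) • β)
          - (q' : ℤ) • (q • (d * k * (d * k)) • β)‖ ≤ (q + q') * B := by
      refine (norm_sub_le _ _).trans ?_
      rw [add_mul (q : ℝ)]
      refine add_le_add ((norm_zsmul_le_abs _ _).trans ?_) ((norm_zsmul_le_abs _ _).trans ?_)
      · rw [Int.cast_natCast, Nat.abs_cast]; gcongr
      · rw [Int.cast_natCast, Nat.abs_cast]; gcongr
    exact mul_le_mul h2 h3 (norm_nonneg _) (by positivity)

/-- The sum over the multiples of a single `d` controls `d² k² φ''(a, b)`. -/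
lemma exists_denominator_of_typeI_single (h1S : (1 : ZMod N) ∈ S) (hσ : 0 < σ) (hΛ : 0 ≤ Λ)
    (hφ : IsLocallyQuadraticOn (bohrSet S σ) φ) (hψ : IsSmoothCutoff S σ Λ ψ)
    {δ X R D : ℝ} (hδ : 0 < δ) (hδ1 : δ ≤ 1) {k : ℕ} (hk : 0 < k)
    (hXδ : 1 / δ ≤ X) (hXσ : 1 / σ ≤ X) (hXΛ : Λ ≤ X) (hXk : (k : ℝ) ≤ X)
    (hX : 2 ^ 24 ≤ X) (hR : X ^ 20 ≤ R) (hD : 0 < D) (hDR : D ≤ X * √R) {E : Finset ℕ}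
    {c : ℤ → ℂ} (hc : ∀ m, ‖c m‖ ≤ 1) (hck : ∀ m t, c (m + k * t) = c m)
    {lo hi : ℕ → ℤ} (hlohi : ∀ d ∈ E, ((hi d - lo d + 1 : ℤ) : ℝ) ≤ N / d)
    (hED : ∀ d ∈ E, D / 2 ≤ d ∧ (d : ℝ) ≤ D)
    (h : ∀ d ∈ E, δ * (N / d) ≤ ‖∑ m ∈ Icc (lo d) (hi d), c m *
      ((ψ ((d : ZMod N) * (m : ZMod N)) : ℂ) * e (φ ((d : ZMod N) * (m : ZMod N))))‖) :
    ∀ d ∈ E, ∀ a b, 0 < bohrNorm S a → 0 < bohrNorm S b → bohrNorm S a ≤ 1 / R ^ 2 →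
      bohrNorm S b ≤ 1 / R ^ 2 → ∃ q : ℕ, 0 < q ∧ (q : ℝ) ≤ X ^ 3 ∧
      ‖q • (d * k * (d * k)) • secondDiff φ a b‖ ≤ X ^ 7 * R ^ 2 * (bohrNorm S a * bohrNorm S b) := by
  have hX0 : 0 < X := lt_of_lt_of_le (by norm_num) hX
  have hX1 : 1 ≤ X := le_trans (by norm_num) hX
  have hR1 : 1 ≤ R := le_trans (one_le_pow₀ hX1) hR
  have hR0 : 0 < R := by linarith
  have hsq : √R * √R = R := Real.mul_self_sqrt hR0.le
  have hsqX : X ^ 10 ≤ √R := Real.le_sqrt_of_sq_le (by rw [← pow_mul]; exact hR)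
  have hs1 : 1 ≤ √R := le_trans (one_le_pow₀ hX1) hsqX
  have hδX : 1 ≤ δ * X := by rwa [div_le_iff₀ hδ, mul_comm] at hXδ
  have hσX : 1 ≤ σ * X := by rwa [div_le_iff₀ hσ, mul_comm] at hXσ
  have hpow : ∀ i j : ℕ, i ≤ j → X ^ i ≤ X ^ j := fun i j hij => pow_le_pow_right₀ hX1 hij
  have hdk : ∀ d ∈ E, (d * k * (1 / R) : ℝ) * X ^ 8 ≤ 1 := by
    intro d hd
    have h1 := (hED d hd).2.trans hDR
    have h2 : (d * k : ℝ) ≤ X * √R * X := by gcongr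
    rw [mul_one_div, div_mul_eq_mul_div, div_le_one hR0]
    calc (d * k : ℝ) * X ^ 8 ≤ X * √R * X * X ^ 8 := by gcongr
      _ = X ^ 10 * √R := by ring
      _ ≤ √R * √R := by gcongr
      _ = R := hsq
  have hdk0 : ∀ d : ℕ, (0 : ℝ) ≤ d * k * (1 / R) := fun d => by positivity
  have hsmall : ∀ d ∈ E, 32 * (d * k * (1 / R)) ≤ δ ∧ 16 * (Λ * (d * k * (1 / R))) ≤ δ ∧
      2 * (d * k * (1 / R)) < σ := by
    intro d hd
    have h1 := hdk d hd
    have h0 := hdk0 d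
    set y := (d * k * (1 / R) : ℝ) with hy
    have h2 : y * X ^ 2 * 32 ≤ y * X ^ 8 := by
      rw [show y * X ^ 8 = y * X ^ 2 * (X * X ^ 5) by ring]
      have : 32 ≤ X * X ^ 5 := by
        nlinarith [one_le_pow₀ hX1 (n := 5)]
      gcongr
    have h3 : y * X ≤ y * X ^ 2 := by
      have := hpow 1 2 (by norm_num)
      rw [pow_one] at this
      gcongr
    refine ⟨?_, ?_, ?_⟩
    · refine le_of_mul_le_mul_right ?_ hX0
      linarith
    · refine le_of_mul_le_mul_right ?_ hX0
      have : Λ * y * X ≤ X * y * X := by gcongr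
      nlinarith
    · refine lt_of_mul_lt_mul_right ?_ hX0.le
      nlinarith
  have hRR : 1 / R ^ 2 ≤ 1 / R * δ ^ 4 / 2 ^ 16 := by
    rw [div_le_iff₀ (by positivity)]
    have h1 : 1 ≤ δ ^ 4 * X ^ 4 := by rw [← mul_pow]; exact one_le_pow₀ hδX
    have h2 : 2 ^ 16 * X ^ 4 ≤ R := by
      calc 2 ^ 16 * X ^ 4 ≤ X * X ^ 4 := by gcongr; linarith
        _ = X ^ 5 := by ring
        _ ≤ X ^ 20 := hpow _ _ (by norm_num)
        _ ≤ R := hR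
    have h3 : 1 / R * δ ^ 4 / 2 ^ 16 * R ^ 2 = δ ^ 4 * R / 2 ^ 16 := by field_simp
    rw [h3, le_div_iff₀ (by norm_num)]
    nlinarith [pow_pos hδ 4]
  intro d hd a b ha0 hb0 ha hb
  have hd0 : 0 < d := by
    have : (0 : ℝ) < d := lt_of_lt_of_le (by positivity) (hED d hd).1
    exact_mod_cast this
  obtain ⟨h1, h2, h3⟩ := hsmall d hd
  obtain ⟨q, hq, hqle, hqβ⟩ := exists_denominator_of_large_sum h1S hσ hΛ hφ hψ hδ hδ1 hd0
    (k := k) (ω := 1 / R) (by positivity) h1 h2 h3 hc hck (hlohi d hd) (h d hd) ha0 hb0 (ha.trans hRR)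
    (hb.trans hRR)
  have h4 : 1 / R ^ 2 ≤ 1 / R := by
    apply one_div_le_one_div_of_le hR0
    nlinarith
  rw [hφ.secondDiff_nsmul (d * k) (d * k) (by
    have e1 : (d * k : ℝ) * bohrNorm S a ≤ d * k * (1 / R) := by gcongr; exact ha.trans h4
    have e2 : (d * k : ℝ) * bohrNorm S b ≤ d * k * (1 / R) := by gcongr; exact hb.trans h4
    push_cast
    linarith)] at hqβ
  have hδinv : ∀ n : ℕ, 1 / δ ^ n ≤ X ^ n := fun n => by
    rw [← one_div_pow]; gcongr
  refine ⟨q, hq, ?_, hqβ.trans ?_⟩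
  · refine hqle.trans ?_
    rw [div_eq_mul_one_div]
    calc 256 * (1 / δ ^ 2) ≤ X * X ^ 2 := by gcongr; linarith; exact hδinv 2
      _ = X ^ 3 := by ring
  · gcongr
    rw [one_div_pow, show 2 ^ 24 / (δ ^ 6 * (1 / R ^ 2)) = 2 ^ 24 * (1 / δ ^ 6) * R ^ 2 by field_simp]
    calc 2 ^ 24 * (1 / δ ^ 6) * R ^ 2 ≤ X * X ^ 6 * R ^ 2 := by gcongr; exact hδinv 6
      _ = _ := by ring

/-- Comparing two close members of `E` removes the factor `d²`, which may be as large as `R`; when `D`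
is bounded a single `d` suffices. -/
lemma exists_denominator_of_typeI_pointwise (h1S : (1 : ZMod N) ∈ S) (hσ : 0 < σ) (hΛ : 0 ≤ Λ)
    (hφ : IsLocallyQuadraticOn (bohrSet S σ) φ) (hψ : IsSmoothCutoff S σ Λ ψ)
    {δ η X R D : ℝ} (hδ : 0 < δ) (hδ1 : δ ≤ 1) (hη : 0 < η) {k : ℕ} (hk : 0 < k)
    (hXδ : 1 / δ ≤ X) (hXη : 1 / η ≤ X) (hXσ : 1 / σ ≤ X) (hXΛ : Λ ≤ X) (hXk : (k : ℝ) ≤ X)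
    (hX : 2 ^ 24 ≤ X) (hR : X ^ 20 ≤ R) (hD : 0 < D) (hDR : D ≤ X * √R) {E : Finset ℕ}
    (hE : η * D < #E) {c : ℤ → ℂ} (hc : ∀ m, ‖c m‖ ≤ 1) (hck : ∀ m t, c (m + k * t) = c m)
    {lo hi : ℕ → ℤ} (hlohi : ∀ d ∈ E, ((hi d - lo d + 1 : ℤ) : ℝ) ≤ N / d)
    (hED : ∀ d ∈ E, D / 2 ≤ d ∧ (d : ℝ) ≤ D)
    (h : ∀ d ∈ E, δ * (N / d) ≤ ‖∑ m ∈ Icc (lo d) (hi d), c m *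
      ((ψ ((d : ZMod N) * (m : ZMod N)) : ℂ) * e (φ ((d : ZMod N) * (m : ZMod N))))‖) :
    ∀ a b, bohrNorm S a < 1 / R ^ 5 → bohrNorm S b < 1 / R ^ 5 → ∃ q : ℕ, 0 < q ∧
      q ≤ ⌊X ^ 12⌋₊ ∧ ‖q • secondDiff φ a b‖ ≤ X ^ 12 * R ^ 3 * (bohrNorm S a * bohrNorm S b) := by
  have hX1 : 1 ≤ X := le_trans (by norm_num) hX
  have hX0 : 0 < X := by linarith
  have hR1 : 1 ≤ R := le_trans (one_le_pow₀ hX1) hR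
  have hR0 : 0 < R := by linarith
  have hsq : √R * √R = R := Real.mul_self_sqrt hR0.le
  have hsqX : X ^ 10 ≤ √R := Real.le_sqrt_of_sq_le (by rw [← pow_mul]; exact hR)
  have hs1 : 1 ≤ √R := le_trans (one_le_pow₀ hX1) hsqX
  have hpow : ∀ i j : ℕ, i ≤ j → X ^ i ≤ X ^ j := fun i j hij => pow_le_pow_right₀ hX1 hij
  have hsingle := exists_denominator_of_typeI_single h1S hσ hΛ hφ hψ hδ hδ1 hk hXδ hXσ hXΛ hXk hX
    hR hD hDR hc hck hlohi hED h
  intro a b ha hb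
  have h52 : 1 / R ^ 5 ≤ 1 / R ^ 2 :=
    one_div_le_one_div_of_le (by positivity) (pow_le_pow_right₀ hR1 (by norm_num))
  have hone : 1 ≤ ⌊X ^ 12⌋₊ := Nat.le_floor (by rw [Nat.cast_one]; exact one_le_pow₀ hX1)
  rcases (bohrNorm_nonneg (S := S) a).eq_or_lt with h0 | ha0
  · rw [eq_zero_of_bohrNorm_eq_zero h1S h0.symm]
    exact ⟨1, one_pos, hone, by simp⟩
  rcases (bohrNorm_nonneg (S := S) b).eq_or_lt with h0 | hb0
  · rw [eq_zero_of_bohrNorm_eq_zero h1S h0.symm, secondDiff_comm]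
    exact ⟨1, one_pos, hone, by simp⟩
  have hab : 0 < bohrNorm S a * bohrNorm S b := mul_pos ha0 hb0
  rcases le_or_gt (η * D) 2 with hsm | hlg
  · -- all the `d` are bounded
    obtain ⟨d, hd⟩ : E.Nonempty := by
      rw [← card_pos]
      have : (0 : ℝ) < #E := lt_of_le_of_lt (by positivity) hE
      exact_mod_cast this
    obtain ⟨q, hq, hqle, hqβ⟩ := hsingle d hd a b ha0 hb0 (ha.le.trans h52) (hb.le.trans h52)
    have hd0 : 0 < d := by
      have : (0 : ℝ) < d := lt_of_lt_of_le (by positivity) (hED d hd).1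
      exact_mod_cast this
    have hd2 : (d : ℝ) ≤ 2 * X := by
      have h1 : D ≤ 2 * (1 / η) := by rw [mul_one_div, le_div_iff₀ hη]; linarith
      linarith [(hED d hd).2]
    refine ⟨q * (d * k * (d * k)), by positivity, ?_, ?_⟩
    · apply Nat.le_floor
      push_cast
      calc (q : ℝ) * (d * k * (d * k)) ≤ X ^ 3 * (2 * X * X * (2 * X * X)) := by gcongr
        _ = 4 * X ^ 7 := by ring
        _ ≤ X * X ^ 7 := by gcongr; linarith
        _ = X ^ 8 := by ring
        _ ≤ X ^ 12 := hpow _ _ (by norm_num)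
    · rw [mul_nsmul']
      refine hqβ.trans (mul_le_mul_of_nonneg_right ?_ hab.le)
      exact mul_le_mul (hpow _ _ (by norm_num)) (pow_le_pow_right₀ hR1 (by norm_num))
        (by positivity) (by positivity)
  · obtain ⟨d, hd, t, ht, htle, hdt⟩ := exists_close_pair hη hlg hE fun d hd => (hED d hd).2
    obtain ⟨q, hq, hqle, hqβ⟩ := hsingle d hd a b ha0 hb0 (ha.le.trans h52) (hb.le.trans h52)
    obtain ⟨q', hq', hqle', hqβ'⟩ := hsingle (d + t) hdt a b ha0 hb0 (ha.le.trans h52)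
      (hb.le.trans h52)
    have htX : (t : ℝ) ≤ 3 * X := by
      have : 2 / η = 2 * (1 / η) := by ring
      linarith
    refine ⟨t ^ 3 * k ^ 2 * q * q', by positivity, ?_, ?_⟩
    · apply Nat.le_floor
      push_cast
      calc (t : ℝ) ^ 3 * k ^ 2 * q * q' ≤ (3 * X) ^ 3 * X ^ 2 * X ^ 3 * X ^ 3 := by gcongr
        _ = 27 * X ^ 11 := by ring
        _ ≤ X * X ^ 11 := by gcongr; linarith
        _ = X ^ 12 := by ring
    · refine (norm_cube_nsmul_le hqβ hqβ').trans ?_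
      have hd' : (d : ℝ) ≤ X * √R := (hED d hd).2.trans hDR
      have ht' : (t : ℝ) ≤ X * √R := htX.trans (by
        have : 3 * X ≤ X * X ^ 10 := by
          nlinarith [hpow 1 10 (by norm_num)]
        refine this.trans ?_
        gcongr)
      have h1 : (4 * t * q' + (2 * d + t) * (q + q') : ℝ) ≤ X ^ 5 * √R := by
        calc (4 * t * q' + (2 * d + t) * (q + q') : ℝ)
            ≤ 4 * (X * √R) * X ^ 3 + (2 * (X * √R) + X * √R) * (X ^ 3 + X ^ 3) := by gcongr
          _ = 10 * (X ^ 4 * √R) := by ring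
          _ ≤ X * (X ^ 4 * √R) := by gcongr; linarith
          _ = _ := by ring
      have h2 : √R ≤ R := by nlinarith
      calc (4 * t * q' + (2 * d + t) * (q + q') : ℝ) * (X ^ 7 * R ^ 2 * (bohrNorm S a * bohrNorm S b))
          ≤ (X ^ 5 * R) * (X ^ 7 * R ^ 2 * (bohrNorm S a * bohrNorm S b)) := by
            gcongr
            exact h1.trans (by gcongr)
        _ = _ := by ring

/-- Large type I sums, with a periodic weight, force the mixed derivative to be approximately
rational. All the parameters of the problem except `R` are bounded by `X`, which is at most a
small power of `R`. -/
theorem exists_denominator_of_typeI (h1S : (1 : ZMod N) ∈ S) (hσ : 0 < σ) (hΛ : 0 ≤ Λ)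
    (hφ : IsLocallyQuadraticOn (bohrSet S σ) φ) (hψ : IsSmoothCutoff S σ Λ ψ)
    {δ η X R D : ℝ} (hδ : 0 < δ) (hδ1 : δ ≤ 1) (hη : 0 < η) {k : ℕ} (hk : 0 < k)
    (hXδ : 1 / δ ≤ X) (hXη : 1 / η ≤ X) (hXσ : 1 / σ ≤ X) (hXΛ : Λ ≤ X) (hXk : (k : ℝ) ≤ X)
    (hX : 2 ^ 24 ≤ X) (hR : X ^ 20 ≤ R) (hD : 0 < D) (hDR : D ≤ X * √R) {E : Finset ℕ}
    (hE : η * D < #E) {c : ℤ → ℂ} (hc : ∀ m, ‖c m‖ ≤ 1) (hck : ∀ m t, c (m + k * t) = c m)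
    {lo hi : ℕ → ℤ} (hlohi : ∀ d ∈ E, ((hi d - lo d + 1 : ℤ) : ℝ) ≤ N / d)
    (hED : ∀ d ∈ E, D / 2 ≤ d ∧ (d : ℝ) ≤ D)
    (h : ∀ d ∈ E, δ * (N / d) ≤ ‖∑ m ∈ Icc (lo d) (hi d), c m *
      ((ψ ((d : ZMod N) * (m : ZMod N)) : ℂ) * e (φ ((d : ZMod N) * (m : ZMod N))))‖) :
    ∃ q : ℕ, 0 < q ∧ (q : ℝ) ≤ X ^ 48 ∧ ∀ a b, bohrNorm S a < 1 / R ^ 8 → bohrNorm S b < 1 / R ^ 8 →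
      ‖q • secondDiff φ a b‖ ≤ X ^ 60 * R ^ 3 * (bohrNorm S a * bohrNorm S b) := by
  have hX1 : 1 ≤ X := le_trans (by norm_num) hX
  have hX0 : 0 < X := by linarith
  have hR1 : 1 ≤ R := le_trans (one_le_pow₀ hX1) hR
  have hR0 : 0 < R := by linarith
  have hσX : 1 ≤ σ * X := by rwa [div_le_iff₀ hσ, mul_comm] at hXσ
  have hpow : ∀ i j : ℕ, i ≤ j → X ^ i ≤ X ^ j := fun i j hij => pow_le_pow_right₀ hX1 hij
  have hpt := exists_denominator_of_typeI_pointwise h1S hσ hΛ hφ hψ hδ hδ1 hη hk hXδ hXη hXσ hXΛ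
    hXk hX hR hD hDR hE hc hck hlohi hED h
  have hQX : (⌊X ^ 12⌋₊ : ℝ) ≤ X ^ 12 := Nat.floor_le (by positivity)
  have hra : 0 < 1 / R ^ 5 := by positivity
  have hrσ : 1 / R ^ 5 + 1 / R ^ 5 ≤ σ := by
    have h1 : 2 / R ^ 5 ≤ σ := by
      rw [div_le_iff₀ (by positivity)]
      have h2 : 2 * X ≤ R ^ 5 := by
        calc 2 * X ≤ X * X := by gcongr; linarith
          _ = X ^ 2 := by ring
          _ ≤ X ^ 20 := hpow _ _ (by norm_num)
          _ ≤ R := hR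
          _ ≤ R ^ 5 := le_self_pow₀ hR1 (by norm_num)
      nlinarith
    have : 1 / R ^ 5 + 1 / R ^ 5 = 2 / R ^ 5 := by ring
    linarith
  obtain ⟨q, hq, hqle, hqβ⟩ := exists_uniform_denominator (S := S) hra hra (χ := secondDiff φ)
    (fun b hb => hφ.locAdd hra (by linarith))
    (fun a ha => by
      have := hφ.locAdd (b := a) hra (by linarith)
      simp_rw [fun b => secondDiff_comm φ b a] at this
      exact this)
    (Q := ⌊X ^ 12⌋₊) (T := ⌊X ^ 12⌋₊ ^ 4) Nat.lt_two_pow_self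
    (g := fun a b => X ^ 12 * R ^ 3 * (bohrNorm S a * bohrNorm S b)) (fun a b ha hb => by
      have h1 : bohrNorm S a * bohrNorm S b ≤ 1 / R ^ 5 * (1 / R ^ 5) := by
        gcongr; exact bohrNorm_nonneg _
      calc 4 * (⌊X ^ 12⌋₊ : ℝ) ^ 3 * (X ^ 12 * R ^ 3 * (bohrNorm S a * bohrNorm S b))
          ≤ X * (X ^ 12) ^ 3 * (X ^ 12 * R ^ 3 * (1 / R ^ 5 * (1 / R ^ 5))) := by
            have := mul_nonneg (bohrNorm_nonneg (S := S) a) (bohrNorm_nonneg (S := S) b)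
            gcongr
            linarith
        _ = X ^ 49 / R ^ 7 := by field_simp
        _ ≤ 1 := by
            rw [div_le_one (by positivity)]
            calc X ^ 49 ≤ X ^ 140 := hpow _ _ (by norm_num)
              _ = (X ^ 20) ^ 7 := by ring
              _ ≤ R ^ 7 := by gcongr) hpt
  have hq48 : (q : ℝ) ≤ X ^ 48 := by
    calc (q : ℝ) ≤ ((⌊X ^ 12⌋₊ ^ 4 : ℕ) : ℝ) := by exact_mod_cast hqle
      _ ≤ (X ^ 12) ^ 4 := by push_cast; gcongr
      _ = X ^ 48 := by ring
  refine ⟨q, hq, hq48, fun a b ha hb => ?_⟩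
  have hrad : 1 / R ^ 8 ≤ 1 / R ^ 5 / ((⌊X ^ 12⌋₊ ^ 4 : ℕ) : ℝ) := by
    have hpos : (0 : ℝ) < ((⌊X ^ 12⌋₊ ^ 4 : ℕ) : ℝ) := by
      have : 1 ≤ ⌊X ^ 12⌋₊ := Nat.le_floor (by rw [Nat.cast_one]; exact one_le_pow₀ hX1)
      positivity
    rw [div_div]
    apply one_div_le_one_div_of_le (by positivity)
    calc R ^ 5 * ((⌊X ^ 12⌋₊ ^ 4 : ℕ) : ℝ) ≤ R ^ 5 * (X ^ 12) ^ 4 := by push_cast; gcongr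
      _ = R ^ 5 * X ^ 48 := by ring
      _ ≤ R ^ 5 * X ^ 60 := by exact mul_le_mul_of_nonneg_left (hpow _ _ (by norm_num)) (by positivity)
      _ = R ^ 5 * (X ^ 20) ^ 3 := by ring
      _ ≤ R ^ 5 * R ^ 3 := by gcongr
      _ = R ^ 8 := by ring
  refine (hqβ a b (ha.trans_le hrad) (hb.trans_le hrad)).trans ?_
  have := mul_nonneg (bohrNorm_nonneg (S := S) a) (bohrNorm_nonneg (S := S) b)
  calc (q : ℝ) * (X ^ 12 * R ^ 3 * (bohrNorm S a * bohrNorm S b))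
      ≤ X ^ 48 * (X ^ 12 * R ^ 3 * (bohrNorm S a * bohrNorm S b)) := by gcongr
    _ = _ := by ring

end TypeI

/-! ### Type II sums: correlations of shifts -/

lemma card_Icc_int_le {a b : ℤ} {x : ℝ} (hx : 0 ≤ x) (h : ((b - a + 1 : ℤ) : ℝ) ≤ x) :
    (#(Icc a b) : ℝ) ≤ x := by
  rw [Int.card_Icc]
  rcases le_total 0 (b + 1 - a) with h0 | h0
  · have h1 : ((b + 1 - a).toNat : ℤ) = b - a + 1 := by rw [Int.toNat_of_nonneg h0]; ring
    have h2 : (((b + 1 - a).toNat : ℤ) : ℝ) = ((b - a + 1 : ℤ) : ℝ) := by rw [h1]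
    rw [Int.cast_natCast] at h2
    rw [h2]; exact h
  · rw [Int.toNat_of_nonpos h0]; simpa using hx

/-- van der Corput's inequality for a set of shifts: if a sum over an interval is large, then so
are many of its correlations. -/
lemma exists_card_correlations {G : ℤ → ℂ} (hG : ∀ m, ‖G m‖ ≤ 1) {V : Finset ℤ} (hV : V.Nonempty)
    {w : ℕ} (hw : ∀ v ∈ V, |v| ≤ w) {lo hi : ℤ} {M μ : ℝ} (hM : 0 < M) (hμ : 0 < μ)
    (hlen : ((hi - lo + 1 : ℤ) : ℝ) ≤ 2 * M) (hwM : 4 * w ≤ μ * M)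
    (h : 2 * (μ * M) ≤ ‖∑ m ∈ Icc lo hi, G m‖) :
    ∃ v' ∈ V, ∃ c d : ℤ, ((d - c + 1 : ℤ) : ℝ) ≤ 2 * M ∧ μ ^ 2 / 8 * #V ≤
      #{v ∈ V | μ ^ 2 / 4 * M < ‖∑ m ∈ Icc c d, G (m + (v - v')) * conj (G m)‖} := by
  have hV0 : (0 : ℝ) < #V := by exact_mod_cast card_pos.2 hV
  set Ω := Icc (lo + w) (hi - w) with hΩ
  have hΩlen : (((hi - w) - (lo + w) + 1 : ℤ) : ℝ) ≤ 2 * M := by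
    refine le_trans ?_ hlen
    exact_mod_cast (by omega : (hi - w) - (lo + w) + 1 ≤ hi - lo + 1)
  have hΩc : (#Ω : ℝ) ≤ 2 * M := card_Icc_int_le (by linarith) hΩlen
  have h1 := card_mul_norm_sum_le V (fun v => v) w hw lo hi G hG
  have h2 : #V * (μ * M) ≤ ∑ m ∈ Ω, ‖∑ v ∈ V, G (m + v)‖ := by
    have h3 : #V * (2 * (μ * M)) ≤ #V * ‖∑ m ∈ Icc lo hi, G m‖ := by gcongr
    have h4 : 4 * w * (#V : ℝ) ≤ μ * M * #V := by gcongr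
    linarith
  set f : ℤ × ℤ → ℝ := fun x => ‖∑ m ∈ Ω, G (m + x.1) * conj (G (m + x.2))‖ with hf
  have hsq : ((#V : ℝ) * (μ * M)) ^ 2 ≤ 2 * M * ∑ x ∈ V ×ˢ V, f x := by
    have h3 : ∑ m ∈ Ω, ‖∑ v ∈ V, G (m + v)‖ ^ 2 ≤ ∑ x ∈ V ×ˢ V, f x := by
      have h4 : ((∑ m ∈ Ω, ‖∑ v ∈ V, G (m + v)‖ ^ 2 : ℝ) : ℂ)
          = ∑ x ∈ V ×ˢ V, ∑ m ∈ Ω, G (m + x.1) * conj (G (m + x.2)) := by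
        rw [sum_comm, Complex.ofReal_sum]
        refine sum_congr rfl fun m _ => ?_
        rw [← Complex.normSq_eq_norm_sq, ← Complex.mul_conj, map_sum, sum_mul_sum, sum_product]
      have h5 := congrArg norm h4
      rw [Complex.norm_real, Real.norm_of_nonneg (sum_nonneg fun _ _ => sq_nonneg _)] at h5
      rw [h5]
      exact norm_sum_le _ _
    calc ((#V : ℝ) * (μ * M)) ^ 2 ≤ (∑ m ∈ Ω, ‖∑ v ∈ V, G (m + v)‖) ^ 2 := by gcongr
      _ ≤ #Ω * ∑ m ∈ Ω, ‖∑ v ∈ V, G (m + v)‖ ^ 2 := sq_sum_le_card_mul_sum_sq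
      _ ≤ 2 * M * ∑ x ∈ V ×ˢ V, f x := by gcongr
  have hsum : (#V : ℝ) ^ 2 * μ ^ 2 * M / 2 ≤ ∑ x ∈ V ×ˢ V, f x := by
    have : 2 * M * ((#V : ℝ) ^ 2 * μ ^ 2 * M / 2) ≤ 2 * M * ∑ x ∈ V ×ˢ V, f x := by
      refine le_trans (le_of_eq (by ring)) hsq
    exact le_of_mul_le_mul_left this (by positivity)
  have hfle : ∀ x, f x ≤ 2 * M := fun x => by
    refine le_trans ?_ hΩc
    refine (norm_sum_le_card_mul (B := 1) _ _ fun m _ => ?_).trans (by rw [mul_one])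
    rw [norm_mul, Complex.norm_conj]
    exact mul_le_one₀ (hG _) (norm_nonneg _) (hG _)
  -- a popular second shift
  obtain ⟨v', hv', hv'sum⟩ : ∃ v' ∈ V, (#V : ℝ) * μ ^ 2 * M / 2 ≤ ∑ v ∈ V, f (v, v') := by
    by_contra hcon
    push Not at hcon
    have h3 := sum_lt_sum_of_nonempty hV hcon
    rw [sum_const, nsmul_eq_mul, ← sum_product_right (f := fun x : ℤ × ℤ => f x)] at h3
    linarith
  refine ⟨v', hv', lo + w + v', hi - w + v', ?_, ?_⟩
  · refine le_trans (le_of_eq ?_) hΩlen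
    congr 1; ring
  have hshift : ∀ v, f (v, v') = ‖∑ m ∈ Icc (lo + w + v') (hi - w + v'), G (m + (v - v')) * conj (G m)‖ := by
    intro v
    simp only [hf]
    congr 1
    have h3 : Icc (lo + w + v') (hi - w + v') = Ω.map (addRightEmbedding v') := by
      rw [hΩ, map_add_right_Icc]
    rw [h3, sum_map]
    refine sum_congr rfl fun m _ => ?_
    simp only [addRightEmbedding_apply]
    congr 2; ring
  have h3 := le_card_filter_mul V (fun v => f (v, v')) (τ := μ ^ 2 / 4 * M) (by positivity)
    (fun v _ => hfle _) hv'sum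
  simp_rw [hshift] at h3
  have h4 : (2 * M) * (μ ^ 2 / 8 * #V) ≤ (2 * M) *
      #{v ∈ V | μ ^ 2 / 4 * M < ‖∑ m ∈ Icc (lo + w + v') (hi - w + v'), G (m + (v - v')) * conj (G m)‖} := by
    linarith
  exact le_of_mul_le_mul_left h4 (by positivity)

section TypeII

variable {N : ℕ} [NeZero N] {S : Finset (ZMod N)} {σ Λ : ℝ} {ψ : ZMod N → ℝ}
  {φ : ZMod N → UnitAddCircle}

/-- The integers `v` with `|v| ≤ B` for which both `v x` and `v y` lie in the Bohr set of
radius `r`. -/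
noncomputable def returnTimes (S : Finset (ZMod N)) (r : ℝ) (B : ℕ) (x y : ZMod N) : Finset ℤ :=
  {v ∈ Icc (-(B : ℤ)) B | bohrNorm S ((v : ZMod N) * x) < r ∧ bohrNorm S ((v : ZMod N) * y) < r}

lemma mem_returnTimes {r : ℝ} {B : ℕ} {x y : ZMod N} {v : ℤ} : v ∈ returnTimes S r B x y ↔
    |v| ≤ B ∧ bohrNorm S ((v : ZMod N) * x) < r ∧ bohrNorm S ((v : ZMod N) * y) < r := by
  rw [returnTimes, mem_filter, mem_Icc, abs_le]

lemma le_card_returnTimes {r : ℝ} (hr : 0 < r) (hr1 : r ≤ 1) (B : ℕ) (x y : ZMod N) :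
    (B : ℝ) ≤ (3 / r) ^ (2 * #S) * #(returnTimes S r B x y) := by
  rcases Nat.eq_zero_or_pos B with rfl | hB
  · rw [Nat.cast_zero]; positivity
  set f : ℤ →+ (S ⊕ S → UnitAddCircle) :=
    { toFun := fun v i => Sum.elim (fun ξ : S => charVal (ξ : ZMod N) ((v : ZMod N) * x))
        (fun ξ : S => charVal (ξ : ZMod N) ((v : ZMod N) * y)) i
      map_zero' := by
        funext i
        rcases i with i | i <;> simp
      map_add' := by
        intro u v
        funext i
        rcases i with i | i <;> simp [add_mul, charVal_add] } with hf
  obtain ⟨a₀, ha₀, hcard⟩ := exists_card_le_of_hom (Icc (1 : ℤ) B) ⟨1, by simp; omega⟩ f hr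
    (Icc ⌊-(1 / 2) / r⌋ ⌊(1 / 2) / r⌋) fun a _ i t _ _ ht => floor_mem_cells hr ht
  have h1 : #{a ∈ Icc (1 : ℤ) B | ∀ i, ‖f (a - a₀) i‖ < r} ≤ #(returnTimes S r B x y) := by
    refine card_le_card_of_injOn (fun a => a - a₀) (fun a ha => ?_) (fun _ _ _ _ h => by simpa using h)
    simp only [coe_filter, mem_Icc, Set.mem_ofPred_eq] at ha ha₀
    rw [mem_coe, mem_returnTimes]
    refine ⟨abs_le.2 ⟨?_, ?_⟩, ?_, ?_⟩
    · show -(B : ℤ) ≤ a - a₀; omega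
    · show a - a₀ ≤ B; omega
    · exact bohrNorm_lt_of_charHom hr fun i => ha.2 (Sum.inl i)
    · exact bohrNorm_lt_of_charHom hr fun i => ha.2 (Sum.inr i)
  have h2 := card_cells_le hr hr1
  have h3 : (#(Icc (1 : ℤ) B) : ℝ) = B := by simp
  have h4 : ((#(Icc (1 : ℤ) B) : ℕ) : ℝ) ≤ ((#(Icc ⌊-(1 / 2) / r⌋ ⌊(1 / 2) / r⌋) ^ Fintype.card (S ⊕ S)
      * #{a ∈ Icc (1 : ℤ) B | ∀ i, ‖f (a - a₀) i‖ < r} : ℕ) : ℝ) := by exact_mod_cast hcard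
  rw [h3] at h4
  refine h4.trans ?_
  have h5 : Fintype.card (S ⊕ S) = 2 * #S := by
    rw [Fintype.card_sum, Fintype.card_coe, two_mul]
  rw [h5]
  push_cast
  gcongr

/-- The cut-off quadratic phase `ψ(n) e(φ(n))`. -/
noncomputable def cutPhase (ψ : ZMod N → ℝ) (φ : ZMod N → UnitAddCircle) (n : ZMod N) : ℂ :=
  ψ n * e (φ n)

/-- The product `F(mx) conj F(my)` of two dilates of a cut-off phase `F`. -/
noncomputable def dilatePair (ψ : ZMod N → ℝ) (φ : ZMod N → UnitAddCircle) (x y : ZMod N) (m : ℤ) :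
    ℂ :=
  cutPhase ψ φ ((m : ZMod N) * x) * conj (cutPhase ψ φ ((m : ZMod N) * y))

lemma norm_cutPhase_le (hψ : IsSmoothCutoff S σ Λ ψ) (n : ZMod N) : ‖cutPhase ψ φ n‖ ≤ 1 :=
  hψ.norm_mul_e_le n _

lemma norm_dilatePair_le (hψ : IsSmoothCutoff S σ Λ ψ) (x y : ZMod N) (m : ℤ) :
    ‖dilatePair ψ φ x y m‖ ≤ 1 := by
  rw [dilatePair, norm_mul, Complex.norm_conj]
  exact mul_le_one₀ (norm_cutPhase_le hψ _) (norm_nonneg _) (norm_cutPhase_le hψ _)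

/-- The shift `h` keeps `hx` and `hy` in the Bohr set of radius `2r`, and the corresponding
correlation of `m ↦ F(mx) conj F(my)` is large on some interval. -/
def CorrelatedShift (ψ : ZMod N → ℝ) (φ : ZMod N → UnitAddCircle) (S : Finset (ZMod N))
    (r κ M : ℝ) (x y : ZMod N) (h : ℤ) : Prop :=
  bohrNorm S ((h : ZMod N) * x) < 2 * r ∧ bohrNorm S ((h : ZMod N) * y) < 2 * r ∧
    ∃ c d : ℤ, ((d - c + 1 : ℤ) : ℝ) ≤ 2 * M ∧
      κ * M < ‖∑ m ∈ Icc c d, dilatePair ψ φ x y (m + h) * conj (dilatePair ψ φ x y m)‖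

open Classical in
/-- A large sum over `m` has many correlated shifts, by van der Corput's inequality. -/
lemma le_card_correlatedShift (hψ : IsSmoothCutoff S σ Λ ψ) {δ r M : ℝ} (hδ : 0 < δ)
    (hr : 0 < r) (hr1 : r ≤ 1) (hrδ : 32 * r ≤ δ) (hM : 1 ≤ r * M) {lo hi : ℤ}
    (hlen : ((hi - lo + 1 : ℤ) : ℝ) ≤ 2 * M) {x y : ZMod N}
    (h : δ / 4 * M ≤ ‖∑ m ∈ Icc lo hi, dilatePair ψ φ x y m‖) :
    δ ^ 2 / 512 * ((r / 3) ^ (2 * #S) * (r * M / 2)) ≤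
      #{h ∈ Icc (-(2 * ⌊r * M⌋₊ : ℤ)) (2 * ⌊r * M⌋₊) |
        CorrelatedShift ψ φ S r (δ ^ 2 / 256) M x y h} := by
  set B := ⌊r * M⌋₊ with hB
  have hM0 : 0 < M := pos_of_mul_pos_right (by linarith) hr.le
  have hB1 : r * M / 2 ≤ B := half_le_floor hM
  have hB2 : (B : ℝ) ≤ r * M := Nat.floor_le (by positivity)
  have hVc := le_card_returnTimes (S := S) hr hr1 B x y
  set V := returnTimes S r B x y with hV
  have hVc' : (r / 3) ^ (2 * #S) * (r * M / 2) ≤ #V := by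
    have h1 : (r / 3) ^ (2 * #S) * (r * M / 2) ≤ (r / 3) ^ (2 * #S) * ((3 / r) ^ (2 * #S) * #V) := by
      have := hB1.trans hVc
      gcongr
    refine h1.trans (le_of_eq ?_)
    rw [← mul_assoc, ← mul_pow, div_mul_div_comm, mul_comm 3 r, div_self (by positivity), one_pow, one_mul]
  have hVne : V.Nonempty := by
    rw [← card_pos]
    have h1 : (0 : ℝ) < (r / 3) ^ (2 * #S) * (r * M / 2) := by positivity
    have h2 : (0 : ℝ) < #V := by linarith
    exact_mod_cast h2
  obtain ⟨v', hv', c, d, hcd, hcard⟩ := exists_card_correlations (norm_dilatePair_le (φ := φ) hψ x y) hVne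
    (w := B) (fun v hv => (mem_returnTimes.1 hv).1) hM0 (μ := δ / 8) (by positivity) hlen (by nlinarith)
    (by linarith)
  calc δ ^ 2 / 512 * ((r / 3) ^ (2 * #S) * (r * M / 2)) ≤ δ ^ 2 / 512 * #V := by gcongr
    _ = (δ / 8) ^ 2 / 8 * #V := by ring
    _ ≤ _ := hcard
    _ ≤ _ := by
      norm_cast
      refine card_le_card_of_injOn (fun v => v - v') (fun v hv => ?_) (fun _ _ _ _ h => by simpa using h)
      simp only [coe_filter, Set.mem_ofPred_eq, mem_Icc] at hv ⊢
      obtain ⟨e1, e2, e3⟩ := mem_returnTimes.1 hv.1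
      obtain ⟨e1', e2', e3'⟩ := mem_returnTimes.1 hv'
      rw [abs_le] at e1 e1'
      refine ⟨by omega, ?_, ?_, c, d, hcd, ?_⟩
      · push_cast; rw [sub_mul]
        linarith [bohrNorm_sub_le (S := S) ((v : ZMod N) * x) ((v' : ZMod N) * x)]
      · push_cast; rw [sub_mul]
        linarith [bohrNorm_sub_le (S := S) ((v : ZMod N) * y) ((v' : ZMod N) * y)]
      · have h2 := hv.2
        rw [show (δ / 8) ^ 2 / 4 = δ ^ 2 / 256 by ring] at h2
        exact h2

end TypeII

/-! ### Type II sums: passing to global characters -/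

section TypeII

variable {N : ℕ} [NeZero N] {S : Finset (ZMod N)} {σ Λ : ℝ} {ψ : ZMod N → ℝ}
  {φ : ZMod N → UnitAddCircle}

lemma abs_mul_four_sub_le {a b c d a' b' c' d' t : ℝ} (ha : 0 ≤ a ∧ a ≤ 1) (hb : 0 ≤ b ∧ b ≤ 1)
    (hc : 0 ≤ c ∧ c ≤ 1) (hb' : 0 ≤ b' ∧ b' ≤ 1)
    (hc' : 0 ≤ c' ∧ c' ≤ 1) (hd' : 0 ≤ d' ∧ d' ≤ 1) (h1 : |a - a'| ≤ t) (h2 : |b - b'| ≤ t)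
    (h3 : |c - c'| ≤ t) (h4 : |d - d'| ≤ t) : |a * b * c * d - a' * b' * c' * d'| ≤ 4 * t := by
  have key : ∀ x y z : ℝ, 0 ≤ x → x ≤ 1 → |z| ≤ t → |x * z| ≤ t := by
    intro x y z hx hx1 hz
    rw [abs_mul, abs_of_nonneg hx]
    exact (mul_le_of_le_one_left (abs_nonneg _) hx1).trans hz
  have e : a * b * c * d - a' * b' * c' * d' = (a * b * c) * (d - d') + (a * b * d') * (c - c')
      + (a * c' * d') * (b - b') + (b' * c' * d') * (a - a') := by ring
  rw [e]
  have m : ∀ x y z : ℝ, (0 ≤ x ∧ x ≤ 1) → (0 ≤ y ∧ y ≤ 1) → (0 ≤ z ∧ z ≤ 1) →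
      0 ≤ x * y * z ∧ x * y * z ≤ 1 := fun x y z hx hy hz =>
    ⟨mul_nonneg (mul_nonneg hx.1 hy.1) hz.1,
      mul_le_one₀ (mul_le_one₀ hx.2 hy.1 hy.2) hz.1 hz.2⟩
  have k1 := key _ 0 _ (m a b c ha hb hc).1 (m a b c ha hb hc).2 h4
  have k2 := key _ 0 _ (m a b d' ha hb hd').1 (m a b d' ha hb hd').2 h3
  have k3 := key _ 0 _ (m a c' d' ha hc' hd').1 (m a c' d' ha hc' hd').2 h2
  have k4 := key _ 0 _ (m b' c' d' hb' hc' hd').1 (m b' c' d' hb' hc' hd').2 h1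
  refine (abs_add_le _ _).trans ?_
  refine (add_le_add_left (abs_add_le _ _) _).trans ?_
  have := abs_add_le (a * b * c * (d - d')) (a * b * d' * (c - c'))
  linarith

omit [NeZero N] in
/-- The value of a correlation of dilates: a product of four values of the cutoff and a phase. -/
lemma dilatePair_mul_conj (x y : ZMod N) (m h : ℤ) :
    dilatePair ψ φ x y (m + h) * conj (dilatePair ψ φ x y m)
      = ((ψ (m * x + h * x) * ψ (m * y + h * y) * ψ (m * x) * ψ (m * y) : ℝ) : ℂ)
        * e ((φ (m * x + h * x) - φ (m * x)) - (φ (m * y + h * y) - φ (m * y))) := by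
  simp only [dilatePair, cutPhase, map_mul, Complex.conj_ofReal, e_sub, Complex.conj_conj]
  push_cast
  rw [add_mul, add_mul]
  ring

/-- Near a point where the cutoff is not small, the phase of a correlation of dilates is additive
in each of the two directions. -/
lemma exists_weighted_sum_of_large_correlation (hσ : 0 < σ) (hΛ : 0 ≤ Λ)
    (hφ : IsLocallyQuadraticOn (bohrSet S σ) φ) (hψ : IsSmoothCutoff S σ Λ ψ) {r κ M rc : ℝ}
    (hκ : 0 < κ) (hrc : 0 < rc) (hκΛ : 128 * Λ * rc ≤ κ) (hκr : 16 * rc ≤ κ)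
    (hrσ : 2 * r + 4 * rc ≤ σ) (hM : 0 < M) {x y : ZMod N} {h : ℤ}
    (hh : CorrelatedShift ψ φ S r κ M x y h) {V : Finset ℤ} {wt : ℤ → ℝ} (hwt : ∀ w ∈ V, 0 ≤ wt w)
    (hwt0 : 0 < ∑ w ∈ V, wt w) (hV : ∀ w ∈ V, |w| ≤ ⌊rc * M⌋₊)
    (hVb : ∀ w ∈ V, wt w ≠ 0 → bohrNorm S ((w : ZMod N) * x) < 2 * rc ∧
      bohrNorm S ((w : ZMod N) * y) < 2 * rc) :
    κ / 4 * ∑ w ∈ V, wt w ≤ ‖∑ w ∈ V, wt w * (e (secondDiff φ (w * x) (h * x)) *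
      conj (e (secondDiff φ (w * y) (h * y))))‖ := by
  obtain ⟨hx, hy, c, d, hcd, hK⟩ := hh
  set K : ℤ → ℂ := fun m => dilatePair ψ φ x y (m + h) * conj (dilatePair ψ φ x y m) with hKdef
  set W := ∑ w ∈ V, wt w with hW
  have hK1 : ∀ m, ‖K m‖ ≤ 1 := fun m => by
    simp only [hKdef]
    rw [norm_mul, Complex.norm_conj]
    exact mul_le_one₀ (norm_dilatePair_le hψ _ _ _) (norm_nonneg _) (norm_dilatePair_le hψ _ _ _)
  have h1 := sum_mul_norm_sum_le V (fun w => w) ⌊rc * M⌋₊ hV wt hwt c d K hK1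
  have hB2 : (⌊rc * M⌋₊ : ℝ) ≤ rc * M := Nat.floor_le (by positivity)
  -- localisation
  obtain ⟨m, hm⟩ : ∃ m, 3 / 8 * κ * W ≤ ‖∑ w ∈ V, wt w * K (m + w)‖ := by
    by_contra hcon
    push Not at hcon
    have h2 : ∑ m ∈ Icc (c + ⌊rc * M⌋₊) (d - ⌊rc * M⌋₊), ‖∑ w ∈ V, wt w * K (m + w)‖
        ≤ 2 * M * (3 / 8 * κ * W) := by
      refine (sum_le_sum fun m _ => (hcon m).le).trans ?_
      rw [sum_const, nsmul_eq_mul]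
      have h3 : (#(Icc (c + (⌊rc * M⌋₊ : ℤ)) (d - ⌊rc * M⌋₊)) : ℝ) ≤ 2 * M := by
        apply card_Icc_int_le (by linarith)
        refine le_trans ?_ hcd
        have : d - (⌊rc * M⌋₊ : ℤ) - (c + ⌊rc * M⌋₊) + 1 ≤ d - c + 1 := by omega
        exact_mod_cast this
      have : 0 ≤ 3 / 8 * κ * W := by positivity
      gcongr
    have h3 : 4 * (⌊rc * M⌋₊ : ℝ) * W ≤ κ / 4 * M * W := by
      have : 4 * (⌊rc * M⌋₊ : ℝ) ≤ κ / 4 * M := by nlinarith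
      gcongr
    have h4 : W * (κ * M) < W * ‖∑ m ∈ Icc c d, K m‖ := by gcongr
    have h5 : W * (κ * M) < 2 * M * (3 / 8 * κ * W) + κ / 4 * M * W := by linarith
    linarith
  set nx : ZMod N := (m : ZMod N) * x with hnx
  set ny : ZMod N := (m : ZMod N) * y with hny
  set a : ZMod N := (h : ZMod N) * x with ha
  set b : ZMod N := (h : ZMod N) * y with hb
  set Ψ := ψ (nx + a) * ψ (ny + b) * ψ nx * ψ ny with hΨ
  set c₀ := (φ (nx + a) - φ nx) - (φ (ny + b) - φ ny) with hc₀
  have hψ01 : ∀ n, 0 ≤ ψ n ∧ ψ n ≤ 1 := fun n => ⟨hψ.nonneg n, hψ.le_one n⟩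
  have hΨ0 : 0 ≤ Ψ := mul_nonneg (mul_nonneg (mul_nonneg (hψ.nonneg _) (hψ.nonneg _))
    (hψ.nonneg _)) (hψ.nonneg _)
  have hKw : ∀ w : ℤ, K (m + w) = ((ψ (nx + a + w * x) * ψ (ny + b + w * y) * ψ (nx + w * x) *
      ψ (ny + w * y) : ℝ) : ℂ) * e ((φ (nx + a + w * x) - φ (nx + w * x))
        - (φ (ny + b + w * y) - φ (ny + w * y))) := by
    intro w
    simp only [hKdef]
    rw [dilatePair_mul_conj]
    have e1 : ((m + w : ℤ) : ZMod N) * x = nx + w * x := by push_cast; ring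
    have e2 : ((m + w : ℤ) : ZMod N) * y = ny + w * y := by push_cast; ring
    rw [e1, e2, add_right_comm nx, add_right_comm ny]
  have hlip : ∀ n v, bohrNorm S v < 2 * rc → |ψ (n + v) - ψ n| ≤ κ / 64 := by
    intro n v hv
    refine (hψ.abs_sub_le hΛ _ _).trans ?_
    rw [add_sub_cancel_left]
    calc Λ * bohrNorm S v ≤ Λ * (2 * rc) := by gcongr
      _ ≤ κ / 64 := by linarith
  have hprod : ∀ w ∈ V, wt w ≠ 0 → |ψ (nx + a + w * x) * ψ (ny + b + w * y) * ψ (nx + w * x) *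
      ψ (ny + w * y) - Ψ| ≤ κ / 16 := by
    intro w hw hw0
    obtain ⟨e1, e2⟩ := hVb w hw hw0
    refine (abs_mul_four_sub_le (hψ01 _) (hψ01 _) (hψ01 _) (hψ01 _) (hψ01 _) (hψ01 _)
      (hlip _ _ e1) (hlip _ _ e2) (hlip _ _ e1) (hlip _ _ e2)).trans (le_of_eq (by ring))
  -- the cutoff is not small at the base point
  have hΨκ : κ / 16 < Ψ := by
    by_contra hcon
    rw [not_lt] at hcon
    have h2 : ‖∑ w ∈ V, wt w * K (m + w)‖ ≤ W * (κ / 8) := by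
      rw [hW, sum_mul]
      refine (norm_sum_le _ _).trans (sum_le_sum fun w hw => ?_)
      rw [norm_mul, Complex.norm_real, Real.norm_of_nonneg (hwt w hw)]
      by_cases hw0 : wt w = 0
      · simp [hw0]
      refine mul_le_mul_of_nonneg_left ?_ (hwt w hw)
      rw [hKw, norm_mul, norm_e, mul_one, Complex.norm_real, Real.norm_eq_abs]
      have h3 := abs_sub_abs_le_abs_sub (ψ (nx + a + w * x) * ψ (ny + b + w * y) * ψ (nx + w * x) *
        ψ (ny + w * y)) Ψ
      have h4 := hprod w hw hw0
      rw [abs_of_nonneg hΨ0] at h3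
      linarith
    have : 0 < κ * W := by positivity
    linarith
  have hfac : ∀ p q s t : ℝ, 0 ≤ p → p ≤ 1 → 0 ≤ q → q ≤ 1 → 0 ≤ s → s ≤ 1 → 0 ≤ t → t ≤ 1 →
      p * q * s * t ≤ p ∧ p * q * s * t ≤ q ∧ p * q * s * t ≤ s ∧ p * q * s * t ≤ t := by
    intro p q s t hp hp1 hq hq1 hs hs1 ht ht1
    have hpq := mul_nonneg hp hq
    have hpqs := mul_nonneg hpq hs
    have k1 : p * q * s * t ≤ p * q * s := mul_le_of_le_one_right hpqs ht1
    have k2 : p * q * s ≤ p * q := mul_le_of_le_one_right hpq hs1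
    refine ⟨k1.trans (k2.trans (mul_le_of_le_one_right hp hq1)),
      k1.trans (k2.trans (mul_le_of_le_one_left hq hp1)),
      k1.trans (mul_le_of_le_one_left hs (mul_le_one₀ hp1 hq hq1)),
      mul_le_of_le_one_left ht (mul_le_one₀ (mul_le_one₀ hp1 hq hq1) hs hs1)⟩
  obtain ⟨f1, f2, f3, f4⟩ := hfac (ψ (nx + a)) (ψ (ny + b)) (ψ nx) (ψ ny) (hψ.nonneg _) (hψ.le_one _)
    (hψ.nonneg _) (hψ.le_one _) (hψ.nonneg _) (hψ.le_one _) (hψ.nonneg _) (hψ.le_one _)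
  have hstay : ∀ n v, κ / 16 < ψ n → bohrNorm S v < 2 * rc → bohrNorm S (n + v) < σ := by
    intro n v hn hv
    refine hψ.bohrNorm_add_lt hσ hΛ ?_
    have : Λ * bohrNorm S v ≤ Λ * (2 * rc) := by gcongr
    linarith
  have hphase : ∀ n a v, κ / 16 < ψ (n + a) → κ / 16 < ψ n → bohrNorm S a < 2 * r →
      bohrNorm S v < 2 * rc → φ (n + a + v) - φ (n + v) = φ (n + a) - φ n + secondDiff φ v a := by
    intro n a v hna hn ha hv
    have k0 : bohrNorm S (0 : ZMod N) < 2 * rc := by rw [bohrNorm_zero]; linarith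
    have k1 := hstay n 0 hn k0
    have k2 := hstay (n + a) 0 hna k0
    rw [add_zero] at k1 k2
    have k3 := hφ.sub_eq_secondDiff hσ (n := n) (a := v) (b := a) (by linarith) k1 (hstay n v hn hv) k2
      (by rw [add_right_comm]; exact hstay _ v hna hv)
    rw [add_right_comm n a v, ← k3]; abel
  have hterm : ∀ w ∈ V, (wt w : ℂ) * K (m + w)
      = (Ψ : ℂ) * e c₀ * (wt w * (e (secondDiff φ (w * x) a) * conj (e (secondDiff φ (w * y) b))))
        + wt w * (((ψ (nx + a + w * x) * ψ (ny + b + w * y) * ψ (nx + w * x) *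
      ψ (ny + w * y) - Ψ : ℝ) : ℂ) * (e c₀ * (e (secondDiff φ (w * x) a) *
        conj (e (secondDiff φ (w * y) b))))) := by
    intro w hw
    by_cases hw0 : wt w = 0
    · simp [hw0]
    obtain ⟨e1, e2⟩ := hVb w hw hw0
    rw [hKw, hphase nx a _ (by linarith) (by linarith) hx e1,
      hphase ny b _ (by linarith) (by linarith) hy e2,
      show (φ (nx + a) - φ nx + secondDiff φ (w * x) a) - (φ (ny + b) - φ ny + secondDiff φ (w * y) b)
        = c₀ + (secondDiff φ (w * x) a - secondDiff φ (w * y) b) by rw [hc₀]; abel, e_add,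
      e_sub (secondDiff φ (w * x) a)]
    push_cast
    ring
  rw [sum_congr rfl hterm, sum_add_distrib, ← mul_sum] at hm
  have h6 : ‖∑ w ∈ V, (wt w : ℂ) * (((ψ (nx + a + w * x) * ψ (ny + b + w * y) * ψ (nx + w * x) *
      ψ (ny + w * y) - Ψ : ℝ) : ℂ) * (e c₀ * (e (secondDiff φ (w * x) a) *
        conj (e (secondDiff φ (w * y) b)))))‖ ≤ W * (κ / 16) := by
    rw [hW, sum_mul]
    refine (norm_sum_le _ _).trans (sum_le_sum fun w hw => ?_)
    rw [norm_mul, Complex.norm_real, Real.norm_of_nonneg (hwt w hw)]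
    by_cases hw0 : wt w = 0
    · simp [hw0]
    refine mul_le_mul_of_nonneg_left ?_ (hwt w hw)
    rw [norm_mul, norm_mul, norm_mul, Complex.norm_conj, norm_e, norm_e, norm_e, mul_one, mul_one,
      mul_one, Complex.norm_real, Real.norm_eq_abs]
    exact hprod w hw hw0
  have h7 := norm_add_le ((Ψ : ℂ) * e c₀ * ∑ w ∈ V, (wt w * (e (secondDiff φ (w * x) a) *
      conj (e (secondDiff φ (w * y) b))))) (∑ w ∈ V, (wt w : ℂ) * (((ψ (nx + a + w * x) *
      ψ (ny + b + w * y) * ψ (nx + w * x) *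
      ψ (ny + w * y) - Ψ : ℝ) : ℂ) * (e c₀ * (e (secondDiff φ (w * x) a) *
        conj (e (secondDiff φ (w * y) b))))))
  rw [norm_mul, norm_mul, norm_e, mul_one, Complex.norm_real, Real.norm_of_nonneg hΨ0] at h7
  have h8 : Ψ * ‖∑ w ∈ V, (wt w * (e (secondDiff φ (w * x) a) * conj (e (secondDiff φ (w * y) b))))‖
      ≤ ‖∑ w ∈ V, (wt w * (e (secondDiff φ (w * x) a) * conj (e (secondDiff φ (w * y) b))))‖ :=
    mul_le_of_le_one_left (norm_nonneg _) (f1.trans (hψ.le_one _))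
  have : 0 < κ * W := by positivity
  linarith

open Classical in
/-- A large correlation of dilates gives frequencies `γ` and `γ'`, approximating the derivatives of
the phase in the directions `hx` and `hy`, for which `γ x` and `γ' y` nearly agree: the additive
phases are expanded into global characters. -/
theorem exists_charApprox_of_correlatedShift (h1S : (1 : ZMod N) ∈ S) (hσ : 0 < σ) (hΛ : 0 ≤ Λ)
    (hφ : IsLocallyQuadraticOn (bohrSet S σ) φ) (hψ : IsSmoothCutoff S σ Λ ψ) {r κ M rc r₁ ω : ℝ}
    (hκ : 0 < κ) (hrc : 0 < rc) (hκΛ : 128 * Λ * rc ≤ κ) (hκr : 16 * rc ≤ κ)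
    (hrσ : 2 * r + 4 * rc ≤ σ) (hM : 1 ≤ rc * M) {x y : ZMod N} {h : ℤ}
    (hh : CorrelatedShift ψ φ S r κ M x y h) (hr₁ : 0 < r₁) (hr₁c : r₁ ≤ rc)
    (hr₁ω : 2500 * 16 ^ #S * (r₁ / rc) ^ 2 * (3 * rc) ≤ κ / 32 * ω) (hω : 0 < ω)
    (hωM : ω * M ≤ ∑ w ∈ Icc (-(⌊rc * M⌋₊ : ℤ)) ⌊rc * M⌋₊, bump S rc (w * x) * bump S rc (w * y)) :
    ∃ γ ∈ charApprox S (r₁ / 4) (fun u => secondDiff φ u (h * x)),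
    ∃ γ' ∈ charApprox S (r₁ / 4) (fun u => secondDiff φ u (h * y)),
      ‖charVal γ x - charVal γ' y‖ ≤ 8 / (κ * ω * M) := by
  have hM0 : 0 < M := pos_of_mul_pos_right (by linarith) hrc.le
  set V := Icc (-(⌊rc * M⌋₊ : ℤ)) ⌊rc * M⌋₊ with hV
  set W := ∑ w ∈ V, bump S rc (w * x) * bump S rc (w * y) with hW
  have hW0 : 0 < W := lt_of_lt_of_le (by positivity) hωM
  have hVcard : (#V : ℝ) ≤ 3 * rc * M := by
    have h1 : (⌊rc * M⌋₊ : ℝ) ≤ rc * M := Nat.floor_le (by positivity)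
    apply card_Icc_int_le (by positivity)
    push_cast
    linarith
  have hmain := exists_weighted_sum_of_large_correlation hσ hΛ hφ hψ hκ hrc hκΛ hκr hrσ hM0 hh
    (V := V) (wt := fun w => bump S rc (w * x) * bump S rc (w * y))
    (fun w _ => mul_nonneg (bump_nonneg _ _) (bump_nonneg _ _)) hW0
    (fun w hw => by rw [hV, mem_Icc] at hw; exact abs_le.2 hw)
    (fun w _ hw => ⟨bohrNorm_lt_of_bump_ne_zero hrc (left_ne_zero_of_mul hw),
      bohrNorm_lt_of_bump_ne_zero hrc (right_ne_zero_of_mul hw)⟩)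
  set χ : ZMod N → UnitAddCircle := fun u => secondDiff φ u (h * x) with hχ
  set χ' : ZMod N → UnitAddCircle := fun u => secondDiff φ u (h * y) with hχ'
  have hχa : LocAdd S (4 * rc) χ := hφ.locAdd (by positivity) (by linarith [hh.1])
  have hχa' : LocAdd S (4 * rc) χ' := hφ.locAdd (by positivity) (by linarith [hh.2.1])
  have hm := sum_coeff_not_charApprox_le h1S hr₁ hr₁c hχa
  have hm' := sum_coeff_not_charApprox_le h1S hr₁ hr₁c hχa'
  set A := charApprox S (r₁ / 4) χ with hA
  set A' := charApprox S (r₁ / 4) χ' with hA'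
  set m₀ := 2500 * 16 ^ #S * (r₁ / rc) ^ 2 with hm₀
  set D : ZMod N → ZMod N → ℝ := fun γ γ' => ‖∑ w ∈ V, e (w • (charVal γ x - charVal γ' y))‖ with hD
  have hexp : ∑ w ∈ V, ((bump S rc (w * x) * bump S rc (w * y) : ℝ) : ℂ) *
      (e (χ (w * x)) * conj (e (χ' (w * y))))
      = ∑ γ, ∑ γ', ((coeff S rc χ γ * coeff S rc χ' γ' : ℝ) : ℂ) *
        ∑ w ∈ V, e (w • (charVal γ x - charVal γ' y)) := by
    have h1 : ∀ w : ℤ, ((bump S rc (w * x) * bump S rc (w * y) : ℝ) : ℂ) *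
      (e (χ (w * x)) * conj (e (χ' (w * y))))
      = ∑ γ, ∑ γ', ((coeff S rc χ γ * coeff S rc χ' γ' : ℝ) : ℂ) *
        e (w • (charVal γ x - charVal γ' y)) := by
      intro w
      have h2 := sum_coeff_mul_e hrc hχa (w * x)
      have h3 := congrArg conj (sum_coeff_mul_e hrc hχa' (w * y))
      rw [map_mul, Complex.conj_ofReal] at h3
      calc _ = (bump S rc (w * x) * e (χ (w * x))) * (bump S rc (w * y) * conj (e (χ' (w * y)))) := by
            push_cast; ring
        _ = _ := by
            rw [← h2, ← h3, map_sum, sum_mul_sum]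
            refine sum_congr rfl fun γ _ => sum_congr rfl fun γ' _ => ?_
            rw [map_mul, Complex.conj_ofReal, zsmul_sub, e_sub, ← charVal_zsmul, ← charVal_zsmul,
              zsmul_eq_mul, zsmul_eq_mul]
            push_cast; ring
    simp_rw [h1]
    rw [sum_comm]
    refine sum_congr rfl fun γ _ => ?_
    rw [sum_comm]
    refine sum_congr rfl fun γ' _ => ?_
    rw [mul_sum]
  have hDle : ∀ γ γ', D γ γ' ≤ 3 * rc * M := fun γ γ' => by
    refine le_trans ?_ hVcard
    have := norm_sum_le_card_mul V (fun w => e (w • (charVal γ x - charVal γ' y))) (B := 1)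
      fun w _ => (norm_e _).le
    rwa [mul_one] at this
  obtain ⟨γ, hγ, γ', hγ', hDγ⟩ : ∃ γ ∈ A, ∃ γ' ∈ A', κ / 16 * W ≤ D γ γ' := by
    by_contra hcon
    push Not at hcon
    have hc0 : ∀ γ, 0 ≤ coeff S rc χ γ := coeff_nonneg χ
    have hc0' : ∀ γ, 0 ≤ coeff S rc χ' γ := coeff_nonneg χ'
    have hs := sum_coeff hrc hχa
    have hs' := sum_coeff hrc hχa'
    have hbound : ∀ γ γ', D γ γ' ≤ κ / 16 * W + ((if γ ∉ A then 3 * rc * M else 0)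
        + (if γ' ∉ A' then 3 * rc * M else 0)) := by
      intro γ γ'
      have e0 : 0 ≤ κ / 16 * W := by positivity
      have e1 : 0 ≤ 3 * rc * M := by positivity
      have e2 := hDle γ γ'
      by_cases k1 : γ ∈ A
      · by_cases k2 : γ' ∈ A'
        · have := hcon γ k1 γ' k2
          simp only [k1, k2, not_true_eq_false, if_false]; linarith
        · simp only [k1, k2, not_true_eq_false, not_false_eq_true, if_true, if_false]; linarith
      · rw [if_pos k1]
        split_ifs <;> linarith
    have h1 : ‖∑ γ, ∑ γ', ((coeff S rc χ γ * coeff S rc χ' γ' : ℝ) : ℂ) *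
        ∑ w ∈ V, e (w • (charVal γ x - charVal γ' y))‖
        ≤ ∑ γ, ∑ γ', coeff S rc χ γ * coeff S rc χ' γ' * (κ / 16 * W +
          ((if γ ∉ A then 3 * rc * M else 0) + (if γ' ∉ A' then 3 * rc * M else 0))) := by
      refine (norm_sum_le _ _).trans (sum_le_sum fun γ _ => ?_)
      refine (norm_sum_le _ _).trans (sum_le_sum fun γ' _ => ?_)
      rw [norm_mul, Complex.norm_real, Real.norm_of_nonneg (mul_nonneg (hc0 _) (hc0' _))]
      exact mul_le_mul_of_nonneg_left (hbound γ γ') (mul_nonneg (hc0 _) (hc0' _))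
    have h2 : ∑ γ, ∑ γ', coeff S rc χ γ * coeff S rc χ' γ' * (κ / 16 * W +
          ((if γ ∉ A then 3 * rc * M else 0) + (if γ' ∉ A' then 3 * rc * M else 0)))
        = κ / 16 * W + (3 * rc * M * (∑ γ with γ ∉ A, coeff S rc χ γ)
          + 3 * rc * M * ∑ γ with γ ∉ A', coeff S rc χ' γ) := by
      have e1 : ∀ γ γ', coeff S rc χ γ * coeff S rc χ' γ' * (κ / 16 * W +
          ((if γ ∉ A then 3 * rc * M else 0) + (if γ' ∉ A' then 3 * rc * M else 0)))
          = coeff S rc χ γ * (κ / 16 * W) * coeff S rc χ' γ'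
            + ((if γ ∉ A then coeff S rc χ γ else 0) * (3 * rc * M) * coeff S rc χ' γ'
            + coeff S rc χ γ * ((3 * rc * M) * (if γ' ∉ A' then coeff S rc χ' γ' else 0))) := by
        intro γ γ'
        split_ifs <;> ring
      simp_rw [e1, sum_add_distrib, ← mul_sum, hs', mul_one, ← sum_mul, hs, one_mul, sum_filter]
      ring
    have h3 : κ / 4 * W ≤ κ / 16 * W + (3 * rc * M * m₀ + 3 * rc * M * m₀) := by
      have h4 : (0 : ℝ) ≤ 3 * rc * M := by positivity
      have h5 := hmain.trans (le_of_eq (congrArg norm hexp))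
      refine h5.trans (h1.trans (h2.le.trans ?_))
      gcongr
    have h4 : 3 * rc * M * m₀ ≤ κ / 32 * W := by
      calc 3 * rc * M * m₀ = (m₀ * (3 * rc)) * M := by ring
        _ ≤ κ / 32 * ω * M := by gcongr
        _ = κ / 32 * (ω * M) := by ring
        _ ≤ κ / 32 * W := by gcongr
    have : 0 < κ * W := by positivity
    linarith
  refine ⟨γ, hγ, γ', hγ', ?_⟩
  have h1 := norm_sum_Icc_e (charVal γ x - charVal γ' y) (-(⌊rc * M⌋₊ : ℤ)) ⌊rc * M⌋₊
  have h2 : κ / 16 * (ω * M) ≤ D γ γ' := le_trans (by gcongr) hDγ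
  rw [le_div_iff₀ (by positivity)]
  have h3 : 2 * ‖charVal γ x - charVal γ' y‖ * (κ / 16 * (ω * M)) ≤ 1 :=
    (mul_le_mul_of_nonneg_left h2 (by positivity)).trans h1
  linarith

/-- A lower bound for the total weight of the product of two bumps along the multiples of two
points. -/
lemma le_sum_bump_mul_bump {rc rb M : ℝ} (hrc : 0 < rc) (hrb : 0 < rb) (hrb1 : rb ≤ 1)
    (hrbc : 4 ^ (#S + 1) * (rb / rc) ^ 2 ≤ 1 / 4) (hbc : rb ≤ rc) (hM : 1 ≤ rb * M) (x y : ZMod N) :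
    (rb / 3) ^ (2 * #S) * rb / 4 * M
      ≤ ∑ w ∈ Icc (-(⌊rc * M⌋₊ : ℤ)) ⌊rc * M⌋₊, bump S rc (w * x) * bump S rc (w * y) := by
  have hM0 : 0 < M := pos_of_mul_pos_right (by linarith) hrb.le
  have hVc := le_card_returnTimes (S := S) hrb hrb1 ⌊rb * M⌋₊ x y
  set V := returnTimes S rb ⌊rb * M⌋₊ x y with hV
  have hB1 : rb * M / 2 ≤ ⌊rb * M⌋₊ := half_le_floor hM
  have hVc' : (rb / 3) ^ (2 * #S) * (rb * M / 2) ≤ #V := by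
    have h1 : (rb / 3) ^ (2 * #S) * (rb * M / 2) ≤ (rb / 3) ^ (2 * #S) * ((3 / rb) ^ (2 * #S) * #V) := by
      have := hB1.trans hVc
      gcongr
    refine h1.trans (le_of_eq ?_)
    rw [← mul_assoc, ← mul_pow, div_mul_div_comm, mul_comm 3 rb, div_self (by positivity), one_pow, one_mul]
  have hbump : ∀ z : ZMod N, bohrNorm S z < rb → 3 / 4 ≤ bump S rc z := by
    intro z hz
    have h1 := one_sub_bump_le (S := S) hrc z
    have h2 : 4 ^ (#S + 1) * (bohrNorm S z / rc) ^ 2 ≤ 4 ^ (#S + 1) * (rb / rc) ^ 2 := by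
      have := bohrNorm_nonneg (S := S) z
      gcongr
    linarith
  have hsub : V ⊆ Icc (-(⌊rc * M⌋₊ : ℤ)) ⌊rc * M⌋₊ := by
    intro v hv
    have h1 := (mem_returnTimes.1 hv).1
    have h2 : ⌊rb * M⌋₊ ≤ ⌊rc * M⌋₊ := Nat.floor_le_floor (by gcongr)
    rw [abs_le] at h1
    rw [mem_Icc]; omega
  calc (rb / 3) ^ (2 * #S) * rb / 4 * M = (rb / 3) ^ (2 * #S) * (rb * M / 2) * (1 / 2) := by ring
    _ ≤ #V * (1 / 2) := by gcongr
    _ = ∑ _w ∈ V, (1 / 2 : ℝ) := by rw [sum_const, nsmul_eq_mul]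
    _ ≤ ∑ w ∈ V, bump S rc (w * x) * bump S rc (w * y) := by
        refine sum_le_sum fun w hw => ?_
        obtain ⟨-, h1, h2⟩ := mem_returnTimes.1 hw
        nlinarith [hbump _ h1, hbump _ h2]
    _ ≤ _ := sum_le_sum_of_subset_of_nonneg hsub fun _ _ _ =>
        mul_nonneg (bump_nonneg _ _) (bump_nonneg _ _)

lemma charApprox_mono {τ τ' : ℝ} (hτ : 0 < τ) (h : τ ≤ τ') (χ : ZMod N → UnitAddCircle) :
    charApprox S τ' χ ⊆ charApprox S τ χ := by
  intro γ hγ a ha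
  refine (hγ a (ha.trans_le h)).trans ?_
  have := bohrNorm_nonneg (S := S) a
  gcongr

open Classical in
lemma card_charApprox_le_pow {Y : ℝ} (hY : 2 ^ 12 ≤ Y) (hS : 1 ≤ #S) (χ : ZMod N → UnitAddCircle) :
    (#{γ | γ ∈ charApprox S (1 / Y) χ} : ℝ) ≤ Y ^ (3 * #S) := by
  have hY0 : 0 < Y := by linarith
  have hτ : 0 < 1 / Y / 16 := by positivity
  have h1 := card_charApprox_le (S := S) (τ := 1 / Y) (by positivity) χ
  have h2 := card_le_bohrFin (S := S) hτ (by
    rw [div_div, div_le_one (by positivity)]; linarith)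
  have hB := card_bohrFin_pos (S := S) hτ
  have h3 : (#{γ | γ ∈ charApprox S (1 / Y) χ} : ℝ) * #(bohrFin S (1 / Y / 16))
      ≤ 64 * (3 / (1 / Y / 16)) ^ #S * #(bohrFin S (1 / Y / 16)) := by
    rw [mul_assoc]; exact h1.trans (by gcongr)
  refine (le_of_mul_le_mul_right h3 hB).trans ?_
  have h4 : 3 / (1 / Y / 16) = 48 * Y := by field_simp; norm_num
  rw [h4, mul_comm 3, pow_mul', pow_succ]
  have h5 : (48 * Y) ^ #S ≤ (Y ^ #S) ^ 2 := by
    calc (48 * Y) ^ #S ≤ (Y ^ 2) ^ #S := by gcongr; nlinarith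
      _ = (Y ^ #S) ^ 2 := by rw [← pow_mul, ← pow_mul, mul_comm]
  have h6 : 64 ≤ Y ^ #S := by
    calc (64 : ℝ) ≤ Y := by linarith
      _ = Y ^ 1 := (pow_one Y).symm
      _ ≤ Y ^ #S := pow_le_pow_right₀ (by linarith) hS
  calc 64 * (48 * Y) ^ #S ≤ Y ^ #S * (Y ^ #S) ^ 2 := by gcongr
    _ = _ := by ring

lemma one_div_pow_le {X : ℝ} (hX : 1 ≤ X) {i j : ℕ} (h : i ≤ j) : 1 / X ^ j ≤ 1 / X ^ i :=
  one_div_le_one_div_of_le (by positivity) (pow_le_pow_right₀ hX h)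

open Classical in
lemma exists_charApprox_of_correlatedShift_pow (h1S : (1 : ZMod N) ∈ S) (hσ : 0 < σ) (hΛ : 0 ≤ Λ)
    (hφ : IsLocallyQuadraticOn (bohrSet S σ) φ) (hψ : IsSmoothCutoff S σ Λ ψ) {δ X M : ℝ}
    (hδ : 0 < δ) (hX : 2 ^ 24 ≤ X) (hXδ : 1 / δ ≤ X) (hXσ : 1 / σ ≤ X) (hXΛ : Λ ≤ X)
    (hM : X ^ (6 * #S) ≤ M) {x y : ZMod N} {h : ℤ}
    (hh : CorrelatedShift ψ φ S (1 / X ^ 2) (δ ^ 2 / 256) M x y h) :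
    ∃ γ ∈ charApprox S (1 / X ^ (31 * #S ^ 2)) (fun u => secondDiff φ u (h * x)),
    ∃ γ' ∈ charApprox S (1 / X ^ (31 * #S ^ 2)) (fun u => secondDiff φ u (h * y)),
      ‖charVal γ x - charVal γ' y‖ ≤ X ^ (31 * #S ^ 2) / M := by
  have hs : 1 ≤ #S := card_pos.2 ⟨1, h1S⟩
  set s := #S with hsdef
  have hs2 : s ≤ s ^ 2 := Nat.le_self_pow (by norm_num) s
  have hX1 : 1 ≤ X := le_trans (by norm_num) hX
  have hX0 : 0 < X := by linarith
  have hpow : ∀ i j : ℕ, i ≤ j → X ^ i ≤ X ^ j := fun i j hij => pow_le_pow_right₀ hX1 hij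
  have hM0 : 0 < M := lt_of_lt_of_le (by positivity) hM
  have hδX : 1 / X ≤ δ := by rw [div_le_iff₀ hδ] at hXδ; rw [div_le_iff₀ hX0]; linarith
  have hσX : 1 / X ≤ σ := by rw [div_le_iff₀ hσ] at hXσ; rw [div_le_iff₀ hX0]; linarith
  have hκ : 1 / X ^ 3 ≤ δ ^ 2 / 256 := by
    calc 1 / X ^ 3 = (1 / X) ^ 2 / X := by field_simp
      _ ≤ δ ^ 2 / 256 := by gcongr; linarith
  have hω : 1 / X ^ (21 * s ^ 2) ≤ (1 / X ^ (6 * s) / 3) ^ (2 * s) * (1 / X ^ (6 * s)) / 4 := by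
    have e1 : 1 / X ^ (7 * s) ≤ 1 / X ^ (6 * s) / 4 := by
      rw [div_div, show 7 * s = 6 * s + s by ring, pow_add]
      apply one_div_le_one_div_of_le (by positivity)
      gcongr
      calc (4 : ℝ) ≤ X ^ 1 := by linarith
        _ ≤ X ^ s := hpow _ _ hs
    have e2 : 1 / X ^ (7 * s) ≤ 1 / X ^ (6 * s) / 3 := e1.trans (by gcongr; norm_num)
    calc 1 / X ^ (21 * s ^ 2) ≤ 1 / X ^ (14 * s ^ 2 + 7 * s) :=
          one_div_pow_le hX1 (by nlinarith)
      _ = (1 / X ^ (7 * s)) ^ (2 * s) * (1 / X ^ (7 * s)) := by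
          rw [one_div_pow, ← pow_mul, one_div_mul_one_div, ← pow_add]
          congr 2; ring
      _ ≤ (1 / X ^ (6 * s) / 3) ^ (2 * s) * (1 / X ^ (6 * s) / 4) := by gcongr
      _ = _ := by ring
  set ω := (1 / X ^ (6 * s) / 3) ^ (2 * s) * (1 / X ^ (6 * s)) / 4 with hωdef
  have hω0 : 0 < ω := by positivity
  have hbump := le_sum_bump_mul_bump (S := S) (rc := 1 / X ^ 5) (rb := 1 / X ^ (6 * s)) (M := M)
    (by positivity) (by positivity) (by rw [div_le_one (by positivity)]; exact one_le_pow₀ hX1) (by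
      rw [← hsdef]
      have e1 : (1 / X ^ (6 * s) / (1 / X ^ 5)) ^ 2 ≤ 1 / X ^ s * (1 / X ^ s) := by
        rw [show 1 / X ^ (6 * s) / (1 / X ^ 5) = X ^ 5 / X ^ (6 * s) by field_simp, sq]
        have : X ^ 5 / X ^ (6 * s) ≤ 1 / X ^ s := by
          rw [div_le_div_iff₀ (by positivity) (by positivity), ← pow_add, one_mul]
          exact hpow _ _ (by omega)
        gcongr
      have e2 : (4 : ℝ) ^ (s + 1) * 4 ≤ X ^ s := by
        calc (4 : ℝ) ^ (s + 1) * 4 = 4 ^ (s + 2) := by ring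
          _ ≤ 4 ^ (3 * s) := pow_le_pow_right₀ (by norm_num) (by omega)
          _ = 64 ^ s := by rw [pow_mul]; norm_num
          _ ≤ X ^ s := by gcongr; linarith
      have e3 : 1 / X ^ s ≤ 1 := by rw [div_le_one (by positivity)]; exact one_le_pow₀ hX1
      calc (4 : ℝ) ^ (s + 1) * (1 / X ^ (6 * s) / (1 / X ^ 5)) ^ 2
          ≤ 4 ^ (s + 1) * (1 / X ^ s * (1 / X ^ s)) := by gcongr
        _ ≤ 4 ^ (s + 1) * (1 / X ^ s * 1) := by gcongr
        _ ≤ 1 / 4 := by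
            rw [mul_one, mul_one_div, div_le_div_iff₀ (by positivity) (by norm_num)]
            linarith) (one_div_pow_le hX1 (by omega))
      (by rw [one_div_mul_eq_div, le_div_iff₀ (by positivity)]; linarith) x y
  rw [← hsdef, ← hωdef] at hbump
  obtain ⟨γ, hγ, γ', hγ', hγγ⟩ := exists_charApprox_of_correlatedShift h1S hσ hΛ hφ hψ
    (κ := δ ^ 2 / 256) (rc := 1 / X ^ 5) (r₁ := 1 / X ^ (30 * s ^ 2)) (ω := ω) (by positivity)
    (by positivity) (by
      refine le_trans ?_ hκ
      calc 128 * Λ * (1 / X ^ 5) ≤ X * X * (1 / X ^ 5) := by gcongr; linarith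
        _ = 1 / X ^ 3 := by field_simp) (by
      refine le_trans ?_ hκ
      calc 16 * (1 / X ^ 5) ≤ X ^ 2 * (1 / X ^ 5) := by gcongr; nlinarith
        _ = 1 / X ^ 3 := by field_simp) (by
      refine le_trans ?_ hσX
      have e1 : 1 / X ^ 5 ≤ 1 / X ^ 2 := one_div_pow_le hX1 (by norm_num)
      calc 2 * (1 / X ^ 2) + 4 * (1 / X ^ 5) ≤ 6 * (1 / X ^ 2) := by linarith
        _ ≤ X * (1 / X ^ 2) := by gcongr; linarith
        _ = 1 / X := by field_simp) (by
      rw [one_div_mul_eq_div, le_div_iff₀ (by positivity), one_mul]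
      exact (hpow 5 (6 * s) (by omega)).trans hM) hh (by positivity)
    (one_div_pow_le hX1 (by nlinarith)) (by
      rw [← hsdef]
      have e1 : (1 / X ^ (30 * s ^ 2) / (1 / X ^ 5)) ^ 2 ≤ 1 / X ^ (50 * s ^ 2) := by
        rw [show 1 / X ^ (30 * s ^ 2) / (1 / X ^ 5) = X ^ 5 / X ^ (30 * s ^ 2) by field_simp, div_pow,
          ← pow_mul, ← pow_mul, div_le_div_iff₀ (by positivity) (by positivity), ← pow_add, one_mul]
        exact hpow _ _ (by nlinarith)
      have e2 : (16 : ℝ) ^ s ≤ X ^ s := by gcongr; linarith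
      have e3 : 3 * (1 / X ^ 5) ≤ 1 := by
        rw [mul_one_div, div_le_one (by positivity)]
        calc (3 : ℝ) ≤ X ^ 1 := by linarith
          _ ≤ X ^ 5 := hpow _ _ (by norm_num)
      calc 2500 * 16 ^ s * (1 / X ^ (30 * s ^ 2) / (1 / X ^ 5)) ^ 2 * (3 * (1 / X ^ 5))
          ≤ X * X ^ s * (1 / X ^ (50 * s ^ 2)) * 1 := by gcongr; linarith
        _ ≤ 1 / X ^ (25 * s ^ 2) := by
            rw [mul_one, mul_one_div, div_le_div_iff₀ (by positivity) (by positivity), one_mul,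
              ← pow_succ', ← pow_add]
            exact hpow _ _ (by nlinarith)
        _ ≤ 1 / X ^ (4 + 21 * s ^ 2) := one_div_pow_le hX1 (by nlinarith)
        _ = 1 / X ^ 3 / X * (1 / X ^ (21 * s ^ 2)) := by rw [pow_add]; field_simp
        _ ≤ δ ^ 2 / 256 / 32 * ω := by gcongr; linarith) hω0 hbump
  have hτ : 1 / X ^ (31 * s ^ 2) ≤ 1 / X ^ (30 * s ^ 2) / 4 := by
    rw [div_div, show 31 * s ^ 2 = 30 * s ^ 2 + s ^ 2 by ring, pow_add]
    apply one_div_le_one_div_of_le (by positivity)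
    gcongr
    calc (4 : ℝ) ≤ X ^ 1 := by linarith
      _ ≤ X ^ (s ^ 2) := hpow _ _ (by nlinarith)
  refine ⟨γ, charApprox_mono (by positivity) hτ _ hγ, γ', charApprox_mono (by positivity) hτ _ hγ',
    hγγ.trans ?_⟩
  have hX8 : 8 ≤ X := by linarith
  have e4 : 1 / X ^ (3 + 21 * s ^ 2) ≤ δ ^ 2 / 256 * ω := by
    calc 1 / X ^ (3 + 21 * s ^ 2) = 1 / X ^ 3 * (1 / X ^ (21 * s ^ 2)) := by
          rw [pow_add]; field_simp
      _ ≤ _ := by gcongr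
  rw [div_le_div_iff₀ (by positivity) hM0]
  have e5 : 8 ≤ X ^ (31 * s ^ 2) * (δ ^ 2 / 256 * ω) := by
    calc 8 ≤ X ^ 1 := by linarith
      _ ≤ X ^ (31 * s ^ 2) * (1 / X ^ (3 + 21 * s ^ 2)) := by
          rw [mul_one_div, le_div_iff₀ (by positivity), ← pow_add]
          exact hpow _ _ (by nlinarith)
      _ ≤ _ := by gcongr
  calc 8 * M ≤ X ^ (31 * s ^ 2) * (δ ^ 2 / 256 * ω) * M := by gcongr
    _ = _ := by ring

/-- The integers in `[L, 2L]`. -/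
noncomputable def dyadic (L : ℝ) : Finset ℕ := Icc ⌈L⌉₊ ⌊2 * L⌋₊

lemma mem_dyadic {L : ℝ} (hL : 0 ≤ L) {l : ℕ} : l ∈ dyadic L ↔ L ≤ l ∧ (l : ℝ) ≤ 2 * L := by
  rw [dyadic, mem_Icc, Nat.ceil_le, Nat.le_floor_iff (by linarith)]

lemma card_dyadic_le {L : ℝ} (hL : 1 ≤ L) : (#(dyadic L) : ℝ) ≤ 2 * L := by
  rw [dyadic, Nat.card_Icc]
  have h1 : ⌊2 * L⌋₊ + 1 - ⌈L⌉₊ ≤ ⌊2 * L⌋₊ := by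
    have : 1 ≤ ⌈L⌉₊ := Nat.one_le_ceil_iff.2 (by linarith)
    omega
  calc ((⌊2 * L⌋₊ + 1 - ⌈L⌉₊ : ℕ) : ℝ) ≤ (⌊2 * L⌋₊ : ℝ) := by exact_mod_cast h1
    _ ≤ 2 * L := Nat.floor_le (by linarith)

lemma dyadic_int_len {M : ℝ} (hM : 1 ≤ M) :
    (((⌊2 * M⌋₊ : ℤ) - (⌈M⌉₊ : ℤ) + 1 : ℤ) : ℝ) ≤ 2 * M := by
  push_cast
  have h1 := Nat.floor_le (a := 2 * M) (by linarith)
  have h2 := Nat.le_ceil M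
  linarith

lemma sum_dyadic_eq (f : ℤ → ℂ) (M : ℝ) :
    ∑ m ∈ dyadic M, f m = ∑ m ∈ Icc (⌈M⌉₊ : ℤ) ⌊2 * M⌋₊, f m := by
  rw [dyadic]
  refine sum_bij (fun i _ => (i : ℤ)) (fun i hi => ?_) (fun i _ j _ h => by exact_mod_cast h)
    (fun j hj => ?_) (fun i _ => rfl)
  · simp only [mem_Icc] at hi ⊢; omega
  · simp only [mem_Icc] at hj
    exact ⟨j.toNat, by simp only [mem_Icc]; omega, by omega⟩

open Classical in
/-- A large type II sum has many correlated shifts, for a fixed second dilation. -/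
lemma exists_correlatedShift_set (h1S : (1 : ZMod N) ∈ S) (hψ : IsSmoothCutoff S σ Λ ψ) {δ X L M : ℝ}
    (hδ : 0 < δ) (hδ1 : δ ≤ 1) (hX : 2 ^ 24 ≤ X) (hXδ : 1 / δ ≤ X)
    (hL : 1 ≤ L) (hM : X ^ (6 * #S) ≤ M)
    (hsum : δ * L ^ 2 * M ^ 2 ≤ ∑ l ∈ dyadic L, ∑ l' ∈ dyadic L,
      ‖∑ m ∈ dyadic M, dilatePair ψ φ (l : ZMod N) (l' : ZMod N) m‖ ^ 2) :
    ∃ l' : ℕ, ∃ H ⊆ Icc (-(2 * ⌊1 / X ^ 2 * M⌋₊ : ℤ)) (2 * ⌊1 / X ^ 2 * M⌋₊),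
      M / X ^ (15 * #S) ≤ #H ∧ ∀ h ∈ H, ∃ A ⊆ dyadic L, L / X ^ (14 * #S) ≤ #A ∧
        ∀ l ∈ A, CorrelatedShift ψ φ S (1 / X ^ 2) (δ ^ 2 / 256) M (l : ZMod N) (l' : ZMod N) h := by
  have hs : 1 ≤ #S := card_pos.2 ⟨1, h1S⟩
  set s := #S with hsdef
  have hX1 : 1 ≤ X := le_trans (by norm_num) hX
  have hX0 : 0 < X := by linarith
  have hpow : ∀ i j : ℕ, i ≤ j → X ^ i ≤ X ^ j := fun i j hij => pow_le_pow_right₀ hX1 hij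
  have hM6 : X ^ 6 ≤ M := (hpow 6 (6 * s) (by omega)).trans hM
  have hM0 : 0 < M := lt_of_lt_of_le (by positivity) hM
  have hM1 : 1 ≤ M := (one_le_pow₀ hX1).trans hM6
  have hδX : 1 / X ≤ δ := by rw [div_le_iff₀ hδ] at hXδ; rw [div_le_iff₀ hX0]; linarith
  have hLc := card_dyadic_le hL
  have hMc := card_dyadic_le hM1
  set r := 1 / X ^ 2 with hr
  have hr0 : 0 < r := by positivity
  set P : ℕ → ℕ → Prop := fun l l' =>
    δ / 4 * M ≤ ‖∑ m ∈ dyadic M, dilatePair ψ φ (l : ZMod N) (l' : ZMod N) m‖ with hP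
  -- a popular `l'`
  obtain ⟨l', hl', hl'sum⟩ : ∃ l' ∈ dyadic L, δ / 2 * L * M ^ 2 ≤
      ∑ l ∈ dyadic L, ‖∑ m ∈ dyadic M, dilatePair ψ φ (l : ZMod N) (l' : ZMod N) m‖ ^ 2 := by
    by_contra hcon
    push Not at hcon
    rw [sum_comm] at hsum
    rcases (dyadic L).eq_empty_or_nonempty with h0 | h0
    · rw [h0, sum_empty] at hsum
      have : 0 < δ * L ^ 2 * M ^ 2 := by positivity
      linarith
    · have h1 := sum_lt_sum_of_nonempty h0 hcon
      rw [sum_const, nsmul_eq_mul] at h1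
      have h2 : (#(dyadic L) : ℝ) * (δ / 2 * L * M ^ 2) ≤ 2 * L * (δ / 2 * L * M ^ 2) := by gcongr
      linarith
  have hgood : δ / 16 * L ≤ #{l ∈ dyadic L | P l l'} := by
    set f : ℕ → ℝ := fun l => ‖∑ m ∈ dyadic M, dilatePair ψ φ (l : ZMod N) (l' : ZMod N) m‖ ^ 2
      with hf
    have h1 := le_card_filter_mul (dyadic L) f
      (τ := δ / 8 * M ^ 2) (B := 4 * M ^ 2) (by positivity) (fun l _ => by
        have h2 := norm_sum_le_card_mul (dyadic M)
          (fun m : ℕ => dilatePair ψ φ (l : ZMod N) (l' : ZMod N) m) (B := 1)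
          fun m _ => norm_dilatePair_le hψ _ _ _
        calc _ ≤ (2 * M) ^ 2 := by
              simp only [hf]
              gcongr; linarith
          _ = _ := by ring) hl'sum
    have h2 : (#{l ∈ dyadic L | δ / 8 * M ^ 2 < f l} : ℝ) ≤ #{l ∈ dyadic L | P l l'} := by
      norm_cast
      refine card_le_card fun l hl => ?_
      rw [mem_filter] at hl ⊢
      refine ⟨hl.1, ?_⟩
      refine le_of_sq_le_sq ?_ (norm_nonneg _)
      refine le_trans ?_ hl.2.le
      have : δ ^ 2 ≤ 1 * δ := by rw [sq]; gcongr
      nlinarith [sq_nonneg M]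
    have h3 : δ / 8 * M ^ 2 * (#(dyadic L) : ℝ) ≤ δ / 8 * M ^ 2 * (2 * L) := by gcongr
    have h4 : 4 * M ^ 2 * (δ / 16 * L) ≤ 4 * M ^ 2 * #{l ∈ dyadic L | P l l'} := by
      have h5 : (#{l ∈ dyadic L | δ / 8 * M ^ 2 < f l} : ℝ) * (4 * M ^ 2)
        ≤ #{l ∈ dyadic L | P l l'} * (4 * M ^ 2) := by gcongr
      linarith
    exact le_of_mul_le_mul_left h4 (by positivity)
  -- the correlated shifts
  set Ω := Icc (-(2 * ⌊r * M⌋₊ : ℤ)) (2 * ⌊r * M⌋₊) with hΩ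
  set Q : ℕ → ℤ → Prop := fun l h =>
    CorrelatedShift ψ φ S r (δ ^ 2 / 256) M (l : ZMod N) (l' : ZMod N) h with hQ
  have hrM : 1 ≤ r * M := by
    rw [hr, one_div_mul_eq_div, le_div_iff₀ (by positivity), one_mul]
    exact (hpow 2 6 (by norm_num)).trans hM6
  have hr32 : 32 * r ≤ 1 / X := by
    calc 32 * r ≤ X * r := by gcongr; linarith
      _ = 1 / X := by rw [hr]; field_simp
  have hr1 : r ≤ 1 := by rw [hr, div_le_one (by positivity)]; exact one_le_pow₀ hX1
  have hmany : ∀ l, P l l' → M / X ^ (12 * s) ≤ #{h ∈ Ω | Q l h} := by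
    intro l hl
    simp only [hP] at hl
    rw [sum_dyadic_eq (fun m => dilatePair ψ φ (l : ZMod N) (l' : ZMod N) m)] at hl
    refine le_trans ?_ (le_card_correlatedShift hψ hδ hr0 hr1 (hr32.trans hδX) hrM
      (dyadic_int_len hM1) hl)
    rw [← hsdef]
    have e1 : 1 / X ^ 3 ≤ r / 3 := by
      rw [hr, div_div]; apply one_div_le_one_div_of_le (by positivity)
      calc X ^ 2 * 3 ≤ X ^ 2 * X := by gcongr; linarith
        _ = X ^ 3 := by ring
    have e2 : (1 / X) ^ 2 / X ≤ δ ^ 2 / 512 := by gcongr; linarith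
    calc M / X ^ (12 * s) = M * (1 / X ^ (12 * s)) := by ring
      _ ≤ M * (1 / X ^ (3 * (2 * s) + 6)) := by
          exact mul_le_mul_of_nonneg_left (one_div_pow_le hX1 (by omega)) hM0.le
      _ = (1 / X) ^ 2 / X * ((1 / X ^ 3) ^ (2 * s) * (1 / X ^ 3 * M)) := by
          rw [pow_add, one_div_pow, one_div_pow, ← pow_mul X 3]; field_simp
      _ ≤ δ ^ 2 / 512 * ((r / 3) ^ (2 * s) * (r * M / 2)) := by
          have e3 : 1 / X ^ 3 * M ≤ r * M / 2 := by
            have e4 : 1 / X ^ 3 ≤ r / 2 := by linarith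
            calc 1 / X ^ 3 * M ≤ r / 2 * M := by gcongr
              _ = _ := by ring
          gcongr
  set c := δ / 16 * L * (M / X ^ (12 * s)) with hc
  have hdouble : c ≤ ∑ h ∈ Ω, (#{l ∈ dyadic L | P l l' ∧ Q l h} : ℝ) := by
    have h1 : ∑ h ∈ Ω, (#{l ∈ dyadic L | P l l' ∧ Q l h} : ℝ)
        = ∑ l ∈ dyadic L with P l l', (#{h ∈ Ω | Q l h} : ℝ) := by
      have : ∀ h, {l ∈ dyadic L | P l l' ∧ Q l h} = {l ∈ {l ∈ dyadic L | P l l'} | Q l h} :=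
        fun h => by rw [filter_filter]
      simp_rw [this, card_filter _ {l ∈ dyadic L | P l l'}, card_filter _ Ω]
      push_cast
      rw [sum_comm]
    rw [h1, hc]
    calc δ / 16 * L * (M / X ^ (12 * s)) ≤ #{l ∈ dyadic L | P l l'} * (M / X ^ (12 * s)) := by gcongr
      _ = ∑ _l ∈ dyadic L with P _l l', M / X ^ (12 * s) := by rw [sum_const, nsmul_eq_mul]
      _ ≤ _ := sum_le_sum fun l hl => hmany l (mem_filter.1 hl).2
  have hΩc : (#Ω : ℝ) ≤ 2 * M := by
    have h1 : (⌊r * M⌋₊ : ℝ) ≤ r * M := Nat.floor_le (by positivity)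
    apply card_Icc_int_le (by positivity)
    push_cast
    have h2 : r ≤ 1 / 32 := by
      have : 1 / X ≤ 1 := by rw [div_le_one hX0]; exact hX1
      linarith
    nlinarith
  have hcnt := le_card_filter_mul Ω (fun h => (#{l ∈ dyadic L | P l l' ∧ Q l h} : ℝ))
    (τ := c / (4 * M)) (B := 2 * L) (by positivity)
    (fun h _ => le_trans (by exact_mod_cast card_filter_le _ _) hLc) hdouble
  set H := {h ∈ Ω | c / (4 * M) < (#{l ∈ dyadic L | P l l' ∧ Q l h} : ℝ)} with hH
  have hc4 : c / (4 * M) = δ / 64 * L / X ^ (12 * s) := by rw [hc]; field_simp; norm_num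
  have hXX : 1 / X / X / X ^ (12 * s) ≤ δ / 64 / X ^ (12 * s) := by gcongr; linarith
  have hX14 : 1 / X ^ (14 * s) ≤ 1 / X / X / X ^ (12 * s) := by
    rw [show 1 / X / X / X ^ (12 * s) = 1 / X ^ (2 + 12 * s) by rw [pow_add]; field_simp]
    exact one_div_pow_le hX1 (by omega)
  refine ⟨l', H, filter_subset _ _, ?_, fun h hh => ⟨{l ∈ dyadic L | P l l' ∧ Q l h}, filter_subset _ _, ?_,
    fun l hl => (mem_filter.1 hl).2.2⟩⟩
  · have h1 : c / (4 * M) * (#Ω : ℝ) ≤ c / (4 * M) * (2 * M) := by gcongr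
    have h2 : c / (4 * M) * (2 * M) = c / 2 := by field_simp; norm_num
    have h3 : c / 2 ≤ #H * (2 * L) := by linarith
    have h4 : 2 * L * (M / X ^ (15 * s)) ≤ 2 * L * #H := by
      refine le_trans ?_ (h3.trans (le_of_eq (mul_comm _ _)))
      calc 2 * L * (M / X ^ (15 * s)) = L * M * (1 / X ^ (15 * s)) * 2 := by ring
        _ ≤ L * M * (1 / X ^ (1 + 14 * s)) * 2 := by
            gcongr ?_ * 2
            refine mul_le_mul_of_nonneg_left (one_div_pow_le hX1 ?_) (by positivity)
            omega
        _ = L * M * (1 / X ^ (14 * s)) * (2 / X) := by rw [pow_add]; field_simp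
        _ ≤ L * M * (δ / 64 / X ^ (12 * s)) * 2 := by
            have e1 : 2 / X ≤ 2 := by rw [div_le_iff₀ hX0]; linarith
            have e2 := hX14.trans hXX
            gcongr
        _ = c / 2 := by rw [hc]; ring
    exact le_of_mul_le_mul_left h4 (by positivity)
  · refine le_trans ?_ (mem_filter.1 hh).2.le
    rw [hc4]
    have e2 := hX14.trans hXX
    calc L / X ^ (14 * s) = L * (1 / X ^ (14 * s)) := by ring
      _ ≤ L * (δ / 64 / X ^ (12 * s)) := by gcongr
      _ = _ := by ring

open Classical in
/-- From a large type II sum: for many `h` there are many `l`, with frequencies `γ l` which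
approximate the derivative of the phase in the direction `h l`, such that `γ(l) l` is nearly
constant. -/
theorem exists_popular_shifts (h1S : (1 : ZMod N) ∈ S) (hσ : 0 < σ) (hΛ : 0 ≤ Λ)
    (hφ : IsLocallyQuadraticOn (bohrSet S σ) φ) (hψ : IsSmoothCutoff S σ Λ ψ) {δ X L M : ℝ}
    (hδ : 0 < δ) (hδ1 : δ ≤ 1) (hX : 2 ^ 24 ≤ X) (hXδ : 1 / δ ≤ X) (hXσ : 1 / σ ≤ X) (hXΛ : Λ ≤ X)
    (hL : 1 ≤ L) (hM : X ^ (6 * #S) ≤ M)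
    (hsum : δ * L ^ 2 * M ^ 2 ≤ ∑ l ∈ dyadic L, ∑ l' ∈ dyadic L,
      ‖∑ m ∈ dyadic M, dilatePair ψ φ (l : ZMod N) (l' : ZMod N) m‖ ^ 2) :
    ∃ H ⊆ Icc (-(2 * ⌊1 / X ^ 2 * M⌋₊ : ℤ)) (2 * ⌊1 / X ^ 2 * M⌋₊),
      M / X ^ (124 * #S ^ 3) ≤ #H ∧ ∀ h ∈ H, ∃ A ⊆ dyadic L, L / X ^ (124 * #S ^ 3) ≤ #A ∧
        ∃ (γ : ℕ → ZMod N) (θ : UnitAddCircle), ∀ l ∈ A,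
          bohrNorm S ((h : ZMod N) * l) < 2 * (1 / X ^ 2) ∧
          γ l ∈ charApprox S (1 / X ^ (124 * #S ^ 3)) (fun u => secondDiff φ u (h * l)) ∧
          ‖charVal (γ l) l - θ‖ ≤ X ^ (124 * #S ^ 3) / M := by
  have hs : 1 ≤ #S := card_pos.2 ⟨1, h1S⟩
  obtain ⟨l', H, hHs, hHc, hH⟩ := exists_correlatedShift_set h1S hψ hδ hδ1 hX hXδ hL hM hsum
  set s := #S with hsdef
  have hX1 : 1 ≤ X := le_trans (by norm_num) hX
  have hX0 : 0 < X := by linarith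
  have hpow : ∀ i j : ℕ, i ≤ j → X ^ i ≤ X ^ j := fun i j hij => pow_le_pow_right₀ hX1 hij
  have hM0 : 0 < M := lt_of_lt_of_le (by positivity) hM
  refine ⟨H, hHs, le_trans ?_ hHc, fun h hh => ?_⟩
  · apply div_le_div_of_nonneg_left hM0.le (by positivity)
    exact hpow _ _ (by nlinarith [Nat.le_self_pow (n := 3) (by norm_num) s])
  obtain ⟨A₀, hA₀s, hA₀c, hA₀⟩ := hH h hh
  have hex : ∀ l ∈ A₀, ∃ γ γ' : ZMod N,
      γ ∈ charApprox S (1 / X ^ (31 * s ^ 2)) (fun u => secondDiff φ u (h * l)) ∧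
      γ' ∈ charApprox S (1 / X ^ (31 * s ^ 2)) (fun u => secondDiff φ u (h * l')) ∧
      ‖charVal γ l - charVal γ' l'‖ ≤ X ^ (31 * s ^ 2) / M := by
    intro l hl
    obtain ⟨γ, hγ, γ', hγ', hγγ⟩ := exists_charApprox_of_correlatedShift_pow h1S hσ hΛ hφ hψ hδ hX hXδ hXσ
      hXΛ hM (hA₀ l hl)
    exact ⟨γ, γ', hγ, hγ', hγγ⟩
  choose! γ γ' hγ hγ' hγγ using hex
  set Cset : Finset (ZMod N) := {γ | γ ∈ charApprox S (1 / X ^ (31 * s ^ 2)) (fun u => secondDiff φ u (h * l'))}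
    with hCset
  have hX31 : X ≤ X ^ (31 * s ^ 2) := by
    calc X = X ^ 1 := (pow_one X).symm
      _ ≤ _ := hpow _ _ (by nlinarith)
  have hCc : (#Cset : ℝ) ≤ X ^ (93 * s ^ 3) := by
    have := card_charApprox_le_pow (S := S) (Y := X ^ (31 * s ^ 2)) (by linarith) hs
      (fun u => secondDiff φ u (h * l'))
    rw [← pow_mul, ← hsdef] at this
    refine this.trans (le_of_eq ?_)
    congr 1; ring
  obtain ⟨g, -, hg⟩ : ∃ g ∈ Cset, L / X ^ (124 * s ^ 3) ≤ #{l ∈ A₀ | γ' l = g} := by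
    by_contra hcon
    push Not at hcon
    have h1 := card_eq_sum_card_fiberwise (f := γ') (s := A₀) (t := Cset) fun l hl => by
      rw [mem_coe, hCset, mem_filter]; exact ⟨mem_univ _, hγ' l hl⟩
    have h2 : (#A₀ : ℝ) ≤ #Cset * (L / X ^ (124 * s ^ 3)) := by
      rw [h1, ← nsmul_eq_mul, ← sum_const]; push_cast
      exact sum_le_sum fun g hg => (hcon g hg).le
    have hne : Cset.Nonempty := by
      rw [nonempty_iff_ne_empty]; intro h0
      rw [h0] at h2
      have : 0 < L / X ^ (14 * s) := by positivity
      simp at h2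
      simp [h2] at hA₀c
      linarith
    have h3 : (#A₀ : ℝ) < #Cset * (L / X ^ (124 * s ^ 3)) := by
      rw [h1, ← nsmul_eq_mul, ← sum_const]; push_cast
      exact sum_lt_sum_of_nonempty hne hcon
    have h4 : (#Cset : ℝ) * (L / X ^ (124 * s ^ 3)) ≤ X ^ (93 * s ^ 3) * (L / X ^ (124 * s ^ 3)) := by
      gcongr
    have h5 : X ^ (93 * s ^ 3) * (L / X ^ (124 * s ^ 3)) ≤ L / X ^ (14 * s) := by
      rw [mul_div_assoc', div_le_div_iff₀ (by positivity) (by positivity)]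
      calc X ^ (93 * s ^ 3) * L * X ^ (14 * s) = L * X ^ (93 * s ^ 3 + 14 * s) := by
            rw [pow_add]; ring
        _ ≤ L * X ^ (124 * s ^ 3) := by
            refine mul_le_mul_of_nonneg_left (hpow _ _ ?_) (by positivity)
            nlinarith [Nat.le_self_pow (n := 3) (by norm_num) s]
    linarith
  have hmono : X ^ (31 * s ^ 2) ≤ X ^ (124 * s ^ 3) := by
    apply hpow
    have : s ^ 2 ≤ s ^ 3 := Nat.pow_le_pow_right hs (by norm_num)
    omega
  refine ⟨{l ∈ A₀ | γ' l = g}, (filter_subset _ _).trans hA₀s, hg, γ, charVal g l',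
    fun l hl => ?_⟩
  obtain ⟨hl1, hl2⟩ := mem_filter.1 hl
  refine ⟨(hA₀ l hl1).1, charApprox_mono (by positivity)
    (one_div_le_one_div_of_le (by positivity) hmono) _ (hγ l hl1), ?_⟩
  rw [← hl2]
  refine (hγγ l hl1).trans ?_
  gcongr

end TypeII

/-! ### Popular differences and additive structure of the frequencies -/

open Classical in
/-- Pigeonhole over a bounded positive integer. -/
lemma exists_popular_denominator {ι : Type*} {s : Finset ι} (hs : s.Nonempty) {Q : ℝ}
    {p : ι → ℕ → Prop} (h : ∀ i ∈ s, ∃ q : ℕ, 0 < q ∧ (q : ℝ) ≤ Q ∧ p i q) :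
    ∃ q : ℕ, 0 < q ∧ (q : ℝ) ≤ Q ∧ (#s : ℝ) ≤ Q * #{i ∈ s | p i q} := by
  choose! f hf0 hfQ hfp using h
  have hQ0 : 0 ≤ Q := by
    obtain ⟨i, hi⟩ := hs
    exact le_trans (by positivity) (hfQ i hi)
  have hmaps : ∀ i ∈ s, f i ∈ Icc 1 ⌊Q⌋₊ := fun i hi =>
    mem_Icc.2 ⟨hf0 i hi, Nat.le_floor (hfQ i hi)⟩
  by_contra hcon
  push Not at hcon
  have h1 := card_eq_sum_card_fiberwise (f := f) (s := s) (t := Icc 1 ⌊Q⌋₊) hmaps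
  have hlt : ∀ q ∈ Icc 1 ⌊Q⌋₊, Q * #{i ∈ s | f i = q} < #s := by
    intro q hq
    rw [mem_Icc] at hq
    refine lt_of_le_of_lt ?_ (hcon q hq.1 ((Nat.le_floor_iff hQ0).1 hq.2))
    gcongr with i hi
    rintro rfl
    exact hfp i hi
  have hne : (Icc 1 ⌊Q⌋₊).Nonempty := by
    obtain ⟨i, hi⟩ := hs
    exact ⟨_, hmaps i hi⟩
  have h2 := sum_lt_sum_of_nonempty hne hlt
  rw [sum_const, nsmul_eq_mul, ← mul_sum, Nat.card_Icc, Nat.add_sub_cancel] at h2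
  have h3 : ∑ q ∈ Icc 1 ⌊Q⌋₊, (#{i ∈ s | f i = q} : ℝ) = #s := by
    rw [h1]; push_cast; rfl
  rw [h3] at h2
  have h4 : (⌊Q⌋₊ : ℝ) * #s ≤ Q * #s := by
    gcongr; exact Nat.floor_le hQ0
  linarith

/-- At least half as many differences as elements are popular. -/
lemma card_popular_differences {H : Type*} [AddCommGroup H] [DecidableEq H] {E D : Finset H}
    (hE : E.Nonempty) (hD : ∀ x ∈ E, ∀ y ∈ E, x - y ∈ D) :
    (#E : ℝ) / 2 ≤ #{d ∈ D | (#E : ℝ) ^ 2 / (2 * #D) < #{g ∈ E | g + d ∈ E}} := by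
  have hE0 : (0 : ℝ) < #E := by exact_mod_cast card_pos.2 hE
  have hD0 : (0 : ℝ) < #D := by
    obtain ⟨x, hx⟩ := hE
    exact_mod_cast card_pos.2 ⟨_, hD x hx x hx⟩
  have h1 : ∑ d ∈ D, #{g ∈ E | g + d ∈ E} = #E * #E := by
    have h2 : ∑ d ∈ D, #{g ∈ E | g + d ∈ E} = ∑ g ∈ E, #{d ∈ D | g + d ∈ E} := by
      simp_rw [card_filter]; exact sum_comm
    rw [h2, ← smul_eq_mul, ← sum_const]
    refine sum_congr rfl fun g hg => ?_
    refine card_bij (fun d _ => g + d) (fun d hd => (mem_filter.1 hd).2)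
      (fun d _ d' _ h => add_left_cancel h) fun y hy => ⟨y - g, ?_, by abel⟩
    rw [mem_filter]
    exact ⟨hD y hy g hg, by rw [add_sub_cancel]; exact hy⟩
  have h2 := le_card_filter_mul D (fun d => (#{g ∈ E | g + d ∈ E} : ℝ)) (c := #E * #E)
    (τ := (#E : ℝ) ^ 2 / (2 * #D)) (B := #E) (by positivity)
    (fun d _ => by exact_mod_cast card_filter_le _ _) (by rw [← Nat.cast_mul, ← h1]; push_cast; rfl)
  have h3 : (#E : ℝ) ^ 2 / (2 * #D) * #D = (#E : ℝ) ^ 2 / 2 := by field_simp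
  rw [h3] at h2
  have h4 : (#E : ℝ) * (#E / 2) ≤
      #E * #{d ∈ D | (#E : ℝ) ^ 2 / (2 * #D) < #{g ∈ E | g + d ∈ E}} := by
    linarith
  exact le_of_mul_le_mul_left h4 hE0

section Frequencies

variable {N : ℕ} [NeZero N]

/-- The function `(l, γ) ↦ γ l / N` is quadratic; on a parallelogram where it is nearly constant its
mixed derivative is small. -/
lemma norm_mixed_le {G : Finset (ℤ × ZMod N)} {θ : UnitAddCircle} {ε : ℝ}
    (hG : ∀ g ∈ G, ‖charVal g.2 (g.1 : ZMod N) - θ‖ ≤ ε) {g d d' : ℤ × ZMod N} (h0 : g ∈ G)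
    (h1 : g + d ∈ G) (h2 : g + d' ∈ G) (h3 : g + d + d' ∈ G) :
    ‖d'.1 • charVal 1 d.2 + d.1 • charVal 1 d'.2‖ ≤ 4 * ε := by
  have key : d'.1 • charVal 1 d.2 + d.1 • charVal 1 d'.2
      = (charVal (g + d + d').2 ((g + d + d').1 : ZMod N) - θ)
        - (charVal (g + d).2 ((g + d).1 : ZMod N) - θ)
        - (charVal (g + d').2 ((g + d').1 : ZMod N) - θ) + (charVal g.2 (g.1 : ZMod N) - θ) := by
    rw [← charVal_intCast, ← charVal_intCast]
    simp only [Prod.fst_add, Prod.snd_add, Int.cast_add, charVal_add, charVal_add_left]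
    abel
  rw [key]
  have e0 := hG _ h0
  have e1 := hG _ h1
  have e2 := hG _ h2
  have e3 := hG _ h3
  refine (norm_add_le _ _).trans ?_
  refine (add_le_add_left (norm_sub_le _ _) _).trans ?_
  have := norm_sub_le (charVal (g + d + d').2 ((g + d + d').1 : ZMod N) - θ)
    (charVal (g + d).2 ((g + d).1 : ZMod N) - θ)
  linarith

/-- The polarisation identity which isolates one frequency from three mixed derivatives. -/
lemma norm_two_mul_le {k₁ k₂ k₃ : ℤ} {x₁ x₂ x₃ : UnitAddCircle} {P ε : ℝ}
    (h1 : |(k₁ : ℝ)| ≤ P) (h2 : |(k₂ : ℝ)| ≤ P) (h3 : |(k₃ : ℝ)| ≤ P)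
    (h12 : ‖k₂ • x₁ + k₁ • x₂‖ ≤ ε) (h13 : ‖k₃ • x₁ + k₁ • x₃‖ ≤ ε)
    (h23 : ‖k₃ • x₂ + k₂ • x₃‖ ≤ ε) : ‖k₃ • ((2 * k₂) • x₁)‖ ≤ 3 * P * ε := by
  have key : k₃ • ((2 * k₂) • x₁) = k₃ • (k₂ • x₁ + k₁ • x₂) + k₂ • (k₃ • x₁ + k₁ • x₃)
      - k₁ • (k₃ • x₂ + k₂ • x₃) := by
    module
  have hb : ∀ (k : ℤ) (x : UnitAddCircle), |(k : ℝ)| ≤ P → ‖x‖ ≤ ε → ‖k • x‖ ≤ P * ε := by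
    intro k x hk hx
    refine (norm_zsmul_le_abs _ _).trans ?_
    exact mul_le_mul hk hx (norm_nonneg _) ((abs_nonneg _).trans hk)
  rw [key]
  refine (norm_sub_le _ _).trans ?_
  refine (add_le_add_left (norm_add_le _ _) _).trans ?_
  linarith [hb _ _ h3 h12, hb _ _ h2 h13, hb _ _ h1 h23]

omit [NeZero N] in
open Classical in
lemma card_le_mul_card_image_fst {D D' : Finset (ℤ × ZMod N)} {Y : ℝ} (hD' : D' ⊆ D)
    (hDf : ∀ k, (#{d ∈ D | d.1 = k} : ℝ) ≤ Y) : (#D' : ℝ) ≤ Y * #(D'.image Prod.fst) := by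
  have h1 := card_eq_sum_card_image Prod.fst D'
  rw [h1, mul_comm, ← nsmul_eq_mul, ← sum_const]
  push_cast
  refine sum_le_sum fun k _ => le_trans ?_ (hDf k)
  norm_cast
  exact card_le_card fun d hd => by
    rw [mem_filter] at hd ⊢
    exact ⟨hD' hd.1, hd.2⟩

lemma nonempty_of_lt_of_le_card {ι : Type*} {E : Finset ι} {x : ℝ} (hx : 0 < x) (h : x ≤ #E) :
    E.Nonempty := by
  rw [← card_pos]
  have : (0 : ℝ) < #E := by linarith
  exact_mod_cast this

omit [NeZero N] in
open Classical in
lemma sq_div_le_popularity {E D : Finset (ℤ × ZMod N)} {P Y x : ℝ} (hP : 0 < P) (hY : 0 < Y)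
    (hD : ∀ x ∈ E, ∀ y ∈ E, x - y ∈ D) (hDc : (#D : ℝ) ≤ 3 * P * Y) (hx : 0 < x) (h : x ≤ #E) :
    x ^ 2 / (6 * P * Y) ≤ (#E : ℝ) ^ 2 / (2 * #D) := by
  have hD0 : (0 : ℝ) < #D := by
    obtain ⟨x, hx⟩ := nonempty_of_lt_of_le_card hx h
    exact_mod_cast card_pos.2 ⟨_, hD x hx x hx⟩
  rw [div_le_div_iff₀ (by positivity) (by positivity)]
  have h1 : x ^ 2 ≤ (#E : ℝ) ^ 2 := by gcongr
  calc x ^ 2 * (2 * #D) ≤ (#E : ℝ) ^ 2 * (2 * (3 * P * Y)) := by gcongr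
    _ = _ := by ring

open Classical in
/-- Two popular differences `d₁, d₂`: letting the third side of a cube vary makes a multiple of
`d₂.1` times the frequency of `d₁` nearly integral. -/
lemma exists_denominator_of_two_differences {G D E' : Finset (ℤ × ZMod N)} {θ : UnitAddCircle}
    {ε P Y : ℝ} (hY : 2 ^ 24 ≤ Y) (hYP : Y ^ 40 ≤ P)
    (hG : ∀ g ∈ G, ‖charVal g.2 (g.1 : ZMod N) - θ‖ ≤ ε)
    (hGD : ∀ x ∈ G, ∀ y ∈ G, x - y ∈ D) (hDP : ∀ d ∈ D, |(d.1 : ℝ)| ≤ P)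
    (hDf : ∀ k, (#{d ∈ D | d.1 = k} : ℝ) ≤ Y) (hε : 768 * P * ε * Y ^ 9 ≤ 1)
    {d₁ d₂ : ℤ × ZMod N} (hd₁D : d₁ ∈ D) (hd₂D : d₂ ∈ D) (hE'c : P / (216 * Y ^ 7) ≤ #E')
    (hE'G : ∀ g ∈ E', g ∈ G ∧ g + d₁ ∈ G ∧ g + d₂ ∈ G ∧ g + d₂ + d₁ ∈ G) :
    ∃ q : ℕ, 0 < q ∧ (q : ℝ) ≤ 8 * Y ^ 9 ∧
      ‖d₂.1 • ((2 * q) • charVal 1 d₁.2)‖ ≤ 1728 * Y ^ 18 * ε := by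
  have hY1 : 1 ≤ Y := le_trans (by norm_num) hY
  have hY0 : 0 < Y := by linarith
  have hP0 : 0 < P := lt_of_lt_of_le (by positivity) hYP
  have hpow : ∀ i j : ℕ, i ≤ j → Y ^ i ≤ Y ^ j := fun i j hij => pow_le_pow_right₀ hY1 hij
  obtain ⟨g₀, hg₀⟩ := nonempty_of_lt_of_le_card (by positivity) hE'c
  set D₃ := E'.image fun g => g - g₀ with hD₃
  have hD₃c : #D₃ = #E' := card_image_of_injective _ sub_left_injective
  have hD₃D : D₃ ⊆ D := by
    intro d hd
    obtain ⟨g, hg, rfl⟩ := mem_image.1 hd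
    exact hGD _ (hE'G g hg).1 _ (hE'G g₀ hg₀).1
  have hK₃c : 1 / Y ^ 9 * P ≤ #(D₃.image Prod.fst) := by
    have h1 := card_le_mul_card_image_fst hD₃D hDf
    rw [hD₃c] at h1
    have h2 := hE'c.trans h1
    rw [div_le_iff₀ (by positivity)] at h2
    rw [one_div_mul_eq_div, div_le_iff₀ (by positivity)]
    calc P ≤ Y * #(D₃.image Prod.fst) * (216 * Y ^ 7) := h2
      _ ≤ Y * #(D₃.image Prod.fst) * (Y * Y ^ 7) := by gcongr; linarith
      _ = _ := by ring
  have hK₃ : ∀ k₃ ∈ D₃.image Prod.fst, ‖k₃ • ((2 * d₂.1) • charVal 1 d₁.2)‖ ≤ 12 * P * ε := by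
    intro k₃ hk₃
    obtain ⟨d₃, hd₃, rfl⟩ := mem_image.1 hk₃
    have hd₃D := hD₃D hd₃
    obtain ⟨g, hg, hgd⟩ := mem_image.1 hd₃
    have hg3 : g = g₀ + d₃ := by rw [← hgd]; abel
    obtain ⟨a0, a1, a2, a12⟩ := hE'G g₀ hg₀
    obtain ⟨b0, b1, b2, -⟩ := hE'G g hg
    rw [hg3] at b0 b1 b2
    have e12 := norm_mixed_le hG a0 a1 a2 (by rw [add_right_comm]; exact a12)
    have e13 := norm_mixed_le hG a0 a1 b0 (by rw [add_right_comm]; exact b1)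
    have e23 := norm_mixed_le hG a0 a2 b0 (by rw [add_right_comm]; exact b2)
    refine (norm_two_mul_le (hDP _ hd₁D) (hDP _ hd₂D) (hDP _ hd₃D) e12 e13 e23).trans
      (le_of_eq (by ring))
  obtain ⟨q, hq, hqle, hqn⟩ := exists_denominator_of_dense (A := D₃.image Prod.fst) (J := P)
    (η := 1 / Y ^ 9) (ε := 12 * P * ε) (θ := (2 * d₂.1) • charVal 1 d₁.2) (by
      intro k hk
      obtain ⟨d, hd, rfl⟩ := mem_image.1 hk
      exact hDP _ (hD₃D hd)) (by positivity)
    (by rw [div_le_one (by positivity)]; exact one_le_pow₀ hY1) hK₃c (by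
      rw [one_div_mul_eq_div, le_div_iff₀ (by positivity)]
      calc 64 * Y ^ 9 ≤ Y * Y ^ 9 := by gcongr; linarith
        _ = Y ^ 10 := by ring
        _ ≤ Y ^ 40 := hpow _ _ (by norm_num)
        _ ≤ P := hYP) (by
      rw [div_div, le_div_iff₀ (by positivity)]; linarith) hK₃
  refine ⟨q, hq, hqle.trans (le_of_eq (by field_simp)), ?_⟩
  have h1 : d₂.1 • ((2 * q) • charVal 1 d₁.2) = q • ((2 * d₂.1) • charVal 1 d₁.2) := by
    simp only [← natCast_zsmul, smul_smul]
    congr 1; push_cast; ring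
  rw [h1]
  refine hqn.trans (le_of_eq ?_)
  field_simp
  norm_num
  ring

open Classical in
/-- A popular difference has a nearly rational frequency. -/
lemma exists_denominator_of_popular_difference {G D : Finset (ℤ × ZMod N)} {θ : UnitAddCircle}
    {ε P Y : ℝ} (hY : 2 ^ 24 ≤ Y) (hYP : Y ^ 40 ≤ P)
    (hG : ∀ g ∈ G, ‖charVal g.2 (g.1 : ZMod N) - θ‖ ≤ ε)
    (hGD : ∀ x ∈ G, ∀ y ∈ G, x - y ∈ D) (hDP : ∀ d ∈ D, |(d.1 : ℝ)| ≤ P)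
    (hDf : ∀ k, (#{d ∈ D | d.1 = k} : ℝ) ≤ Y) (hDc : (#D : ℝ) ≤ 3 * P * Y)
    (hε : 768 * P * ε * Y ^ 9 ≤ 1) (hε0 : 0 ≤ ε) {d₁ : ℤ × ZMod N} (hd₁D : d₁ ∈ D)
    (hEc : P / (6 * Y ^ 3) ≤ #{g ∈ G | g + d₁ ∈ G}) :
    ∃ q : ℕ, 0 < q ∧ (q : ℝ) ≤ Y ^ 24 ∧ ‖q • charVal 1 d₁.2‖ ≤ Y ^ 47 * ε / P := by
  have hY1 : 1 ≤ Y := le_trans (by norm_num) hY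
  have hY0 : 0 < Y := by linarith
  have hP0 : 0 < P := lt_of_lt_of_le (by positivity) hYP
  have hpow : ∀ i j : ℕ, i ≤ j → Y ^ i ≤ Y ^ j := fun i j hij => pow_le_pow_right₀ hY1 hij
  set E := {g ∈ G | g + d₁ ∈ G} with hE
  have hED : ∀ x ∈ E, ∀ y ∈ E, x - y ∈ D := fun x hx y hy =>
    hGD x (mem_filter.1 hx).1 y (mem_filter.1 hy).1
  set D₂ := {d ∈ D | (#E : ℝ) ^ 2 / (2 * #D) < #{g ∈ E | g + d ∈ E}} with hD₂
  have hD₂c := card_popular_differences (nonempty_of_lt_of_le_card (by positivity) hEc) hED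
  rw [← hD₂] at hD₂c
  have hK₂c : P / (12 * Y ^ 4) ≤ #(D₂.image Prod.fst) := by
    have h1 := card_le_mul_card_image_fst (filter_subset _ _ : D₂ ⊆ D) hDf
    have h2 : P / (12 * Y ^ 3) ≤ #D₂ := by
      refine le_trans (le_of_eq ?_) ((div_le_div_of_nonneg_right hEc zero_le_two).trans hD₂c)
      rw [div_div]; congr 1; ring
    rw [div_le_iff₀ (by positivity)] at h2 ⊢
    calc P ≤ #D₂ * (12 * Y ^ 3) := h2
      _ ≤ Y * #(D₂.image Prod.fst) * (12 * Y ^ 3) := by gcongr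
      _ = _ := by ring
  have hthird : ∀ k₂ ∈ D₂.image Prod.fst, ∃ q : ℕ, 0 < q ∧ (q : ℝ) ≤ 8 * Y ^ 9 ∧
      ‖k₂ • ((2 * q) • charVal 1 d₁.2)‖ ≤ 1728 * Y ^ 18 * ε := by
    intro k₂ hk₂
    obtain ⟨d₂, hd₂, rfl⟩ := mem_image.1 hk₂
    obtain ⟨hd₂D, hd₂E⟩ := mem_filter.1 hd₂
    refine exists_denominator_of_two_differences (E' := {g ∈ E | g + d₂ ∈ E}) hY hYP hG hGD hDP hDf
      hε hd₁D hd₂D ?_ fun g hg => ?_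
    · refine le_trans ?_ ((sq_div_le_popularity hP0 hY0 hED hDc (by positivity) hEc).trans hd₂E.le)
      apply le_of_eq; field_simp; norm_num
    · obtain ⟨h1, h2⟩ := mem_filter.1 hg
      obtain ⟨h3, h4⟩ := mem_filter.1 h1
      obtain ⟨h5, h6⟩ := mem_filter.1 h2
      exact ⟨h3, h4, h5, h6⟩
  have hK₂ne : (D₂.image Prod.fst).Nonempty := by
    rw [← card_pos]
    have : (0 : ℝ) < #(D₂.image Prod.fst) := lt_of_lt_of_le (by positivity) hK₂c
    exact_mod_cast this
  obtain ⟨q, hq, hqle, hqc⟩ := exists_popular_denominator hK₂ne hthird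
  set K := {k₂ ∈ D₂.image Prod.fst | ‖k₂ • ((2 * q) • charVal 1 d₁.2)‖ ≤ 1728 * Y ^ 18 * ε} with hK
  have hKc : 1 / Y ^ 14 * P ≤ #K := by
    have h2 := hK₂c.trans hqc
    rw [div_le_iff₀ (by positivity)] at h2
    rw [one_div_mul_eq_div, div_le_iff₀ (by positivity)]
    calc P ≤ 8 * Y ^ 9 * #K * (12 * Y ^ 4) := h2
      _ = 96 * (#K * Y ^ 13) := by ring
      _ ≤ Y * (#K * Y ^ 13) := by gcongr; linarith
      _ = _ := by ring
  have hεY : 1728 * Y ^ 18 * ε ≤ 1 / Y ^ 14 / 64 := by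
    rw [div_div, le_div_iff₀ (by positivity)]
    have h1 : Y ^ 40 * ε * Y ^ 9 ≤ P * ε * Y ^ 9 := by gcongr
    have h2 : 1728 * Y ^ 18 * ε * (Y ^ 14 * 64) = 110592 * (Y ^ 32 * ε) := by ring
    have h3 : 110592 * (Y ^ 32 * ε) ≤ Y * (Y ^ 32 * ε) := by gcongr; linarith
    have h4 : Y * (Y ^ 32 * ε) ≤ Y ^ 40 * ε * Y ^ 9 := by
      calc Y * (Y ^ 32 * ε) = Y ^ 33 * ε := by ring
        _ ≤ Y ^ 49 * ε := by gcongr ?_ * ε; exact hpow _ _ (by norm_num)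
        _ = _ := by ring
    have : 0 ≤ P * ε * Y ^ 9 := by positivity
    linarith
  obtain ⟨q', hq', hqle', hqn'⟩ := exists_denominator_of_dense (A := K) (J := P)
    (η := 1 / Y ^ 14) (ε := 1728 * Y ^ 18 * ε) (θ := (2 * q) • charVal 1 d₁.2) (by
      intro k hk
      obtain ⟨d, hd, rfl⟩ := mem_image.1 (mem_filter.1 hk).1
      exact hDP _ (mem_filter.1 hd).1) (by positivity)
    (by rw [div_le_one (by positivity)]; exact one_le_pow₀ hY1) hKc (by
      rw [one_div_mul_eq_div, le_div_iff₀ (by positivity)]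
      calc 64 * Y ^ 14 ≤ Y * Y ^ 14 := by gcongr; linarith
        _ = Y ^ 15 := by ring
        _ ≤ Y ^ 40 := hpow _ _ (by norm_num)
        _ ≤ P := hYP) hεY fun k hk => (mem_filter.1 hk).2
  refine ⟨q' * (2 * q), by positivity, ?_, ?_⟩
  · push_cast
    have h1 : 8 / (1 / Y ^ 14) = 8 * Y ^ 14 := by field_simp
    rw [h1] at hqle'
    calc (q' : ℝ) * (2 * q) ≤ 8 * Y ^ 14 * (2 * (8 * Y ^ 9)) := by gcongr
      _ = 128 * Y ^ 23 := by ring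
      _ ≤ Y * Y ^ 23 := by gcongr; linarith
      _ = Y ^ 24 := by ring
  · rw [mul_nsmul']
    refine hqn'.trans ?_
    calc 144 * (1728 * Y ^ 18 * ε) / ((1 / Y ^ 14) ^ 2 * P) = 248832 * (Y ^ 46 * ε / P) := by
          field_simp; norm_num; ring
      _ ≤ Y * (Y ^ 46 * ε / P) := by gcongr; linarith
      _ = _ := by ring

open Classical in
/-- A set of pairs `(l, γ)` with few differences on which `γ l / N` is nearly constant: many of its
differences have a frequency which is nearly rational, with small error. -/
theorem card_nearly_rational_differences {G D : Finset (ℤ × ZMod N)} {θ : UnitAddCircle}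
    {ε P Y : ℝ} (hY : 2 ^ 24 ≤ Y) (hYP : Y ^ 40 ≤ P) (hG : ∀ g ∈ G, ‖charVal g.2 (g.1 : ZMod N) - θ‖ ≤ ε)
    (hGc : P / Y ≤ #G) (hGD : ∀ x ∈ G, ∀ y ∈ G, x - y ∈ D) (hDP : ∀ d ∈ D, |(d.1 : ℝ)| ≤ P)
    (hDf : ∀ k, (#{d ∈ D | d.1 = k} : ℝ) ≤ Y) (hDc : (#D : ℝ) ≤ 3 * P * Y)
    (hε : 768 * P * ε * Y ^ 9 ≤ 1) (hε0 : 0 ≤ ε) :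
    P / (2 * Y ^ 2) ≤ #{k ∈ D.image Prod.fst | ∃ ρ, (k, ρ) ∈ D ∧ ∃ q : ℕ, 0 < q ∧ (q : ℝ) ≤ Y ^ 24 ∧
      ‖q • charVal 1 ρ‖ ≤ Y ^ 47 * ε / P} := by
  have hY1 : 1 ≤ Y := le_trans (by norm_num) hY
  have hY0 : 0 < Y := by linarith
  have hP0 : 0 < P := lt_of_lt_of_le (by positivity) hYP
  have hGc0 : 0 < P / Y := by positivity
  set D₁ := {d ∈ D | (#G : ℝ) ^ 2 / (2 * #D) < #{g ∈ G | g + d ∈ G}} with hD₁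
  have hD₁c := card_popular_differences (nonempty_of_lt_of_le_card hGc0 hGc) hGD
  rw [← hD₁] at hD₁c
  have hfinal : (#D₁ : ℝ) ≤ Y * #{k ∈ D.image Prod.fst | ∃ ρ, (k, ρ) ∈ D ∧ ∃ q : ℕ, 0 < q ∧
      (q : ℝ) ≤ Y ^ 24 ∧ ‖q • charVal 1 ρ‖ ≤ Y ^ 47 * ε / P} := by
    refine (card_le_mul_card_image_fst (filter_subset _ _ : D₁ ⊆ D) hDf).trans ?_
    refine mul_le_mul_of_nonneg_left ?_ hY0.le
    refine Nat.cast_le.2 (card_le_card fun k hk => ?_)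
    obtain ⟨d₁, hd₁, rfl⟩ := mem_image.1 hk
    obtain ⟨hd₁D, hd₁E⟩ := mem_filter.1 hd₁
    rw [mem_filter]
    refine ⟨mem_image_of_mem _ hd₁D, d₁.2, hd₁D, ?_⟩
    refine exists_denominator_of_popular_difference hY hYP hG hGD hDP hDf hDc hε hε0 hd₁D ?_
    refine le_trans ?_ ((sq_div_le_popularity hP0 hY0 hGD hDc hGc0 hGc).trans hd₁E.le)
    apply le_of_eq; field_simp
  have h1 : P / Y / 2 ≤ #D₁ := (div_le_div_of_nonneg_right hGc zero_le_two).trans hD₁c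
  have h2 := h1.trans hfinal
  rw [div_le_iff₀ (by positivity)]
  rw [div_div, div_le_iff₀ (by positivity)] at h2
  refine h2.trans (le_of_eq ?_)
  ring

end Frequencies

/-! ### Type II sums: directions in which the second derivative is rational -/

open Classical in
lemma exists_dense_block {L Y : ℝ} (hL : 1 ≤ L) (hY : 0 < Y) {A : Finset ℕ} (hA : A ⊆ dyadic L)
    (hAc : L / Y ≤ #A) {w : ℕ} (hw : 0 < w) (hwL : (w : ℝ) ≤ L) :
    ∃ z : ℤ, w / (3 * Y) ≤ #{i ∈ range w | z + i • (1 : ℤ) ∈ A.image (Nat.cast : ℕ → ℤ)} := by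
  set A' := A.image (Nat.cast : ℕ → ℤ) with hA'
  have hA'c : #A' = #A := card_image_of_injective _ Nat.cast_injective
  have hne : A'.Nonempty := by
    apply nonempty_of_lt_of_le_card (x := L / Y) (by positivity)
    rw [hA'c]; exact hAc
  obtain ⟨z, -, hz⟩ := exists_translate_card A' (Icc 0 ⌊2 * L⌋) 1 w hw hne (by
    intro a ha i hi
    obtain ⟨l, hl, rfl⟩ := mem_image.1 ha
    have hl' := (mem_dyadic (by linarith)).1 (hA hl)
    rw [mem_Icc, nsmul_eq_mul, mul_one, Int.le_floor]
    constructor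
    · have h1 : (i : ℝ) ≤ l := by
        have : (i : ℝ) ≤ w := by exact_mod_cast hi.le
        linarith
      have h2 : i ≤ l := by exact_mod_cast h1
      omega
    · push_cast
      have : (0 : ℝ) ≤ i := by positivity
      linarith)
  refine ⟨z, ?_⟩
  have hΩ : (#(Icc (0 : ℤ) ⌊2 * L⌋) : ℝ) ≤ 3 * L := by
    apply card_Icc_int_le (by positivity)
    push_cast
    have := Int.floor_le (2 * L)
    linarith
  rw [hA'c] at hz
  have hz' : (w : ℝ) * #A ≤ 3 * L * #{i ∈ range w | z + i • (1 : ℤ) ∈ A'} := by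
    have h0 := (Nat.cast_le (α := ℝ)).2 hz
    push_cast at h0
    exact h0.trans (by gcongr)
  rw [div_le_iff₀ (by positivity)]
  have h1 : (w : ℝ) * (L / Y) ≤ w * #A := by gcongr
  have h2 : L * w ≤ L * (#{i ∈ range w | z + i • (1 : ℤ) ∈ A'} * (3 * Y)) := by
    have h3 : (w : ℝ) * (L / Y) * Y = L * w := by field_simp
    calc L * w = (w : ℝ) * (L / Y) * Y := h3.symm
      _ ≤ 3 * L * #{i ∈ range w | z + i • (1 : ℤ) ∈ A'} * Y := mul_le_mul_of_nonneg_right (h1.trans hz') hY.le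
      _ = _ := by ring
  exact le_of_mul_le_mul_left h2 (by linarith)

section RationalDirections

variable {N : ℕ} [NeZero N] {S : Finset (ZMod N)} {σ Λ : ℝ} {ψ : ZMod N → ℝ}
  {φ : ZMod N → UnitAddCircle}

/-- `y` is a small direction in which the second derivative of `φ` is rational with denominator `q`,
with an error proportional to the Bohr norm of the other argument; the scale `Z` sets the radius and
the constant, and `2 * r` bounds the Bohr norm of `y`. -/
def RationalDirection (S : Finset (ZMod N)) (φ : ZMod N → UnitAddCircle) (Z r : ℝ) (q : ℕ)
    (y : ZMod N) : Prop :=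
  bohrNorm S y < 2 * r ∧ ∀ a, bohrNorm S a < 1 / Z → ‖q • secondDiff φ a y‖ ≤ Z ^ 62 * bohrNorm S a

/-- Additivity of `φ''` in the second variable. -/
lemma IsLocallyQuadraticOn.locAdd_right {R R' : ℝ} (hφ : IsLocallyQuadraticOn (bohrSet S R) φ)
    {a : ZMod N} (hR' : 0 < R') (ha : R' + bohrNorm S a ≤ R) :
    LocAdd S R' (fun b => secondDiff φ a b) := by
  have h := hφ.locAdd hR' ha
  intro x y hxy
  have := h x y hxy
  simp only [secondDiff_comm φ _ a] at this
  exact this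

/-- Differences of approximating frequencies approximate the derivative in the difference of the
directions. -/
lemma sub_mem_charApprox (hφ : IsLocallyQuadraticOn (bohrSet S σ) φ) {Y r : ℝ} (hY : 0 < Y)
    (hr : 3 * r + 1 / (2 * Y) ≤ σ) {u v γ γ' : ZMod N} (hu : bohrNorm S u < r)
    (hv : bohrNorm S v < r) (hγ : γ ∈ charApprox S (1 / Y) (fun a => secondDiff φ a u))
    (hγ' : γ' ∈ charApprox S (1 / Y) (fun a => secondDiff φ a v)) :
    γ - γ' ∈ charApprox S (1 / (2 * Y)) (fun a => secondDiff φ a (u - v)) := by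
  have h := charApprox_sub hγ hγ' (by positivity)
  rw [div_div, mul_comm Y 2] at h
  have hr0 : 0 < r := lt_of_le_of_lt (bohrNorm_nonneg _) hu
  intro a ha
  have h1 := h a ha
  have h2 := (hφ.locAdd_right (a := a) (R' := 3 * r) (by positivity) (by linarith)).sub
    (x := u) (y := v) (by linarith)
  simp only [Pi.sub_apply] at h1 h2 ⊢
  rw [h2]
  exact h1

lemma rationalDirection_of_charApprox (h1S : (1 : ZMod N) ∈ S) {Y Z B r : ℝ} (hZ : 2 ^ 24 ≤ Z)
    (hYZ : 4 * Y ≤ Z) (hY : 0 < Y) {ρ y : ZMod N} {q : ℕ} (hq : (q : ℝ) ≤ Z ^ 24)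
    (hρ : ρ ∈ charApprox S (1 / (2 * Y)) (fun a => secondDiff φ a y))
    (hqρ : ‖q • charVal 1 ρ‖ ≤ B) (hB : N * B ≤ Z ^ 61) (hy : bohrNorm S y < 2 * r) :
    RationalDirection S φ Z r q y := by
  refine ⟨hy, ?_⟩
  intro a ha
  have hZ0 : 0 < Z := lt_of_lt_of_le (by norm_num) hZ
  have ha0 := bohrNorm_nonneg (S := S) a
  have h1 := hρ a (ha.trans_le (one_div_le_one_div_of_le (by positivity) (by linarith)))
  have h2 : q • secondDiff φ a y = q • (secondDiff φ a y - charVal ρ a) + charVal (q • ρ) a := by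
    rw [smul_sub, charVal_comm (q • ρ) a, ← natCast_zsmul ρ q, charVal_zsmul, natCast_zsmul,
      charVal_comm ρ a]
    abel
  have h3 := norm_charVal_le h1S (q • ρ) a
  rw [← natCast_zsmul ρ q, charVal_zsmul, natCast_zsmul, natCast_zsmul] at h3
  rw [h2]
  refine (norm_add_le _ _).trans ?_
  have h4 : ‖q • (secondDiff φ a y - charVal ρ a)‖ ≤ Z ^ 24 * (bohrNorm S a / (1 / (2 * Y))) := by
    refine (norm_nsmul_le).trans ?_
    exact mul_le_mul hq h1 (norm_nonneg _) (by positivity)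
  have h5 : N * bohrNorm S a * ‖q • charVal 1 ρ‖ ≤ Z ^ 61 * bohrNorm S a := by
    calc N * bohrNorm S a * ‖q • charVal 1 ρ‖ ≤ N * bohrNorm S a * B := by gcongr
      _ = N * B * bohrNorm S a := by ring
      _ ≤ _ := by gcongr
  have h6 : Z ^ 24 * (bohrNorm S a / (1 / (2 * Y))) ≤ Z ^ 61 * bohrNorm S a := by
    calc Z ^ 24 * (bohrNorm S a / (1 / (2 * Y))) = Z ^ 24 * (2 * Y) * bohrNorm S a := by field_simp
      _ ≤ Z ^ 24 * Z ^ 37 * bohrNorm S a := by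
          gcongr
          calc 2 * Y ≤ Z := by linarith
            _ = Z ^ 1 := (pow_one Z).symm
            _ ≤ Z ^ 37 := pow_le_pow_right₀ (by linarith) (by norm_num)
      _ = _ := by ring
  have h7 : 2 * (Z ^ 61 * bohrNorm S a) ≤ Z ^ 62 * bohrNorm S a := by
    have hZ2 : 2 ≤ Z := le_trans (by norm_num) hZ
    rw [pow_succ' Z 61, mul_assoc]
    exact mul_le_mul_of_nonneg_right hZ2 (mul_nonneg (pow_nonneg hZ0.le _) ha0)
  linarith

open Classical in
/-- For a popular shift `h`, many multiples of `h` are rational directions. -/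
theorem card_rationalDirection_mul (h1S : (1 : ZMod N) ∈ S) 
    (hφ : IsLocallyQuadraticOn (bohrSet S σ) φ) {L M Y Z r : ℝ} (hZ : 2 ^ 24 ≤ Z) (hY : 2 ^ 12 ≤ Y)
    (hYZ : (2 * Y) ^ (3 * #S) ≤ Z) (hr : 3 * r + 1 / (2 * Y) ≤ σ) (hL : 1 ≤ L) (hLM : L ≤ M)
    {w : ℕ} (hwZ : Z ^ 40 ≤ w) (hwL : (w : ℝ) ≤ L / Z ^ 11) (hNw : N ≤ Z ^ 13 * (w * M))
    {h : ℤ} {A : Finset ℕ} (hA : A ⊆ dyadic L) (hAc : L / Y ≤ #A) {γ : ℕ → ZMod N}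
    {θ : UnitAddCircle} (hbohr : ∀ l ∈ A, bohrNorm S ((h : ZMod N) * l) < r)
    (hγ : ∀ l ∈ A, γ l ∈ charApprox S (1 / Y) (fun u => secondDiff φ u (h * l)))
    (hθ : ∀ l ∈ A, ‖charVal (γ l) l - θ‖ ≤ Y / M) :
    w / (2 * Z ^ 2) ≤ #{k ∈ Icc (-(w : ℤ)) w |
      ∃ q : ℕ, 0 < q ∧ (q : ℝ) ≤ Z ^ 24 ∧ RationalDirection S φ Z r q ((k * h : ℤ) : ZMod N)} := by
  have hs : 1 ≤ #S := card_pos.2 ⟨1, h1S⟩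
  have hZ1 : 1 ≤ Z := le_trans (by norm_num) hZ
  have hZ0 : 0 < Z := by linarith
  have hY0 : 0 < Y := lt_of_lt_of_le (by norm_num) hY
  have hM0 : 0 < M := by linarith
  have hpow : ∀ i j : ℕ, i ≤ j → Z ^ i ≤ Z ^ j := fun i j hij => pow_le_pow_right₀ hZ1 hij
  have hw0' : (0 : ℝ) < w := lt_of_lt_of_le (by positivity) hwZ
  have hw0 : 0 < w := by exact_mod_cast hw0'
  have hY3 : (2 * Y) ^ 3 ≤ Z := le_trans (pow_le_pow_right₀ (by linarith) (by omega)) hYZ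
  have hY4 : 4 * Y ≤ Z := by
    refine le_trans ?_ hY3
    have : 1 ≤ Y ^ 2 := one_le_pow₀ (by linarith)
    nlinarith
  have hYsq : 3 * Y ≤ Z := by linarith
  have hwL' : (w : ℝ) ≤ L := hwL.trans (div_le_self (by linarith) (one_le_pow₀ hZ1))
  obtain ⟨z, hz⟩ := exists_dense_block hL hY0 hA hAc hw0 hwL'
  set I := {i ∈ range w | z + i • (1 : ℤ) ∈ A.image (Nat.cast : ℕ → ℤ)} with hI
  have hIA : ∀ i ∈ I, ∃ l ∈ A, (l : ℤ) = z + i ∧ i < w := by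
    intro i hi
    obtain ⟨hi1, hi2⟩ := mem_filter.1 hi
    obtain ⟨l, hl, hli⟩ := mem_image.1 hi2
    exact ⟨l, hl, by simpa using hli, mem_range.1 hi1⟩
  set G : Finset (ℤ × ZMod N) := I.image fun i : ℕ => (z + (i : ℤ), γ (z + (i : ℤ)).toNat) with hG
  have hGc : #G = #I := card_image_of_injOn fun i _ j _ hij => by
    have := congrArg Prod.fst hij
    simpa using this
  have hGA : ∀ g ∈ G, ∃ l ∈ A, g = ((l : ℤ), γ l) ∧ z ≤ l ∧ (l : ℤ) < z + w := by
    intro g hg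
    obtain ⟨i, hi, rfl⟩ := mem_image.1 hg
    obtain ⟨l, hl, hli, hiw⟩ := hIA i hi
    refine ⟨l, hl, ?_, by omega, by omega⟩
    rw [← hli, Int.toNat_natCast]
  set D : Finset (ℤ × ZMod N) := {d ∈ Icc (-(w : ℤ)) w ×ˢ univ |
    bohrNorm S ((d.1 * h : ℤ) : ZMod N) < 2 * r ∧
    d.2 ∈ charApprox S (1 / (2 * Y)) (fun u => secondDiff φ u ((d.1 * h : ℤ) : ZMod N))} with hD
  have hGD : ∀ x ∈ G, ∀ y ∈ G, x - y ∈ D := by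
    intro x hx y hy
    obtain ⟨l, hl, rfl, hl1, hl2⟩ := hGA x hx
    obtain ⟨l', hl', rfl, hl1', hl2'⟩ := hGA y hy
    have e1 : ((((l : ℤ) - l') * h : ℤ) : ZMod N) = (h : ZMod N) * l - h * l' := by
      push_cast; ring
    simp only [hD, mem_filter, mem_product, mem_Icc, mem_univ, and_true, Prod.mk_sub_mk]
    rw [e1]
    refine ⟨by omega, ?_, ?_⟩
    · refine (bohrNorm_sub_le _ _).trans_lt ?_
      linarith [hbohr l hl, hbohr l' hl']
    · exact sub_mem_charApprox hφ hY0 hr (hbohr l hl) (hbohr l' hl') (hγ l hl) (hγ l' hl')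
  have hDf : ∀ k, (#{d ∈ D | d.1 = k} : ℝ) ≤ Z := by
    intro k
    refine le_trans ?_ (((card_charApprox_le_pow (S := S) (Y := 2 * Y) (by linarith) hs
      (fun u => secondDiff φ u ((k * h : ℤ) : ZMod N)))).trans hYZ)
    norm_cast
    refine card_le_card_of_injOn Prod.snd (fun d hd => ?_) fun d hd d' hd' hdd => ?_
    · obtain ⟨hd1, rfl⟩ := mem_filter.1 hd
      simpa using (mem_filter.1 hd1).2.2
    · rw [mem_coe, mem_filter] at hd hd'
      exact Prod.ext (hd.2.trans hd'.2.symm) hdd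
  have hDP : ∀ d ∈ D, |(d.1 : ℝ)| ≤ (w : ℝ) := by
    intro d hd
    obtain ⟨h1, -⟩ := mem_filter.1 hd
    rw [mem_product, mem_Icc] at h1
    have h2 : |d.1| ≤ (w : ℤ) := abs_le.2 h1.1
    exact_mod_cast h2
  have hDc : (#D : ℝ) ≤ 3 * w * Z := by
    have h1 := card_eq_sum_card_fiberwise (f := Prod.fst) (s := D) (t := Icc (-(w : ℤ)) w)
      fun d hd => (mem_product.1 (mem_filter.1 hd).1).1
    rw [h1]; push_cast
    calc ∑ k ∈ Icc (-(w : ℤ)) w, (#{d ∈ D | d.1 = k} : ℝ) ≤ ∑ _k ∈ Icc (-(w : ℤ)) w, Z :=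
          sum_le_sum fun k _ => hDf k
      _ = #(Icc (-(w : ℤ)) w) * Z := by rw [sum_const, nsmul_eq_mul]
      _ ≤ 3 * w * Z := by
          gcongr
          apply card_Icc_int_le (by positivity)
          have : (1 : ℝ) ≤ w := by exact_mod_cast hw0
          push_cast; linarith
  have hε : 768 * (w : ℝ) * (Y / M) * Z ^ 9 ≤ 1 := by
    rw [mul_div_assoc', div_mul_eq_mul_div, div_le_one hM0]
    calc 768 * (w : ℝ) * Y * Z ^ 9 ≤ 768 * (L / Z ^ 11) * Y * Z ^ 9 := by gcongr
      _ = 768 * Y * L / Z ^ 2 := by field_simp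
      _ ≤ Z * Z * L / Z ^ 2 := by gcongr; linarith; linarith
      _ = L := by field_simp
      _ ≤ M := hLM
  have hGθ : ∀ g ∈ G, ‖charVal g.2 (g.1 : ZMod N) - θ‖ ≤ Y / M := by
    intro g hg
    obtain ⟨l, hl, rfl, -, -⟩ := hGA g hg
    simpa using hθ l hl
  have hmain := card_nearly_rational_differences (D := D) hZ hwZ hGθ (by
    rw [hGc]; refine le_trans ?_ hz
    exact div_le_div_of_nonneg_left hw0'.le (by positivity) hYsq) hGD hDP hDf hDc hε (by positivity)
  refine hmain.trans (Nat.cast_le.2 (card_le_card fun k hk => ?_))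
  obtain ⟨-, ρ, hρD, q, hq, hqle, hqρ⟩ := mem_filter.1 hk
  obtain ⟨h1, h2, h3⟩ := mem_filter.1 hρD
  rw [mem_filter]
  refine ⟨(mem_product.1 h1).1, q, hq, hqle, ?_⟩
  refine rationalDirection_of_charApprox h1S hZ hY4 hY0 hqle h3 hqρ ?_ h2
  rw [mul_div_assoc', div_le_iff₀ hw0']
  calc (N : ℝ) * (Z ^ 47 * (Y / M)) ≤ Z ^ 13 * (w * M) * (Z ^ 47 * (Z / M)) := by
        gcongr; linarith
    _ = Z ^ 61 * w := by field_simp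

end RationalDirections

section Directions

variable {N : ℕ} [NeZero N] {S : Finset (ZMod N)} {σ : ℝ} {φ : ZMod N → UnitAddCircle}

open Classical in
/-- A version of `card_sq_le_card_products` for signed factors, with products taken in `ℤ/Nℤ`. -/
lemma card_sq_le_card_products_zmod (P M : ℕ) (A : Finset (ℤ × ℤ))
    (hA : ∀ x ∈ A, x.1 ≠ 0 ∧ |x.1| ≤ P ∧ x.2 ≠ 0 ∧ |x.2| ≤ M) (hPM : 2 * (P * M) < N) :
    (#A : ℝ) ^ 2 ≤ 16 * (#(A.image fun x => ((x.1 * x.2 : ℤ) : ZMod N)) *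
      (P * M * (1 + Real.log P) ^ 2)) := by
  set B : Finset (ℕ × ℕ) := A.image fun x => (x.1.natAbs, x.2.natAbs) with hB
  have hAB : #A ≤ 4 * #B := by
    refine card_le_mul_card_image A 4 fun b _ => ?_
    have hsub : {a ∈ A | (a.1.natAbs, a.2.natAbs) = b} ⊆
        ({(b.1 : ℤ), -(b.1 : ℤ)} : Finset ℤ) ×ˢ ({(b.2 : ℤ), -(b.2 : ℤ)} : Finset ℤ) := by
      intro a ha
      obtain ⟨-, rfl⟩ := mem_filter.1 ha
      simp only [mem_product, mem_insert, mem_singleton]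
      exact ⟨Int.natAbs_eq _, Int.natAbs_eq _⟩
    refine (card_le_card hsub).trans ?_
    rw [card_product]
    exact Nat.mul_le_mul (card_le_two) (card_le_two)
  have hBp := card_sq_le_card_products P M B (by
    intro x hx
    obtain ⟨a, ha, rfl⟩ := mem_image.1 hx
    obtain ⟨h1, h2, h3, h4⟩ := hA a ha
    rw [Int.abs_eq_natAbs] at h2 h4
    dsimp only
    omega)
  have himg : #(B.image fun x => x.1 * x.2) ≤ #(A.image fun x => ((x.1 * x.2 : ℤ) : ZMod N)) := by
    have h1 : B.image (fun x => x.1 * x.2) =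
        (A.image fun x => ((x.1 * x.2 : ℤ) : ZMod N)).image fun y => y.valMinAbs.natAbs := by
      rw [hB, image_image, image_image]
      refine image_congr fun a ha => ?_
      obtain ⟨-, h2, -, h4⟩ := hA a ha
      have h5 : |a.1 * a.2| ≤ P * M := by
        rw [abs_mul]; exact mul_le_mul h2 h4 (abs_nonneg _) (by positivity)
      have h6 : ((a.1 * a.2 : ℤ) : ZMod N).valMinAbs = a.1 * a.2 := by
        rw [ZMod.valMinAbs_spec]
        refine ⟨rfl, ?_⟩
        rw [abs_le] at h5
        rw [Set.mem_Ioc]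
        zify at hPM
        constructor <;> linarith
      simp only [Function.comp]
      rw [h6, Int.natAbs_mul]
    rw [h1]
    exact card_image_le
  calc (#A : ℝ) ^ 2 ≤ (4 * #B) ^ 2 := by gcongr; exact_mod_cast hAB
    _ = 16 * (#B : ℝ) ^ 2 := by ring
    _ ≤ 16 * (#(B.image fun x => x.1 * x.2) * (P * M * (1 + Real.log P) ^ 2)) := by gcongr
    _ ≤ _ := by gcongr

open Classical in
lemma mul_card_le_card_filter_product {α β : Type*} (K : Finset α) (H : Finset β)
    (p : α → β → Prop) {c : ℝ} (h : ∀ y ∈ H, c ≤ #{x ∈ K | p x y}) :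
    #H * c ≤ #{x ∈ K ×ˢ H | p x.1 x.2} := by
  have h1 : (#{x ∈ K ×ˢ H | p x.1 x.2} : ℝ) = ∑ y ∈ H, (#{x ∈ K | p x y} : ℝ) := by
    simp_rw [card_filter]
    push_cast
    rw [sum_product_right]
  rw [h1, ← nsmul_eq_mul, ← sum_const]
  exact sum_le_sum h

open Classical in
/-- The rational directions found for the popular shifts `h` form a dense subset of `ℤ/Nℤ`, since
an integer has few factorisations on average. -/
theorem exists_dense_rationalDirection {M Z r : ℝ} {w : ℕ} (hZ : 2 ^ 24 ≤ Z)
    (hwZ : Z ^ 40 ≤ w) (hM : 2 * Z ≤ M) (hNw : N ≤ Z ^ 13 * (w * M)) (hwM : 2 * (w * M) < N)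
    (hlog : Real.log N ≤ Z) {H : Finset ℤ} (hHM : ∀ h ∈ H, |(h : ℝ)| ≤ M) (hHc : M / Z ≤ #H)
    (hH : ∀ h ∈ H, w / (2 * Z ^ 2) ≤ #{k ∈ Icc (-(w : ℤ)) w |
      ∃ q : ℕ, 0 < q ∧ (q : ℝ) ≤ Z ^ 24 ∧ RationalDirection S φ Z r q ((k * h : ℤ) : ZMod N)}) :
    ∃ q : ℕ, 0 < q ∧ (q : ℝ) ≤ Z ^ 24 ∧ ∃ V : Finset (ZMod N), N / Z ^ 72 ≤ #V ∧
      ∀ y ∈ V, RationalDirection S φ Z r q y := by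
  have hZ1 : 1 ≤ Z := le_trans (by norm_num) hZ
  have hZ0 : 0 < Z := by linarith
  have hM0 : 0 < M := by linarith
  have hpow : ∀ i j : ℕ, i ≤ j → Z ^ i ≤ Z ^ j := fun i j hij => pow_le_pow_right₀ hZ1 hij
  have hw0 : (0 : ℝ) < w := lt_of_lt_of_le (by positivity) hwZ
  have hw2 : 4 * Z ^ 2 ≤ w := by
    refine le_trans ?_ hwZ
    calc 4 * Z ^ 2 ≤ Z * Z ^ 2 := by gcongr; linarith
      _ = Z ^ 3 := by ring
      _ ≤ Z ^ 40 := hpow _ _ (by norm_num)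
  set p : ℤ → ℤ → ℕ → Prop := fun k h q => RationalDirection S φ Z r q ((k * h : ℤ) : ZMod N) with hp
  set p' : ℤ → ℤ → Prop := fun k h =>
    ∃ q : ℕ, 0 < q ∧ (q : ℝ) ≤ Z ^ 24 ∧ RationalDirection S φ Z r q ((k * h : ℤ) : ZMod N) with hp'
  set K := Icc (-(w : ℤ)) w with hK
  have hcount := mul_card_le_card_filter_product (K.erase 0) (H.erase 0) p' (c := w / (4 * Z ^ 2)) (by
    intro h hh
    have h1 : w / (2 * Z ^ 2) ≤ (#{k ∈ K | p' k h} : ℝ) := hH h (mem_of_mem_erase hh)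
    have h2 : #{k ∈ K | p' k h} ≤ #{k ∈ K.erase 0 | p' k h} + 1 := by
      have h3 : {k ∈ K | p' k h} ⊆ insert 0 {k ∈ K.erase 0 | p' k h} := by
        intro k hk
        obtain ⟨hk1, hk2⟩ := mem_filter.1 hk
        rw [mem_insert, mem_filter, mem_erase]
        tauto
      exact (card_le_card h3).trans (card_insert_le _ _)
    have h4 : (#{k ∈ K | p' k h} : ℝ) ≤ #{k ∈ K.erase 0 | p' k h} + 1 := by exact_mod_cast h2
    have h5 : 1 ≤ w / (4 * Z ^ 2) := by rw [le_div_iff₀ (by positivity)]; linarith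
    have h6 : w / (2 * Z ^ 2) = w / (4 * Z ^ 2) + w / (4 * Z ^ 2) := by field_simp; norm_num
    linarith)
  have hHc' : M / (2 * Z) ≤ #(H.erase 0) := by
    have h1 : (#H : ℝ) ≤ #(H.erase 0) + 1 := by
      have := pred_card_le_card_erase (s := H) (a := 0)
      exact_mod_cast (by omega : #H ≤ #(H.erase 0) + 1)
    have h2 : 1 ≤ M / (2 * Z) := by rw [le_div_iff₀ (by positivity)]; linarith
    have h3 : M / Z = M / (2 * Z) + M / (2 * Z) := by field_simp; norm_num
    linarith
  set Pairs := {x ∈ K.erase 0 ×ˢ H.erase 0 | p' x.1 x.2} with hPairs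
  have hPc : w * M / Z ^ 4 ≤ #Pairs := by
    refine le_trans ?_ hcount
    refine le_trans ?_ (mul_le_mul_of_nonneg_right hHc' (by positivity))
    rw [div_mul_div_comm, mul_comm (w : ℝ) M]
    refine div_le_div_of_nonneg_left (by positivity) (by positivity) ?_
    calc 2 * Z * (4 * Z ^ 2) = 8 * Z ^ 3 := by ring
      _ ≤ Z * Z ^ 3 := by gcongr; linarith
      _ = Z ^ 4 := by ring
  have hPne : Pairs.Nonempty := nonempty_of_lt_of_le_card (by positivity) hPc
  obtain ⟨q, hq, hqle, hqc⟩ := exists_popular_denominator hPne (Q := Z ^ 24)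
    (p := fun x q => p x.1 x.2 q) (by
      intro x hx
      exact (mem_filter.1 hx).2)
  set Pq := {x ∈ Pairs | p x.1 x.2 q} with hPq
  have hPqc : w * M / Z ^ 28 ≤ #Pq := by
    have hqc' : (#Pairs : ℝ) ≤ Z ^ 24 * #Pq := hqc
    have h1 := hPc.trans hqc'
    rw [div_le_iff₀ (by positivity)] at h1 ⊢
    refine h1.trans (le_of_eq ?_)
    ring
  refine ⟨q, hq, hqle, Pq.image fun x => ((x.1 * x.2 : ℤ) : ZMod N), ?_, ?_⟩
  · have hflo : (⌊M⌋₊ : ℝ) ≤ M := Nat.floor_le hM0.le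
    have hwM' : 2 * (w * ⌊M⌋₊) < N := by
      have : 2 * ((w : ℝ) * ⌊M⌋₊) < N := lt_of_le_of_lt (by gcongr) hwM
      exact_mod_cast this
    have h1 := card_sq_le_card_products_zmod (N := N) w ⌊M⌋₊ Pq (by
      intro x hx
      obtain ⟨h1, -⟩ := mem_filter.1 (mem_filter.1 hx).1
      rw [mem_product, mem_erase, mem_erase] at h1
      refine ⟨h1.1.1, abs_le.2 (mem_Icc.1 h1.1.2), h1.2.1, ?_⟩
      have h2 := hHM _ h1.2.2
      have h3 : ((x.2.natAbs : ℕ) : ℝ) = |(x.2 : ℝ)| := by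
        rw [Nat.cast_natAbs, Int.cast_abs]
      rw [Int.abs_eq_natAbs]
      rw [← h3] at h2
      exact_mod_cast Nat.le_floor h2) hwM'
    set c := #(Pq.image fun x => ((x.1 * x.2 : ℤ) : ZMod N)) with hc
    have hw1 : (1 : ℝ) ≤ w := by
      have : 0 < w := by exact_mod_cast hw0
      exact_mod_cast this
    have hlogw : Real.log w ≤ Z := by
      refine le_trans (Real.log_le_log hw0 ?_) hlog
      have : (w : ℝ) * 1 ≤ w * M := by gcongr; linarith
      have : 0 ≤ (w : ℝ) * M := by positivity
      linarith
    have hlog0 : 0 ≤ Real.log w := Real.log_nonneg hw1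
    have h2 : (w * M / Z ^ 28) ^ 2 ≤ Z ^ 3 * (c * (w * M)) := by
      calc (w * M / Z ^ 28) ^ 2 ≤ (#Pq : ℝ) ^ 2 := by gcongr
        _ ≤ _ := h1
        _ ≤ 16 * (c * (w * M * (2 * Z) ^ 2)) := by
            gcongr
            linarith
        _ = 64 * Z ^ 2 * (c * (w * M)) := by ring
        _ ≤ Z * Z ^ 2 * (c * (w * M)) := by gcongr; linarith
        _ = _ := by ring
    have h3 : w * M * (w * M) ≤ w * M * (Z ^ 59 * c) := by
      rw [div_pow, div_le_iff₀ (by positivity)] at h2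
      calc w * M * (w * M) = (w * M) ^ 2 := by ring
        _ ≤ _ := h2
        _ = _ := by ring
    have h4 := le_of_mul_le_mul_left h3 (by positivity)
    rw [div_le_iff₀ (by positivity)]
    calc (N : ℝ) ≤ Z ^ 13 * (w * M) := hNw
      _ ≤ Z ^ 13 * (Z ^ 59 * c) := by gcongr
      _ = _ := by ring
  · intro y hy
    obtain ⟨x, hx, rfl⟩ := mem_image.1 hy
    exact (mem_filter.1 hx).2

open Classical in
/-- A dense set of rational directions makes each value of `φ''` near `0` rational. -/
lemma exists_denominator_of_dense_rationalDirection (h1S : (1 : ZMod N) ∈ S)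
    (hφ : IsLocallyQuadraticOn (bohrSet S σ) φ)
    {Z r : ℝ} (hZ : 2 ^ 24 ≤ Z) (hr : 6 * r + 1 / Z ≤ σ) (hZσ : 4 / Z ≤ σ) {q : ℕ} {V : Finset (ZMod N)}
    (hr0 : 0 < r) (hVc : N / Z ^ 72 ≤ #V)
    (hV : ∀ y ∈ V, RationalDirection S φ Z r q y) {a b : ZMod N}
    (ha : bohrNorm S a < 1 / Z ^ 136) (hb : bohrNorm S b < 1 / Z ^ 136) :
    ∃ q' : ℕ, 0 < q' ∧ (q' : ℝ) ≤ Z ^ 73 ∧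
      ‖(q' * q) • secondDiff φ a b‖ ≤ Z ^ 208 * (bohrNorm S a * bohrNorm S b) := by
  have hZ1 : 1 ≤ Z := le_trans (by norm_num) hZ
  have hZ0 : 0 < Z := by linarith
  have hN : (0 : ℝ) < N := by exact_mod_cast Nat.pos_of_ne_zero (NeZero.ne N)
  have hpow : ∀ i j : ℕ, i ≤ j → Z ^ i ≤ Z ^ j := fun i j hij => pow_le_pow_right₀ hZ1 hij
  have ha0 := bohrNorm_nonneg (S := S) a
  have hb0 := bohrNorm_nonneg (S := S) b
  have haZ : bohrNorm S a < 1 / Z := by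
    refine ha.trans_le ?_
    have := one_div_pow_le hZ1 (i := 1) (j := 136) (by norm_num)
    rwa [pow_one] at this
  -- the value is additive in the second variable
  have hadd : LocAdd S (3 / Z) (fun b => secondDiff φ a b) :=
    hφ.locAdd_right (by positivity) (by
      have : 3 / Z + 1 / Z = 4 / Z := by ring
      linarith)
  have hadd' : LocAdd S (6 * r) (fun b => secondDiff φ a b) :=
    hφ.locAdd_right (by positivity) (by linarith)
  rcases hb0.eq_or_lt with hb0' | hb0'
  · refine ⟨1, one_pos, by push_cast; exact one_le_pow₀ hZ1, ?_⟩
    have h1 : secondDiff φ a b = 0 := by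
      rw [eq_zero_of_bohrNorm_eq_zero h1S hb0'.symm]
      exact hadd.zero (by positivity)
    rw [h1, smul_zero, norm_zero]
    positivity
  set w := ⌊1 / Z / bohrNorm S b⌋₊ with hw
  have hx : Z ^ 135 ≤ 1 / Z / bohrNorm S b := by
    rw [le_div_iff₀ hb0', le_div_iff₀ hZ0]
    rw [lt_div_iff₀ (by positivity)] at hb
    calc Z ^ 135 * bohrNorm S b * Z = bohrNorm S b * Z ^ 136 := by ring
      _ ≤ 1 := hb.le
  have hx1 : 1 ≤ 1 / Z / bohrNorm S b := (one_le_pow₀ hZ1).trans hx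
  have hwlo := half_le_floor hx1
  have hwhi := Nat.floor_le (a := 1 / Z / bohrNorm S b) (by positivity)
  rw [← hw] at hwlo hwhi
  have hw0' : (0 : ℝ) < w := by linarith
  have hw0 : 0 < w := by exact_mod_cast hw0'
  have hwZ : Z ^ 134 ≤ w := by
    calc Z ^ 134 ≤ Z ^ 135 / 2 := by
          rw [le_div_iff₀ two_pos, pow_succ Z 134]
          exact mul_le_mul_of_nonneg_left (by linarith) (by positivity)
      _ ≤ _ := by linarith
  have hwb : w * bohrNorm S b ≤ 1 / Z := by
    rw [le_div_iff₀ hb0'] at hwhi; exact hwhi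
  have hVne : V.Nonempty := nonempty_of_lt_of_le_card (by positivity) hVc
  obtain ⟨z, -, hz⟩ := exists_translate_card V univ b w hw0 hVne fun _ _ _ _ => mem_univ _
  set I := {i ∈ range w | z + i • b ∈ V} with hI
  have hIc : 1 / Z ^ 72 * w ≤ #I := by
    rw [card_univ, ZMod.card] at hz
    have hz' : (w : ℝ) * #V ≤ N * #I := by exact_mod_cast hz
    have h1 : (w : ℝ) * (N / Z ^ 72) ≤ w * #V := by gcongr
    have h2 : N * (1 / Z ^ 72 * w) ≤ N * #I := by
      refine le_trans (le_of_eq ?_) (h1.trans hz'); ring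
    exact le_of_mul_le_mul_left h2 hN
  have hIne : I.Nonempty := nonempty_of_lt_of_le_card (by positivity) hIc
  obtain ⟨i₀, hi₀⟩ := hIne
  set A : Finset ℤ := I.image fun i : ℕ => (i : ℤ) - i₀ with hA
  have hAc : #A = #I := card_image_of_injective _ fun i j hij => by simpa using hij
  have hAw : ∀ t ∈ A, |(t : ℝ)| ≤ w := by
    intro t ht
    obtain ⟨i, hi, rfl⟩ := mem_image.1 ht
    have h1 := mem_range.1 (mem_filter.1 hi).1
    have h2 := mem_range.1 (mem_filter.1 hi₀).1
    have h3 : |(i : ℤ) - i₀| ≤ (w : ℤ) := abs_le.2 ⟨by omega, by omega⟩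
    exact_mod_cast h3
  obtain ⟨q', hq', hq'le, hq'n⟩ := exists_denominator_of_dense (A := A) (J := w)
    (η := 1 / Z ^ 72) (ε := 2 * (Z ^ 62 * bohrNorm S a)) (θ := q • secondDiff φ a b) hAw (by positivity)
    (by rw [div_le_one (by positivity)]; exact one_le_pow₀ hZ1) (by rw [hAc]; exact hIc) (by
      rw [one_div_mul_eq_div, le_div_iff₀ (by positivity)]
      refine le_trans ?_ hwZ
      calc 64 * Z ^ 72 ≤ Z * Z ^ 72 := by gcongr; linarith
        _ = Z ^ 73 := by ring
        _ ≤ Z ^ 134 := hpow _ _ (by norm_num)) (by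
      rw [div_div, le_div_iff₀ (by positivity)]
      rw [lt_div_iff₀ (by positivity)] at ha
      calc 2 * (Z ^ 62 * bohrNorm S a) * (Z ^ 72 * 64) = 128 * (bohrNorm S a * Z ^ 134) := by ring
        _ ≤ Z * (bohrNorm S a * Z ^ 134) := by gcongr; linarith
        _ = bohrNorm S a * Z ^ 135 := by ring
        _ ≤ bohrNorm S a * Z ^ 136 := mul_le_mul_of_nonneg_left (hpow _ _ (by norm_num)) ha0
        _ ≤ 1 := ha.le) (by
      intro t ht
      obtain ⟨i, hi, rfl⟩ := mem_image.1 ht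
      have hiV := hV _ (mem_filter.1 hi).2
      have hi₀V := hV _ (mem_filter.1 hi₀).2
      have h1 : ((i : ℤ) - i₀) • b = (z + i • b) - (z + i₀ • b) := by
        rw [sub_smul, natCast_zsmul, natCast_zsmul]; abel
      have h2 := hadd'.sub (x := z + i • b) (y := z + i₀ • b) (by linarith [hiV.1, hi₀V.1])
      rw [← h1] at h2
      have ht' := hAw _ ht
      have hZ3 : 2 * (|((((i : ℤ) - i₀ : ℤ)) : ℝ)| * bohrNorm S b) < 3 / Z := by
        have : |((((i : ℤ) - i₀ : ℤ)) : ℝ)| * bohrNorm S b ≤ 1 / Z :=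
          (mul_le_mul_of_nonneg_right ht' hb0).trans hwb
        have h3 : 3 / Z = 1 / Z + 1 / Z + 1 / Z := by ring
        have : 0 < 1 / Z := by positivity
        linarith
      have h3 := hadd.zsmul (x := b) ((i : ℤ) - i₀) hZ3
      have h4 : ((i : ℤ) - i₀) • secondDiff φ a b
          = secondDiff φ a (z + i • b) - secondDiff φ a (z + i₀ • b) := h3.symm.trans h2
      rw [smul_comm, h4, smul_sub]
      refine (norm_sub_le _ _).trans ?_
      linarith [hiV.2 a haZ, hi₀V.2 a haZ])
  refine ⟨q', hq', hq'le.trans ?_, ?_⟩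
  · calc 8 / (1 / Z ^ 72) = 8 * Z ^ 72 := by field_simp
      _ ≤ Z * Z ^ 72 := by gcongr; linarith
      _ = _ := by ring
  · rw [mul_smul]
    refine hq'n.trans ?_
    have h1 : 1 / w ≤ 2 * Z * bohrNorm S b := by
      rw [div_le_iff₀ hw0']
      rw [div_div, div_div, div_le_iff₀ (by positivity)] at hwlo
      linarith
    calc 144 * (2 * (Z ^ 62 * bohrNorm S a)) / ((1 / Z ^ 72) ^ 2 * w)
        = 288 * Z ^ 206 * bohrNorm S a * (1 / w) := by field_simp; norm_num; ring
      _ ≤ 288 * Z ^ 206 * bohrNorm S a * (2 * Z * bohrNorm S b) := by gcongr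
      _ = 576 * (Z ^ 207 * (bohrNorm S a * bohrNorm S b)) := by ring
      _ ≤ Z * (Z ^ 207 * (bohrNorm S a * bohrNorm S b)) := by gcongr; linarith
      _ = _ := by ring

lemma four_mul_cube_mul_le {q Q W u x y : ℝ} (hx : 0 ≤ x) (hy : 0 ≤ y) (hxu : x ≤ u) (hyu : y ≤ u)
    (hW : 0 ≤ W) (hq : 0 ≤ q) (hqQ : q ≤ Q) (h : 4 * Q ^ 3 * (W * (u * u)) ≤ 1) :
    4 * q ^ 3 * (W * (x * y)) ≤ 1 := by
  refine le_trans ?_ h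
  have hu : 0 ≤ u := hx.trans hxu
  have hQ : 0 ≤ Q := hq.trans hqQ
  gcongr

/-- A dense set of rational directions makes `φ''` rational near `0`, with one denominator. -/
theorem exists_uniform_denominator_of_dense_rationalDirection (h1S : (1 : ZMod N) ∈ S)
    (hφ : IsLocallyQuadraticOn (bohrSet S σ) φ) {Z r : ℝ} (hZ : 2 ^ 24 ≤ Z) (hr : 6 * r + 1 / Z ≤ σ)
    (hZσ : 4 / Z ≤ σ) {q : ℕ} {V : Finset (ZMod N)} (hr0 : 0 < r) (hVc : N / Z ^ 72 ≤ #V)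
    (hq : 0 < q) (hqle : (q : ℝ) ≤ Z ^ 24)
    (hV : ∀ y ∈ V, RationalDirection S φ Z r q y) :
    ∃ q' : ℕ, 0 < q' ∧ (q' : ℝ) ≤ Z ^ 388 ∧ ∀ a b, bohrNorm S a < 1 / Z ^ 254 →
      bohrNorm S b < 1 / Z ^ 254 →
      ‖q' • secondDiff φ a b‖ ≤ Z ^ 600 * (bohrNorm S a * bohrNorm S b) := by
  have hZ1 : 1 ≤ Z := le_trans (by norm_num) hZ
  have hZ0 : 0 < Z := by linarith
  have hpow : ∀ i j : ℕ, i ≤ j → Z ^ i ≤ Z ^ j := fun i j hij => pow_le_pow_right₀ hZ1 hij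
  set Q := ⌊Z ^ 97⌋₊ with hQ
  have hQle : (Q : ℝ) ≤ Z ^ 97 := Nat.floor_le (by positivity)
  set t := ⌊Z⌋₊ + 1 with ht
  have htZ : Z < t := by rw [ht]; push_cast; exact Nat.lt_floor_add_one Z
  have htle : (t : ℝ) ≤ Z + 1 := by
    rw [ht]; push_cast; linarith [Nat.floor_le hZ0.le]
  set T := 400 * t with hT
  have hTle : (T : ℝ) ≤ Z ^ 2 := by
    rw [hT]; push_cast
    calc 400 * (t : ℝ) ≤ 400 * (Z + 1) := by gcongr
      _ ≤ 800 * Z := by linarith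
      _ ≤ Z * Z := by gcongr; linarith
      _ = _ := by ring
  have hT0 : (0 : ℝ) < T := by rw [hT, ht]; positivity
  have hQT : Q ^ 4 < 2 ^ T := by
    have h1 : (Q : ℝ) ^ 4 < 2 ^ T := by
      calc (Q : ℝ) ^ 4 ≤ (Z ^ 97) ^ 4 := by gcongr
        _ = Z ^ 388 := by rw [← pow_mul]
        _ ≤ Z ^ 400 := hpow _ _ (by norm_num)
        _ < (t : ℝ) ^ 400 := pow_lt_pow_left₀ htZ hZ0.le (by norm_num)
        _ ≤ (2 ^ t) ^ 400 := by
            gcongr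
            exact_mod_cast Nat.lt_two_pow_self.le
        _ = 2 ^ T := by rw [← pow_mul, hT, mul_comm]
    exact_mod_cast h1
  have hZn : ∀ n : ℕ, 0 < Z ^ n := fun n => pow_pos hZ0 n
  have hZi : ∀ n : ℕ, 0 < 1 / Z ^ n := fun n => one_div_pos.2 (hZn n)
  have hrad : 1 / Z ^ 252 ≤ 1 / Z := by
    have := one_div_pow_le hZ1 (i := 1) (j := 252) (by norm_num)
    rwa [pow_one] at this
  have h4 : 4 / Z = 1 / Z + 1 / Z + 2 / Z := by ring
  have hZp : 0 < 2 / Z := by positivity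
  obtain ⟨q', hq', hq'le, hq'n⟩ := exists_uniform_denominator (S := S) (ra := 1 / Z ^ 252)
    (rb := 1 / Z ^ 252) (hZi _) (hZi _) (χ := fun a b => secondDiff φ a b)
    (fun b hb => hφ.locAdd (hZi _) (by linarith))
    (fun a ha => hφ.locAdd_right (hZi _) (by linarith)) hQT
    (g := fun a b => Z ^ 208 * (bohrNorm S a * bohrNorm S b)) (by
      intro a b ha hb
      have ha0 := bohrNorm_nonneg (S := S) a
      have hb0 := bohrNorm_nonneg (S := S) b
      refine four_mul_cube_mul_le ha0 hb0 ha.le hb.le (hZn _).le (Nat.cast_nonneg _) hQle ?_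
      calc 4 * (Z ^ 97) ^ 3 * (Z ^ 208 * (1 / Z ^ 252 * (1 / Z ^ 252)))
          = 4 / Z ^ 5 := by
            rw [one_div_mul_one_div, mul_one_div, mul_div_assoc', div_eq_div_iff (mul_pos (hZn _) (hZn _)).ne' (hZn _).ne']
            ring
        _ ≤ 1 := by
          rw [div_le_one (hZn _)]
          calc 4 ≤ Z ^ 1 := by rw [pow_one]; linarith
            _ ≤ Z ^ 5 := hpow _ _ (by norm_num)) (by
      intro a b ha hb
      have hle : 1 / Z ^ 252 ≤ 1 / Z ^ 136 := one_div_pow_le hZ1 (by norm_num)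
      obtain ⟨q', hq', hq'le, hq'n⟩ := exists_denominator_of_dense_rationalDirection h1S hφ hZ hr hZσ hr0
        hVc hV (ha.trans_le hle) (hb.trans_le hle)
      refine ⟨q' * q, Nat.mul_pos hq' hq, Nat.le_floor ?_, hq'n⟩
      push_cast
      calc (q' : ℝ) * q ≤ Z ^ 73 * Z ^ 24 := mul_le_mul hq'le hqle (Nat.cast_nonneg _) (hZn _).le
        _ = Z ^ 97 := by rw [← pow_add])
  have hq'le' : (q' : ℝ) ≤ Z ^ 388 := by
    calc (q' : ℝ) ≤ (Q : ℝ) ^ 4 := by exact_mod_cast hq'le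
      _ ≤ (Z ^ 97) ^ 4 := pow_le_pow_left₀ (Nat.cast_nonneg _) hQle 4
      _ = _ := by rw [← pow_mul]
  refine ⟨q', hq', hq'le', fun a b ha hb => ?_⟩
  have hTr : 1 / Z ^ 254 ≤ 1 / Z ^ 252 / T := by
    rw [div_div]
    apply one_div_le_one_div_of_le (mul_pos (hZn _) hT0)
    calc Z ^ 252 * (T : ℝ) ≤ Z ^ 252 * Z ^ 2 := mul_le_mul_of_nonneg_left hTle (hZn _).le
      _ = _ := by rw [← pow_add]
  refine (hq'n a b (ha.trans_le hTr) (hb.trans_le hTr)).trans ?_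
  have ha0 := bohrNorm_nonneg (S := S) a
  have hb0 := bohrNorm_nonneg (S := S) b
  have hab := mul_nonneg ha0 hb0
  calc (q' : ℝ) * (Z ^ 208 * (bohrNorm S a * bohrNorm S b))
      ≤ Z ^ 388 * (Z ^ 208 * (bohrNorm S a * bohrNorm S b)) :=
        mul_le_mul_of_nonneg_right hq'le' (mul_nonneg (hZn _).le hab)
    _ = Z ^ 596 * (bohrNorm S a * bohrNorm S b) := by rw [← mul_assoc, ← pow_add]
    _ ≤ _ := mul_le_mul_of_nonneg_right (hpow _ _ (by norm_num)) hab

end Directions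

/-! ### Type II sums: rationality near the origin -/

section TypeIILocal

variable {N : ℕ} [NeZero N] {S : Finset (ZMod N)} {σ Λ : ℝ} {ψ : ZMod N → ℝ}
  {φ : ZMod N → UnitAddCircle}

omit [NeZero N] in
/-- The sum over `l, l', m, m'` of the products of four phases, written as a sum of squares. -/
lemma sum_norm_sum_dilatePair_sq (s t : Finset ℕ) :
    ((∑ l ∈ s, ∑ l' ∈ s, ‖∑ m ∈ t, dilatePair ψ φ (l : ZMod N) (l' : ZMod N) m‖ ^ 2 : ℝ) : ℂ)
      = ∑ l ∈ s, ∑ l' ∈ s, ∑ m ∈ t, ∑ m' ∈ t,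
        dilatePair ψ φ (l : ZMod N) (l' : ZMod N) m *
          conj (dilatePair ψ φ (l : ZMod N) (l' : ZMod N) m') := by
  push_cast
  refine sum_congr rfl fun l _ => sum_congr rfl fun l' _ => ?_
  rw [← Complex.ofReal_pow, ← Complex.normSq_eq_norm_sq, ← Complex.mul_conj, map_sum, sum_mul_sum]

omit [NeZero N] in
/-- The roles of the two variables of a type II sum are symmetric. -/
lemma sum_norm_sum_dilatePair_sq_comm (s t : Finset ℕ) :
    ∑ l ∈ s, ∑ l' ∈ s, ‖∑ m ∈ t, dilatePair ψ φ (l : ZMod N) (l' : ZMod N) m‖ ^ 2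
      = ∑ m ∈ t, ∑ m' ∈ t, ‖∑ l ∈ s, dilatePair ψ φ (m : ZMod N) (m' : ZMod N) l‖ ^ 2 := by
  have h : ((∑ l ∈ s, ∑ l' ∈ s, ‖∑ m ∈ t, dilatePair ψ φ (l : ZMod N) (l' : ZMod N) m‖ ^ 2 : ℝ) : ℂ)
      = ((∑ m ∈ t, ∑ m' ∈ t, ‖∑ l ∈ s, dilatePair ψ φ (m : ZMod N) (m' : ZMod N) l‖ ^ 2 : ℝ) : ℂ) := by
    rw [sum_norm_sum_dilatePair_sq, sum_norm_sum_dilatePair_sq]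
    have e1 : ∀ f : ℕ → ℕ → ℕ → ℕ → ℂ, ∑ l ∈ s, ∑ l' ∈ s, ∑ m ∈ t, ∑ m' ∈ t, f l l' m m'
        = ∑ m ∈ t, ∑ m' ∈ t, ∑ l ∈ s, ∑ l' ∈ s, f l l' m m' := by
      intro f
      have e2 := sum_comm (s := s ×ˢ s) (t := t ×ˢ t) (f := fun x y => f x.1 x.2 y.1 y.2)
      simpa only [sum_product] using e2
    rw [e1]
    refine sum_congr rfl fun m _ => sum_congr rfl fun m' _ => sum_congr rfl fun l _ =>
      sum_congr rfl fun l' _ => ?_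
    simp only [dilatePair, map_mul, Complex.conj_conj, Int.cast_natCast]
    rw [mul_comm (m : ZMod N) l, mul_comm (m : ZMod N) l', mul_comm (m' : ZMod N) l,
      mul_comm (m' : ZMod N) l']
    ring
  exact_mod_cast h

omit [NeZero N] in
/-- The type II sum as a sum of squares. -/
lemma typeII_sum_eq (L M : ℝ) :
    ∑ l ∈ Finset.Icc ⌈L⌉₊ ⌊2 * L⌋₊, ∑ l' ∈ Finset.Icc ⌈L⌉₊ ⌊2 * L⌋₊,
        ∑ m ∈ Finset.Icc ⌈M⌉₊ ⌊2 * M⌋₊, ∑ m' ∈ Finset.Icc ⌈M⌉₊ ⌊2 * M⌋₊,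
          ((ψ ((m * l : ℕ) : ZMod N) * ψ ((m' * l : ℕ) : ZMod N) *
            ψ ((m * l' : ℕ) : ZMod N) * ψ ((m' * l' : ℕ) : ZMod N) : ℝ) : ℂ) *
          e (φ ((m * l : ℕ) : ZMod N) - φ ((m' * l : ℕ) : ZMod N)
            - φ ((m * l' : ℕ) : ZMod N) + φ ((m' * l' : ℕ) : ZMod N))
      = ((∑ l ∈ dyadic L, ∑ l' ∈ dyadic L,
        ‖∑ m ∈ dyadic M, dilatePair ψ φ (l : ZMod N) (l' : ZMod N) m‖ ^ 2 : ℝ) : ℂ) := by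
  rw [sum_norm_sum_dilatePair_sq]
  refine sum_congr rfl fun l _ => sum_congr rfl fun l' _ => sum_congr rfl fun m _ =>
      sum_congr rfl fun m' _ => ?_
  simp only [dilatePair, cutPhase, map_mul, Complex.conj_conj, Complex.conj_ofReal,
    Int.cast_natCast, Nat.cast_mul]
  rw [show φ (m * l) - φ (m' * l) - φ (m * l') + φ (m' * l')
    = φ (m * l) + -φ (m' * l) + -φ (m * l') + φ (m' * l') by abel, e_add, e_add, e_add, e_neg, e_neg]
  push_cast
  ring

open Classical in
/-- A large type II sum makes `φ''` rational near the origin, with radius and constants which are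
powers of `Z`. -/
theorem exists_denominator_of_typeII_of_le (h1S : (1 : ZMod N) ∈ S) (hσ : 0 < σ) (hΛ : 0 ≤ Λ)
    (hφ : IsLocallyQuadraticOn (bohrSet S σ) φ) (hψ : IsSmoothCutoff S σ Λ ψ) {δ X Z L M : ℝ}
    (hδ : 0 < δ) (hδ1 : δ ≤ 1) (hX : 2 ^ 24 ≤ X) (hXδ : 1 / δ ≤ X) (hXσ : 1 / σ ≤ X) (hXΛ : Λ ≤ X)
    (hlog : Real.log N ≤ X) (hZ : Z = X ^ (496 * #S ^ 4)) (hL : Z ^ 52 ≤ L) (hLM : L ≤ M)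
    (hLMN : L * M ≤ N) (hNLM : δ * N ≤ L * M)
    (hsum : δ * L ^ 2 * M ^ 2 ≤ ∑ l ∈ dyadic L, ∑ l' ∈ dyadic L,
      ‖∑ m ∈ dyadic M, dilatePair ψ φ (l : ZMod N) (l' : ZMod N) m‖ ^ 2) :
    ∃ q : ℕ, 0 < q ∧ (q : ℝ) ≤ Z ^ 388 ∧ ∀ a b, bohrNorm S a < 1 / Z ^ 254 →
      bohrNorm S b < 1 / Z ^ 254 →
      ‖q • secondDiff φ a b‖ ≤ Z ^ 600 * (bohrNorm S a * bohrNorm S b) := by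
  have hs : 1 ≤ #S := card_pos.2 ⟨1, h1S⟩
  set s := #S with hsdef
  have hX1 : 1 ≤ X := le_trans (by norm_num) hX
  have hX0 : 0 < X := by linarith
  have hpow : ∀ i j : ℕ, i ≤ j → X ^ i ≤ X ^ j := fun i j hij => pow_le_pow_right₀ hX1 hij
  have hs4 : s ≤ s ^ 4 := Nat.le_self_pow (by norm_num) s
  have hs3 : s ≤ s ^ 3 := Nat.le_self_pow (by norm_num) s
  set Y := X ^ (124 * s ^ 3) with hY
  have hY0 : 0 < Y := by positivity
  have hZY : Z = Y ^ (4 * s) := by rw [hZ, hY, ← pow_mul]; congr 1; ring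
  have hXY : X ^ 2 ≤ Y := hpow _ _ (by omega)
  have hXX2 : X ≤ X ^ 2 := by nlinarith
  have hX24 : 2 ^ 24 ≤ Y := hX.trans (hXX2.trans hXY)
  have hY1 : 1 ≤ Y := le_trans (by norm_num) hX24
  have hYZ : Y ≤ Z := by
    rw [hZY]; calc Y = Y ^ 1 := (pow_one Y).symm
      _ ≤ _ := pow_le_pow_right₀ hY1 (by omega)
  have hXZ : X ≤ Z := hXX2.trans (hXY.trans hYZ)
  have hX2Z : X ^ 2 ≤ Z := hXY.trans hYZ
  have hZ24 : 2 ^ 24 ≤ Z := hX.trans hXZ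
  have hZ1 : 1 ≤ Z := hX1.trans hXZ
  have hZ0 : 0 < Z := by linarith
  have hZpow : ∀ i j : ℕ, i ≤ j → Z ^ i ≤ Z ^ j := fun i j hij => pow_le_pow_right₀ hZ1 hij
  have hYZ3 : (2 * Y) ^ (3 * s) ≤ Z := by
    rw [hZY, mul_pow, show 4 * s = s + 3 * s by ring, pow_add Y]
    refine mul_le_mul_of_nonneg_right ?_ (by positivity)
    rw [pow_mul]
    exact pow_le_pow_left₀ (by norm_num) (by linarith) s
  have hL0 : 0 < L := lt_of_lt_of_le (by positivity) hL
  have hL1 : 1 ≤ L := (one_le_pow₀ hZ1).trans hL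
  have hM0 : 0 < M := by linarith
  have hZL : Z ≤ L := by
    refine le_trans ?_ hL
    calc Z = Z ^ 1 := (pow_one Z).symm
      _ ≤ Z ^ 52 := hZpow _ _ (by norm_num)
  have hM6 : X ^ (6 * s) ≤ M := by
    refine le_trans ?_ (hZL.trans hLM)
    rw [hZ]; exact hpow _ _ (by omega)
  obtain ⟨H, hHs, hHc, hH⟩ := exists_popular_shifts h1S hσ hΛ hφ hψ hδ hδ1 hX hXδ hXσ hXΛ hL1 hM6 hsum
  rw [← hsdef, ← hY] at hHc hH
  set r : ℝ := 2 * (1 / X ^ 2) with hr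
  have hr0 : 0 < r := by positivity
  have hσX : 1 / X ≤ σ := by rw [div_le_iff₀ hσ] at hXσ; rw [div_le_iff₀ hX0]; linarith
  have hr32 : 16 * (1 / X ^ 2) ≤ 1 / X := by
    rw [mul_one_div, div_le_div_iff₀ (by positivity) hX0]
    calc 16 * X ≤ X * X := by gcongr; linarith
      _ = 1 * X ^ 2 := by ring
  have hYinv : 1 / Y ≤ 1 / X ^ 2 := one_div_le_one_div_of_le (by positivity) hXY
  have hZinv : 1 / Z ≤ 1 / X ^ 2 := one_div_le_one_div_of_le (by positivity) hX2Z
  have hX2i : 0 < 1 / X ^ 2 := by positivity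
  set w := ⌊L / Z ^ 11⌋₊ with hw
  have hLZ : Z ^ 41 ≤ L / Z ^ 11 := by
    rw [le_div_iff₀ (by positivity), ← pow_add]; exact hL
  have hwlo := half_le_floor ((one_le_pow₀ hZ1).trans hLZ)
  have hwhi : (w : ℝ) ≤ L / Z ^ 11 := Nat.floor_le (by positivity)
  rw [← hw] at hwlo
  have hwZ : Z ^ 40 ≤ w := by
    have h1 : Z ^ 40 * 2 ≤ Z ^ 41 := by
      rw [pow_succ Z 40]
      exact mul_le_mul_of_nonneg_left (by linarith) (by positivity)
    linarith
  have hNw : (N : ℝ) ≤ Z ^ 13 * (w * M) := by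
    have h1 : (N : ℝ) ≤ X * (L * M) := by
      rw [div_le_iff₀ hδ] at hXδ
      have hN0 : (0 : ℝ) ≤ N := by positivity
      calc (N : ℝ) = 1 * N := (one_mul _).symm
        _ ≤ X * δ * N := by gcongr
        _ = X * (δ * N) := by ring
        _ ≤ _ := by gcongr
    rw [div_div, div_le_iff₀ (by positivity)] at hwlo
    calc (N : ℝ) ≤ X * (L * M) := h1
      _ ≤ Z * (w * (Z ^ 11 * 2) * M) := by gcongr
      _ = 2 * (Z ^ 12 * (w * M)) := by ring
      _ ≤ Z * (Z ^ 12 * (w * M)) := by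
          refine mul_le_mul_of_nonneg_right (by linarith) (by positivity)
      _ = _ := by ring
  have hwM : 2 * (w * M) < N := by
    have h1 : (w : ℝ) * M ≤ L * M / Z ^ 11 := by
      calc (w : ℝ) * M ≤ L / Z ^ 11 * M := by gcongr
        _ = _ := by ring
    have h2 : 4 ≤ Z ^ 11 := by
      calc 4 ≤ Z ^ 1 := by rw [pow_one]; linarith
        _ ≤ _ := hZpow _ _ (by norm_num)
    have h3 : L * M / Z ^ 11 ≤ L * M / 4 := div_le_div_of_nonneg_left (by positivity) (by norm_num) h2
    have h4 : 0 < L * M := by positivity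
    linarith
  have hM2 : 2 * Z ≤ M := by
    refine le_trans ?_ (hL.trans hLM)
    calc 2 * Z ≤ Z * Z := by gcongr; linarith
      _ = Z ^ 2 := by ring
      _ ≤ _ := hZpow _ _ (by norm_num)
  have hHM : ∀ h ∈ H, |(h : ℝ)| ≤ M := by
    intro h hh
    have h1 := mem_Icc.1 (hHs hh)
    have h2 : |h| ≤ 2 * (⌊1 / X ^ 2 * M⌋₊ : ℤ) := abs_le.2 h1
    have h3 : |(h : ℝ)| ≤ 2 * (⌊1 / X ^ 2 * M⌋₊ : ℝ) := by exact_mod_cast h2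
    have h4 := Nat.floor_le (a := 1 / X ^ 2 * M) (by positivity)
    have h5 : 1 / X ^ 2 ≤ 1 / 2 := by
      apply one_div_le_one_div_of_le two_pos
      linarith
    have h6 : 1 / X ^ 2 * M ≤ 1 / 2 * M := by gcongr
    linarith
  have hHc' : M / Z ≤ #H := le_trans (div_le_div_of_nonneg_left hM0.le hY0 hYZ) hHc
  obtain ⟨q, hq, hqle, V, hVc, hV⟩ := exists_dense_rationalDirection (S := S) (φ := φ) (r := r) hZ24 hwZ hM2
    hNw hwM (hlog.trans hXZ) hHM hHc' (by
      intro h hh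
      obtain ⟨A, hAs, hAc, γ, θ, hA⟩ := hH h hh
      exact card_rationalDirection_mul h1S hφ hZ24 (by linarith) hYZ3 (by
          have : 1 / (2 * Y) ≤ 1 / Y := one_div_le_one_div_of_le hY0 (by linarith)
          linarith) hL1 hLM hwZ hwhi hNw hAs hAc
        (fun l hl => (hA l hl).1) (fun l hl => (hA l hl).2.1) fun l hl => (hA l hl).2.2)
  refine exists_uniform_denominator_of_dense_rationalDirection h1S hφ hZ24 (r := r) ?_ ?_ hr0 hVc hq hqle hV
  · linarith
  · have : 4 / Z = 4 * (1 / Z) := by ring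
    linarith

/-- The same without an assumption on the order of the two lengths. -/
theorem exists_denominator_of_typeII (h1S : (1 : ZMod N) ∈ S) (hσ : 0 < σ) (hΛ : 0 ≤ Λ)
    (hφ : IsLocallyQuadraticOn (bohrSet S σ) φ) (hψ : IsSmoothCutoff S σ Λ ψ) {δ X Z L M : ℝ}
    (hδ : 0 < δ) (hδ1 : δ ≤ 1) (hX : 2 ^ 24 ≤ X) (hXδ : 1 / δ ≤ X) (hXσ : 1 / σ ≤ X) (hXΛ : Λ ≤ X)
    (hlog : Real.log N ≤ X) (hZ : Z = X ^ (496 * #S ^ 4)) (hL : Z ^ 52 ≤ L) (hM : Z ^ 52 ≤ M)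
    (hLMN : L * M ≤ N) (hNLM : δ * N ≤ L * M)
    (hsum : δ * L ^ 2 * M ^ 2 ≤ ∑ l ∈ dyadic L, ∑ l' ∈ dyadic L,
      ‖∑ m ∈ dyadic M, dilatePair ψ φ (l : ZMod N) (l' : ZMod N) m‖ ^ 2) :
    ∃ q : ℕ, 0 < q ∧ (q : ℝ) ≤ Z ^ 388 ∧ ∀ a b, bohrNorm S a < 1 / Z ^ 254 →
      bohrNorm S b < 1 / Z ^ 254 →
      ‖q • secondDiff φ a b‖ ≤ Z ^ 600 * (bohrNorm S a * bohrNorm S b) := by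
  rcases le_total L M with h | h
  · exact exists_denominator_of_typeII_of_le h1S hσ hΛ hφ hψ hδ hδ1 hX hXδ hXσ hXΛ hlog hZ hL h hLMN
      hNLM hsum
  · rw [sum_norm_sum_dilatePair_sq_comm] at hsum
    exact exists_denominator_of_typeII_of_le h1S hσ hΛ hφ hψ hδ hδ1 hX hXδ hXσ hXΛ hlog hZ hM h
      (by rwa [mul_comm]) (by rwa [mul_comm M]) (by linarith)

end TypeIILocal

/-! ### Type II sums: points where the derivatives are rational -/

section Extension

variable {N : ℕ} [NeZero N] {S : Finset (ZMod N)} {σ Λ : ℝ} {ψ : ZMod N → ℝ}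
  {φ : ZMod N → UnitAddCircle}

/-- The second derivative of `φ` is rational with denominator `q` near the origin; `B` bounds the
denominator, the inverse of the radius and the implied constant. -/
def RationalNearZero (S : Finset (ZMod N)) (φ : ZMod N → UnitAddCircle) (B : ℝ) (q : ℕ) : Prop :=
  0 < q ∧ (q : ℝ) ≤ B ∧ ∀ a b, bohrNorm S a < 1 / B → bohrNorm S b < 1 / B →
    ‖q • secondDiff φ a b‖ ≤ B * (bohrNorm S a * bohrNorm S b)

/-- Since `φ''(qx, qy) = q² φ''(x, y)`, the phase is nearly linear along multiples of `q`. -/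
lemma RationalNearZero.norm_secondDiff_nsmul_le (hφ : IsLocallyQuadraticOn (bohrSet S σ) φ) {B : ℝ}
    (hB : 2 ^ 24 ≤ B) (hBσ : 1 / B ≤ σ) {q : ℕ} (h : RationalNearZero S φ B q) {x y : ZMod N}
    (hx : bohrNorm S x ≤ 2 / B ^ 4) (hy : bohrNorm S y ≤ 2 / B ^ 4) :
    ‖secondDiff φ (q • x) (q • y)‖ ≤ B ^ 2 * (bohrNorm S x * bohrNorm S y) := by
  have hB0 : 0 < B := lt_of_lt_of_le (by norm_num) hB
  have hB1 : 1 ≤ B := le_trans (by norm_num) hB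
  obtain ⟨hq, hqB, h⟩ := h
  have hsmall : 2 / B ^ 4 < 1 / B := by
    rw [div_lt_div_iff₀ (by positivity) hB0, one_mul]
    calc 2 * B < B * B := by nlinarith
      _ = B ^ 2 := by ring
      _ ≤ B ^ 4 := pow_le_pow_right₀ hB1 (by norm_num)
  have h1 : ∀ x, bohrNorm S x ≤ 2 / B ^ 4 → q * bohrNorm S x < 1 / B / 2 := by
    intro x hx
    have h2 : q * bohrNorm S x ≤ B * (2 / B ^ 4) := by
      have := bohrNorm_nonneg (S := S) x
      gcongr
    refine h2.trans_lt ?_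
    rw [div_div, mul_div_assoc', div_lt_div_iff₀ (by positivity) (by positivity)]
    have : B * 2 * (B * 2) < B * B ^ 2 := by nlinarith
    calc B * 2 * (B * 2) < B * B ^ 2 := this
      _ = B ^ 3 := by ring
      _ ≤ 1 * B ^ 4 := by rw [one_mul]; exact pow_le_pow_right₀ hB1 (by norm_num)
  rw [hφ.secondDiff_nsmul q q (by linarith [h1 x hx, h1 y hy]), mul_smul]
  have h2 := h x y (hx.trans_lt hsmall) (hy.trans_lt hsmall)
  have hxy := mul_nonneg (bohrNorm_nonneg (S := S) x) (bohrNorm_nonneg (S := S) y)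
  calc ‖q • q • secondDiff φ x y‖ ≤ q * ‖q • secondDiff φ x y‖ := norm_nsmul_le
    _ ≤ B * (B * (bohrNorm S x * bohrNorm S y)) := by gcongr
    _ = _ := by ring

/-- The mass `Σ_x tent(x)`. -/
noncomputable def tentSum (S : Finset (ZMod N)) (r : ℝ) : ℝ := ∑ x, tent S r x

lemma card_bohrFin_half_le_tentSum {r : ℝ} (hr : 0 < r) :
    (#(bohrFin S (r / 2)) : ℝ) ≤ 2 * tentSum S r := by
  have h1 : (#(bohrFin S (r / 2)) : ℝ) * (1 / 2) ≤ tentSum S r := by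
    rw [tentSum, ← nsmul_eq_mul, ← sum_const]
    calc ∑ _x ∈ bohrFin S (r / 2), (1 / 2 : ℝ) ≤ ∑ x ∈ bohrFin S (r / 2), tent S r x :=
          sum_le_sum fun x hx => half_le_tent hr (mem_bohrFin.1 hx).le
      _ ≤ _ := sum_le_sum_of_subset_of_nonneg (subset_univ _) fun _ _ _ => tent_nonneg _ _
  linarith

lemma tentSum_pos {r : ℝ} (hr : 0 < r) : 0 < tentSum S r := by
  have h1 := card_bohrFin_half_le_tentSum (S := S) hr
  have h2 := card_bohrFin_pos (S := S) (half_pos hr)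
  linarith

lemma card_bohrFin_two_mul_le_tentSum {r : ℝ} (hr : 0 < r) :
    (#(bohrFin S (2 * r)) : ℝ) ≤ 2 * 16 ^ #S * tentSum S r := by
  have h1 := card_bohrFin_half_le_tentSum (S := S) hr
  have h2 := card_bohrFin_two_mul_le (S := S) hr
  have h3 := card_bohrFin_two_mul_le (S := S) (half_pos hr)
  rw [mul_div_cancel₀ r two_ne_zero] at h3
  calc (#(bohrFin S (2 * r)) : ℝ) ≤ 4 ^ #S * (4 ^ #S * (2 * tentSum S r)) :=
        h2.trans (by gcongr; exact h3.trans (by gcongr))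
    _ = _ := by
        rw [show (16 : ℝ) = 4 * 4 by norm_num, mul_pow]; ring

/-- A Fourier coefficient of the phase along multiples of `q`, localised near the origin. -/
noncomputable def localCoeff (S : Finset (ZMod N)) (φ : ZMod N → UnitAddCircle) (r : ℝ) (q : ℕ)
    (z γ : ZMod N) : ℂ :=
  ∑ x, (tent S r x : ℂ) * e (φ (z + q • x) + charVal γ (q • x))

/-- A large local Fourier coefficient determines the derivatives of the phase along multiples of
`q`, by comparing the coefficient with its translate. -/
theorem norm_derivative_add_charVal_le (hφ : IsLocallyQuadraticOn (bohrSet S σ) φ) {B η : ℝ}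
    (hB : 2 ^ 24 ≤ B) (hBσ : 1 / B ≤ σ) {q : ℕ} (h : RationalNearZero S φ B q) {z γ b : ZMod N}
    (hz : ∀ v, bohrNorm S v ≤ 4 / B ^ 3 → bohrNorm S (z + v) < σ) (hη : 0 < η)
    (hA : η * tentSum S (1 / B ^ 4) ≤ ‖localCoeff S φ (1 / B ^ 4) q z γ‖)
    (hb : bohrNorm S b < 1 / B ^ 4) :
    ‖φ (z + q • b) - φ z + charVal γ (q • b)‖ ≤ 16 ^ #S * B ^ 4 / η * bohrNorm S b := by
  have hB0 : 0 < B := lt_of_lt_of_le (by norm_num) hB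
  have hB1 : 1 ≤ B := le_trans (by norm_num) hB
  have hσ : 0 < σ := lt_of_lt_of_le (by positivity) hBσ
  set r := 1 / B ^ 4 with hr
  have hr0 : 0 < r := by positivity
  have hb0 := bohrNorm_nonneg (S := S) b
  have hm := tentSum_pos (S := S) hr0
  set m := tentSum S r with hmdef
  set A := localCoeff S φ r q z γ with hAdef
  set β := φ (z + q • b) - φ z + charVal γ (q • b) with hβ
  set E : ZMod N → ℂ := fun x => e (φ (z + q • x) + charVal γ (q • x)) with hE
  have hr2 : 2 * r = 2 / B ^ 4 := by rw [hr]; ring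
  have hqr : ∀ x, bohrNorm S x ≤ 2 * r → bohrNorm S (q • x) ≤ 2 / B ^ 3 := by
    intro x hx
    refine (bohrNorm_nsmul_le q x).trans ?_
    have h1 := h.2.1
    calc q * bohrNorm S x ≤ B * (2 * r) := by
          have := bohrNorm_nonneg (S := S) x
          gcongr
      _ = 2 / B ^ 3 := by rw [hr]; field_simp
  -- translation by `b` multiplies the summand by `e β`, up to a small error
  have hpoint : ∀ x, bohrNorm S x < r → ‖E (x + b) - e β * E x‖ ≤ 7 * (B ^ 2 * (r * bohrNorm S b)) := by
    intro x hx
    have h1 := hqr x (by linarith)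
    have h2 := hqr b (by linarith)
    have h4 : (4 : ℝ) / B ^ 3 = 2 / B ^ 3 + 2 / B ^ 3 := by ring
    have h5 : 0 ≤ 2 / B ^ 3 := by positivity
    have h6 : 4 / B ^ 3 < σ := by
      refine lt_of_lt_of_le ?_ hBσ
      rw [div_lt_div_iff₀ (by positivity) hB0]
      calc 4 * B < B * B := by nlinarith
        _ = B ^ 2 := by ring
        _ ≤ 1 * B ^ 3 := by rw [one_mul]; exact pow_le_pow_right₀ hB1 (by norm_num)
    have hsd := hφ.sub_eq_secondDiff hσ (n := z) (a := q • x) (b := q • b) (by linarith)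
      (by simpa using hz 0 (by rw [bohrNorm_zero]; positivity)) (hz _ (by linarith))
      (hz _ (by linarith))
      (by rw [add_assoc]; exact hz _ ((bohrNorm_add_le _ _).trans (by linarith)))
    have hsm := h.norm_secondDiff_nsmul_le hφ hB hBσ (x := x) (y := b) (by linarith) (by linarith)
    have key : φ (z + q • (x + b)) + charVal γ (q • (x + b)) - (β + (φ (z + q • x) + charVal γ (q • x)))
        = secondDiff φ (q • x) (q • b) := by
      rw [← hsd, hβ, smul_add, charVal_add, ← add_assoc z]; abel
    simp only [hE]
    rw [← e_add]
    refine (norm_e_sub_e_le _ _).trans ?_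
    rw [key]
    gcongr
    refine hsm.trans ?_
    have := bohrNorm_nonneg (S := S) x
    gcongr
  have hshift : A = ∑ x, (tent S r (x + b) : ℂ) * E (x + b) :=
    (Equiv.sum_comp (Equiv.addRight b) fun x => (tent S r x : ℂ) * E x).symm
  have hdiff : ‖A - e β * A‖ ≤ bohrNorm S b / r * (2 * 16 ^ #S * m)
      + 7 * (B ^ 2 * (r * bohrNorm S b)) * m := by
    have h1 : A - e β * A = ∑ x, (((tent S r (x + b) - tent S r x : ℝ) : ℂ) * E (x + b)
        + (tent S r x : ℂ) * (E (x + b) - e β * E x)) := by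
      have hA' : e β * A = ∑ x, e β * ((tent S r x : ℂ) * E x) := by
        rw [← mul_sum]
        rfl
      rw [hA', hshift, ← sum_sub_distrib]
      refine sum_congr rfl fun x _ => ?_
      push_cast
      ring
    rw [h1, sum_add_distrib]
    refine (norm_add_le _ _).trans (add_le_add ?_ ?_)
    · calc ‖∑ x, ((tent S r (x + b) - tent S r x : ℝ) : ℂ) * E (x + b)‖
          ≤ ∑ x, |tent S r (x + b) - tent S r x| := by
            refine (norm_sum_le _ _).trans (sum_le_sum fun x _ => ?_)
            rw [norm_mul, norm_e, mul_one, Complex.norm_real, Real.norm_eq_abs]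
        _ = ∑ x ∈ bohrFin S (2 * r), |tent S r (x + b) - tent S r x| := by
            refine (sum_subset (subset_univ _) fun x _ hx => ?_).symm
            rw [mem_bohrFin, not_lt] at hx
            have h2 := bohrNorm_sub_le (S := S) (x + b) b
            rw [add_sub_cancel_right] at h2
            rw [tent_eq_zero hr0 (by linarith), tent_eq_zero hr0 (by linarith), sub_self, abs_zero]
        _ ≤ ∑ _x ∈ bohrFin S (2 * r), bohrNorm S b / r := by
            refine sum_le_sum fun x _ => ?_
            have := abs_tent_sub_le (S := S) hr0 (x + b) x
            rwa [add_sub_cancel_left] at this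
        _ = bohrNorm S b / r * #(bohrFin S (2 * r)) := by rw [sum_const, nsmul_eq_mul, mul_comm]
        _ ≤ _ := by
            gcongr
            exact card_bohrFin_two_mul_le_tentSum hr0
    · rw [hmdef, tentSum, mul_sum]
      refine (norm_sum_le _ _).trans (sum_le_sum fun x _ => ?_)
      rw [norm_mul, Complex.norm_real, Real.norm_of_nonneg (tent_nonneg _ _), mul_comm]
      by_cases hx : tent S r x = 0
      · rw [hx, mul_zero, mul_zero]
      · exact mul_le_mul_of_nonneg_right (hpoint x (bohrNorm_lt_of_tent_ne_zero hr0 hx)) (tent_nonneg _ _)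
  have hβA : 4 * ‖β‖ * (η * m) ≤ ‖A - e β * A‖ := by
    have h1 : A - e β * A = -((e β - 1) * A) := by ring
    rw [h1, norm_neg, norm_mul]
    have := four_mul_norm_le β
    gcongr
  have h16 : (1 : ℝ) ≤ 16 ^ #S := one_le_pow₀ (by norm_num)
  have hBr : 1 / r = B ^ 4 := by rw [hr, one_div_one_div]
  have hfin : 4 * ‖β‖ * (η * m) ≤ 4 * (16 ^ #S * B ^ 4 * bohrNorm S b * m) := by
    refine (hβA.trans hdiff).trans ?_
    have e1 : bohrNorm S b / r * (2 * 16 ^ #S * m) = 2 * (16 ^ #S * B ^ 4 * bohrNorm S b * m) := by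
      rw [div_eq_mul_one_div, hBr]; ring
    have e2 : 7 * (B ^ 2 * (r * bohrNorm S b)) * m ≤ 2 * (16 ^ #S * B ^ 4 * bohrNorm S b * m) := by
      have e3 : 7 * (B ^ 2 * r) ≤ 2 * (16 ^ #S * B ^ 4) := by
        calc 7 * (B ^ 2 * r) = 7 / B ^ 2 := by rw [hr]; field_simp
          _ ≤ 2 := by
              rw [div_le_iff₀ (by positivity)]
              nlinarith
          _ ≤ 2 * (16 ^ #S * B ^ 4) := by
              have : 1 ≤ B ^ 4 := one_le_pow₀ hB1
              nlinarith
      calc 7 * (B ^ 2 * (r * bohrNorm S b)) * m = 7 * (B ^ 2 * r) * (bohrNorm S b * m) := by ring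
        _ ≤ 2 * (16 ^ #S * B ^ 4) * (bohrNorm S b * m) := by gcongr
        _ = _ := by ring
    linarith
  rw [div_mul_eq_mul_div, le_div_iff₀ hη]
  have h5 : 4 * m * (‖β‖ * η) ≤ 4 * m * (16 ^ #S * B ^ 4 * bohrNorm S b) := by linarith
  exact le_of_mul_le_mul_left h5 (by positivity)

omit [NeZero N] in
/-- The fibres of `x ↦ q x` on `ℤ/Nℤ` have at most `q` elements. -/
lemma card_filter_nsmul_eq_le [NeZero N] {q : ℕ} (hq : 0 < q) (y : ZMod N) : #{x : ZMod N | q • x = y} ≤ q := by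
  classical
  rcases Finset.eq_empty_or_nonempty {x : ZMod N | q • x = y} with h0 | ⟨x₀, hx₀⟩
  · rw [h0]; simp
  rw [mem_filter] at hx₀
  calc #{x : ZMod N | q • x = y} ≤ #{x : ZMod N | q • x = 0} := by
        refine card_le_card_of_injOn (fun x => x - x₀) (fun x hx => ?_)
          (fun x _ x' _ h => sub_left_injective h)
        rw [mem_coe, mem_filter] at hx
        simp only [coe_filter, mem_univ, true_and, Set.mem_ofPred_eq]
        rw [smul_sub, hx.2, hx₀.2, sub_self]
    _ ≤ q := IsAddCyclic.card_nsmul_eq_zero_le hq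

/-- The localised phase near `z`, along multiples of `q`. -/
noncomputable def tentPhase (S : Finset (ZMod N)) (φ : ZMod N → UnitAddCircle) (r : ℝ) (q : ℕ)
    (z x : ZMod N) : ℂ :=
  (tent S r x : ℂ) * e (φ (z + q • x))

lemma norm_tentPhase (r : ℝ) (q : ℕ) (z x : ZMod N) : ‖tentPhase S φ r q z x‖ = tent S r x := by
  rw [tentPhase, norm_mul, norm_e, mul_one, Complex.norm_real, Real.norm_of_nonneg (tent_nonneg _ _)]

lemma localCoeff_eq (r : ℝ) (q : ℕ) (z γ : ZMod N) :
    localCoeff S φ r q z γ = ∑ x, tentPhase S φ r q z x * e (charVal γ (q • x)) :=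
  sum_congr rfl fun x _ => by rw [tentPhase, e_add, mul_assoc]

lemma sum_norm_localCoeff_sq_le {q : ℕ} (hq : 0 < q) {r : ℝ} (hr : 0 < r) (z : ZMod N) :
    ∑ γ, ‖localCoeff S φ r q z γ‖ ^ 2 ≤ N * (q * tentSum S r) := by
  classical
  have hp := parseval (univ : Finset (ZMod N)) (univ : Finset (ZMod N)) (tentPhase S φ r q z)
    (tentPhase S φ r q z) (fun x => -(q • x)) (fun x => -(q • x)) 0
  simp only [charVal_neg, neg_neg, charVal_zero, e_zero, mul_one, ← localCoeff_eq] at hp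
  have h1 : ((∑ γ, ‖localCoeff S φ r q z γ‖ ^ 2 : ℝ) : ℂ)
      = ∑ γ, localCoeff S φ r q z γ * conj (localCoeff S φ r q z γ) := by
    push_cast
    refine sum_congr rfl fun γ _ => ?_
    rw [Complex.mul_conj, Complex.normSq_eq_norm_sq]; push_cast; rfl
  have h2 := congrArg norm (h1.trans hp)
  rw [Complex.norm_real, Real.norm_of_nonneg (sum_nonneg fun _ _ => sq_nonneg _), norm_mul,
    Complex.norm_natCast] at h2
  rw [h2, tentSum, mul_sum]
  refine mul_le_mul_of_nonneg_left ?_ (Nat.cast_nonneg _)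
  refine (norm_sum_le _ _).trans (sum_le_sum fun x _ => ?_)
  rw [← sum_filter]
  have hfib : ({y : ZMod N | -(q • x) - -(q • y) = 0} : Finset (ZMod N)) ⊆
      ({y : ZMod N | q • y = q • x} : Finset (ZMod N)) := by
    intro y hy
    rw [mem_filter] at hy ⊢
    refine ⟨mem_univ _, ?_⟩
    have := hy.2
    rw [sub_neg_eq_add, neg_add_eq_zero] at this
    exact this.symm
  calc _ ≤ (#{y : ZMod N | -(q • x) - -(q • y) = 0} : ℝ) * tent S r x := by
        refine norm_sum_le_card_mul _ _ fun y _ => ?_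
        rw [norm_mul, Complex.norm_conj, norm_tentPhase, norm_tentPhase]
        exact mul_le_of_le_one_right (tent_nonneg _ _) (tent_le_one hr _)
    _ ≤ q * tent S r x := by
        refine mul_le_mul_of_nonneg_right ?_ (tent_nonneg _ _)
        exact_mod_cast (card_le_card hfib).trans (card_filter_nsmul_eq_le hq _)

/-- The part of a weighted sum over pairs which is assigned to the point `z`. -/
noncomputable def localSum (S : Finset (ZMod N)) (φ : ZMod N → UnitAddCircle) (r : ℝ) (q : ℕ)
    (s : Finset (ℕ × ℕ)) (u : ℕ × ℕ → ℂ) (z : ZMod N) : ℂ :=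
  ∑ i ∈ s, ∑ j : ZMod N × ZMod N, if ((i.1 * i.2 : ℕ) : ZMod N) - (q • j.1 + q • j.2) = z then
    u i * (tentPhase S φ r q z j.1 * tentPhase S φ r q z j.2) else 0

lemma sum_mul_localCoeff_sq (r : ℝ) (q : ℕ) (s : Finset (ℕ × ℕ)) (u : ℕ × ℕ → ℂ) (z : ZMod N) :
    ∑ γ, (∑ i ∈ s, u i * e (-charVal γ ((i.1 * i.2 : ℕ) : ZMod N))) * localCoeff S φ r q z γ ^ 2
      * e (charVal γ z) = N * localSum S φ r q s u z := by
  have hp := parseval s (univ : Finset (ZMod N × ZMod N)) u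
    (fun j => conj (tentPhase S φ r q z j.1 * tentPhase S φ r q z j.2))
    (fun i => ((i.1 * i.2 : ℕ) : ZMod N)) (fun j => q • j.1 + q • j.2) z
  have hsq : ∀ γ, conj (∑ j : ZMod N × ZMod N, conj (tentPhase S φ r q z j.1 * tentPhase S φ r q z j.2) *
      e (-charVal γ (q • j.1 + q • j.2))) = localCoeff S φ r q z γ ^ 2 := by
    intro γ
    rw [localCoeff_eq, sq, sum_mul_sum, ← sum_product', map_sum]
    refine sum_congr rfl fun j _ => ?_
    rw [map_mul, Complex.conj_conj, ← e_neg, neg_neg, charVal_add, e_add]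
    ring
  simp only [hsq, Complex.conj_conj] at hp
  exact hp

/-- The frequencies `γ` for which `γ / N` is nearly rational are few. -/
lemma card_nearly_rational_frequencies {Q ε : ℝ} (hε : 0 ≤ ε) (Γ : Finset (ZMod N))
    (hΓ : ∀ γ ∈ Γ, ∃ q : ℕ, 0 < q ∧ (q : ℝ) ≤ Q ∧ ‖q • charVal 1 γ‖ ≤ ε) :
    (#Γ : ℝ) ≤ Q ^ 2 * (2 * (N * ε) + 1) := by
  classical
  rcases Γ.eq_empty_or_nonempty with rfl | hne
  · simp; positivity
  obtain ⟨q, hq, hqQ, hqc⟩ := exists_popular_denominator hne hΓ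
  have hQ0 : 0 ≤ Q := le_trans (Nat.cast_nonneg _) hqQ
  set G := {γ ∈ Γ | ‖q • charVal 1 γ‖ ≤ ε} with hG
  have h1 : #G ≤ q * #(G.image fun γ => q • γ) := by
    refine card_le_mul_card_image G q fun y _ => ?_
    exact (card_le_card (filter_subset_filter _ (subset_univ _))).trans (card_filter_nsmul_eq_le hq y)
  have h2 : (#(G.image fun γ => q • γ) : ℝ) ≤ 2 * (N * ε) + 1 := by
    have h3 : #(G.image fun γ => q • γ) ≤ #(Icc (-⌊N * ε⌋) ⌊N * ε⌋) := by
      refine card_le_card_of_injOn (fun y => y.valMinAbs) (fun y hy => ?_)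
        fun y _ y' _ h => ZMod.injective_valMinAbs h
      obtain ⟨γ, hγ, rfl⟩ := mem_image.1 hy
      have h4 := (mem_filter.1 hγ).2
      have h5 := abs_valMinAbs_eq (q • γ)
      rw [← natCast_zsmul γ q, charVal_zsmul, natCast_zsmul, natCast_zsmul] at h5
      have h6 : |((q • γ).valMinAbs : ℝ)| ≤ N * ε := by rw [h5]; gcongr
      have h7 : |(q • γ).valMinAbs| ≤ ⌊N * ε⌋ := by rw [Int.le_floor]; push_cast; exact h6
      exact mem_coe.2 (mem_Icc.2 (abs_le.1 h7))
    refine le_trans (by exact_mod_cast h3) (card_Icc_int_le (by positivity) ?_)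
    push_cast
    linarith [Int.floor_le (N * ε)]
  calc (#Γ : ℝ) ≤ Q * #G := hqc
    _ ≤ Q * (q * #(G.image fun γ => q • γ)) := by gcongr; exact_mod_cast h1
    _ ≤ Q * (Q * (2 * (N * ε) + 1)) := by gcongr
    _ = _ := by ring

/-- A frequency correlating with the products `m l` is nearly rational. -/
lemma exists_denominator_of_large_product_sum {L M η : ℝ} (hη : 0 < η) (hη1 : η ≤ 1)
    (hL : 128 / η ^ 4 ≤ L) (hM : 128 / η ^ 4 ≤ M) {f g : ℕ → ℂ} (hf : ∀ i, ‖f i‖ ≤ 1)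
    (hg : ∀ i, ‖g i‖ ≤ 1) {γ : ZMod N}
    (h : 4 * η * (L * M) ≤ ‖∑ i ∈ dyadic M ×ˢ dyadic L,
      f i.1 * g i.2 * e (-charVal γ ((i.1 * i.2 : ℕ) : ZMod N))‖) :
    ∃ q : ℕ, 0 < q ∧ (q : ℝ) ≤ 16 / η ^ 2 ∧ ‖q • charVal 1 γ‖ ≤ 144 / (η ^ 6 * (L * M)) := by
  have h128 : 128 ≤ 128 / η ^ 4 := by
    rw [le_div_iff₀ (by positivity)]
    have : η ^ 4 ≤ 1 := pow_le_one₀ hη.le hη1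
    linarith
  have hL1 : 1 ≤ L := by linarith
  have hM1 : 1 ≤ M := by linarith
  have h24 : 128 / η ^ 2 ≤ 128 / η ^ 4 :=
    div_le_div_of_nonneg_left (by norm_num) (by positivity) (pow_le_pow_of_le_one hη.le hη1 (by norm_num))
  obtain ⟨q, hq, hqle, hqn⟩ := exists_denominator_of_bilinear (a₀ := ⌈M⌉₊) (a₁ := ⌊2 * M⌋₊)
    (B := dyadic L) (I := 2 * M) (J := 2 * L) (u := f) (v := g) (α := -charVal 1 γ) hη hη1 (by linarith)
    (by linarith) (card_dyadic_le hM1) (card_dyadic_le hL1) (by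
      intro j hj j' hj'
      rw [mem_dyadic (by linarith)] at hj hj'
      rw [abs_le]; constructor <;> linarith) hf hg (by
      rw [sum_product] at h
      refine le_trans (le_of_eq (by ring)) (h.trans (le_of_eq ?_))
      congr 1
      refine sum_congr rfl fun i _ => sum_congr rfl fun j _ => ?_
      congr 2
      rw [smul_neg, ← natCast_zsmul, ← charVal_intCast, Int.cast_natCast])
  refine ⟨q, hq, hqle, ?_⟩
  rw [smul_neg, norm_neg] at hqn
  refine hqn.trans (le_of_eq ?_)
  field_simp
  norm_num

/-- If the part of the sum at `z` is large then a local Fourier coefficient at `z` with nearly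
rational frequency is large. -/
lemma exists_large_localCoeff {q : ℕ} (hq : 0 < q) {r : ℝ} (hr : 0 < r) {L M η κ : ℝ}
    (hη : 0 < η) (hη1 : η ≤ 1) (hL : 128 / η ^ 4 ≤ L) (hM : 128 / η ^ 4 ≤ M) {f g : ℕ → ℂ}
    (hf : ∀ i, ‖f i‖ ≤ 1) (hg : ∀ i, ‖g i‖ ≤ 1) {z : ZMod N} (hκ : 0 < κ)
    (hηκ : 8 * η * (N * q) ≤ κ * tentSum S r)
    (hT : κ * (L * M) * tentSum S r ^ 2 ≤
      N * ‖localSum S φ r q (dyadic M ×ˢ dyadic L) (fun i => f i.1 * g i.2) z‖) :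
    ∃ γ : ZMod N, (∃ q' : ℕ, 0 < q' ∧ (q' : ℝ) ≤ 16 / η ^ 2 ∧
        ‖q' • charVal 1 γ‖ ≤ 144 / (η ^ 6 * (L * M))) ∧
      κ * tentSum S r ^ 2 ≤ 8 * ((16 / η ^ 2) ^ 2 * (2 * (N * (144 / (η ^ 6 * (L * M)))) + 1)) *
        ‖localCoeff S φ r q z γ‖ ^ 2 := by
  classical
  have h128 : 128 ≤ 128 / η ^ 4 := by
    rw [le_div_iff₀ (by positivity)]
    have : η ^ 4 ≤ 1 := pow_le_one₀ hη.le hη1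
    linarith
  have hL1 : 1 ≤ L := by linarith
  have hM1 : 1 ≤ M := by linarith
  have hLM0 : 0 < L * M := by positivity
  have hm := tentSum_pos (S := S) hr
  set m := tentSum S r with hmdef
  set s := dyadic M ×ˢ dyadic L with hs
  set F : ZMod N → ℂ := fun γ => ∑ i ∈ s, f i.1 * g i.2 * e (-charVal γ ((i.1 * i.2 : ℕ) : ZMod N))
    with hF
  set A : ZMod N → ℂ := fun γ => localCoeff S φ r q z γ with hA
  have hFle : ∀ γ, ‖F γ‖ ≤ 4 * (L * M) := by
    intro γ
    refine (norm_sum_le_card_mul (B := 1) _ _ fun i _ => ?_).trans ?_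
    · rw [norm_mul, norm_mul, norm_e, mul_one]
      exact mul_le_one₀ (hf _) (norm_nonneg _) (hg _)
    · rw [mul_one, hs, card_product]
      push_cast
      have h1 := card_dyadic_le hL1
      have h2 := card_dyadic_le hM1
      calc (#(dyadic M) : ℝ) * #(dyadic L) ≤ 2 * M * (2 * L) := by gcongr
        _ = _ := by ring
  have hNT : N * ‖localSum S φ r q s (fun i => f i.1 * g i.2) z‖ ≤ ∑ γ, ‖F γ‖ * ‖A γ‖ ^ 2 := by
    rw [← Complex.norm_natCast N, ← norm_mul, ← sum_mul_localCoeff_sq]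
    refine (norm_sum_le _ _).trans (sum_le_sum fun γ _ => ?_)
    rw [norm_mul, norm_mul, norm_e, mul_one, norm_pow]
  set Γ : Finset (ZMod N) := {γ | 4 * η * (L * M) ≤ ‖F γ‖} with hΓ
  have hsmall : ∑ γ with ¬ 4 * η * (L * M) ≤ ‖F γ‖, ‖F γ‖ * ‖A γ‖ ^ 2 ≤ κ * (L * M) * m ^ 2 / 2 := by
    calc ∑ γ with ¬ 4 * η * (L * M) ≤ ‖F γ‖, ‖F γ‖ * ‖A γ‖ ^ 2
        ≤ ∑ γ with ¬ 4 * η * (L * M) ≤ ‖F γ‖, 4 * η * (L * M) * ‖A γ‖ ^ 2 := by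
          refine sum_le_sum fun γ hγ => ?_
          have := (not_le.1 (mem_filter.1 hγ).2).le
          gcongr
      _ ≤ ∑ γ, 4 * η * (L * M) * ‖A γ‖ ^ 2 :=
          sum_le_sum_of_subset_of_nonneg (subset_univ _) fun _ _ _ => by positivity
      _ = 4 * η * (L * M) * ∑ γ, ‖A γ‖ ^ 2 := by rw [mul_sum]
      _ ≤ 4 * η * (L * M) * (N * (q * m)) := by
          gcongr
          exact sum_norm_localCoeff_sq_le hq hr z
      _ = 8 * η * (N * q) * ((L * M) * m / 2) := by ring
      _ ≤ κ * m * ((L * M) * m / 2) := by gcongr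
      _ = _ := by ring
  have hlarge : κ * (L * M) * m ^ 2 / 2 ≤ ∑ γ ∈ Γ, ‖F γ‖ * ‖A γ‖ ^ 2 := by
    have := sum_filter_add_sum_filter_not univ (fun γ => 4 * η * (L * M) ≤ ‖F γ‖)
      (fun γ => ‖F γ‖ * ‖A γ‖ ^ 2)
    linarith
  have hΓA : κ * m ^ 2 / 8 ≤ ∑ γ ∈ Γ, ‖A γ‖ ^ 2 := by
    have h1 : ∑ γ ∈ Γ, ‖F γ‖ * ‖A γ‖ ^ 2 ≤ 4 * (L * M) * ∑ γ ∈ Γ, ‖A γ‖ ^ 2 := by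
      rw [mul_sum]
      refine sum_le_sum fun γ _ => ?_
      have := hFle γ
      gcongr
    have h2 : 4 * (L * M) * (κ * m ^ 2 / 8) ≤ 4 * (L * M) * ∑ γ ∈ Γ, ‖A γ‖ ^ 2 := by
      refine le_trans (le_of_eq (by ring)) (hlarge.trans h1)
    exact le_of_mul_le_mul_left h2 (by positivity)
  have hΓq : ∀ γ ∈ Γ, ∃ q' : ℕ, 0 < q' ∧ (q' : ℝ) ≤ 16 / η ^ 2 ∧
      ‖q' • charVal 1 γ‖ ≤ 144 / (η ^ 6 * (L * M)) := fun γ hγ =>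
    exists_denominator_of_large_product_sum hη hη1 hL hM hf hg (mem_filter.1 hγ).2
  have hΓc := card_nearly_rational_frequencies (by positivity) Γ hΓq
  set c := (16 / η ^ 2) ^ 2 * (2 * (N * (144 / (η ^ 6 * (L * M)))) + 1) with hc
  have hc0 : 0 < c := by positivity
  by_contra hcon
  push Not at hcon
  have h1 : ∀ γ ∈ Γ, ‖A γ‖ ^ 2 < κ * m ^ 2 / (8 * c) := by
    intro γ hγ
    rw [lt_div_iff₀ (by positivity)]
    have := hcon γ (hΓq γ hγ)
    linarith
  have hne : Γ.Nonempty := by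
    rw [nonempty_iff_ne_empty]; intro h0
    rw [h0, sum_empty] at hΓA
    have : 0 < κ * m ^ 2 / 8 := by positivity
    linarith
  have h2 := sum_lt_sum_of_nonempty hne h1
  rw [sum_const, nsmul_eq_mul] at h2
  have h3 : #Γ * (κ * m ^ 2 / (8 * c)) ≤ c * (κ * m ^ 2 / (8 * c)) := by gcongr
  have h4 : c * (κ * m ^ 2 / (8 * c)) = κ * m ^ 2 / 8 := by field_simp
  linarith

/-- If the part of the sum at `z` is large then the derivatives of the phase at `z` along multiples
of `q` are nearly rational. -/
theorem exists_denominator_derivative_of_localSum (h1S : (1 : ZMod N) ∈ S)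
    (hφ : IsLocallyQuadraticOn (bohrSet S σ) φ) {B L M : ℝ} (hB : 2 ^ 24 ≤ B) (hBσ : 1 / B ≤ σ) {q : ℕ}
    (h : RationalNearZero S φ B q) (hNLM : N ≤ B * (L * M)) (hL : B ^ (40 * #S) ≤ L)
    (hM : B ^ (40 * #S) ≤ M) {f g : ℕ → ℂ} (hf : ∀ i, ‖f i‖ ≤ 1) (hg : ∀ i, ‖g i‖ ≤ 1) {z : ZMod N}
    (hz : ∀ v, bohrNorm S v ≤ 4 / B ^ 3 → bohrNorm S (z + v) < σ)
    (hT : 1 / B * (L * M) * tentSum S (1 / B ^ 4) ^ 2 ≤ N *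
      ‖localSum S φ (1 / B ^ 4) q (dyadic M ×ˢ dyadic L) (fun i => f i.1 * g i.2) z‖) :
    ∃ q' : ℕ, 0 < q' ∧ (q' : ℝ) ≤ B ^ (19 * #S) ∧ ∀ b, bohrNorm S b < 1 / B ^ 4 →
      ‖q' • (φ (z + q • b) - φ z)‖ ≤ B ^ (73 * #S) * bohrNorm S b := by
  have hs : 1 ≤ #S := card_pos.2 ⟨1, h1S⟩
  set s := #S with hsdef
  have hB1 : 1 ≤ B := le_trans (by norm_num) hB
  have hB0 : 0 < B := by linarith
  have hpow : ∀ i j : ℕ, i ≤ j → B ^ i ≤ B ^ j := fun i j hij => pow_le_pow_right₀ hB1 hij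
  have hBn : ∀ n : ℕ, 0 < B ^ n := fun n => pow_pos hB0 n
  have hmul : ∀ (c : ℝ) (i j : ℕ), c ≤ B → i + 1 ≤ j → c * B ^ i ≤ B ^ j := by
    intro c i j hc hij
    calc c * B ^ i ≤ B * B ^ i := mul_le_mul_of_nonneg_right hc (hBn i).le
      _ = B ^ (i + 1) := by ring
      _ ≤ B ^ j := hpow _ _ hij
  have hL0 : 0 < L := lt_of_lt_of_le (hBn _) hL
  have hM0 : 0 < M := lt_of_lt_of_le (hBn _) hM
  set r := 1 / B ^ 4 with hr
  have hr0 : 0 < r := by positivity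
  have hm := tentSum_pos (S := S) hr0
  set m := tentSum S r with hmdef
  have hη : 0 < 1 / B ^ (9 * s) := by positivity
  have hη1 : 1 / B ^ (9 * s) ≤ 1 := by rw [div_le_one (hBn _)]; exact one_le_pow₀ hB1
  have hη4 : 128 / (1 / B ^ (9 * s)) ^ 4 ≤ B ^ (40 * s) := by
    rw [one_div_pow, ← pow_mul, div_div_eq_mul_div, div_one]
    exact hmul _ _ _ (by linarith) (by omega)
  have hNm : (N : ℝ) ≤ 2 * B ^ (5 * s) * m := by
    have h1 := card_le_bohrFin (S := S) (r := r / 2) (by positivity) (by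
      have : r ≤ 1 := by rw [hr, div_le_one (hBn _)]; exact one_le_pow₀ hB1
      linarith)
    have h2 := card_bohrFin_half_le_tentSum (S := S) hr0
    have h3 : (3 / (r / 2)) ^ s ≤ B ^ (5 * s) := by
      rw [pow_mul]
      refine pow_le_pow_left₀ (by positivity) ?_ s
      have : 3 / (r / 2) = 6 * B ^ 4 := by rw [hr]; field_simp; norm_num
      rw [this]
      exact hmul _ _ _ (by linarith) (by norm_num)
    calc (N : ℝ) ≤ (3 / (r / 2)) ^ s * #(bohrFin S (r / 2)) := h1
      _ ≤ B ^ (5 * s) * (2 * m) := by gcongr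
      _ = _ := by ring
  have hqB := h.2.1
  obtain ⟨γ, ⟨q', hq', hq'le, hq'n⟩, hγ⟩ := exists_large_localCoeff h.1 hr0 hη hη1 (hη4.trans hL) (hη4.trans hM)
    hf hg (z := z) (κ := 1 / B) (by positivity) (by
      calc 8 * (1 / B ^ (9 * s)) * (N * q) ≤ 8 * (1 / B ^ (9 * s)) * (2 * B ^ (5 * s) * m * B) := by
            gcongr
        _ = 16 * B ^ (5 * s + 1) * (1 / B ^ (9 * s)) * m := by ring
        _ ≤ B ^ (5 * s + 2) * (1 / B ^ (9 * s)) * m := by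
            refine mul_le_mul_of_nonneg_right (mul_le_mul_of_nonneg_right ?_ hη.le) hm.le
            exact hmul _ _ _ (by linarith) (by omega)
        _ ≤ 1 / B * m := by
            refine mul_le_mul_of_nonneg_right ?_ hm.le
            rw [mul_one_div, div_le_div_iff₀ (hBn _) hB0, ← pow_succ, one_mul]
            exact hpow _ _ (by omega)) hT
  have e2 : 16 / (1 / B ^ (9 * s)) ^ 2 = 16 * B ^ (18 * s) := by
    rw [one_div_pow, ← pow_mul, div_div_eq_mul_div, div_one]; congr 2; ring
  have e6 : N * (144 / ((1 / B ^ (9 * s)) ^ 6 * (L * M))) ≤ 144 * B ^ (54 * s + 1) := by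
    rw [one_div_pow, ← pow_mul, mul_div_assoc', div_le_iff₀ (by positivity)]
    calc (N : ℝ) * 144 ≤ B * (L * M) * 144 := by gcongr
      _ = 144 * B ^ (54 * s + 1) * (1 / B ^ (54 * s) * (L * M)) := by
          rw [pow_succ]; field_simp
      _ = _ := by rw [show 9 * s * 6 = 54 * s by ring]
  have hB16 : 16 ≤ B := by linarith
  have hB512 : 512 ≤ B := by linarith
  rw [e2] at hq'le hγ
  have hq'le' : (q' : ℝ) ≤ B ^ (19 * s) := hq'le.trans (hmul _ _ _ hB16 (by omega))
  -- the local coefficient is large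
  have hcoef : 1 / B ^ (47 * s) * m ≤ ‖localCoeff S φ r q z γ‖ := by
    set a := ‖localCoeff S φ r q z γ‖ with ha
    have ha0 : 0 ≤ a := norm_nonneg _
    have h1 : 8 * ((16 * B ^ (18 * s)) ^ 2 *
        (2 * (N * (144 / ((1 / B ^ (9 * s)) ^ 6 * (L * M)))) + 1)) ≤ B ^ (90 * s + 3) := by
      have h2 : 2 * (N * (144 / ((1 / B ^ (9 * s)) ^ 6 * (L * M)))) + 1 ≤ 512 * B ^ (54 * s + 1) := by
        have : 1 ≤ B ^ (54 * s + 1) := one_le_pow₀ hB1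
        linarith
      calc _ ≤ 8 * ((16 * B ^ (18 * s)) ^ 2 * (512 * B ^ (54 * s + 1))) := by gcongr
        _ = 1048576 * B ^ (90 * s + 1) := by ring
        _ ≤ B ^ (90 * s + 3) := hmul _ _ _ (by linarith) (by omega)
    have h3 : 1 / B * m ^ 2 ≤ B ^ (90 * s + 3) * a ^ 2 :=
      hγ.trans (mul_le_mul_of_nonneg_right h1 (sq_nonneg _))
    refine le_of_sq_le_sq ?_ ha0
    rw [mul_pow, one_div_pow, ← pow_mul, one_div_mul_eq_div, div_le_iff₀ (hBn _)]
    rw [one_div_mul_eq_div, div_le_iff₀ hB0] at h3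
    calc m ^ 2 ≤ B ^ (90 * s + 3) * a ^ 2 * B := h3
      _ = a ^ 2 * B ^ (90 * s + 4) := by ring
      _ ≤ a ^ 2 * B ^ (47 * s * 2) := mul_le_mul_of_nonneg_left (hpow _ _ (by omega)) (sq_nonneg _)
  refine ⟨q', hq', hq'le', fun b hb => ?_⟩
  have hb0 := bohrNorm_nonneg (S := S) b
  have hβ := norm_derivative_add_charVal_le hφ hB hBσ h hz (by positivity) hcoef hb
  rw [← hsdef] at hβ
  have hβ' : 16 ^ s * B ^ 4 / (1 / B ^ (47 * s)) ≤ B ^ (52 * s) := by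
    rw [div_div_eq_mul_div, div_one, mul_assoc, ← pow_add]
    calc 16 ^ s * B ^ (4 + 47 * s) ≤ B ^ s * B ^ (4 + 47 * s) := by
          refine mul_le_mul_of_nonneg_right (pow_le_pow_left₀ (by norm_num) hB16 s) (hBn _).le
      _ = B ^ (s + (4 + 47 * s)) := by rw [← pow_add]
      _ ≤ B ^ (52 * s) := hpow _ _ (by omega)
  have hγb : ‖q' • charVal γ (q • b)‖ ≤ B ^ (57 * s) * bohrNorm S b := by
    have h1 : q' • charVal γ (q • b) = q • charVal (q' • γ) b := by
      rw [← natCast_zsmul b q, charVal_zsmul, natCast_zsmul, smul_comm, charVal_comm (q' • γ) b,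
        ← natCast_zsmul γ q', charVal_zsmul, natCast_zsmul, charVal_comm γ b]
    have h2 := norm_charVal_le h1S (q' • γ) b
    rw [← natCast_zsmul γ q', charVal_zsmul, natCast_zsmul, natCast_zsmul] at h2
    rw [h1]
    calc ‖q • charVal (q' • γ) b‖ ≤ q * ‖charVal (q' • γ) b‖ := norm_nsmul_le
      _ ≤ B * (N * bohrNorm S b * (144 / ((1 / B ^ (9 * s)) ^ 6 * (L * M)))) := by
          gcongr
          exact h2.trans (by gcongr)
      _ = B * (N * (144 / ((1 / B ^ (9 * s)) ^ 6 * (L * M)))) * bohrNorm S b := by ring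
      _ ≤ B * (144 * B ^ (54 * s + 1)) * bohrNorm S b := by gcongr
      _ = 144 * B ^ (54 * s + 2) * bohrNorm S b := by ring
      _ ≤ B ^ (57 * s) * bohrNorm S b :=
          mul_le_mul_of_nonneg_right (hmul _ _ _ (by linarith) (by omega)) hb0
  have key : q' • (φ (z + q • b) - φ z)
      = q' • (φ (z + q • b) - φ z + charVal γ (q • b)) - q' • charVal γ (q • b) := by
    rw [smul_add]; abel
  rw [key]
  refine (norm_sub_le _ _).trans ?_
  have h1 : ‖q' • (φ (z + q • b) - φ z + charVal γ (q • b))‖ ≤ B ^ (71 * s) * bohrNorm S b := by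
    calc _ ≤ q' * ‖φ (z + q • b) - φ z + charVal γ (q • b)‖ := norm_nsmul_le
      _ ≤ B ^ (19 * s) * (B ^ (52 * s) * bohrNorm S b) :=
          mul_le_mul hq'le' (hβ.trans (mul_le_mul_of_nonneg_right hβ' hb0)) (norm_nonneg _) (hBn _).le
      _ = B ^ (71 * s) * bohrNorm S b := by ring
  have h2 : B ^ (57 * s) * bohrNorm S b ≤ B ^ (71 * s) * bohrNorm S b :=
    mul_le_mul_of_nonneg_right (hpow _ _ (by omega)) hb0
  have h3 : 2 * B ^ (71 * s) * bohrNorm S b ≤ B ^ (73 * s) * bohrNorm S b :=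
    mul_le_mul_of_nonneg_right (hmul _ _ _ (by linarith) (by omega)) hb0
  linarith

/-- The point `n` is well inside the Bohr set of radius `σ`, and the derivatives of the phase at
`n` along small multiples of `q` are nearly rational, with a common denominator. -/
def NearlyRationalDerivative (S : Finset (ZMod N)) (φ : ZMod N → UnitAddCircle) (σ B : ℝ) (q : ℕ)
    (n : ZMod N) : Prop :=
  (∀ v, bohrNorm S v ≤ 1 / B ^ 3 → bohrNorm S (n + v) < σ) ∧
    ∃ q' : ℕ, 0 < q' ∧ (q' : ℝ) ≤ B ^ (19 * #S) ∧ ∀ b, bohrNorm S b < 1 / B ^ 4 →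
      ‖q' • (φ (n + q • b) - φ n)‖ ≤ B ^ (74 * #S) * bohrNorm S b

lemma RationalNearZero.bohrNorm_nsmul_le {B : ℝ} (hB : 0 < B) {q : ℕ} (h : RationalNearZero S φ B q)
    {x : ZMod N} (hx : bohrNorm S x < 1 / B ^ 4) : bohrNorm S (q • x) ≤ 1 / B ^ 3 := by
  refine (BohrQuad.bohrNorm_nsmul_le q x).trans ?_
  calc q * bohrNorm S x ≤ B * (1 / B ^ 4) := mul_le_mul h.2.1 hx.le (bohrNorm_nonneg _) hB.le
    _ = 1 / B ^ 3 := by field_simp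

/-- Nearly rational derivatives persist under small translations by multiples of `q`. -/
lemma NearlyRationalDerivative.of_translate (hS : 1 ≤ #S)
    (hφ : IsLocallyQuadraticOn (bohrSet S σ) φ) {B : ℝ} (hB : 2 ^ 24 ≤ B) (hBσ : 1 / B ≤ σ) {q : ℕ}
    (h : RationalNearZero S φ B q) {z x x' : ZMod N}
    (hz : ∀ v, bohrNorm S v ≤ 4 / B ^ 3 → bohrNorm S (z + v) < σ)
    (hx : bohrNorm S x < 1 / B ^ 4) (hx' : bohrNorm S x' < 1 / B ^ 4)
    (hq : ∃ q' : ℕ, 0 < q' ∧ (q' : ℝ) ≤ B ^ (19 * #S) ∧ ∀ b, bohrNorm S b < 1 / B ^ 4 →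
      ‖q' • (φ (z + q • b) - φ z)‖ ≤ B ^ (73 * #S) * bohrNorm S b) :
    NearlyRationalDerivative S φ σ B q (z + (q • x + q • x')) := by
  have hB1 : 1 ≤ B := le_trans (by norm_num) hB
  have hB0 : 0 < B := by linarith
  have hσ : 0 < σ := lt_of_lt_of_le (by positivity) hBσ
  have hpow : ∀ i j : ℕ, i ≤ j → B ^ i ≤ B ^ j := fun i j hij => pow_le_pow_right₀ hB1 hij
  have hBn : ∀ n : ℕ, 0 < B ^ n := fun n => pow_pos hB0 n
  have hqx := h.bohrNorm_nsmul_le hB0 hx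
  have hqx' := h.bohrNorm_nsmul_le hB0 hx'
  have h4 : (4 : ℝ) / B ^ 3 = 1 / B ^ 3 + 1 / B ^ 3 + 1 / B ^ 3 + 1 / B ^ 3 := by ring
  have hi : 0 < 1 / B ^ 3 := one_div_pos.2 (hBn _)
  have hadd := bohrNorm_add_le (S := S) (q • x) (q • x')
  obtain ⟨q', hq', hq'le, hq'n⟩ := hq
  refine ⟨fun v hv => ?_, q', hq', hq'le, fun b hb => ?_⟩
  · rw [add_assoc]
    exact hz _ ((bohrNorm_add_le _ _).trans (by linarith))
  have hb0 := bohrNorm_nonneg (S := S) b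
  have hqb := h.bohrNorm_nsmul_le hB0 hb
  have hxx := bohrNorm_add_le (S := S) x x'
  have h2 : (2 : ℝ) / B ^ 4 = 1 / B ^ 4 + 1 / B ^ 4 := by ring
  have hi4 : 0 < 1 / B ^ 4 := one_div_pos.2 (hBn _)
  have hsm := h.norm_secondDiff_nsmul_le hφ hB hBσ (x := x + x') (y := b) (by linarith) (by linarith)
  have h4σ : 4 / B ^ 3 < σ := by
    refine lt_of_lt_of_le ?_ hBσ
    rw [div_lt_div_iff₀ (hBn _) hB0]
    calc 4 * B < B * B := by nlinarith
      _ = B ^ 2 := by ring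
      _ ≤ 1 * B ^ 3 := by rw [one_mul]; exact hpow _ _ (by norm_num)
  rw [smul_add] at hsm
  have hsd := hφ.sub_eq_secondDiff hσ (n := z) (a := q • x + q • x') (b := q • b) (by linarith)
    (by simpa using hz 0 (by rw [bohrNorm_zero]; positivity)) (hz _ (by linarith))
    (hz _ (by linarith))
    (by rw [add_assoc]; exact hz _ ((bohrNorm_add_le _ _).trans (by linarith)))
  have key : φ (z + (q • x + q • x') + q • b) - φ (z + (q • x + q • x'))
      = (φ (z + q • b) - φ z) + secondDiff φ (q • x + q • x') (q • b) := by
    rw [← hsd]; abel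
  rw [key, smul_add]
  refine (norm_add_le _ _).trans ?_
  have e1 : ‖q' • secondDiff φ (q • x + q • x') (q • b)‖ ≤ B ^ (73 * #S) * bohrNorm S b := by
    calc _ ≤ q' * ‖secondDiff φ (q • x + q • x') (q • b)‖ := norm_nsmul_le
      _ ≤ B ^ (19 * #S) * (B ^ 2 * (2 / B ^ 4 * bohrNorm S b)) := by
          refine mul_le_mul hq'le (hsm.trans ?_) (norm_nonneg _) (hBn _).le
          refine mul_le_mul_of_nonneg_left ?_ (hBn _).le
          exact mul_le_mul_of_nonneg_right (by linarith) hb0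
      _ = B ^ (19 * #S) * (2 / B ^ 2) * bohrNorm S b := by field_simp
      _ ≤ B ^ (19 * #S) * B * bohrNorm S b := by
          refine mul_le_mul_of_nonneg_right (mul_le_mul_of_nonneg_left ?_ (hBn _).le) hb0
          rw [div_le_iff₀ (hBn _)]
          nlinarith
      _ = B ^ (19 * #S + 1) * bohrNorm S b := by ring
      _ ≤ _ := mul_le_mul_of_nonneg_right (hpow _ _ (by omega)) hb0
  have e2 : 2 * B ^ (73 * #S) * bohrNorm S b ≤ B ^ (74 * #S) * bohrNorm S b := by
    refine mul_le_mul_of_nonneg_right ?_ hb0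
    calc 2 * B ^ (73 * #S) ≤ B * B ^ (73 * #S) := mul_le_mul_of_nonneg_right (by linarith) (hBn _).le
      _ = B ^ (73 * #S + 1) := by ring
      _ ≤ _ := hpow _ _ (by omega)
  linarith [hq'n b hb]

/-- Near `z` the cut-off phase is nearly a product of functions of `x` and of `x'`. -/
lemma norm_cutPhase_sub_le (hσ : 0 < σ) (hΛ : 0 ≤ Λ) (hφ : IsLocallyQuadraticOn (bohrSet S σ) φ)
    (hψ : IsSmoothCutoff S σ Λ ψ) {B : ℝ} (hB : 2 ^ 24 ≤ B) (hBσ : 1 / B ≤ σ) (hΛB : Λ ≤ B) {q : ℕ}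
    (h : RationalNearZero S φ B q) {n x x' : ZMod N} (hx : bohrNorm S x < 1 / B ^ 4)
    (hx' : bohrNorm S x' < 1 / B ^ 4) {z : ZMod N} (hnz : n - (q • x + q • x') = z) :
    ‖cutPhase ψ φ n - ψ z * e (-φ z) * (e (φ (z + q • x)) * e (φ (z + q • x')))‖ ≤ 1 / B := by
  have hB1 : 1 ≤ B := le_trans (by norm_num) hB
  have hB0 : 0 < B := by linarith
  have hpow : ∀ i j : ℕ, i ≤ j → B ^ i ≤ B ^ j := fun i j hij => pow_le_pow_right₀ hB1 hij
  have hBn : ∀ n : ℕ, 0 < B ^ n := fun n => pow_pos hB0 n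
  have hqx := h.bohrNorm_nsmul_le hB0 hx
  have hqx' := h.bohrNorm_nsmul_le hB0 hx'
  have hi : 0 < 1 / B ^ 3 := one_div_pos.2 (hBn _)
  have h4 : (4 : ℝ) / B ^ 3 = 1 / B ^ 3 + 1 / B ^ 3 + 1 / B ^ 3 + 1 / B ^ 3 := by ring
  have hn : n = z + q • x + q • x' := by rw [← hnz]; abel
  have hadd := bohrNorm_add_le (S := S) (q • x) (q • x')
  have hψnz : |ψ n - ψ z| ≤ 2 / B ^ 2 := by
    refine (hψ.abs_sub_le hΛ n z).trans ?_
    have : n - z = q • x + q • x' := by rw [← hnz]; abel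
    rw [this]
    calc Λ * bohrNorm S (q • x + q • x') ≤ B * (2 / B ^ 3) := by
          have h2 : (2 : ℝ) / B ^ 3 = 1 / B ^ 3 + 1 / B ^ 3 := by ring
          refine mul_le_mul hΛB (by linarith) (bohrNorm_nonneg _) hB0.le
      _ = 2 / B ^ 2 := by field_simp
  have hsplit : cutPhase ψ φ n - ψ z * e (-φ z) * (e (φ (z + q • x)) * e (φ (z + q • x')))
      = ((ψ n - ψ z : ℝ) : ℂ) * e (φ n)
        + ψ z * (e (φ n) - e (φ (z + q • x) + φ (z + q • x') - φ z)) := by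
    rw [cutPhase, sub_eq_add_neg (φ (z + q • x) + φ (z + q • x')), e_add, e_add]
    push_cast
    ring
  have hψz0 := hψ.nonneg z
  rw [hsplit]
  refine (norm_add_le _ _).trans ?_
  rw [norm_mul, norm_e, mul_one, Complex.norm_real, Real.norm_eq_abs, norm_mul, Complex.norm_real,
    Real.norm_of_nonneg hψz0]
  have hmain : ψ z * ‖e (φ n) - e (φ (z + q • x) + φ (z + q • x') - φ z)‖ ≤ 8 / B ^ 2 := by
    rcases le_or_gt (ψ z) (Λ * (4 / B ^ 3)) with hle | hlt
    · have h1 : ‖e (φ n) - e (φ (z + q • x) + φ (z + q • x') - φ z)‖ ≤ 2 := by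
        refine (norm_sub_le _ _).trans ?_
        rw [norm_e, norm_e]; norm_num
      calc ψ z * ‖e (φ n) - e (φ (z + q • x) + φ (z + q • x') - φ z)‖ ≤ B * (4 / B ^ 3) * 2 := by
            refine mul_le_mul (hle.trans ?_) h1 (norm_nonneg _) (by positivity)
            exact mul_le_mul_of_nonneg_right hΛB (by positivity)
        _ = 8 / B ^ 2 := by field_simp; norm_num
    · have hz : ∀ v, bohrNorm S v ≤ 4 / B ^ 3 → bohrNorm S (z + v) < σ := fun v hv =>
        hψ.bohrNorm_add_lt hσ hΛ ((mul_le_mul_of_nonneg_left hv hΛ).trans_lt hlt)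
      have h4σ : 4 / B ^ 3 < σ := by
        refine lt_of_lt_of_le ?_ hBσ
        rw [div_lt_div_iff₀ (hBn _) hB0]
        calc 4 * B < B * B := by nlinarith
          _ = B ^ 2 := by ring
          _ ≤ 1 * B ^ 3 := by rw [one_mul]; exact hpow _ _ (by norm_num)
      have hsd := hφ.sub_eq_secondDiff hσ (n := z) (a := q • x) (b := q • x') (by linarith)
        (by simpa using hz 0 (by rw [bohrNorm_zero]; positivity)) (hz _ (by linarith))
        (hz _ (by linarith)) (by rw [add_assoc]; exact hz _ (by linarith))
      have h2 : (2 : ℝ) / B ^ 4 = 1 / B ^ 4 + 1 / B ^ 4 := by ring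
      have hi4 : 0 < 1 / B ^ 4 := one_div_pos.2 (hBn _)
      have hsm := h.norm_secondDiff_nsmul_le hφ hB hBσ (x := x) (y := x') (by linarith) (by linarith)
      have h5 : φ n - (φ (z + q • x) + φ (z + q • x') - φ z) = secondDiff φ (q • x) (q • x') := by
        rw [← hsd, hn]; abel
      have h6 : ‖e (φ n) - e (φ (z + q • x) + φ (z + q • x') - φ z)‖
          ≤ 7 * (B ^ 2 * (1 / B ^ 4 * (1 / B ^ 4))) := by
        refine (norm_e_sub_e_le _ _).trans ?_
        rw [h5]
        have hx0 := bohrNorm_nonneg (S := S) x'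
        have : bohrNorm S x * bohrNorm S x' ≤ 1 / B ^ 4 * (1 / B ^ 4) :=
          mul_le_mul hx.le hx'.le hx0 hi4.le
        have h7 := mul_le_mul_of_nonneg_left this (hBn 2).le
        linarith
      calc ψ z * ‖e (φ n) - e (φ (z + q • x) + φ (z + q • x') - φ z)‖
          ≤ 1 * (7 * (B ^ 2 * (1 / B ^ 4 * (1 / B ^ 4)))) :=
            mul_le_mul (hψ.le_one z) h6 (norm_nonneg _) zero_le_one
        _ = 7 / B ^ 6 := by field_simp
        _ ≤ 8 / B ^ 2 := div_le_div₀ (by norm_num) (by norm_num) (hBn _) (hpow _ _ (by norm_num))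
  have h10 : 2 / B ^ 2 + 8 / B ^ 2 ≤ 1 / B := by
    rw [← add_div, div_le_div_iff₀ (hBn _) hB0]
    nlinarith
  linarith

/-- The total weight of the representations of points of `s` which are assigned to `z`. -/
noncomputable def localMass (S : Finset (ZMod N)) (r : ℝ) (q : ℕ) (s : Finset (ℕ × ℕ)) (z : ZMod N) : ℝ :=
  ∑ i ∈ s, ∑ j : ZMod N × ZMod N,
    if ((i.1 * i.2 : ℕ) : ZMod N) - (q • j.1 + q • j.2) = z then tent S r j.1 * tent S r j.2 else 0

lemma localMass_nonneg (r : ℝ) (q : ℕ) (s : Finset (ℕ × ℕ)) (z : ZMod N) :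
    0 ≤ localMass S r q s z :=
  sum_nonneg fun _ _ => sum_nonneg fun _ _ => by
    split_ifs
    · exact mul_nonneg (tent_nonneg _ _) (tent_nonneg _ _)
    · exact le_rfl

lemma norm_localSum_le (r : ℝ) (q : ℕ) (s : Finset (ℕ × ℕ)) {u : ℕ × ℕ → ℂ} (hu : ∀ i, ‖u i‖ ≤ 1)
    (z : ZMod N) : ‖localSum S φ r q s u z‖ ≤ localMass S r q s z := by
  refine (norm_sum_le _ _).trans (sum_le_sum fun i _ => (norm_sum_le _ _).trans
    (sum_le_sum fun j _ => ?_))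
  split_ifs
  · rw [norm_mul, norm_mul, norm_tentPhase, norm_tentPhase]
    exact mul_le_of_le_one_left (mul_nonneg (tent_nonneg _ _) (tent_nonneg _ _)) (hu i)
  · rw [norm_zero]

lemma sum_tent_mul_tent (r : ℝ) :
    ∑ j : ZMod N × ZMod N, tent S r j.1 * tent S r j.2 = tentSum S r ^ 2 := by
  rw [sq, tentSum, sum_mul_sum, ← sum_product']; rfl

lemma sum_localMass_filter (r : ℝ) (q : ℕ) (s : Finset (ℕ × ℕ)) (p : ZMod N → Prop)
    [DecidablePred p] :
    ∑ z with p z, localMass S r q s z = ∑ i ∈ s, ∑ j : ZMod N × ZMod N,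
      if p (((i.1 * i.2 : ℕ) : ZMod N) - (q • j.1 + q • j.2)) then tent S r j.1 * tent S r j.2
      else 0 := by
  simp only [localMass]
  rw [sum_comm]
  refine sum_congr rfl fun i _ => ?_
  rw [sum_comm]
  refine sum_congr rfl fun j _ => ?_
  rw [sum_ite_eq]
  simp only [mem_filter, mem_univ, true_and]

lemma sum_localMass (r : ℝ) (q : ℕ) (s : Finset (ℕ × ℕ)) :
    ∑ z, localMass S r q s z = #s * tentSum S r ^ 2 := by
  classical
  have h := sum_localMass_filter (S := S) r q s (fun _ => True)
  simp only [if_true, filter_true, sum_tent_mul_tent, sum_const, nsmul_eq_mul] at h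
  exact h

/-- A sum of the cut-off phase, decomposed according to the points `z`. -/
lemma norm_sum_cutPhase_sub_sum_localSum_le (hσ : 0 < σ) (hΛ : 0 ≤ Λ)
    (hφ : IsLocallyQuadraticOn (bohrSet S σ) φ) (hψ : IsSmoothCutoff S σ Λ ψ) {B : ℝ} (hB : 2 ^ 24 ≤ B)
    (hBσ : 1 / B ≤ σ) (hΛB : Λ ≤ B) {q : ℕ} (h : RationalNearZero S φ B q) (s : Finset (ℕ × ℕ))
    {u : ℕ × ℕ → ℂ} (hu : ∀ i, ‖u i‖ ≤ 1) :
    ‖(tentSum S (1 / B ^ 4) ^ 2 : ℂ) * ∑ i ∈ s, u i * cutPhase ψ φ ((i.1 * i.2 : ℕ) : ZMod N)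
      - ∑ z, (ψ z * e (-φ z)) * localSum S φ (1 / B ^ 4) q s u z‖
      ≤ #s * (1 / B * tentSum S (1 / B ^ 4) ^ 2) := by
  have hB0 : 0 < B := lt_of_lt_of_le (by norm_num) hB
  set r := 1 / B ^ 4 with hr
  have hr0 : 0 < r := by positivity
  have h1 : ∑ z, (ψ z * e (-φ z)) * localSum S φ r q s u z
      = ∑ i ∈ s, ∑ j : ZMod N × ZMod N, u i * ((tent S r j.1 * tent S r j.2 : ℝ) : ℂ) *
        (ψ (((i.1 * i.2 : ℕ) : ZMod N) - (q • j.1 + q • j.2)) *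
          e (-φ (((i.1 * i.2 : ℕ) : ZMod N) - (q • j.1 + q • j.2))) *
          (e (φ (((i.1 * i.2 : ℕ) : ZMod N) - (q • j.1 + q • j.2) + q • j.1)) *
            e (φ (((i.1 * i.2 : ℕ) : ZMod N) - (q • j.1 + q • j.2) + q • j.2)))) := by
    simp only [localSum, mul_sum, mul_ite, mul_zero]
    rw [sum_comm]
    refine sum_congr rfl fun i _ => ?_
    rw [sum_comm]
    refine sum_congr rfl fun j _ => ?_
    rw [sum_ite_eq, if_pos (mem_univ _)]
    simp only [tentPhase]
    push_cast
    ring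
  have h2 : (tentSum S r ^ 2 : ℂ) * ∑ i ∈ s, u i * cutPhase ψ φ ((i.1 * i.2 : ℕ) : ZMod N)
      = ∑ i ∈ s, ∑ j : ZMod N × ZMod N, u i * ((tent S r j.1 * tent S r j.2 : ℝ) : ℂ) *
        cutPhase ψ φ ((i.1 * i.2 : ℕ) : ZMod N) := by
    rw [mul_sum]
    refine sum_congr rfl fun i _ => ?_
    rw [← sum_mul, ← mul_sum, ← Complex.ofReal_sum, sum_tent_mul_tent]
    push_cast
    ring
  rw [h1, h2, ← sum_sub_distrib]
  refine norm_sum_le_card_mul _ _ fun i _ => ?_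
  rw [← sum_sub_distrib, ← sum_tent_mul_tent, mul_sum]
  refine (norm_sum_le _ _).trans (sum_le_sum fun j _ => ?_)
  rw [← mul_sub, norm_mul, norm_mul, Complex.norm_real, Real.norm_of_nonneg
    (mul_nonneg (tent_nonneg _ _) (tent_nonneg _ _))]
  by_cases h0 : tent S r j.1 * tent S r j.2 = 0
  · rw [h0, mul_zero, zero_mul, mul_zero]
  have hj1 := bohrNorm_lt_of_tent_ne_zero hr0 (left_ne_zero_of_mul h0)
  have hj2 := bohrNorm_lt_of_tent_ne_zero hr0 (right_ne_zero_of_mul h0)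
  have h3 := norm_cutPhase_sub_le hσ hΛ hφ hψ hB hBσ hΛB h hj1 hj2
    (n := ((i.1 * i.2 : ℕ) : ZMod N)) rfl
  have h4 := mul_nonneg (tent_nonneg (S := S) r j.1) (tent_nonneg (S := S) r j.2)
  calc _ ≤ 1 * (tent S r j.1 * tent S r j.2) * (1 / B) := by
        exact mul_le_mul (mul_le_mul_of_nonneg_right (hu i) h4) h3 (norm_nonneg _) (by linarith)
    _ = _ := by ring

open Classical in
/-- Many products `m l` are points where the derivatives of the phase are nearly rational. -/
theorem card_nearlyRationalDerivative (h1S : (1 : ZMod N) ∈ S) (hσ : 0 < σ) (hΛ : 0 ≤ Λ)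
    (hφ : IsLocallyQuadraticOn (bohrSet S σ) φ) (hψ : IsSmoothCutoff S σ Λ ψ) {δ B L M : ℝ}
    (hB : 2 ^ 24 ≤ B) (hBσ : 1 / B ≤ σ) (hΛB : Λ ≤ B) (hδB : 80 ≤ δ * B) {q : ℕ}
    (h : RationalNearZero S φ B q) (hNLM : N ≤ B * (L * M)) (hL : B ^ (40 * #S) ≤ L)
    (hM : B ^ (40 * #S) ≤ M) {f g : ℕ → ℂ} (hf : ∀ i, ‖f i‖ ≤ 1) (hg : ∀ i, ‖g i‖ ≤ 1)
    (hsum : δ / 4 * (L * M) ≤ ‖∑ i ∈ dyadic M ×ˢ dyadic L, f i.1 * g i.2 *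
      cutPhase ψ φ ((i.1 * i.2 : ℕ) : ZMod N)‖) :
    δ / 8 * (L * M) ≤ #{i ∈ dyadic M ×ˢ dyadic L |
      NearlyRationalDerivative S φ σ B q ((i.1 * i.2 : ℕ) : ZMod N)} := by
  have hs : 1 ≤ #S := card_pos.2 ⟨1, h1S⟩
  have hB1 : 1 ≤ B := le_trans (by norm_num) hB
  have hB0 : 0 < B := by linarith
  have hBn : ∀ n : ℕ, 0 < B ^ n := fun n => pow_pos hB0 n
  have hL1 : 1 ≤ L := (one_le_pow₀ hB1).trans hL
  have hM1 : 1 ≤ M := (one_le_pow₀ hB1).trans hM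
  have hLM0 : 0 < L * M := by positivity
  have hN : (0 : ℝ) < N := by exact_mod_cast Nat.pos_of_ne_zero (NeZero.ne N)
  set r := 1 / B ^ 4 with hr
  have hr0 : 0 < r := by positivity
  have hm := tentSum_pos (S := S) hr0
  set m := tentSum S r with hmdef
  set s := dyadic M ×ˢ dyadic L with hsdef
  have hsc : (#s : ℝ) ≤ 4 * (L * M) := by
    rw [hsdef, card_product]
    push_cast
    have h1 := card_dyadic_le hL1
    have h2 := card_dyadic_le hM1
    calc (#(dyadic M) : ℝ) * #(dyadic L) ≤ 2 * M * (2 * L) := by gcongr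
      _ = _ := by ring
  set u : ℕ × ℕ → ℂ := fun i => f i.1 * g i.2 with hu
  have hu1 : ∀ i, ‖u i‖ ≤ 1 := fun i => by
    rw [hu, norm_mul]; exact mul_le_one₀ (hf _) (norm_nonneg _) (hg _)
  set T : ZMod N → ℂ := fun z => localSum S φ r q s u z with hT
  set W : ZMod N → ℝ := fun z => localMass S r q s z with hW
  have hW0 : ∀ z, 0 ≤ W z := fun z => localMass_nonneg _ _ _ _
  have hTW : ∀ z, ‖T z‖ ≤ W z := fun z => norm_localSum_le _ _ _ hu1 z
  have hdec := norm_sum_cutPhase_sub_sum_localSum_le hσ hΛ hφ hψ hB hBσ hΛB h s hu1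
  rw [← hr, ← hmdef] at hdec
  set p : ZMod N → Prop := fun z => δ / 64 < ψ z ∧ 1 / B * (L * M) * m ^ 2 ≤ N * ‖T z‖ with hp
  have hδ0 : 0 < δ := pos_of_mul_pos_left (by linarith) hB0.le
  -- the bad points contribute little
  have hpt : ∀ z, ‖(ψ z * e (-φ z)) * T z‖ ≤ (if p z then W z else 0) + δ / 64 * W z
      + 1 / B * (L * M) * m ^ 2 / N := by
    intro z
    have e1 : ‖(ψ z * e (-φ z)) * T z‖ ≤ ψ z * ‖T z‖ := by
      rw [norm_mul, norm_mul, norm_e, mul_one, Complex.norm_real, Real.norm_of_nonneg (hψ.nonneg z)]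
    have e2 : 0 ≤ δ / 64 * W z := mul_nonneg (by positivity) (hW0 z)
    have e3 : 0 ≤ 1 / B * (L * M) * m ^ 2 / N := by positivity
    refine e1.trans ?_
    have e4 : ψ z * ‖T z‖ ≤ ‖T z‖ := mul_le_of_le_one_left (norm_nonneg _) (hψ.le_one z)
    split_ifs with hpz
    · linarith [hTW z]
    · rcases le_or_gt (ψ z) (δ / 64) with h1 | h1
      · have := mul_le_mul h1 (hTW z) (norm_nonneg _) (by positivity)
        linarith
      · have h2 : N * ‖T z‖ < 1 / B * (L * M) * m ^ 2 := not_le.1 fun h2 => hpz ⟨h1, h2⟩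
        have h3 : ‖T z‖ ≤ 1 / B * (L * M) * m ^ 2 / N := by
          rw [le_div_iff₀ hN]; linarith
        linarith
  have hsumT : ‖∑ z, (ψ z * e (-φ z)) * T z‖ ≤ ∑ z with p z, W z
      + δ / 64 * (#s * m ^ 2) + 1 / B * (L * M) * m ^ 2 := by
    refine (norm_sum_le _ _).trans ((sum_le_sum fun z _ => hpt z).trans (le_of_eq ?_))
    rw [sum_add_distrib, sum_add_distrib, ← sum_filter, ← mul_sum, sum_localMass, sum_const, card_univ,
      ZMod.card, nsmul_eq_mul]
    congr 1
    field_simp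
  -- the good points are seen from nearby products
  have hgood : ∑ z with p z, W z ≤
      #{i ∈ s | NearlyRationalDerivative S φ σ B q ((i.1 * i.2 : ℕ) : ZMod N)} * m ^ 2 := by
    refine (sum_localMass_filter r q s p).le.trans ?_
    rw [← nsmul_eq_mul, ← sum_const, sum_filter]
    refine sum_le_sum fun i _ => ?_
    by_cases hV : NearlyRationalDerivative S φ σ B q ((i.1 * i.2 : ℕ) : ZMod N)
    · rw [if_pos hV]
      refine le_trans (sum_le_sum fun j _ => ?_) (sum_tent_mul_tent (S := S) r).le
      have := mul_nonneg (tent_nonneg (S := S) r j.1) (tent_nonneg (S := S) r j.2)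
      split_ifs <;> linarith
    · rw [if_neg hV]
      refine le_of_eq (sum_eq_zero fun j _ => ?_)
      by_cases h0 : tent S r j.1 * tent S r j.2 = 0
      · rw [h0, ite_self]
      rw [if_neg]
      intro hpz
      apply hV
      have hj1 := bohrNorm_lt_of_tent_ne_zero hr0 (left_ne_zero_of_mul h0)
      have hj2 := bohrNorm_lt_of_tent_ne_zero hr0 (right_ne_zero_of_mul h0)
      have hlt : Λ * (4 / B ^ 3) < ψ (((i.1 * i.2 : ℕ) : ZMod N) - (q • j.1 + q • j.2)) := by
        refine lt_of_le_of_lt ?_ hpz.1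
        calc Λ * (4 / B ^ 3) ≤ B * (4 / B ^ 3) := mul_le_mul_of_nonneg_right hΛB (by positivity)
          _ = 4 / B ^ 2 := by field_simp
          _ ≤ δ / 64 := by
              rw [div_le_div_iff₀ (hBn _) (by norm_num)]
              have : 80 * B ≤ δ * B * B := mul_le_mul_of_nonneg_right hδB hB0.le
              nlinarith
      have hz : ∀ v, bohrNorm S v ≤ 4 / B ^ 3 →
          bohrNorm S (((i.1 * i.2 : ℕ) : ZMod N) - (q • j.1 + q • j.2) + v) < σ := fun v hv =>
        hψ.bohrNorm_add_lt hσ hΛ ((mul_le_mul_of_nonneg_left hv hΛ).trans_lt hlt)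
      have h1 := exists_denominator_derivative_of_localSum h1S hφ hB hBσ h hNLM hL hM hf hg hz hpz.2
      have h2 := NearlyRationalDerivative.of_translate hs hφ hB hBσ h hz hj1 hj2 h1
      rwa [sub_add_cancel] at h2
  set c := (#{i ∈ s | NearlyRationalDerivative S φ σ B q ((i.1 * i.2 : ℕ) : ZMod N)} : ℝ) with hc
  have hlow : m ^ 2 * (δ / 4 * (L * M)) ≤
      ‖(m ^ 2 : ℂ) * ∑ i ∈ s, u i * cutPhase ψ φ ((i.1 * i.2 : ℕ) : ZMod N)‖ := by
    rw [norm_mul, norm_pow, Complex.norm_real, Real.norm_of_nonneg hm.le]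
    exact mul_le_mul_of_nonneg_left hsum (sq_nonneg _)
  have hm2 : 0 < m ^ 2 := by positivity
  have htri := norm_le_norm_add_norm_sub' ((m ^ 2 : ℂ) * ∑ i ∈ s, u i * cutPhase ψ φ ((i.1 * i.2 : ℕ) : ZMod N))
    (∑ z, (ψ z * e (-φ z)) * T z)
  have hBδ : 1 / B ≤ δ / 80 := by
    rw [div_le_div_iff₀ hB0 (by norm_num)]; linarith
  have e5 : #s * (1 / B * m ^ 2) ≤ 4 * (L * M) * (δ / 80 * m ^ 2) := by gcongr
  have e6 : δ / 64 * (#s * m ^ 2) ≤ δ / 64 * (4 * (L * M) * m ^ 2) := by gcongr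
  have e7 : 1 / B * (L * M) * m ^ 2 ≤ δ / 80 * (L * M) * m ^ 2 := by gcongr
  have hfin : m ^ 2 * (δ / 8 * (L * M)) ≤ m ^ 2 * c := by
    have e8 : 0 ≤ δ * (L * M) * m ^ 2 := by positivity
    nlinarith
  exact le_of_mul_le_mul_left hfin hm2

end Extension

/-! ### Type II sums: rationality away from the origin -/

section Extension

variable {N : ℕ} [NeZero N] {S : Finset (ZMod N)} {σ Λ : ℝ} {ψ : ZMod N → ℝ}
  {φ : ZMod N → UnitAddCircle}

omit [NeZero N] in
/-- Freezing one variable of each pair in a type II sum leaves a bilinear sum of the cut-off phase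
with bounded coefficients. -/
lemma exists_bilinear_of_typeII (hψ : ∀ n, ‖cutPhase ψ φ n‖ ≤ 1) {δ L M : ℝ} (hδ : 0 < δ)
    (hL : 1 ≤ L) (hM : 1 ≤ M)
    (hsum : δ * L ^ 2 * M ^ 2 ≤ ∑ l ∈ dyadic L, ∑ l' ∈ dyadic L,
      ‖∑ m ∈ dyadic M, dilatePair ψ φ (l : ZMod N) (l' : ZMod N) m‖ ^ 2) :
    ∃ f g : ℕ → ℂ, (∀ i, ‖f i‖ ≤ 1) ∧ (∀ i, ‖g i‖ ≤ 1) ∧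
      δ / 4 * (L * M) ≤ ‖∑ i ∈ dyadic M ×ˢ dyadic L, f i.1 * g i.2 *
        cutPhase ψ φ ((i.1 * i.2 : ℕ) : ZMod N)‖ := by
  set F : ℕ → ℂ := fun n => cutPhase ψ φ (n : ZMod N) with hF
  set T : ℕ × ℕ → ℂ := fun x => ∑ i ∈ dyadic M ×ˢ dyadic L, conj (F (i.1 * x.1)) *
    conj (F (x.2 * i.2)) * F (i.1 * i.2) with hT
  have heq : ((∑ l ∈ dyadic L, ∑ l' ∈ dyadic L,
      ‖∑ m ∈ dyadic M, dilatePair ψ φ (l : ZMod N) (l' : ZMod N) m‖ ^ 2 : ℝ) : ℂ)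
      = ∑ x ∈ dyadic L ×ˢ dyadic M, F (x.2 * x.1) * T x := by
    rw [sum_norm_sum_dilatePair_sq, sum_comm, sum_product]
    refine sum_congr rfl fun l' _ => ?_
    have e1 : ∀ f : ℕ → ℕ → ℕ → ℂ, ∑ l ∈ dyadic L, ∑ m ∈ dyadic M, ∑ m' ∈ dyadic M, f l m m'
        = ∑ m' ∈ dyadic M, ∑ m ∈ dyadic M, ∑ l ∈ dyadic L, f l m m' := by
      intro f
      calc _ = ∑ l ∈ dyadic L, ∑ m' ∈ dyadic M, ∑ m ∈ dyadic M, f l m m' :=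
            sum_congr rfl fun _ _ => sum_comm
        _ = ∑ m' ∈ dyadic M, ∑ l ∈ dyadic L, ∑ m ∈ dyadic M, f l m m' := sum_comm
        _ = _ := sum_congr rfl fun _ _ => sum_comm
    rw [e1]
    refine sum_congr rfl fun m' _ => ?_
    rw [hT, mul_sum, sum_product]
    refine sum_congr rfl fun m _ => sum_congr rfl fun l _ => ?_
    simp only [dilatePair, map_mul, Complex.conj_conj, hF]
    push_cast
    ring
  have h0 : (0 : ℝ) ≤ ∑ l ∈ dyadic L, ∑ l' ∈ dyadic L,
      ‖∑ m ∈ dyadic M, dilatePair ψ φ (l : ZMod N) (l' : ZMod N) m‖ ^ 2 :=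
    sum_nonneg fun _ _ => sum_nonneg fun _ _ => sq_nonneg _
  have h1 : δ * L ^ 2 * M ^ 2 ≤ ∑ x ∈ dyadic L ×ˢ dyadic M, ‖T x‖ := by
    have h2 := congrArg norm heq
    rw [Complex.norm_real, Real.norm_of_nonneg h0] at h2
    rw [h2] at hsum
    refine hsum.trans ((norm_sum_le _ _).trans (sum_le_sum fun x _ => ?_))
    rw [norm_mul]
    exact mul_le_of_le_one_left (norm_nonneg _) (hψ _)
  have hpos : 0 < δ * L ^ 2 * M ^ 2 := by positivity
  have hne : (dyadic L ×ˢ dyadic M).Nonempty := by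
    rw [nonempty_iff_ne_empty]
    intro h
    rw [h, sum_empty] at h1
    linarith
  obtain ⟨x, -, hx⟩ := exists_le_of_sum_le (f := fun _ => δ / 4 * (L * M)) hne
    (le_trans (by
      rw [sum_const, nsmul_eq_mul, card_product]
      push_cast
      have h2 : (#(dyadic L) : ℝ) * #(dyadic M) ≤ 2 * L * (2 * M) :=
        mul_le_mul (card_dyadic_le hL) (card_dyadic_le hM) (by positivity) (by positivity)
      calc _ ≤ 2 * L * (2 * M) * (δ / 4 * (L * M)) := by gcongr
        _ = δ * L ^ 2 * M ^ 2 := by ring) h1)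
  exact ⟨fun m => conj (F (m * x.1)), fun l => conj (F (x.2 * l)),
    fun _ => by rw [Complex.norm_conj]; exact hψ _, fun _ => by rw [Complex.norm_conj]; exact hψ _, hx⟩

/-- A set of residues containing the product of a positive proportion of the pairs is dense, up to
logarithms. -/
lemma card_of_dense_products (V : Finset (ZMod N)) {δ U L M : ℝ} (hδ : 0 < δ)
    (hU : 2 ^ 13 ≤ U) (hUδ : 1 / δ ≤ U) (hlog : Real.log N ≤ U) (hL : 1 ≤ L) (hM : 1 ≤ M)
    (hLMN : L * M ≤ N) (hNLM : δ * N ≤ L * M)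
    (h : δ / 8 * (L * M) ≤
      #{i ∈ dyadic M ×ˢ dyadic L | ((i.1 * i.2 : ℕ) : ZMod N) ∈ V}) :
    N / U ^ 6 ≤ #V := by
  have hU0 : 0 < U := lt_of_lt_of_le (by norm_num) hU
  have hN0 : 0 < N := Nat.pos_of_ne_zero (NeZero.ne N)
  have hN : (0 : ℝ) < N := by exact_mod_cast hN0
  have hLM0 : 0 < L * M := by positivity
  set A := {i ∈ dyadic M ×ˢ dyadic L | ((i.1 * i.2 : ℕ) : ZMod N) ∈ V} with hA
  have hAm : ∀ x ∈ A, 1 ≤ x.1 ∧ x.1 ≤ ⌊2 * M⌋₊ ∧ 1 ≤ x.2 ∧ x.2 ≤ ⌊2 * L⌋₊ := by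
    intro x hx
    obtain ⟨h1, -⟩ := mem_filter.1 hx
    obtain ⟨h2, h3⟩ := mem_product.1 h1
    have h2' := mem_Icc.1 h2
    have h3' := mem_Icc.1 h3
    have hc : ∀ y : ℝ, 1 ≤ y → 1 ≤ ⌈y⌉₊ := fun y hy => Nat.one_le_ceil_iff.2 (by linarith)
    exact ⟨(hc _ hM).trans h2'.1, h2'.2, (hc _ hL).trans h3'.1, h3'.2⟩
  have h1 := card_sq_le_card_products _ _ A hAm
  set I := A.image fun x => x.1 * x.2 with hI
  -- the products are at most `4 N`, so that at most five of them are congruent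
  have h2 : #I ≤ 5 * #(I.image fun n : ℕ => (n : ZMod N)) := by
    refine card_le_mul_card_image I 5 fun b _ => ?_
    rw [← card_range 5]
    refine card_le_card_of_injOn (fun n => n / N) (fun n hn => ?_) fun n hn n' hn' hnn => ?_
    · obtain ⟨hn1, -⟩ := mem_filter.1 hn
      obtain ⟨x, hx, rfl⟩ := mem_image.1 hn1
      obtain ⟨-, h3, -, h4⟩ := hAm x hx
      have h5 : ((x.1 * x.2 : ℕ) : ℝ) ≤ ((4 * N : ℕ) : ℝ) := by
        push_cast
        calc (x.1 : ℝ) * x.2 ≤ (2 * M) * (2 * L) := by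
              refine mul_le_mul ?_ ?_ (by positivity) (by positivity)
              · exact (Nat.cast_le.2 h3).trans (Nat.floor_le (by positivity))
              · exact (Nat.cast_le.2 h4).trans (Nat.floor_le (by positivity))
          _ = 4 * (L * M) := by ring
          _ ≤ _ := by gcongr
      have h6 : x.1 * x.2 ≤ 4 * N := by exact_mod_cast h5
      rw [coe_range, Set.mem_Iio]
      exact Nat.div_lt_of_lt_mul (by omega)
    · have e1 := (mem_filter.1 hn).2
      have e2 := (mem_filter.1 hn').2
      have e3 : n % N = n' % N := (ZMod.natCast_eq_natCast_iff' n n' N).1 (e1.trans e2.symm)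
      rw [← Nat.div_add_mod n N, ← Nat.div_add_mod n' N, e3, show n / N = n' / N from hnn]
  have h3 : #(I.image fun n : ℕ => (n : ZMod N)) ≤ #V := by
    refine card_le_card fun y hy => ?_
    obtain ⟨n, hn, rfl⟩ := mem_image.1 hy
    obtain ⟨x, hx, rfl⟩ := mem_image.1 hn
    exact (mem_filter.1 hx).2
  have h4 : (#I : ℝ) ≤ 5 * #V := by exact_mod_cast h2.trans (Nat.mul_le_mul_left 5 h3)
  have hP1 : (1 : ℝ) ≤ (⌊2 * M⌋₊ : ℝ) := by
    exact_mod_cast (Nat.one_le_floor_iff _).2 (by linarith : (1 : ℝ) ≤ 2 * M)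
  have hlogP : Real.log (⌊2 * M⌋₊ : ℝ) ≤ 1 + U := by
    have e1 : (⌊2 * M⌋₊ : ℝ) ≤ 2 * N := by
      refine (Nat.floor_le (by positivity)).trans ?_
      have : 1 * M ≤ L * M := by gcongr
      linarith
    have e2 := Real.log_le_log (by linarith) e1
    rw [Real.log_mul (by norm_num) hN.ne'] at e2
    linarith [Real.log_two_lt_d9]
  have hlog0 : 0 ≤ Real.log (⌊2 * M⌋₊ : ℝ) := Real.log_nonneg hP1
  have h5 : (⌊2 * M⌋₊ : ℝ) * ⌊2 * L⌋₊ * (1 + Real.log (⌊2 * M⌋₊ : ℝ)) ^ 2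
      ≤ 4 * (L * M) * (4 * U ^ 2) := by
    have e1 : (⌊2 * M⌋₊ : ℝ) * ⌊2 * L⌋₊ ≤ 2 * M * (2 * L) := by
      refine mul_le_mul (Nat.floor_le (by positivity)) (Nat.floor_le (by positivity)) (by positivity)
        (by positivity)
    have e2 : (1 + Real.log (⌊2 * M⌋₊ : ℝ)) ^ 2 ≤ (2 * U) ^ 2 := by
      refine pow_le_pow_left₀ (by linarith) ?_ 2
      linarith
    calc _ ≤ 2 * M * (2 * L) * (2 * U) ^ 2 :=
          mul_le_mul e1 e2 (sq_nonneg _) (by positivity)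
      _ = _ := by ring
  have h6 : (δ / 8 * (L * M)) ^ 2 ≤ 5 * #V * (4 * (L * M) * (4 * U ^ 2)) :=
    (pow_le_pow_left₀ (by positivity) h 2).trans (h1.trans (mul_le_mul h4 h5 (by positivity)
      (by positivity)))
  have h7 : δ ^ 2 * (L * M) ≤ 5120 * U ^ 2 * #V := by
    have e1 : (L * M) * (δ ^ 2 * (L * M)) ≤ (L * M) * (5120 * U ^ 2 * #V) := by nlinarith
    exact le_of_mul_le_mul_left e1 hLM0
  have h8 : δ ^ 2 * (δ * N) ≤ 5120 * U ^ 2 * #V :=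
    (mul_le_mul_of_nonneg_left hNLM (sq_nonneg _)).trans h7
  have h9 : 1 ≤ δ * U := by rwa [div_le_iff₀ hδ, mul_comm] at hUδ
  rw [div_le_iff₀ (by positivity)]
  have h10 : (1 : ℝ) ≤ (δ * U) ^ 3 := one_le_pow₀ h9
  calc (N : ℝ) ≤ (δ * U) ^ 3 * N := le_mul_of_one_le_left hN.le h10
    _ = U ^ 3 * (δ ^ 2 * (δ * N)) := by ring
    _ ≤ U ^ 3 * (5120 * U ^ 2 * #V) := by gcongr
    _ = #V * U ^ 5 * 5120 := by ring
    _ ≤ #V * U ^ 5 * U := by gcongr; linarith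
    _ = _ := by ring

/-- Two elements of a dense set differ by a bounded multiple of `a`. -/
lemma exists_add_nsmul_mem (V : Finset (ZMod N)) {W : ℝ} (hW : 1 ≤ W) (hV : N / W ≤ #V)
    (a : ZMod N) : ∃ n ∈ V, ∃ j : ℕ, 0 < j ∧ (j : ℝ) ≤ W ∧ n + j • a ∈ V := by
  have hN : (0 : ℝ) < N := by exact_mod_cast Nat.pos_of_ne_zero (NeZero.ne N)
  have hVne : V.Nonempty := nonempty_of_lt_of_le_card (by positivity) hV
  obtain ⟨z, -, hz⟩ := exists_translate_card V univ a (⌊W⌋₊ + 1) (by omega) hVne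
    fun _ _ _ _ => mem_univ _
  rw [card_univ, ZMod.card] at hz
  have hz' : ((⌊W⌋₊ + 1 : ℕ) : ℝ) * #V ≤ N * #{i ∈ range (⌊W⌋₊ + 1) | z + i • a ∈ V} := by
    exact_mod_cast hz
  have h1 : 1 < #{i ∈ range (⌊W⌋₊ + 1) | z + i • a ∈ V} := by
    have hW0 : 0 < W := by linarith
    have h2 : W < ((⌊W⌋₊ + 1 : ℕ) : ℝ) := by push_cast; exact Nat.lt_floor_add_one W
    have h3 : (N : ℝ) * 1 < N * #{i ∈ range (⌊W⌋₊ + 1) | z + i • a ∈ V} := by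
      refine lt_of_lt_of_le ?_ hz'
      calc (N : ℝ) * 1 = W * (N / W) := by field_simp
        _ < ((⌊W⌋₊ + 1 : ℕ) : ℝ) * (N / W) := mul_lt_mul_of_pos_right h2 (by positivity)
        _ ≤ _ := by gcongr
    exact_mod_cast lt_of_mul_lt_mul_left h3 hN.le
  obtain ⟨i, hi, i', hi', hne⟩ := one_lt_card.1 h1
  wlog hlt : i < i' generalizing i i'
  · exact this i' hi' i hi hne.symm (by omega)
  obtain ⟨h2, h3⟩ := mem_filter.1 hi
  obtain ⟨h4, h5⟩ := mem_filter.1 hi'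
  refine ⟨z + i • a, h3, i' - i, by omega, ?_, ?_⟩
  · have h6 : i' - i ≤ ⌊W⌋₊ := by have := mem_range.1 h4; omega
    exact (Nat.cast_le.2 h6).trans (Nat.floor_le (by linarith))
  · rwa [add_assoc, ← add_nsmul, Nat.add_sub_cancel' hlt.le]

/-- Comparing the derivatives of `φ` at two points with nearly rational derivatives which differ by
`j • a`. -/
lemma exists_denominator_of_nearlyRationalDerivative (hS : 1 ≤ #S)
    (hφ : IsLocallyQuadraticOn (bohrSet S σ) φ) {B : ℝ} (hB : 2 ^ 24 ≤ B) (hBσ : 1 / B ≤ σ) {q : ℕ}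
    (h : RationalNearZero S φ B q) {n a b : ZMod N} {j : ℕ} (hj : 0 < j) (hjB : (j : ℝ) ≤ B)
    (hn : NearlyRationalDerivative S φ σ B q n) (hna : NearlyRationalDerivative S φ σ B q (n + j • a))
    (ha : j * bohrNorm S a ≤ σ / 2) (hb : bohrNorm S b < 1 / B ^ 4) :
    ∃ p : ℕ, 0 < p ∧ (p : ℝ) ≤ B ^ (40 * #S) ∧
      ‖p • secondDiff φ a b‖ ≤ B ^ (94 * #S) * bohrNorm S b := by
  set s := #S with hs
  have hB0 : 0 < B := lt_of_lt_of_le (by norm_num) hB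
  have hB1 : 1 ≤ B := le_trans (by norm_num) hB
  have hBn : ∀ n : ℕ, 0 < B ^ n := fun n => pow_pos hB0 n
  obtain ⟨hv, q₁, hq₁, hq₁B, h1⟩ := hn
  obtain ⟨hv', q₂, hq₂, hq₂B, h2⟩ := hna
  obtain ⟨hq, hqB, -⟩ := id h
  have hb3 := h.bohrNorm_nsmul_le hB0 hb
  have h0B : bohrNorm S (0 : ZMod N) ≤ 1 / B ^ 3 := by
    rw [bohrNorm_zero]; exact (one_div_pos.2 (hBn 3)).le
  have hσ0 : 0 < σ := lt_of_lt_of_le (by positivity) hBσ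
  have hsmall : 1 / B ^ 3 < σ / 2 := by
    have e1 : 1 / B ^ 3 < 1 / B / 2 := by
      rw [div_div, one_div_lt_one_div (hBn 3) (by linarith)]
      have : B ^ 2 * B ≥ 4 * B := by
        refine mul_le_mul_of_nonneg_right ?_ hB0.le
        have : (2 : ℝ) ^ 2 ≤ B ^ 2 := pow_le_pow_left₀ (by norm_num) (le_trans (by norm_num) hB) 2
        linarith
      have e : B ^ 3 = B ^ 2 * B := by ring
      rw [e]; linarith
    linarith
  have hqb : q * bohrNorm S b ≤ 1 / B ^ 3 := by
    calc q * bohrNorm S b ≤ B * (1 / B ^ 4) :=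
          mul_le_mul hqB hb.le (bohrNorm_nonneg _) hB0.le
      _ = 1 / B ^ 3 := by field_simp
  have hja := bohrNorm_nsmul_le (S := S) j a
  have hdiff : (φ (n + j • a + q • b) - φ (n + j • a)) - (φ (n + q • b) - φ n)
      = (j * q) • secondDiff φ a b := by
    rw [← hφ.secondDiff_nsmul j q (by linarith), ← hφ.sub_eq_secondDiff hσ0
      (n := n) (by linarith) (by simpa using hv 0 h0B) (by simpa using hv' 0 h0B) (hv _ hb3)
      (hv' _ hb3)]
    abel
  refine ⟨q₁ * q₂ * (j * q), by positivity, ?_, ?_⟩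
  · push_cast
    calc (q₁ : ℝ) * q₂ * (j * q) ≤ B ^ (19 * s) * B ^ (19 * s) * (B * B) :=
          mul_le_mul (mul_le_mul hq₁B hq₂B (by positivity) (hBn _).le)
            (mul_le_mul hjB hqB (by positivity) hB0.le) (by positivity) (by positivity)
      _ = B ^ (38 * s + 2) := by rw [← pow_add, ← sq, ← pow_add]; congr 1; ring
      _ ≤ B ^ (40 * s) := pow_le_pow_right₀ hB1 (by omega)
  · rw [mul_nsmul', ← hdiff, nsmul_sub]
    have e1 : (q₁ * q₂) • (φ (n + j • a + q • b) - φ (n + j • a))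
        = q₁ • q₂ • (φ (n + j • a + q • b) - φ (n + j • a)) := mul_nsmul' _ _ _
    have e2 : (q₁ * q₂) • (φ (n + q • b) - φ n) = q₂ • q₁ • (φ (n + q • b) - φ n) := by
      rw [mul_comm, mul_nsmul']
    rw [e1, e2]
    have hbb := bohrNorm_nonneg (S := S) b
    have e3 : ‖q₁ • q₂ • (φ (n + j • a + q • b) - φ (n + j • a))‖
        ≤ B ^ (19 * s) * (B ^ (74 * s) * bohrNorm S b) :=
      norm_nsmul_le.trans (mul_le_mul hq₁B (h2 b hb) (norm_nonneg _) (hBn _).le)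
    have e4 : ‖q₂ • q₁ • (φ (n + q • b) - φ n)‖ ≤ B ^ (19 * s) * (B ^ (74 * s) * bohrNorm S b) :=
      norm_nsmul_le.trans (mul_le_mul hq₂B (h1 b hb) (norm_nonneg _) (hBn _).le)
    refine (norm_sub_le _ _).trans ((add_le_add e3 e4).trans ?_)
    have e5 : B ^ (19 * s) * (B ^ (74 * s) * bohrNorm S b) = B ^ (93 * s) * bohrNorm S b := by
      rw [← mul_assoc, ← pow_add]; congr 2; ring
    have e6 : 2 * B ^ (93 * s) ≤ B ^ (94 * s) := by
      calc 2 * B ^ (93 * s) ≤ B * B ^ (93 * s) :=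
            mul_le_mul_of_nonneg_right (le_trans (by norm_num) hB) (hBn _).le
        _ = B ^ (93 * s + 1) := by rw [pow_succ']
        _ ≤ _ := pow_le_pow_right₀ hB1 (by omega)
    calc _ = 2 * B ^ (93 * s) * bohrNorm S b := by rw [e5]; ring
      _ ≤ _ := mul_le_mul_of_nonneg_right e6 hbb

/-- A large type II sum, for a phase which is already known to be rational near the origin, makes
`φ''(a, b)` rational when only `b` is very small. The radius of the set of `a` depends on the
parameter `U` only, not on `B`. -/
theorem exists_denominator_extension (h1S : (1 : ZMod N) ∈ S) (hσ : 0 < σ) (hΛ : 0 ≤ Λ)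
    (hφ : IsLocallyQuadraticOn (bohrSet S σ) φ) (hψ : IsSmoothCutoff S σ Λ ψ) {δ U B L M : ℝ}
    (hδ : 0 < δ) (hU : 2 ^ 13 ≤ U) (hUδ : 1 / δ ≤ U) (hlog : Real.log N ≤ U)
    (hB : 2 ^ 24 ≤ B) (hUB : U ^ 6 ≤ B) (hBσ : 1 / B ≤ σ) (hΛB : Λ ≤ B) {q : ℕ}
    (h : RationalNearZero S φ B q) (hL : B ^ (40 * #S) ≤ L)
    (hM : B ^ (40 * #S) ≤ M) (hLMN : L * M ≤ N) (hNLM : δ * N ≤ L * M)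
    (hsum : δ * L ^ 2 * M ^ 2 ≤ ∑ l ∈ dyadic L, ∑ l' ∈ dyadic L,
      ‖∑ m ∈ dyadic M, dilatePair ψ φ (l : ZMod N) (l' : ZMod N) m‖ ^ 2)
    {T : ℕ} (hT : B ^ (160 * #S) < 2 ^ T) :
    ∃ p : ℕ, 0 < p ∧ (p : ℝ) ≤ B ^ (160 * #S) ∧ ∀ a b, bohrNorm S a < σ / (4 * U ^ 6) / T →
      bohrNorm S b < 1 / B ^ (215 * #S) / T →
      ‖p • secondDiff φ a b‖ ≤ B ^ (254 * #S) * bohrNorm S b := by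
  classical
  have hs1 : 1 ≤ #S := card_pos.2 ⟨1, h1S⟩
  have hB0 : 0 < B := lt_of_lt_of_le (by norm_num) hB
  have hB1 : 1 ≤ B := le_trans (by norm_num) hB
  have hBn : ∀ n : ℕ, 0 < B ^ n := fun n => pow_pos hB0 n
  have hU0 : 0 < U := lt_of_lt_of_le (by norm_num) hU
  have hU1 : 1 ≤ U := le_trans (by norm_num) hU
  have hL1 : 1 ≤ L := (one_le_pow₀ hB1).trans hL
  have hM1 : 1 ≤ M := (one_le_pow₀ hB1).trans hM
  have hN : (0 : ℝ) < N := by exact_mod_cast Nat.pos_of_ne_zero (NeZero.ne N)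
  have hδU : 1 ≤ δ * U := by rwa [div_le_iff₀ hδ, mul_comm] at hUδ
  have hU2 : 80 * U ≤ B := by
    refine le_trans ?_ hUB
    have e1 : U ^ 6 = U ^ 5 * U := by ring
    rw [e1]
    refine mul_le_mul_of_nonneg_right ?_ hU0.le
    exact le_trans (by linarith) (le_self_pow₀ hU1 (by norm_num : 5 ≠ 0))
  have hδB : 80 ≤ δ * B := by
    calc (80 : ℝ) ≤ 80 * (δ * U) := by linarith
      _ = δ * (80 * U) := by ring
      _ ≤ δ * B := mul_le_mul_of_nonneg_left hU2 hδ.le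
  have hNB : N ≤ B * (L * M) := by
    calc (N : ℝ) ≤ δ * B * N := le_mul_of_one_le_left hN.le (by linarith)
      _ = B * (δ * N) := by ring
      _ ≤ _ := mul_le_mul_of_nonneg_left hNLM hB0.le
  obtain ⟨f, g, hf, hg, hfg⟩ := exists_bilinear_of_typeII (norm_cutPhase_le hψ) hδ hL1 hM1 hsum
  have h1 := card_nearlyRationalDerivative h1S hσ hΛ hφ hψ hB hBσ hΛB hδB h hNB hL hM hf hg hfg
  set V : Finset (ZMod N) := {n | NearlyRationalDerivative S φ σ B q n} with hV
  have h2 := card_of_dense_products V hδ hU hUδ hlog hL1 hM1 hLMN hNLM (by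
    refine h1.trans (le_of_eq ?_)
    congr 2
    ext i
    simp only [hV, mem_filter, mem_univ, true_and])
  set ra := σ / (4 * U ^ 6) with hra
  set rb := 1 / B ^ (215 * #S) with hrb
  have hra0 : 0 < ra := by positivity
  have hrb0 : 0 < rb := by positivity
  have hraσ : ra ≤ σ / 4 := by
    rw [hra]
    refine div_le_div_of_nonneg_left hσ.le (by norm_num) ?_
    linarith [one_le_pow₀ (n := 6) hU1]
  have hrbB : rb ≤ 1 / B ^ 4 :=
    one_div_le_one_div_of_le (hBn _) (pow_le_pow_right₀ hB1 (by omega))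
  have hB4 : 1 / B ^ 4 ≤ σ / 4 := by
    have e1 : 1 / B ^ 4 ≤ 1 / B / 4 := by
      rw [div_div]
      refine one_div_le_one_div_of_le (by positivity) ?_
      have e2 : B ^ 4 = B * B ^ 3 := by ring
      rw [e2]
      refine mul_le_mul_of_nonneg_left ?_ hB0.le
      exact le_trans (le_trans (by norm_num) hB) (le_self_pow₀ hB1 (by norm_num : 3 ≠ 0))
    linarith
  set Q := ⌊B ^ (40 * #S)⌋₊ with hQ
  have hQB : (Q : ℝ) ≤ B ^ (40 * #S) := Nat.floor_le (hBn _).le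
  have hQ4 : (Q : ℝ) ^ 4 ≤ B ^ (160 * #S) := by
    refine (pow_le_pow_left₀ (by positivity) hQB 4).trans (le_of_eq ?_)
    rw [← pow_mul]; congr 1; ring
  obtain ⟨p, hp, hpQ, hpb⟩ := exists_uniform_denominator (S := S) hra0 hrb0
    (χ := fun a b => secondDiff φ a b)
    (fun b hb => hφ.locAdd hra0 (by linarith)) (fun a ha => hφ.locAdd_right hrb0 (by linarith))
    (Q := Q) (T := T) (by exact_mod_cast hQ4.trans_lt hT)
    (g := fun _ b => B ^ (94 * #S) * bohrNorm S b)
    (fun a b _ hb => by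
      have e1 : (Q : ℝ) ^ 3 ≤ B ^ (120 * #S) := by
        refine (pow_le_pow_left₀ (by positivity) hQB 3).trans (le_of_eq ?_)
        rw [← pow_mul]; congr 1; ring
      have hbb := bohrNorm_nonneg (S := S) b
      have e2 : B ^ (94 * #S) * bohrNorm S b ≤ B ^ (94 * #S) * rb :=
        mul_le_mul_of_nonneg_left hb.le (hBn _).le
      have e3 : 4 * B ^ (214 * #S) ≤ B ^ (215 * #S) := by
        calc 4 * B ^ (214 * #S) ≤ B * B ^ (214 * #S) :=
              mul_le_mul_of_nonneg_right (le_trans (by norm_num) hB) (hBn _).le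
          _ = B ^ (214 * #S + 1) := by rw [pow_succ']
          _ ≤ _ := pow_le_pow_right₀ hB1 (by omega)
      calc 4 * (Q : ℝ) ^ 3 * (B ^ (94 * #S) * bohrNorm S b)
          ≤ 4 * B ^ (120 * #S) * (B ^ (94 * #S) * rb) :=
            mul_le_mul (by linarith) e2 (mul_nonneg (hBn _).le hbb)
              (mul_nonneg (by norm_num) (hBn _).le)
        _ = 4 * B ^ (214 * #S) * rb := by
            rw [show 214 * #S = 120 * #S + 94 * #S by ring, pow_add]; ring
        _ ≤ B ^ (215 * #S) * rb := mul_le_mul_of_nonneg_right e3 hrb0.le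
        _ = 1 := by rw [hrb, mul_one_div, div_self (hBn _).ne'])
    (fun a b ha hb => by
      obtain ⟨n, hn, j, hj, hjU, hnj⟩ := exists_add_nsmul_mem V (one_le_pow₀ hU1) h2 a
      obtain ⟨p, hp, hpB, hpn⟩ := exists_denominator_of_nearlyRationalDerivative hs1 hφ hB hBσ h hj
        (hjU.trans hUB) (mem_filter.1 hn).2 (mem_filter.1 hnj).2 (by
          calc (j : ℝ) * bohrNorm S a ≤ U ^ 6 * ra :=
                mul_le_mul hjU ha.le (bohrNorm_nonneg _) (by positivity)
            _ = σ / 4 := by rw [hra]; field_simp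
            _ ≤ σ / 2 := by linarith) (hb.trans_le hrbB)
      exact ⟨p, hp, Nat.le_floor hpB, hpn⟩)
  have hpB : (p : ℝ) ≤ B ^ (160 * #S) := le_trans (by exact_mod_cast hpQ) hQ4
  refine ⟨p, hp, hpB, fun a b ha hb => (hpb a b ha hb).trans ?_⟩
  have hbb := bohrNorm_nonneg (S := S) b
  calc (p : ℝ) * (B ^ (94 * #S) * bohrNorm S b)
      ≤ B ^ (160 * #S) * (B ^ (94 * #S) * bohrNorm S b) :=
        mul_le_mul_of_nonneg_right hpB (mul_nonneg (hBn _).le hbb)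
    _ = B ^ (254 * #S) * bohrNorm S b := by rw [← mul_assoc, ← pow_add]; congr 2; ring

/-- A large type II sum makes `φ''` rational on a Bohr set whose radius is, up to the number `T`,
a power of `U`. -/
theorem exists_denominator_of_typeII_large_radius (h1S : (1 : ZMod N) ∈ S) (hσ : 0 < σ)
    (hΛ : 0 ≤ Λ) (hφ : IsLocallyQuadraticOn (bohrSet S σ) φ) (hψ : IsSmoothCutoff S σ Λ ψ)
    {δ U X B L M : ℝ} (hδ : 0 < δ) (hδ1 : δ ≤ 1) (hU : 2 ^ 13 ≤ U) (hUδ : 1 / δ ≤ U)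
    (hlog : Real.log N ≤ U) (hUX : U ≤ X) (hX : 2 ^ 24 ≤ X) (hXσ : 1 / σ ≤ X) (hXΛ : Λ ≤ X)
    (hB : B = X ^ (297600 * #S ^ 4)) (hL : B ^ (40 * #S) ≤ L)
    (hM : B ^ (40 * #S) ≤ M) (hLMN : L * M ≤ N) (hNLM : δ * N ≤ L * M)
    (hsum : δ * L ^ 2 * M ^ 2 ≤ ∑ l ∈ dyadic L, ∑ l' ∈ dyadic L,
      ‖∑ m ∈ dyadic M, dilatePair ψ φ (l : ZMod N) (l' : ZMod N) m‖ ^ 2)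
    {T : ℕ} (hT : B ^ (160 * #S) < 2 ^ T) (hTB : (T : ℝ) ≤ B) :
    ∃ q : ℕ, 0 < q ∧ (q : ℝ) ≤ B ^ (161 * #S) ∧ ∀ a b, bohrNorm S a < σ / (4 * U ^ 6) / T →
      bohrNorm S b < σ / (4 * U ^ 6) / T →
      ‖q • secondDiff φ a b‖ ≤ B ^ (472 * #S) * (bohrNorm S a * bohrNorm S b) := by
  have hs1 : 1 ≤ #S := card_pos.2 ⟨1, h1S⟩
  have hs4 : 1 ≤ #S ^ 4 := Nat.one_le_pow _ _ hs1
  have hX0 : 0 < X := lt_of_lt_of_le (by norm_num) hX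
  have hX1 : 1 ≤ X := le_trans (by norm_num) hX
  have hU0 : 0 < U := lt_of_lt_of_le (by norm_num) hU
  set Z := X ^ (496 * #S ^ 4) with hZ
  have hZ1 : 1 ≤ Z := one_le_pow₀ hX1
  have hZ0 : 0 < Z := by linarith
  have hBZ : B = Z ^ 600 := by rw [hB, hZ, ← pow_mul]; congr 1; ring
  have hXB : X ^ 6 ≤ B := by rw [hB]; exact pow_le_pow_right₀ hX1 (by omega)
  have hXB1 : X ≤ B := (le_self_pow₀ hX1 (by norm_num)).trans hXB
  have hB24 : 2 ^ 24 ≤ B := hX.trans hXB1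
  have hB1 : 1 ≤ B := hX1.trans hXB1
  have hB0 : 0 < B := by linarith
  have hBn : ∀ n : ℕ, 0 < B ^ n := fun n => pow_pos hB0 n
  have hBσ : 1 / B ≤ σ := by
    rw [div_le_iff₀ hB0]
    rw [div_le_iff₀ hσ] at hXσ
    calc 1 ≤ X * σ := hXσ
      _ ≤ B * σ := mul_le_mul_of_nonneg_right hXB1 hσ.le
      _ = _ := mul_comm _ _
  have hZL : ∀ {y : ℝ}, B ^ (40 * #S) ≤ y → Z ^ 52 ≤ y := fun hy => by
    refine le_trans ?_ hy
    rw [hBZ, ← pow_mul Z]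
    exact pow_le_pow_right₀ hZ1 (by omega)
  obtain ⟨q, hq, hqZ, hqn⟩ := exists_denominator_of_typeII h1S hσ hΛ hφ hψ hδ hδ1 hX
    (hUδ.trans hUX) hXσ hXΛ (hlog.trans hUX) hZ (hZL hL) (hZL hM) hLMN hNLM hsum
  have hr : RationalNearZero S φ B q := by
    have e0 : ∀ y, y < 1 / B → y < 1 / Z ^ 254 := fun y hy => hy.trans_le
      (one_div_le_one_div_of_le (by positivity) (by
        rw [hBZ]; exact pow_le_pow_right₀ hZ1 (by norm_num)))
    refine ⟨hq, hqZ.trans (by rw [hBZ]; exact pow_le_pow_right₀ hZ1 (by norm_num)),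
      fun a b ha hb => ?_⟩
    have := hqn a b (e0 _ ha) (e0 _ hb)
    rwa [← hBZ] at this
  obtain ⟨p, hp, hpB, hpn⟩ := exists_denominator_extension h1S hσ hΛ hφ hψ hδ hU hUδ hlog hB24
    ((pow_le_pow_left₀ hU0.le hUX 6).trans hXB) hBσ (hXΛ.trans hXB1) hr hL hM hLMN hNLM hsum hT
  obtain ⟨-, hqB, hqn⟩ := hr
  have hT0 : 0 < T := by
    rcases Nat.eq_zero_or_pos T with rfl | h0
    · exact absurd hT (not_lt.2 (by simpa using one_le_pow₀ hB1))
    · exact h0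
  have hT0' : (0 : ℝ) < T := by exact_mod_cast hT0
  -- below the radius `1 / B ^ (216 s)` both partial results apply
  have htiny : ∀ y, y < 1 / B ^ (216 * #S) → y < 1 / B ∧ y < 1 / B ^ (215 * #S) / T := by
    intro y hy
    refine ⟨hy.trans_le (one_div_le_one_div_of_le hB0 (le_self_pow₀ hB1 (by omega))),
      hy.trans_le ?_⟩
    rw [div_div]
    refine one_div_le_one_div_of_le (by positivity) ?_
    calc B ^ (215 * #S) * T ≤ B ^ (215 * #S) * B := mul_le_mul_of_nonneg_left hTB (hBn _).le
      _ = B ^ (215 * #S + 1) := by rw [pow_succ]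
      _ ≤ _ := pow_le_pow_right₀ hB1 (by omega)
  have hbig : ∀ y, 1 / B ^ (216 * #S) ≤ y → 1 ≤ B ^ (216 * #S) * y := fun y hy => by
    rwa [div_le_iff₀ (hBn _), mul_comm] at hy
  have hone : ∀ a b, bohrNorm S a < σ / (4 * U ^ 6) / T → 1 / B ^ (216 * #S) ≤ bohrNorm S a →
      bohrNorm S b < 1 / B ^ (216 * #S) →
      ‖(q * p) • secondDiff φ a b‖ ≤ B ^ (472 * #S) * (bohrNorm S a * bohrNorm S b) := by
    intro a b ha ha' hb
    have hbb := bohrNorm_nonneg (S := S) b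
    rw [mul_nsmul']
    have e1 : ‖q • p • secondDiff φ a b‖ ≤ B * (B ^ (254 * #S) * bohrNorm S b) :=
      norm_nsmul_le.trans (mul_le_mul hqB (hpn a b ha (htiny _ hb).2) (norm_nonneg _) hB0.le)
    have e2 : B * B ^ (254 * #S) ≤ B ^ (256 * #S) := by
      rw [← pow_succ']; exact pow_le_pow_right₀ hB1 (by omega)
    calc _ ≤ B * B ^ (254 * #S) * bohrNorm S b := by rw [mul_assoc]; exact e1
      _ ≤ B ^ (256 * #S) * bohrNorm S b := mul_le_mul_of_nonneg_right e2 hbb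
      _ ≤ B ^ (256 * #S) * bohrNorm S b * (B ^ (216 * #S) * bohrNorm S a) :=
          le_mul_of_one_le_right (mul_nonneg (hBn _).le hbb) (hbig _ ha')
      _ = _ := by rw [show 472 * #S = 256 * #S + 216 * #S by ring, pow_add]; ring
  refine ⟨q * p, Nat.mul_pos hq hp, ?_, fun a b ha hb => ?_⟩
  · push_cast
    calc (q : ℝ) * p ≤ B * B ^ (160 * #S) := mul_le_mul hqB hpB (by positivity) hB0.le
      _ ≤ _ := by rw [← pow_succ']; exact pow_le_pow_right₀ hB1 (by omega)
  have haa := bohrNorm_nonneg (S := S) a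
  have hbb := bohrNorm_nonneg (S := S) b
  rcases lt_or_ge (bohrNorm S a) (1 / B ^ (216 * #S)) with ha' | ha' <;>
    rcases lt_or_ge (bohrNorm S b) (1 / B ^ (216 * #S)) with hb' | hb'
  · rw [mul_comm q p, mul_nsmul']
    have e1 : ‖p • q • secondDiff φ a b‖
        ≤ B ^ (160 * #S) * (B * (bohrNorm S a * bohrNorm S b)) :=
      norm_nsmul_le.trans (mul_le_mul hpB (hqn a b (htiny _ ha').1 (htiny _ hb').1)
        (norm_nonneg _) (hBn _).le)
    refine e1.trans ?_
    rw [← mul_assoc, ← pow_succ]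
    exact mul_le_mul_of_nonneg_right (pow_le_pow_right₀ hB1 (by omega)) (mul_nonneg haa hbb)
  · rw [secondDiff_comm, mul_comm (bohrNorm S a)]
    exact hone b a hb hb' ha'
  · exact hone a b ha ha' hb'
  · refine (circle_norm_le_half _).trans ?_
    have e1 : 1 * 1 ≤ B ^ (216 * #S) * bohrNorm S a * (B ^ (216 * #S) * bohrNorm S b) :=
      mul_le_mul (hbig _ ha') (hbig _ hb') (by norm_num) (mul_nonneg (hBn _).le haa)
    have e2 : B ^ (216 * #S) * bohrNorm S a * (B ^ (216 * #S) * bohrNorm S b)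
        = B ^ (432 * #S) * (bohrNorm S a * bohrNorm S b) := by
      rw [show 432 * #S = 216 * #S + 216 * #S by ring, pow_add]; ring
    have e3 : B ^ (432 * #S) * (bohrNorm S a * bohrNorm S b)
        ≤ B ^ (472 * #S) * (bohrNorm S a * bohrNorm S b) :=
      mul_le_mul_of_nonneg_right (pow_le_pow_right₀ hB1 (by omega)) (mul_nonneg haa hbb)
    linarith

end Extension

/-! ### The choice of parameters -/

section Parameters

lemma loss_eq (A : ℝ) {δ : ℝ} (hδ : 0 < δ) (s : ℕ) : loss A δ s = (1 / δ) ^ ((A * s) ^ A) := by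
  rw [loss, Real.rpow_neg hδ.le, one_div, Real.inv_rpow hδ.le]

/-- As soon as there are any characters at all, `|S| ≤ log^C (1/δ)` bounds `δ` away from `1`. -/
lemma exp_one_le_of_le_log {C δ : ℝ} (hC : 0 < C) (hδ : 0 < δ) (hδ1 : δ < 1)
    (h : 1 ≤ Real.log (1 / δ) ^ C) : Real.exp 1 ≤ 1 / δ := by
  have h1 : 1 < 1 / δ := (one_lt_div hδ).2 hδ1
  rw [← Real.le_log_iff_exp_le (by linarith)]
  by_contra! h2
  have := Real.rpow_lt_one (Real.log_nonneg h1.le) h2 hC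
  linarith

lemma le_rpow_self {v c : ℝ} (hv : Real.exp 1 ≤ v) (hc : 0 ≤ c) : c ≤ v ^ c :=
  calc c ≤ Real.exp c := by linarith [Real.add_one_le_exp c]
    _ = Real.exp 1 ^ c := by rw [← Real.exp_mul, one_mul]
    _ ≤ v ^ c := Real.rpow_le_rpow (Real.exp_pos 1).le hv hc

lemma two_pow_le_rpow {v t : ℝ} (hv : Real.exp 1 ≤ v) (n : ℕ) (hn : n ≤ t) : 2 ^ n ≤ v ^ t := by
  have h2 : 2 ≤ v := by linarith [Real.add_one_le_exp (1 : ℝ)]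
  calc (2 : ℝ) ^ n ≤ v ^ n := pow_le_pow_left₀ (by norm_num) h2 n
    _ = v ^ (n : ℝ) := (Real.rpow_natCast _ _).symm
    _ ≤ v ^ t := Real.rpow_le_rpow_of_exponent_le (by linarith) hn

variable {δ : ℝ} {s : ℕ}

lemma rpow_le_loss {A t : ℝ} (hδ : 0 < δ) (hδ1 : δ ≤ 1) (hs : 1 ≤ s) (hA : 1 ≤ A) (ht : t ≤ A) :
    (1 / δ) ^ t ≤ loss A δ s := by
  rw [loss_eq A hδ]
  refine Real.rpow_le_rpow_of_exponent_le ((one_le_div hδ).2 hδ1) ?_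
  have hs' : (1 : ℝ) ≤ s := by exact_mod_cast hs
  have h1 : A ≤ A * s := le_mul_of_one_le_right (by linarith) hs'
  calc t ≤ A * s := ht.trans h1
    _ = (A * s) ^ (1 : ℝ) := (Real.rpow_one _).symm
    _ ≤ (A * s) ^ A := Real.rpow_le_rpow_of_exponent_le (by linarith) hA

lemma loss_mono {A A' : ℝ} (hδ : 0 < δ) (hδ1 : δ ≤ 1) (hs : 1 ≤ s) (hA : 0 ≤ A) (hA' : 1 ≤ A')
    (h : A ≤ A') : loss A δ s ≤ loss A' δ s := by
  rw [loss_eq A hδ, loss_eq A' hδ]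
  refine Real.rpow_le_rpow_of_exponent_le ((one_le_div hδ).2 hδ1) ?_
  have hs' : (1 : ℝ) ≤ s := by exact_mod_cast hs
  have h1 : A' ≤ A' * s := le_mul_of_one_le_right (by linarith) hs'
  calc (A * s) ^ A ≤ (A' * s) ^ A :=
        Real.rpow_le_rpow (by positivity) (mul_le_mul_of_nonneg_right h (by linarith)) hA
    _ ≤ (A' * s) ^ A' := Real.rpow_le_rpow_of_exponent_le (by linarith) h

/-- Powers of a loss whose exponent is polynomial in `s` are again losses. -/
lemma loss_pow_le {A K : ℝ} (hδ : 0 < δ) (hδ1 : δ ≤ 1) (hs : 1 ≤ s) (hA : 0 ≤ A) (p j : ℕ)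
    (hp : p ≤ K) (hK : A + j + 1 ≤ K) : loss A δ s ^ (p * s ^ j) ≤ loss K δ s := by
  have hv : 1 ≤ 1 / δ := (one_le_div hδ).2 hδ1
  have hs' : (1 : ℝ) ≤ s := by exact_mod_cast hs
  have hj : (0 : ℝ) ≤ j := Nat.cast_nonneg j
  have hK1 : 1 ≤ K := by linarith
  have h1 : K ≤ K * s := le_mul_of_one_le_right (by linarith) hs'
  have hKs : (0 : ℝ) < K * s := by linarith
  rw [loss_eq A hδ, loss_eq K hδ, ← Real.rpow_natCast, ← Real.rpow_mul (by linarith)]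
  refine Real.rpow_le_rpow_of_exponent_le hv ?_
  push_cast
  calc (A * s) ^ A * (p * (s : ℝ) ^ j) ≤ (K * s) ^ A * ((K * s) * (K * s) ^ j) := by
        refine mul_le_mul (Real.rpow_le_rpow (by positivity)
          (mul_le_mul_of_nonneg_right (by linarith) (by linarith)) hA)
          (mul_le_mul (hp.trans h1) (pow_le_pow_left₀ (by linarith)
            (le_mul_of_one_le_left (by linarith) hK1) j) (by positivity) hKs.le)
          (by positivity) (by positivity)
    _ = (K * s) ^ (A + j + 1) := by
        rw [Real.rpow_add_one hKs.ne', Real.rpow_add hKs, Real.rpow_natCast]; ring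
    _ ≤ (K * s) ^ K := Real.rpow_le_rpow_of_exponent_le (by linarith) hK

/-- The standing parameters: `X = loss C₀ δ s` dominates the quantities of the problem. -/
lemma le_loss_of_le {C C₀ ρ : ℝ} {N : ℕ} (hC : 0 < C) (hC₀ : 2 * C + 30 ≤ C₀) (hδ : 0 < δ)
    (hδ1 : δ < 1) (hv : Real.exp 1 ≤ 1 / δ) (hs : 1 ≤ s) (hlog : Real.log N ≤ δ ^ (-C))
    (hρ : C⁻¹ * δ ^ C ≤ ρ) :
    2 ^ 24 ≤ loss C₀ δ s ∧ 1 / δ ≤ loss C₀ δ s ∧ 1 / (64 * ρ) ≤ loss C₀ δ s ∧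
      loss C δ s ≤ loss C₀ δ s ∧ C ≤ loss C₀ δ s ∧ 1 / δ ^ C ≤ loss C₀ δ s ∧
      Real.log N ≤ (1 / δ) ^ C := by
  have h1 : ∀ t, t ≤ C₀ → (1 / δ) ^ t ≤ loss C₀ δ s := fun t ht =>
    rpow_le_loss hδ hδ1.le hs (by linarith) ht
  have hv0 : 0 < 1 / δ := by positivity
  have hinv : (1 / δ) ^ C = 1 / δ ^ C := by
    rw [Real.div_rpow (by norm_num) hδ.le, Real.one_rpow]
  refine ⟨(two_pow_le_rpow hv 24 (by push_cast; linarith)).trans (h1 C₀ le_rfl), ?_, ?_,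
    loss_mono hδ hδ1.le hs hC.le (by linarith) (by linarith), ?_, ?_, ?_⟩
  · simpa using h1 1 (by linarith)
  · have hδC : 0 < δ ^ C := Real.rpow_pos_of_pos hδ C
    have hρ0 : 0 < C⁻¹ * δ ^ C := by positivity
    calc 1 / (64 * ρ) ≤ 1 / (C⁻¹ * δ ^ C) :=
          one_div_le_one_div_of_le hρ0 (by linarith)
      _ = C * (1 / δ) ^ C := by rw [hinv]; field_simp
      _ ≤ (1 / δ) ^ C * (1 / δ) ^ C :=
          mul_le_mul_of_nonneg_right (le_rpow_self hv hC.le) (by positivity)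
      _ = (1 / δ) ^ (C + C) := (Real.rpow_add hv0 _ _).symm
      _ ≤ _ := h1 _ (by linarith)
  · exact (le_rpow_self hv hC.le).trans (h1 C (by linarith))
  · rw [← hinv]; exact h1 C (by linarith)
  · rwa [Real.rpow_neg hδ.le, ← one_div, ← hinv] at hlog

end Parameters

/-! ### From the three hypotheses to the conclusions -/

section DivisorSums

/-- The sum over the multiples of `d` in an interval, as a sum over their quotients by `d`. -/
lemma sum_filter_dvd_Icc {d a b : ℕ} (hd : 0 < d) (F : ℕ → ℕ → ℂ) (G : ℤ → ℂ)
    (h : ∀ m : ℕ, F (d * m) m = G m) :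
    ∑ n ∈ Icc a b with d ∣ n, F n (n / d)
      = ∑ m ∈ Icc (((a + d - 1) / d : ℕ) : ℤ) ((b / d : ℕ) : ℤ), G m := by
  have key : ∀ m : ℕ, (a + d - 1) / d ≤ m ↔ a ≤ d * m := fun m => by
    rw [Nat.div_le_iff_le_mul_add_pred hd]; omega
  refine sum_bij' (fun n _ => ((n / d : ℕ) : ℤ)) (fun m _ => d * m.toNat) ?_ ?_ ?_ ?_ ?_
  · intro n hn
    obtain ⟨h1, m, rfl⟩ := mem_filter.1 hn
    rw [mem_Icc] at h1
    rw [Nat.mul_div_cancel_left m hd, mem_Icc, Nat.cast_le, Nat.cast_le, key, Nat.le_div_iff_mul_le hd,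
      mul_comm m]
    exact h1
  · intro m hm
    obtain ⟨m, rfl⟩ := Int.eq_ofNat_of_zero_le ((Int.natCast_nonneg _).trans (mem_Icc.1 hm).1)
    rw [mem_Icc, Nat.cast_le, Nat.cast_le, key, Nat.le_div_iff_mul_le hd, mul_comm m] at hm
    exact mem_filter.2 ⟨mem_Icc.2 hm, dvd_mul_right _ _⟩
  · intro n hn
    obtain ⟨-, m, rfl⟩ := mem_filter.1 hn
    simp [Nat.mul_div_cancel_left m hd]
  · intro m hm
    obtain ⟨m, rfl⟩ := Int.eq_ofNat_of_zero_le ((Int.natCast_nonneg _).trans (mem_Icc.1 hm).1)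
    simp [Nat.mul_div_cancel_left m hd]
  · intro n hn
    obtain ⟨-, m, rfl⟩ := mem_filter.1 hn
    rw [Nat.mul_div_cancel_left m hd, h]

/-- The type I argument with the quantitative hypotheses of the theorem, for a general bounded
periodic weight. -/
lemma conclusionI_of_divisor_sums {C C₀ K : ℝ} (hC : 0 < C) (hC₀ : 2 * C + 30 ≤ C₀)
    (hK : C₀ + 200 ≤ K) {N : ℕ} [NeZero N] {S : Finset (ZMod N)} {δ ρ R : ℝ}
    {φ : ZMod N → UnitAddCircle} {ψ : ZMod N → ℝ} (h1S : (1 : ZMod N) ∈ S) (hδ : 0 < δ) (hδ1 : δ < 1)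
    (hlog : Real.log N ≤ δ ^ (-C)) (hρ : C⁻¹ * δ ^ C ≤ ρ) (hρ1 : ρ ≤ 1)
    (hS : (#S : ℝ) ≤ Real.log (1 / δ) ^ C) (hφ : IsLocallyQuadraticOn (bohrSet S (64 * ρ)) φ)
    (hψ : IsSmoothCutoff S (64 * ρ) (loss C δ #S) ψ) (hR : K * loss K δ #S < R) {k : ℕ} (hk : 0 < k)
    (hkX : k ≤ loss C₀ δ #S) {c : ℤ → ℂ} (hc : ∀ m, ‖c m‖ ≤ 1) (hck : ∀ m t, c (m + k * t) = c m)
    {D : ℝ} {E : Finset ℕ} (hD : 0 < D) (hDR : D ≤ C * √R) (hE : δ ^ C * D < #E)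
    (h : ∀ d ∈ E, D / 2 ≤ (d : ℝ) ∧ (d : ℝ) ≤ D ∧
      δ * N / d ≤ ‖∑ n ∈ Icc ⌈δ * N⌉₊ N with d ∣ n,
        (ψ (n : ZMod N) : ℂ) * c ((n / d : ℕ) : ℤ) * e (φ (n : ZMod N))‖) :
    ConclusionI K δ ρ R S φ := by
  have hs : 1 ≤ #S := card_pos.2 ⟨1, h1S⟩
  have hs' : (1 : ℝ) ≤ #S := by exact_mod_cast hs
  have hv := exp_one_le_of_le_log hC hδ hδ1 (hs'.trans hS)
  obtain ⟨hX, hXδ, hXσ, hXΛ, hXC, hXη, -⟩ := le_loss_of_le hC hC₀ hδ hδ1 hv hs hlog hρ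
  set X := loss C₀ δ #S with hXdef
  have hX1 : 1 ≤ X := le_trans (by norm_num) hX
  have hX0 : 0 < X := by linarith
  have hδC : 0 < δ ^ C := Real.rpow_pos_of_pos hδ C
  have hρ0 : 0 < ρ := lt_of_lt_of_le (by positivity) hρ
  have hN0 : 0 < N := Nat.pos_of_ne_zero (NeZero.ne N)
  have hN : (0 : ℝ) < N := by exact_mod_cast hN0
  have hK1 : 1 ≤ K := by linarith
  have hXK : ∀ p : ℕ, p ≤ 200 → X ^ p ≤ loss K δ #S := fun p hp => by
    have h1 := loss_pow_le (K := K) hδ hδ1.le hs (A := C₀) (by linarith) p 0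
      (by have : (p : ℝ) ≤ 200 := by exact_mod_cast hp
          linarith) (by push_cast; linarith)
    simpa using h1
  have hlK : 1 ≤ loss K δ #S := (one_le_pow₀ hX1).trans (hXK 1 (by norm_num))
  have hlR : loss K δ #S ≤ R := (le_mul_of_one_le_left (by linarith) hK1).trans hR.le
  have hR1 : 1 ≤ R := hlK.trans hlR
  have hceil : 1 ≤ ⌈δ * N⌉₊ := Nat.one_le_ceil_iff.2 (by positivity)
  have hdpos : ∀ d ∈ E, 0 < d := fun d hd => by
    have := (h d hd).1
    have : (0 : ℝ) < d := by linarith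
    exact_mod_cast this
  obtain ⟨q, hq, hqX, hqn⟩ := exists_denominator_of_typeI h1S (by positivity : 0 < 64 * ρ)
    (by rw [loss_eq C hδ]; positivity) hφ hψ hδ hδ1.le hδC hk hXδ hXη hXσ hXΛ hkX hX
    ((hXK 20 (by norm_num)).trans hlR) hD
    (hDR.trans (mul_le_mul_of_nonneg_right hXC (Real.sqrt_nonneg R))) hE hc hck
    (lo := fun d => ((⌈δ * N⌉₊ + d - 1) / d : ℕ)) (hi := fun d => (N / d : ℕ))
    (fun d hd => by
      have hd0 := hdpos d hd
      have h1 : 1 ≤ (⌈δ * N⌉₊ + d - 1) / d := (Nat.one_le_div_iff hd0).2 (by omega)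
      have h2 : ((N / d : ℕ) : ℝ) ≤ N / d := Nat.cast_div_le
      have h3 : (1 : ℝ) ≤ ((⌈δ * N⌉₊ + d - 1) / d : ℕ) := by exact_mod_cast h1
      rw [Int.cast_add, Int.cast_sub, Int.cast_natCast, Int.cast_natCast, Int.cast_one]
      linarith)
    (fun d hd => ⟨(h d hd).1, (h d hd).2.1⟩)
    (fun d hd => by
      have h1 := (h d hd).2.2
      rw [sum_filter_dvd_Icc (hdpos d hd) (fun n m => (ψ (n : ZMod N) : ℂ) * c (m : ℤ) *
        e (φ (n : ZMod N))) (fun m => c m * ((ψ ((d : ZMod N) * (m : ZMod N)) : ℂ) *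
          e (φ ((d : ZMod N) * (m : ZMod N))))) (fun m => by push_cast; ring)] at h1
      rwa [mul_div_assoc] at h1)
  refine ⟨q, hq, ?_, fun a ha b hb => ?_⟩
  · exact (hqX.trans (hXK 48 (by norm_num))).trans (le_mul_of_one_le_left (by linarith) hK1)
  have hRK : R ^ (8 : ℕ) ≤ R ^ K := by
    rw [← Real.rpow_natCast]
    exact Real.rpow_le_rpow_of_exponent_le hR1 (by push_cast; linarith)
  have hRK0 : 0 < R ^ K := Real.rpow_pos_of_pos (by linarith) K
  have hR3 : R ^ 3 ≤ R ^ K :=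
    (pow_le_pow_right₀ hR1 (by norm_num)).trans hRK
  have hKs : 1 ≤ (K * #S) ^ #S := one_le_pow₀ (one_le_mul_of_one_le_of_one_le hK1 hs')
  have hδK : δ ^ K ≤ 1 := Real.rpow_le_one hδ.le hδ1.le (by linarith)
  have hrad : δ ^ K * (ρ / R ^ K) / (K * #S) ^ #S ≤ 1 / R ^ 8 := by
    have hδK0 := Real.rpow_pos_of_pos hδ K
    calc _ ≤ δ ^ K * (ρ / R ^ K) := div_le_self (by positivity) hKs
      _ ≤ 1 * (1 / R ^ K) := by gcongr
      _ ≤ 1 / R ^ 8 := by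
          rw [one_mul]
          exact one_div_le_one_div_of_le (pow_pos (by linarith) 8) hRK
  have hrad0 : 0 < δ ^ K * (ρ / R ^ K) / (K * #S) ^ #S := by
    have hδK0 := Real.rpow_pos_of_pos hδ K
    positivity
  have ha' := ((bohrNorm_lt_iff hrad0).2 ha).trans_le hrad
  have hb' := ((bohrNorm_lt_iff hrad0).2 hb).trans_le hrad
  have hab : 0 ≤ bohrNorm S a * bohrNorm S b := mul_nonneg (bohrNorm_nonneg _) (bohrNorm_nonneg _)
  refine (hqn a b ha' hb').trans ?_
  have hρR : (ρ / R ^ K) ^ 2 ≤ 1 := by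
    refine pow_le_one₀ (by positivity) ((div_le_one hRK0).2 ?_)
    exact hρ1.trans ((one_le_pow₀ hR1).trans hRK)
  have e1 : bohrNorm S a * bohrNorm S b ≤ bohrNorm S a * bohrNorm S b / (ρ / R ^ K) ^ 2 :=
    le_div_self hab (by positivity) hρR
  refine mul_le_mul ?_ e1 hab (by positivity)
  refine mul_le_mul ?_ hR3 (by positivity) (by positivity)
  exact (hXK 60 (by norm_num)).trans (le_mul_of_one_le_left (by linarith) hK1)

end DivisorSums

section LargeTypeII

/-- The type II argument with the quantitative hypotheses of the theorem. -/
lemma exists_conclusionII_of_typeII {C : ℝ} (hC : 0 < C) : ∃ K₀ : ℝ, ∀ K, K₀ ≤ K →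
    ∀ (N : ℕ) [NeZero N] (S : Finset (ZMod N)) (δ ρ R : ℝ) (φ : ZMod N → UnitAddCircle)
      (ψ : ZMod N → ℝ), (1 : ZMod N) ∈ S → 0 < δ → δ < 1 → Real.log N ≤ δ ^ (-C) →
      C⁻¹ * δ ^ C ≤ ρ → ρ ≤ 1 → (#S : ℝ) ≤ Real.log (1 / δ) ^ C → 0 < R →
      IsLocallyQuadraticOn (bohrSet S (64 * ρ)) φ →
      IsSmoothCutoff S (64 * ρ) (loss C δ #S) ψ → K * loss K δ #S < R → TypeII δ R ψ φ →
      ConclusionII K δ ρ S φ := by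
  set C₀ := 2 * C + 30 with hC₀
  -- `τ` bounds the exponent of the number `T` of summands in the subset sum argument
  set τ : ℝ := (2 * 47616000 * C₀ ^ C₀ + 1) + (5 * C + C * C₀ + 1) with hτ
  refine ⟨150000000 + C₀ + 6 * (C + 13) + τ, ?_⟩
  intro K hK N _ S δ ρ R φ ψ h1S hδ hδ1 hlog hρ hρ1 hS hR0 hφ hψ hR hII
  have hC₀0 : 0 < C₀ := by linarith
  have hCC : 0 < C₀ ^ C₀ := Real.rpow_pos_of_pos hC₀0 C₀
  have hτ0 : 0 ≤ τ := by positivity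
  have hs : 1 ≤ #S := card_pos.2 ⟨1, h1S⟩
  have hs' : (1 : ℝ) ≤ #S := by exact_mod_cast hs
  have hv := exp_one_le_of_le_log hC hδ hδ1 (hs'.trans hS)
  obtain ⟨hX, hXδ, hXσ, hXΛ, hXC, hXη, hlog'⟩ := le_loss_of_le hC hC₀.ge hδ hδ1 hv hs hlog hρ
  set v := 1 / δ with hvdef
  set X := loss C₀ δ #S with hXdef
  have hv0 : 0 < v := by positivity
  have hv1 : 1 ≤ v := (one_le_div hδ).2 hδ1.le
  have hX1 : 1 ≤ X := le_trans (by norm_num) hX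
  have hX0 : 0 < X := by linarith
  have hXn : ∀ n : ℕ, 0 < X ^ n := fun n => pow_pos hX0 n
  have hδC : 0 < δ ^ C := Real.rpow_pos_of_pos hδ C
  have hρ0 : 0 < ρ := lt_of_lt_of_le (by positivity) hρ
  have hN : (0 : ℝ) < N := by exact_mod_cast Nat.pos_of_ne_zero (NeZero.ne N)
  have hK1 : 1 ≤ K := by linarith
  have hXK : X ^ (150000000 * #S ^ 5) ≤ loss K δ #S :=
    loss_pow_le hδ hδ1.le hs hC₀0.le _ _ (by push_cast; linarith) (by push_cast; linarith)
  have hs5 : 1 ≤ #S ^ 5 := Nat.one_le_pow _ _ hs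
  have hlR : loss K δ #S ≤ R := by
    refine (le_mul_of_one_le_left ?_ hK1).trans hR.le
    exact (hXn _).le.trans hXK
  set U := v ^ (C + 13) with hU
  have hU13 : 2 ^ 13 ≤ U := two_pow_le_rpow hv 13 (by push_cast; linarith)
  have hUv : v ≤ U := by
    calc v = v ^ (1 : ℝ) := (Real.rpow_one v).symm
      _ ≤ U := Real.rpow_le_rpow_of_exponent_le hv1 (by linarith)
  have hUlog : Real.log N ≤ U :=
    hlog'.trans (Real.rpow_le_rpow_of_exponent_le hv1 (by linarith))
  have hUX : U ≤ X := rpow_le_loss hδ hδ1.le hs (by linarith) (by linarith)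
  have hU0 : 0 < U := by linarith
  set B := X ^ (297600 * #S ^ 4) with hB
  have hBX : ∀ p : ℕ, B ^ (p * #S) = X ^ (297600 * p * #S ^ 5) := fun p => by
    rw [hB, ← pow_mul]; congr 1; ring
  have hs4 : 1 ≤ #S ^ 4 := Nat.one_le_pow _ _ hs
  have hXB : X ≤ B := le_self_pow₀ hX1 (by omega)
  have hB1 : 1 ≤ B := hX1.trans hXB
  have hB0 : 0 < B := by linarith
  have hBn : ∀ n : ℕ, 0 < B ^ n := fun n => pow_pos hB0 n
  have hBK : ∀ p : ℕ, p ≤ 500 → B ^ (p * #S) ≤ loss K δ #S := fun p hp => by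
    rw [hBX]
    refine (pow_le_pow_right₀ hX1 (Nat.mul_le_mul_right _ ?_)).trans hXK
    omega
  -- the lengths of the two variables
  obtain ⟨L, M, hRL, hLN, hNLM, hLMN, hsum⟩ := hII
  have hsqrt : B ^ (41 * #S) ≤ √R := by
    refine Real.le_sqrt_of_sq_le (le_trans (le_of_eq ?_) ((hBK 82 (by norm_num)).trans hlR))
    rw [← pow_mul]; congr 1; ring
  have hsqrt0 : 0 < √R := Real.sqrt_pos.2 hR0
  have hL0 : 0 < L := hsqrt0.trans_le hRL
  have hB40 : B ^ (40 * #S) ≤ δ * √R := by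
    have h1 : B ^ (40 * #S) * v ≤ √R := by
      refine le_trans ?_ hsqrt
      calc B ^ (40 * #S) * v ≤ B ^ (40 * #S) * B :=
            mul_le_mul_of_nonneg_left (hXδ.trans hXB) (hBn _).le
        _ = B ^ (40 * #S + 1) := by rw [pow_succ]
        _ ≤ _ := pow_le_pow_right₀ hB1 (by omega)
    calc B ^ (40 * #S) = δ * (B ^ (40 * #S) * v) := by rw [hvdef]; field_simp
      _ ≤ _ := mul_le_mul_of_nonneg_left h1 hδ.le
  have hLB : B ^ (40 * #S) ≤ L :=
    (pow_le_pow_right₀ hB1 (by omega)).trans (hsqrt.trans hRL)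
  have hMB : B ^ (40 * #S) ≤ M := by
    refine hB40.trans ?_
    have h1 : L * √R ≤ N := (le_div_iff₀ hsqrt0).1 hLN
    have h2 : L * (δ * √R) ≤ L * M := by
      calc L * (δ * √R) = δ * (L * √R) := by ring
        _ ≤ δ * N := mul_le_mul_of_nonneg_left h1 hδ.le
        _ ≤ L * M := hNLM
    exact le_of_mul_le_mul_left h2 hL0
  rw [typeII_sum_eq, Complex.norm_real, Real.norm_of_nonneg
    (sum_nonneg fun _ _ => sum_nonneg fun _ _ => sq_nonneg _)] at hsum
  -- the number of summands in the subset sum argument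
  set Y := X ^ (47616000 * #S ^ 5) with hY
  have hY160 : B ^ (160 * #S) = Y := hBX 160
  have hY1 : 1 ≤ Y := one_le_pow₀ hX1
  have hlogY0 : 0 ≤ Real.log Y := Real.log_nonneg hY1
  have hlogX : Real.log X = (C₀ * #S) ^ C₀ * Real.log v := by
    rw [hXdef, loss_eq C₀ hδ, Real.log_rpow hv0]
  have hlogv0 : 0 ≤ Real.log v := Real.log_nonneg hv1
  have hlogv : Real.log v ≤ v := (Real.log_le_sub_one_of_pos hv0).trans (by linarith)
  have hlogY : Real.log Y = 47616000 * (#S : ℝ) ^ 5 * Real.log X := by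
    rw [hY, Real.log_pow]; push_cast; ring
  set T := ⌊2 * Real.log Y⌋₊ + 1 with hT
  have hTlt : 2 * Real.log Y < T := by rw [hT]; push_cast; exact Nat.lt_floor_add_one _
  have hTle : (T : ℝ) ≤ 2 * Real.log Y + 1 := by
    rw [hT]; push_cast
    linarith [Nat.floor_le (by linarith : 0 ≤ 2 * Real.log Y)]
  have hT0 : (0 : ℝ) < T := by linarith
  have hTY : B ^ (160 * #S) < 2 ^ T := by
    rw [hY160, ← Real.log_lt_log_iff (by linarith) (by positivity), Real.log_pow (2 : ℝ) T]
    have := Real.log_two_gt_d9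
    have : (T : ℝ) * (1 / 2) ≤ T * Real.log 2 := mul_le_mul_of_nonneg_left (by linarith) hT0.le
    linarith
  have hsv : (#S : ℝ) ≤ v ^ C :=
    hS.trans (Real.rpow_le_rpow hlogv0 hlogv hC.le)
  have hTτ : (T : ℝ) ≤ v ^ τ := by
    have e1 : (#S : ℝ) ^ 5 ≤ v ^ (5 * C) := by
      calc (#S : ℝ) ^ 5 ≤ (v ^ C) ^ 5 := pow_le_pow_left₀ (by positivity) hsv 5
        _ = v ^ (5 * C) := by rw [← Real.rpow_mul_natCast hv0.le]; congr 1; push_cast; ring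
    have e2 : (C₀ * #S) ^ C₀ ≤ C₀ ^ C₀ * v ^ (C * C₀) := by
      rw [Real.mul_rpow hC₀0.le (by positivity), Real.rpow_mul hv0.le]
      exact mul_le_mul_of_nonneg_left (Real.rpow_le_rpow (by positivity) hsv hC₀0.le) hCC.le
    have e3 : v ^ (5 * C) * v ^ (C * C₀) * v = v ^ (5 * C + C * C₀ + 1) := by
      rw [Real.rpow_add_one hv0.ne', Real.rpow_add hv0]
    have e4 : 1 ≤ v ^ (5 * C + C * C₀ + 1) := Real.one_le_rpow hv1 (by positivity)
    have e5 : Real.log X ≤ C₀ ^ C₀ * v ^ (C * C₀) * v := by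
      rw [hlogX]; exact mul_le_mul e2 hlogv hlogv0 (by positivity)
    have e6 : (#S : ℝ) ^ 5 * Real.log X ≤ v ^ (5 * C) * (C₀ ^ C₀ * v ^ (C * C₀) * v) :=
      mul_le_mul e1 e5 (Real.log_nonneg hX1) (by positivity)
    calc (T : ℝ) ≤ 2 * 47616000 * ((#S : ℝ) ^ 5 * Real.log X) + 1 := by
          rw [hlogY] at hTle; linarith
      _ ≤ 2 * 47616000 * (v ^ (5 * C) * (C₀ ^ C₀ * v ^ (C * C₀) * v))
          + v ^ (5 * C + C * C₀ + 1) := by linarith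
      _ = (2 * 47616000 * C₀ ^ C₀ + 1) * v ^ (5 * C + C * C₀ + 1) := by rw [← e3]; ring
      _ ≤ v ^ (2 * 47616000 * C₀ ^ C₀ + 1) * v ^ (5 * C + C * C₀ + 1) :=
          mul_le_mul_of_nonneg_right (le_rpow_self hv (by positivity)) (by positivity)
      _ = v ^ τ := by rw [← Real.rpow_add hv0]
  have hTB : (T : ℝ) ≤ B := by
    have e1 : (#S : ℝ) ≤ X :=
      hsv.trans (rpow_le_loss hδ hδ1.le hs (by linarith) (by linarith))
    have e2 : Real.log X ≤ X := (Real.log_le_sub_one_of_pos hX0).trans (by linarith)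
    have e3 : (#S : ℝ) ^ 5 * Real.log X ≤ X ^ 5 * X :=
      mul_le_mul (pow_le_pow_left₀ (by positivity) e1 5) e2 (Real.log_nonneg hX1) (hXn 5).le
    have e4 : (2 ^ 24 : ℝ) ^ 2 ≤ X ^ 2 := pow_le_pow_left₀ (by norm_num) hX 2
    have e5 : 2 * 47616000 + 1 ≤ X ^ 2 := le_trans (by norm_num) e4
    have e6 : 1 ≤ X ^ 6 := one_le_pow₀ hX1
    calc (T : ℝ) ≤ 2 * 47616000 * ((#S : ℝ) ^ 5 * Real.log X) + 1 := by
          rw [hlogY] at hTle; linarith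
      _ ≤ (2 * 47616000 + 1) * X ^ 6 := by
          have e7 : X ^ 6 = X ^ 5 * X := pow_succ X 5
          rw [← e7] at e3
          linarith
      _ ≤ X ^ 2 * X ^ 6 := mul_le_mul_of_nonneg_right e5 (hXn 6).le
      _ = X ^ 8 := by rw [← pow_add]
      _ ≤ B := pow_le_pow_right₀ hX1 (by omega)
  obtain ⟨q, hq, hqB, hqn⟩ := exists_denominator_of_typeII_large_radius h1S
    (by positivity : 0 < 64 * ρ) (by rw [loss_eq C hδ]; positivity) hφ hψ hδ hδ1.le hU13 hUv hUlog
    hUX hX hXσ hXΛ hB hLB hMB hLMN hNLM hsum hTY hTB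
  have hl0 : 0 ≤ loss K δ #S := (hXn _).le.trans hXK
  refine ⟨q, hq, ?_, fun a ha b hb => ?_⟩
  · exact (hqB.trans (hBK 161 (by norm_num))).trans (le_mul_of_one_le_left hl0 hK1)
  have hδK0 := Real.rpow_pos_of_pos hδ K
  have hKs : 1 ≤ (K * #S) ^ #S := one_le_pow₀ (one_le_mul_of_one_le_of_one_le hK1 hs')
  have hrad0 : 0 < δ ^ K * ρ / (K * #S) ^ #S := by positivity
  have hrad : δ ^ K * ρ / (K * #S) ^ #S ≤ 64 * ρ / (4 * U ^ 6) / T := by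
    refine (div_le_self (by positivity) hKs).trans ?_
    rw [div_div, le_div_iff₀ (by positivity)]
    have e1 : U ^ 6 * T ≤ v ^ K := by
      calc U ^ 6 * T ≤ v ^ (6 * (C + 13)) * v ^ τ := by
            refine mul_le_mul (le_of_eq ?_) hTτ hT0.le (by positivity)
            rw [hU, ← Real.rpow_mul_natCast hv0.le]; congr 1; push_cast; ring
        _ = v ^ (6 * (C + 13) + τ) := (Real.rpow_add hv0 _ _).symm
        _ ≤ v ^ K := Real.rpow_le_rpow_of_exponent_le hv1 (by linarith)
    have e2 : δ ^ K * v ^ K = 1 := by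
      rw [← Real.mul_rpow hδ.le hv0.le, hvdef, mul_one_div_cancel hδ.ne', Real.one_rpow]
    calc δ ^ K * ρ * (4 * U ^ 6 * T) = 4 * ρ * (δ ^ K * (U ^ 6 * T)) := by ring
      _ ≤ 4 * ρ * (δ ^ K * v ^ K) := by gcongr
      _ ≤ 64 * ρ := by rw [e2]; linarith
  have hab : 0 ≤ bohrNorm S a * bohrNorm S b := mul_nonneg (bohrNorm_nonneg _) (bohrNorm_nonneg _)
  refine (hqn a b (((bohrNorm_lt_iff hrad0).2 ha).trans_le hrad)
    (((bohrNorm_lt_iff hrad0).2 hb).trans_le hrad)).trans ?_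
  have e1 : bohrNorm S a * bohrNorm S b ≤ bohrNorm S a * bohrNorm S b / ρ ^ 2 :=
    le_div_self hab (by positivity) (pow_le_one₀ hρ0.le hρ1)
  exact mul_le_mul ((hBK 472 (by norm_num)).trans (le_mul_of_one_le_left hl0 hK1)) e1 hab
    (mul_nonneg (by linarith) hl0)

end LargeTypeII

end BohrQuad

theorem mainTheorem2 (C A : ℝ) (hC : 0 < C) (hA : 0 < A) :
    ∃ K : ℝ, 0 < K ∧
      ∀ (N : ℕ) [NeZero N] (S : Finset (ZMod N)) (δ ρ R : ℝ)
        (φ : ZMod N → UnitAddCircle) (ψ : ZMod N → ℝ)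
        (k : ℕ) [NeZero k] (χ : DirichletCharacter ℂ k),
        (1 : ZMod N) ∈ S →
        0 < δ → δ < 1 → Real.log N ≤ δ ^ (-C) →
        C⁻¹ * δ ^ C ≤ ρ → ρ ≤ 1 →
        (S.card : ℝ) ≤ Real.log (1 / δ) ^ C →
        0 < R → R < N →
        BohrQuad.IsLocallyQuadraticOn (BohrQuad.bohrSet S (64 * ρ)) φ →
        BohrQuad.IsSmoothCutoff S (64 * ρ) (BohrQuad.loss C δ S.card) ψ →
        (BohrQuad.TypeI C δ R ψ φ →
          BohrQuad.ConclusionI K δ ρ R S φ ∨ BohrQuad.Degenerate K δ R S.card N) ∧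
        (BohrQuad.TwistedTypeI C δ R χ ψ φ →
          BohrQuad.ConclusionI K δ ρ R S φ ∨ BohrQuad.Degenerate K δ R S.card N ∨
            BohrQuad.loss A δ S.card ≤ (k : ℝ)) ∧
        (BohrQuad.TypeII δ R ψ φ →
          BohrQuad.ConclusionII K δ ρ S φ ∨ BohrQuad.Degenerate K δ R S.card N) := by
  obtain ⟨K₀, hK₀⟩ := BohrQuad.exists_conclusionII_of_typeII hC
  -- the type I argument treats the modulus `k` as one of the parameters bounded by a loss
  set C₀ := 2 * C + 30 + A with hC₀
  set K := max K₀ (C₀ + 200) with hK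
  have hKC : C₀ + 200 ≤ K := le_max_right _ _
  refine ⟨K, by linarith, ?_⟩
  intro N _ S δ ρ R φ ψ k _ χ h1S hδ hδ1 hlog hρ hρ1 hS hR0 _ hφ hψ
  rcases le_or_gt R (K * BohrQuad.loss K δ S.card) with hR | hR
  · exact ⟨fun _ => .inr (.inl hR), fun _ => .inr (.inl (.inl hR)), fun _ => .inr (.inl hR)⟩
  have hs : 1 ≤ S.card := Finset.card_pos.2 ⟨1, h1S⟩
  refine ⟨?_, ?_, fun h => .inl (hK₀ K (le_max_left _ _) N S δ ρ R φ ψ h1S hδ hδ1 hlog hρ hρ1 hS hR0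
    hφ hψ hR h)⟩
  · rintro ⟨D, E, hD, hDR, hE, h⟩
    left
    refine BohrQuad.conclusionI_of_divisor_sums hC (by linarith) hKC h1S hδ hδ1 hlog hρ hρ1 hS hφ
      hψ hR one_pos ?_ (c := fun _ => 1) (fun _ => by rw [norm_one]) (fun _ _ => rfl) hD hDR hE
      (fun d hd => ?_)
    · rw [BohrQuad.loss_eq C₀ hδ, Nat.cast_one]
      exact Real.one_le_rpow ((one_le_div hδ).2 hδ1.le) (by positivity)
    · simpa only [mul_one] using h d hd
  · rintro ⟨D, E, hD, hDR, hE, h⟩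
    rcases le_or_gt (BohrQuad.loss A δ S.card) k with hk | hk
    · exact .inr (.inr hk)
    left
    refine BohrQuad.conclusionI_of_divisor_sums hC (by linarith) hKC h1S hδ hδ1 hlog hρ hρ1 hS hφ
      hψ hR (Nat.pos_of_ne_zero (NeZero.ne k))
      (hk.le.trans (BohrQuad.loss_mono hδ hδ1.le hs hA.le (by linarith) (by linarith)))
      (c := fun m => χ (m : ZMod k)) (fun _ => χ.norm_le_one _) (fun m t => ?_) hD hDR hE
      (fun d hd => ?_)
    · push_cast
      rw [ZMod.natCast_self, zero_mul, add_zero]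
    · simpa only [Int.cast_natCast] using h d hd
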